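/- **Setting.** Let $(\mathbf M,\otimes,I)$ be a cocomplete closed symmetric monoidal category, and let $(\mathbf M,J,j)$ be an involutive symmetric monoidal category: $J=(J,J_2,J_0)$ is a symmetric (lax) monoidal endofunctor of $\mathbf M$, and $j:\mathrm{Id}_{\mathbf M}\Rightarrow J^2$ is a monoidal natural isomorphism with $jJ=Jj$. Let $\mathfrak C$ be a non-empty set. Let $\Sigma_{\mathfrak C}$ be the groupoid of finite sequences $\underline c=(c_1,\dots,c_n)$, $n\ge 0$, in $\mathfrak C$, with morphisms $\sigma:\underline c\to\underline c\sigma=(c_{\sigma(1)},\dots,c_{\sigma(n)})$ for permutations $\sigma$; it is symmetric monoidal under concatenation $\otimes$. Put $\mathbf{SymSeq}_{\mathfrak C}(\mathbf M):=\mathbf M^{\Sigma_{\mathfrak C}\times\mathfrak C}$ ($\mathfrak C$ a discrete category) and write $X\binom{t}{\underline c}$ for the value of $X$ at $(\underline c,t)$. For a set $S$ and $m\in\mathbf M$ let $S\otimes m:=\coprod_{s\in S}m$. The circle product and the circle unit are $$(X\circ Y)\tbinom{t}{\underline c}=\int^{\underline a}\int^{(\underline b_1,\dots,\underline b_m)}\Sigma_{\mathfrak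 C}(\underline b_1\otimes\cdots\otimes\underline b_m,\underline c)\otimes X\tbinom{t}{\underline a}\otimes Y\tbinom{a_1}{\underline b_1}\otimes\cdots\otimes Y\tbinom{a_m}{\underline b_m},\qquad I_\circ\tbinom{t}{\underline c}=\Sigma_{\mathfrak C}(t,\underline c)\otimes I,$$ where $m$ is the length of $\underline a$. Let $J_*$ be the endofunctor $X\mapsto JX$ of $\mathbf{SymSeq}_{\mathfrak C}(\mathbf M)$ given by post-composition with $J$, and let $j_*:\mathrm{Id}\Rightarrow J_*^2$ have the components $jX$. Let $(J_{*2})_{X,Y}:J_*X\circ J_*Y\to J_*(X\circ Y)$ have as components the composite $$\int^{\underline a}\!\!\int^{(\underline b_i)}\!\Sigma_{\mathfrak C}(\otimes_i\underline b_i,\underline c)\otimes JX\tbinom{t}{\underline a}\otimes\bigotimes_{i=1}^m JY\tbinom{a_i}{\underline b_i}\longrightarrow\int^{\underline a}\!\!\int^{(\underline b_i)}\!\Sigma_{\mathfrak C}(\otimes_i\underline b_i,\underline c)\otimes J\Big(X\tbinom{t}{\underline a}\otimes\bigotimes_{i=1}^m Y\tbinom{a_i}{\underline b_i}\Big)\longrightarrow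 J\big((X\circ Y)\tbinom{t}{\underline c}\big)$$ of the morphism induced by the $m$-fold iteration of $J_2$ and of the canonical comparison morphism. Let $J_{*0}:I_\circ\to J_*I_\circ$ have as components the composite $\Sigma_{\mathfrak C}(t,\underline c)\otimes I\to\Sigma_{\mathfrak C}(t,\underline c)\otimes JI\to J(\Sigma_{\mathfrak C}(t,\underline c)\otimes I)$ of $\mathrm{id}\otimes J_0$ and the canonical comparison morphism. **Theorem.** 1. The circle product $\circ$ and the circle unit $I_\circ$, together with the associator and the unitors that are induced on the summands of the coends by the associator, the unitors and the braiding of $\mathbf M$, make $\mathbf{SymSeq}_{\mathfrak C}(\mathbf M)$ into a monoidal category. 2. If $\mathbf M$ also has all small limits, this monoidal category is right closed: for every $Y$ the functor $(-)\circ Y$ has a right adjoint. 3. $(J_*,J_{*2},J_{*0})$ is a monoidal endofunctor of this monoidal category, $j_*$ is a monoidal natural isomorphism $\mathrm{Id}\Rightarrow J_*^2$, and $j_*J_*=J_*j_*$. That is, $(\mathbf{SymSeq}_{\mathfrak C}(\mathbf M),J_*,j_*)$ with the structure maps $J_{*2}$ and $J_{*0}$ is an involutive monoidal category, and it is right closed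 whenever $\mathbf M$ has all small limits. -/

import Mathlib

open CategoryTheory MonoidalCategory Limits Opposite

universe v u

namespace CircleSeq

section TensorFamily

variable {M : Type u} [Category.{v} M] [MonoidalCategory M]

/-- The tensor product `A₀ ⊗ (A₁ ⊗ (⋯ ⊗ 𝟙))` of a finite family of objects. -/
@[reducible] def tensorFam : (n : ℕ) → (Fin n → M) → M
  | 0, _ => 𝟙_ M
  | n + 1, A => A 0 ⊗ tensorFam n (fun i => A i.succ)

/-- `skip n k` is the increasing injection `Fin n → Fin (n + 1)` that omits `k`. -/
def skip : (n : ℕ) → Fin (n + 1) → Fin n → Fin (n + 1)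
  | 0, _, j => j.elim0
  | n + 1, k, j =>
    Fin.cases (motive := fun _ => Fin (n + 2)) j.succ
      (fun k' => Fin.cases (motive := fun _ => Fin (n + 2)) 0 (fun j' => (skip n k' j').succ) j) k

theorem skip_eq_succAbove : (n : ℕ) → (k : Fin (n + 1)) → (j : Fin n) → skip n k j = k.succAbove j
  | 0, _, j => j.elim0
  | n + 1, k, j => by
    refine Fin.cases ?_ (fun k' => ?_) k
    · simp [skip]
    · refine Fin.cases ?_ (fun j' => ?_) j
      · simp [skip]
      · simp [skip, skip_eq_succAbove n k' j']

/-- The permutation that remains of `σ` when `k` is removed from its domain and `σ k` from its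
codomain. -/
def residual {m n : ℕ} (σ : Fin (m + 1) ≃ Fin (n + 1)) (k : Fin (m + 1)) : Fin m ≃ Fin n :=
  (finSuccAboveEquiv k).trans
    ((σ.subtypeEquiv (fun _ => by simp)).trans (finSuccAboveEquiv (σ k)).symm)

theorem skip_residual {m n : ℕ} (σ : Fin (m + 1) ≃ Fin (n + 1)) (k : Fin (m + 1)) (i : Fin m) :
    skip n (σ k) (residual σ k i) = σ (skip m k i) := by
  have h := congrArg Subtype.val ((finSuccAboveEquiv (σ k)).apply_symm_apply
    ⟨σ (k.succAbove i), fun h => Fin.succAbove_ne k i (σ.injective h)⟩)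
  rw [skip_eq_succAbove, skip_eq_succAbove]
  exact h

theorem skip_zero : (n : ℕ) → (j : Fin n) → skip n 0 j = j.succ
  | 0, j => j.elim0
  | _ + 1, _ => rfl

/-- The tensor product of a family of morphisms. -/
def tensorFamMap : (n : ℕ) → {A B : Fin n → M} → (∀ i, A i ⟶ B i) →
    (tensorFam n A ⟶ tensorFam n B)
  | 0, _, _, _ => 𝟙 (𝟙_ M)
  | n + 1, _, _, f => f 0 ⊗ₘ tensorFamMap n (fun i => f i.succ)

theorem tensorFamMap_id : (n : ℕ) → (A : Fin n → M) →
    tensorFamMap n (fun i => 𝟙 (A i)) = 𝟙 (tensorFam n A)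
  | 0, _ => rfl
  | n + 1, A => by
    simp only [tensorFamMap, tensorFamMap_id n]
    exact id_tensorHom_id _ _

theorem tensorFamMap_comp : (n : ℕ) → {A B D : Fin n → M} → (f : ∀ i, A i ⟶ B i) →
    (g : ∀ i, B i ⟶ D i) →
    tensorFamMap n f ≫ tensorFamMap n g = tensorFamMap n (fun i => f i ≫ g i)
  | 0, _, _, _, _, _ => Category.comp_id _
  | n + 1, _, _, _, f, g =>
    (tensorHom_comp_tensorHom _ _ _ _).trans
      (congrArg _ (tensorFamMap_comp n (fun i => f i.succ) (fun i => g i.succ)))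

theorem eqToHom_family {M : Type u} [Category.{v} M] {m n : ℕ} {σ : Fin m → Fin n}
    {A : Fin n → M} {B : Fin m → M}
    (f : ∀ i, A (σ i) ⟶ B i) {i j : Fin m} (h : i = j) :
    f i = eqToHom (by rw [h]) ≫ f j ≫ eqToHom (by rw [h]) := by
  subst h; simp

variable [SymmetricCategory M]

/-- The interchange `X ⊗ (Y ⊗ Z) ⟶ Y ⊗ (X ⊗ Z)`. -/
def interchange (X Y Z : M) : X ⊗ (Y ⊗ Z) ⟶ Y ⊗ (X ⊗ Z) :=
  (α_ X Y Z).inv ≫ (β_ X Y).hom ▷ Z ≫ (α_ Y X Z).hom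

/-- Move the `k`-th factor of a tensor product of a family to the front, through the braiding. -/
def pull : (n : ℕ) → (k : Fin (n + 1)) → (A : Fin (n + 1) → M) →
    (tensorFam (n + 1) A ⟶ A k ⊗ tensorFam n (fun j => A (skip n k j)))
  | 0, k, A =>
    Fin.cases
      (motive := fun k => tensorFam 1 A ⟶ A k ⊗ tensorFam 0 (fun j => A (skip 0 k j)))
      (𝟙 _) (fun k' => k'.elim0) k
  | n + 1, k, A =>
    Fin.cases
      (motive := fun k => tensorFam (n + 2) A ⟶ A k ⊗ tensorFam (n + 1) (fun j => A (skip (n + 1) k j)))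
      (𝟙 _) (fun k' => A 0 ◁ pull n k' (fun i => A i.succ) ≫ interchange _ _ _) k

/-- The tensor product `⨂ⱼ Aⱼ ⟶ ⨂ᵢ Bᵢ` of the morphisms `A_{σ i} ⟶ Bᵢ`, where the factors are
permuted by the bijection `σ` through the braiding. -/
def reindex : (m n : ℕ) → (σ : Fin m ≃ Fin n) → {A : Fin n → M} → {B : Fin m → M} →
    (∀ i, A (σ i) ⟶ B i) → (tensorFam n A ⟶ tensorFam m B)
  | 0, 0, _, _, _, _ => 𝟙 (𝟙_ M)
  | 0, _ + 1, σ, _, _, _ => (σ.symm 0).elim0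
  | _ + 1, 0, σ, _, _, _ => (σ 0).elim0
  | m + 1, n + 1, σ, A, _, f =>
    pull n (σ 0) A ≫ (f 0 ⊗ₘ reindex m n (residual σ 0)
      (fun i => eqToHom (congrArg A ((skip_residual σ 0 i).trans
        (congrArg σ (skip_zero m i)))) ≫ f i.succ))

theorem interchange_natural {X X' Y Y' Z Z' : M} (f : X ⟶ X') (g : Y ⟶ Y') (h : Z ⟶ Z') :
    (f ⊗ₘ (g ⊗ₘ h)) ≫ interchange X' Y' Z' = interchange X Y Z ≫ (g ⊗ₘ (f ⊗ₘ h)) := by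
  simp only [interchange, Category.assoc, ← associator_naturality,
    associator_inv_naturality_assoc]
  simp only [← tensorHom_id, tensorHom_comp_tensorHom_assoc,
    Category.comp_id, Category.id_comp, BraidedCategory.braiding_naturality]

theorem interchange_interchange (X Y Z : M) :
    interchange X Y Z ≫ interchange Y X Z = 𝟙 _ := by
  simp [interchange, ← comp_whiskerRight_assoc]

theorem interchange_yang_baxter (X Y Z W : M) :
    X ◁ interchange Y Z W ≫ interchange X Z (Y ⊗ W) ≫ Z ◁ interchange X Y W =
      interchange X Y (Z ⊗ W) ≫ Y ◁ interchange X Z W ≫ interchange Y Z (X ⊗ W) := by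
  have h := congrArg (fun f => (α_ X Y (Z ⊗ W)).inv ≫ (α_ (X ⊗ Y) Z W).inv ≫
    (α_ X Y Z).hom ▷ W ≫ f ▷ W ≫ (α_ Z (Y ⊗ X) W).hom ≫ Z ◁ (α_ Y X W).hom)
    (BraidedCategory.yang_baxter X Y Z)
  simp only [interchange]
  calc _ = _ := ?_
    _ = _ := h.symm
    _ = _ := ?_
  · monoidal
  · monoidal

theorem pull_zero (n : ℕ) (A : Fin (n + 1) → M) :
    pull n 0 A = A 0 ◁ tensorFamMap n (fun j => eqToHom (congrArg A (skip_zero n j).symm)) := by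
  cases n with
  | zero => exact (whiskerLeft_id _ _).symm
  | succ n =>
    refine Eq.trans ?_ (congrArg _ (tensorFamMap_id (n + 1) (fun j => A j.succ)).symm)
    exact (whiskerLeft_id _ _).symm

theorem pull_succ (n : ℕ) (k : Fin (n + 1)) (A : Fin (n + 2) → M) :
    pull (n + 1) k.succ A = A 0 ◁ pull n k (fun i => A i.succ) ≫ interchange _ _ _ := rfl

theorem interchange_step {A B X Y P P' Q Q' : M} (f : A ⟶ B) (t : P ⟶ Q) (a : P ⟶ X ⊗ P')
    (b : Q ⟶ Y ⊗ Q') (g : X ⟶ Y) (t' : P' ⟶ Q') (h : t ≫ b = a ≫ (g ⊗ₘ t')) :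
    (f ⊗ₘ t) ≫ B ◁ b ≫ interchange B Y Q' =
      (A ◁ a ≫ interchange A X P') ≫ (g ⊗ₘ (f ⊗ₘ t')) := by
  rw [Category.assoc, ← interchange_natural, ← id_tensorHom, ← id_tensorHom,
    tensorHom_comp_tensorHom_assoc, tensorHom_comp_tensorHom_assoc, h, Category.id_comp,
    Category.comp_id]

theorem interchange_step' {A X Y Z P P₁ P₂ P₃ P₄ : M} (p : P ⟶ X ⊗ P₁) (q : P₁ ⟶ Y ⊗ P₂)
    (p' : P ⟶ Y ⊗ P₃) (q' : P₃ ⟶ Z ⊗ P₄) (e : Z ⟶ X) (t : P₄ ⟶ P₂)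
    (h : p ≫ X ◁ q ≫ interchange X Y P₂ = p' ≫ Y ◁ (q' ≫ (e ⊗ₘ t))) :
    (A ◁ p ≫ interchange A X P₁) ≫ X ◁ (A ◁ q ≫ interchange A Y P₂) ≫ interchange X Y (A ⊗ P₂) =
      (A ◁ p' ≫ interchange A Y P₃) ≫
        Y ◁ ((A ◁ q' ≫ interchange A Z P₄) ≫ (e ⊗ₘ (𝟙 A ⊗ₘ t))) := by
  have h1 := interchange_yang_baxter A X Y P₂
  have h2 := interchange_natural (𝟙 A) (𝟙 X) q
  have h3 := interchange_natural (𝟙 A) (𝟙 Y) (q' ≫ (e ⊗ₘ t))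
  simp only [id_tensorHom] at h2 h3
  rw [whiskerLeft_comp, Category.assoc, Category.assoc, ← reassoc_of% h2, ← h1,
    ← whiskerLeft_comp_assoc, ← whiskerLeft_comp_assoc, Category.assoc, h, whiskerLeft_comp,
    Category.assoc, reassoc_of% h3, Category.assoc, Category.assoc, ← interchange_natural,
    id_tensorHom]
  simp only [whiskerLeft_comp, Category.assoc]

theorem interchange_base {X Y P P₁ : M} (q : P₁ ⟶ Y ⊗ P) {t : X ⊗ P ⟶ X ⊗ P} (ht : t = 𝟙 _) :
    𝟙 (X ⊗ P₁) ≫ X ◁ q ≫ interchange X Y P =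
      (X ◁ q ≫ interchange X Y P) ≫ Y ◁ (𝟙 _ ≫ t) := by
  simp [ht]

theorem interchange_base' {A X P P₁ : M} (p : P ⟶ X ⊗ P₁) {t : X ⊗ P₁ ⟶ X ⊗ P₁} (ht : t = 𝟙 _) :
    (A ◁ p ≫ interchange A X P₁) ≫ X ◁ 𝟙 _ ≫ interchange X A P₁ =
      𝟙 _ ≫ A ◁ (p ≫ t) := by
  simp [ht, interchange_interchange]

theorem tensorFamMap_pull : (n : ℕ) → (k : Fin (n + 1)) → {A B : Fin (n + 1) → M} →
    (f : ∀ i, A i ⟶ B i) → tensorFamMap (n + 1) f ≫ pull n k B =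
      pull n k A ≫ (f k ⊗ₘ tensorFamMap n (fun j => f (skip n k j)))
  | 0, k, A, B, f => by
    refine Fin.cases ?_ (fun k' => k'.elim0) k
    exact (Category.comp_id _).trans (Category.id_comp _).symm
  | n + 1, k, A, B, f => by
    refine Fin.cases ?_ (fun k' => ?_) k
    · exact (Category.comp_id _).trans (Category.id_comp _).symm
    · exact interchange_step _ _ _ _ _ _ (tensorFamMap_pull n k' (fun i => f i.succ))

/-- The position that `p` has after `skip n p q` is removed. -/
def dualSkip : (n : ℕ) → Fin (n + 2) → Fin (n + 1) → Fin (n + 1)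
  | 0, _, _ => 0
  | n + 1, p, q =>
    Fin.cases (motive := fun _ => Fin (n + 2)) 0
      (fun p' => Fin.cases (motive := fun _ => Fin (n + 2)) p'
        (fun q' => (dualSkip n p' q').succ) q) p

theorem skip_dualSkip : (n : ℕ) → (p : Fin (n + 2)) → (q : Fin (n + 1)) →
    skip (n + 1) (skip (n + 1) p q) (dualSkip n p q) = p
  | 0, p, q => by revert p q; decide
  | n + 1, p, q => by
    refine Fin.cases ?_ (fun p' => ?_) p
    · rfl
    · refine Fin.cases ?_ (fun q' => ?_) q
      · rfl
      · exact congrArg Fin.succ (skip_dualSkip n p' q')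

theorem skip_skip_dualSkip : (n : ℕ) → (p : Fin (n + 2)) → (q : Fin (n + 1)) → (j : Fin n) →
    skip (n + 1) (skip (n + 1) p q) (skip n (dualSkip n p q) j) = skip (n + 1) p (skip n q j)
  | 0, _, _, j => j.elim0
  | n + 1, p, q, j => by
    refine Fin.cases ?_ (fun p' => ?_) p
    · rfl
    · refine Fin.cases ?_ (fun q' => ?_) q
      · rfl
      · refine Fin.cases ?_ (fun j' => ?_) j
        · rfl
        · exact congrArg Fin.succ (skip_skip_dualSkip n p' q' j')

theorem pull_pull : (n : ℕ) → (p : Fin (n + 2)) → (q : Fin (n + 1)) → (A : Fin (n + 2) → M) →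
    pull (n + 1) p A ≫ A p ◁ pull n q _ ≫ interchange _ _ _ =
      pull (n + 1) (skip (n + 1) p q) A ≫ A (skip (n + 1) p q) ◁
        (pull n (dualSkip n p q) _ ≫ (eqToHom (congrArg A (skip_dualSkip n p q)) ⊗ₘ
          tensorFamMap n (fun j => eqToHom (congrArg A (skip_skip_dualSkip n p q j)))))
  | 0, p, q, A => by
    refine Fin.cases ?_ (fun q' => q'.elim0) q
    refine Fin.cases ?_ (fun p' => Fin.cases ?_ (fun p' => p'.elim0) p') p
    · exact interchange_base _ (id_tensorHom_id _ _)
    · exact interchange_base' _ (id_tensorHom_id _ _)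
  | n + 1, p, q, A => by
    refine Fin.cases ?_ (fun p' => ?_) p
    · exact interchange_base _
        ((congrArg _ (tensorFamMap_id (n + 1) _)).trans (id_tensorHom_id _ _))
    · refine Fin.cases ?_ (fun q' => ?_) q
      · exact interchange_base' _
          ((congrArg _ (tensorFamMap_id (n + 1) _)).trans (id_tensorHom_id _ _))
      · exact interchange_step' _ _ _ _ _ _ (pull_pull n p' q' (fun i => A i.succ))

theorem reindex_succ {m n : ℕ} (σ : Fin (m + 1) ≃ Fin (n + 1)) {A : Fin (n + 1) → M}
    {B : Fin (m + 1) → M} (f : ∀ i, A (σ i) ⟶ B i) :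
    reindex (m + 1) (n + 1) σ f = pull n (σ 0) A ≫ (f 0 ⊗ₘ reindex m n (residual σ 0)
      (fun i => eqToHom (congrArg A ((skip_residual σ 0 i).trans
        (congrArg σ (skip_zero m i)))) ≫ f i.succ)) := rfl

theorem reindex_congr {m n : ℕ} {σ σ' : Fin m ≃ Fin n} (h : σ = σ') {A : Fin n → M}
    {B : Fin m → M} (f : ∀ i, A (σ i) ⟶ B i) :
    reindex m n σ f = reindex m n σ' (fun i => eqToHom (by rw [h]) ≫ f i) := by
  subst h
  simp

theorem reindex_tensorFamMap : (m n : ℕ) → (σ : Fin m ≃ Fin n) → {A : Fin n → M} →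
    {B D : Fin m → M} → (f : ∀ i, A (σ i) ⟶ B i) → (g : ∀ i, B i ⟶ D i) →
    reindex m n σ f ≫ tensorFamMap m g = reindex m n σ (fun i => f i ≫ g i)
  | 0, 0, _, _, _, _, _, _ => Category.comp_id _
  | 0, _ + 1, σ, _, _, _, _, _ => (σ.symm 0).elim0
  | _ + 1, 0, σ, _, _, _, _, _ => (σ 0).elim0
  | m + 1, n + 1, σ, A, B, D, f, g => by
    have h := reindex_tensorFamMap m n (residual σ 0) (A := fun j => A (skip n (σ 0) j))
      (fun i => eqToHom (congrArg A ((skip_residual σ 0 i).trans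
        (congrArg σ (skip_zero m i)))) ≫ f i.succ) (fun i => g i.succ)
    simp only [Category.assoc] at h
    rw [reindex_succ σ (fun i => f i ≫ g i), ← h, ← tensorHom_comp_tensorHom,
      ← Category.assoc]
    rfl

theorem tensorFamMap_reindex : (m n : ℕ) → (σ : Fin m ≃ Fin n) → {A B : Fin n → M} →
    {D : Fin m → M} → (g : ∀ i, A i ⟶ B i) → (f : ∀ i, B (σ i) ⟶ D i) →
    tensorFamMap n g ≫ reindex m n σ f = reindex m n σ (fun i => g (σ i) ≫ f i)
  | 0, 0, _, _, _, _, _, _ => Category.comp_id _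
  | 0, _ + 1, σ, _, _, _, _, _ => (σ.symm 0).elim0
  | _ + 1, 0, σ, _, _, _, _, _ => (σ 0).elim0
  | m + 1, n + 1, σ, A, B, D, g, f => by
    have h := tensorFamMap_reindex m n (residual σ 0) (fun j => g (skip n (σ 0) j))
      (fun i => eqToHom (congrArg B ((skip_residual σ 0 i).trans
        (congrArg σ (skip_zero m i)))) ≫ f i.succ)
    have e : ∀ {j j' : Fin (n + 1)} (h : j = j'), g j ≫ eqToHom (congrArg B h) =
        eqToHom (congrArg A h) ≫ g j' := by rintro j _ rfl; simp
    rw [reindex_succ, reindex_succ, ← Category.assoc, tensorFamMap_pull, Category.assoc,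
      tensorHom_comp_tensorHom, h]
    congr 3
    funext i
    rw [← Category.assoc, e ((skip_residual σ 0 i).trans (congrArg σ (skip_zero m i))),
      Category.assoc]

theorem skip_injective (n : ℕ) (k : Fin (n + 1)) {i j : Fin n} (h : skip n k i = skip n k j) :
    i = j := by
  rw [skip_eq_succAbove, skip_eq_succAbove] at h
  exact Fin.succAbove_right_injective h

theorem pull_congr {n : ℕ} {k k' : Fin (n + 1)} (h : k = k') (A : Fin (n + 1) → M) :
    pull n k A = pull n k' A ≫
      (eqToHom (by rw [h]) ⊗ₘ tensorFamMap n (fun j => eqToHom (by rw [h]))) := by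
  subst h
  simp [tensorFamMap_id]

/-- Permuting the factors and then moving the `k`-th one to the front. -/
theorem reindex_pull : (m n : ℕ) → (σ : Fin (m + 1) ≃ Fin (n + 1)) → (k : Fin (m + 1)) →
    {A : Fin (n + 1) → M} → {B : Fin (m + 1) → M} → (f : ∀ i, A (σ i) ⟶ B i) →
    reindex (m + 1) (n + 1) σ f ≫ pull m k B =
      pull n (σ k) A ≫ (f k ⊗ₘ reindex m n (residual σ k)
        (fun i => eqToHom (congrArg A (skip_residual σ k i)) ≫ f (skip m k i)))
  | m, n, σ, k, A, B, f => by
    refine Fin.cases ?_ (fun k' => ?_) k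
    · rw [reindex_succ, pull_zero, Category.assoc, ← id_tensorHom, tensorHom_comp_tensorHom,
        reindex_tensorFamMap, Category.comp_id]
      congr 3
      funext i
      rw [eqToHom_family f (skip_zero m i)]
      simp
    · cases m with
      | zero => exact k'.elim0
      | succ m =>
      cases n with
      | zero =>
        exact absurd (σ.injective ((Fin.fin_one_eq_zero (σ 0)).trans
          (Fin.fin_one_eq_zero (σ k'.succ)).symm)) (Fin.succ_ne_zero k').symm
      | succ n =>
      have hp : skip (n + 1) (σ 0) (residual σ 0 k') = σ k'.succ := skip_residual σ 0 k'
      have hq : dualSkip n (σ 0) (residual σ 0 k') = residual σ k'.succ 0 := by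
        apply skip_injective (n + 1) (σ k'.succ)
        rw [skip_residual, ← hp]
        exact skip_dualSkip n _ _
      have hr : residual (residual σ 0) k' = residual (residual σ k'.succ) 0 := by
        ext1 i
        apply skip_injective n (residual σ k'.succ 0)
        apply skip_injective (n + 1) (σ k'.succ)
        have h1 := skip_skip_dualSkip n (σ 0) (residual σ 0 k') (residual (residual σ 0) k' i)
        rw [hq, hp, skip_residual, skip_residual] at h1
        rw [h1, skip_residual, skip_residual, skip_zero, skip_zero]
        rfl
      have h1 := interchange_step (f 0) _ _ _ _ _ (reindex_pull m n (residual σ 0) k'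
        (A := fun j => A (skip (n + 1) (σ 0) j)) (B := fun i => B i.succ)
        (fun i => eqToHom (congrArg A ((skip_residual σ 0 i).trans
          (congrArg σ (skip_zero (m + 1) i)))) ≫ f i.succ))
      have h2 := pull_pull n (σ 0) (residual σ 0 k') A
      refine (Category.assoc _ _ _).trans ((congrArg (pull (n + 1) (σ 0) A ≫ ·) h1).trans ?_)
      refine (Category.assoc _ _ _).symm.trans ((congrArg (· ≫ _) h2).trans ?_)
      rw [pull_congr hp A, Category.assoc, Category.assoc, ← id_tensorHom,
        tensorHom_comp_tensorHom, tensorHom_comp_tensorHom]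
      congr 2
      · simp
      · rw [reindex_succ, pull_congr hq]
        simp only [Category.assoc]
        rw [← Category.assoc, tensorFamMap_pull]
        simp only [Category.assoc, tensorHom_comp_tensorHom]
        congr 2
        · simp
          rfl
        · rw [reindex_congr hr]
          simp only [tensorFamMap_reindex]
          congr 1
          funext i
          simp [eqToHom_trans_assoc]
          rfl

theorem reindex_reindex : (l m n : ℕ) → (σ : Fin m ≃ Fin n) → (τ : Fin l ≃ Fin m) →
    {A : Fin n → M} → {B : Fin m → M} → {D : Fin l → M} → (f : ∀ i, A (σ i) ⟶ B i) →
    (g : ∀ i, B (τ i) ⟶ D i) →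
    reindex m n σ f ≫ reindex l m τ g = reindex l n (τ.trans σ) (fun i => f (τ i) ≫ g i)
  | 0, 0, 0, _, _, _, _, _, _, _ => Category.comp_id _
  | _, 0, _ + 1, σ, _, _, _, _, _, _ => (σ.symm 0).elim0
  | _, _ + 1, 0, σ, _, _, _, _, _, _ => (σ 0).elim0
  | 0, _ + 1, _, _, τ, _, _, _, _, _ => (τ.symm 0).elim0
  | _ + 1, 0, _, _, τ, _, _, _, _, _ => (τ 0).elim0
  | l + 1, m + 1, n + 1, σ, τ, A, B, D, f, g => by
    have hr : (residual τ 0).trans (residual σ (τ 0)) = residual (τ.trans σ) 0 := by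
      ext1 i
      apply skip_injective n (σ (τ 0))
      exact ((skip_residual σ (τ 0) (residual τ 0 i)).trans
        (congrArg σ (skip_residual τ 0 i))).trans (skip_residual (τ.trans σ) 0 i).symm
    rw [reindex_succ τ g, ← Category.assoc, reindex_pull, Category.assoc,
      tensorHom_comp_tensorHom, reindex_reindex l m n, reindex_succ, reindex_congr hr]
    congr 3
    funext i
    rw [eqToHom_family f ((skip_residual τ 0 i).trans (congrArg τ (skip_zero l i)))]
    simp
    refine (Category.assoc _ _ _).symm.trans ?_
    exact congrArg (· ≫ f (τ i.succ) ≫ g i.succ) (eqToHom_trans (C := M) _ _)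

theorem reindex_refl' : (n : ℕ) → {A B : Fin n → M} → (σ : Fin n ≃ Fin n) →
    (h : σ = Equiv.refl _) → (f : ∀ i, A (σ i) ⟶ B i) →
    reindex n n σ f = tensorFamMap n (fun i => eqToHom (by rw [h]; rfl) ≫ f i)
  | 0, _, _, _, _, _ => rfl
  | n + 1, A, B, σ, h, f => by
    have hr : residual σ 0 = Equiv.refl (Fin n) := by
      ext1 i
      apply skip_injective n 0
      have := skip_residual σ 0 i
      rw [h] at this ⊢
      exact this
    rw [reindex_succ, reindex_refl' n _ hr]
    have h0 : σ 0 = 0 := by rw [h]; rfl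
    rw [pull_congr h0, pull_zero, Category.assoc, ← id_tensorHom, tensorHom_comp_tensorHom,
      tensorHom_comp_tensorHom, tensorFamMap_comp, tensorFamMap_comp, tensorFamMap]
    refine congrArg₂ (fun x y => x ⊗ₘ tensorFamMap n y) ?_ ?_
    · simp
    · funext i
      simp

theorem reindex_refl (n : ℕ) {A B : Fin n → M} (f : ∀ i, A i ⟶ B i) :
    reindex n n (Equiv.refl _) f = tensorFamMap n f := by
  refine (reindex_refl' n _ rfl f).trans (congrArg _ ?_)
  funext i
  exact Category.id_comp _

end TensorFamily

section Blocks

/-- The total length of `m` consecutive blocks of lengths `n 0, …, n (m - 1)`. -/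
def sumLen : (m : ℕ) → (Fin m → ℕ) → ℕ
  | 0, _ => 0
  | m + 1, n => sumLen m (fun k => n k.succ) + n 0

theorem sumLen_eq_sum : (m : ℕ) → (n : Fin m → ℕ) → sumLen m n = ∑ k, n k
  | 0, _ => rfl
  | m + 1, n => by rw [sumLen, sumLen_eq_sum m, Fin.sum_univ_succ, add_comm]

/-- The position of the `l`-th entry of the `k`-th block in the concatenation of the blocks. -/
def blockPos : (m : ℕ) → (n : Fin m → ℕ) → (k : Fin m) → Fin (n k) → Fin (sumLen m n)
  | m + 1, n, k =>
    Fin.cases (motive := fun k => Fin (n k) → Fin (sumLen (m + 1) n))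
      (fun l => Fin.castLE (Nat.le_add_left _ _) l)
      (fun k' l => (blockPos m (fun k => n k.succ) k' l).addNat (n 0)) k

/-- The blocks are placed one after the other. -/
theorem blockPos_val : (m : ℕ) → (n : Fin m → ℕ) → (k : Fin m) → (l : Fin (n k)) →
    (blockPos m n k l : ℕ) = (∑ i : Fin k, n (Fin.castLE k.isLt.le i)) + l
  | m + 1, n, k, l => by
    revert l
    refine Fin.cases (fun l => ?_) (fun k' l => ?_) k
    · exact (Nat.zero_add _).symm
    · have h := blockPos_val m (fun k => n k.succ) k' l
      change (blockPos m (fun k => n k.succ) k' l : ℕ) + n 0 =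
        (∑ i : Fin (k'.val + 1), n (Fin.castLE k'.succ.isLt.le i)) + l
      rw [h, Fin.sum_univ_succ]
      simp only [Fin.castLE_zero, Fin.castLE_succ]
      ring

theorem blockPos_injective : (m : ℕ) → (n : Fin m → ℕ) →
    Function.Injective (fun p : (k : Fin m) × Fin (n k) => blockPos m n p.1 p.2)
  | 0, _, ⟨k, _⟩, _, _ => k.elim0
  | m + 1, n, ⟨k, l⟩, ⟨k', l'⟩, h => by
    revert l l'
    refine Fin.cases ?_ (fun k => ?_) k <;> refine Fin.cases ?_ (fun k' => ?_) k' <;>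
      intro l l' h
    · have h' := congrArg Fin.val h
      have : l = l' := Fin.ext h'
      rw [this]
    · have h' : (l : ℕ) = (blockPos m (fun k => n k.succ) k' l' : ℕ) + n 0 := congrArg Fin.val h
      have := l.isLt
      omega
    · have h' : (blockPos m (fun k => n k.succ) k l : ℕ) + n 0 = (l' : ℕ) := congrArg Fin.val h
      have := l'.isLt
      omega
    · have h' : (blockPos m (fun k => n k.succ) k l : ℕ) + n 0 =
        (blockPos m (fun k => n k.succ) k' l' : ℕ) + n 0 := congrArg Fin.val h
      have h2 := blockPos_injective m (fun k => n k.succ) (a₁ := ⟨k, l⟩) (a₂ := ⟨k', l'⟩)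
        (Fin.ext (Nat.add_right_cancel h'))
      cases h2
      rfl

/-- The positions in a concatenation of blocks are the pairs of a block and a position in it. -/
noncomputable def blockEquiv (m : ℕ) (n : Fin m → ℕ) :
    ((k : Fin m) × Fin (n k)) ≃ Fin (sumLen m n) :=
  Equiv.ofBijective (fun p => blockPos m n p.1 p.2)
    ((Fintype.bijective_iff_injective_and_card _).2 ⟨blockPos_injective m n, by
      rw [Fintype.card_sigma, Fintype.card_fin, sumLen_eq_sum]; simp⟩)

end Blocks

section Profiles

/-- A profile: a finite sequence of elements of `C`. -/
structure Profile (C : Type v) where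
  /-- the length of the sequence -/
  len : ℕ
  /-- the entries of the sequence -/
  col : Fin len → C

/-- A morphism `c ⟶ d` is a permutation `σ` with `d = c σ = (c_{σ 1}, …, c_{σ n})`. -/
@[ext]
structure Profile.Hom {C : Type v} (c d : Profile C) where
  /-- the permutation -/
  perm : Fin d.len ≃ Fin c.len
  col_perm : ∀ i, c.col (perm i) = d.col i

variable {C : Type v}

/-- The groupoid of profiles. -/
instance : Groupoid (Profile C) where
  Hom c d := Profile.Hom c d
  id c := ⟨Equiv.refl _, fun _ => rfl⟩
  comp f g := ⟨g.perm.trans f.perm, fun i => (f.col_perm _).trans (g.col_perm i)⟩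
  inv f := ⟨f.perm.symm, fun i => by
    rw [← f.col_perm, Equiv.apply_symm_apply]⟩
  inv_comp f := Profile.Hom.ext (Equiv.self_trans_symm f.perm)
  comp_inv f := Profile.Hom.ext (Equiv.symm_trans_self f.perm)

@[ext]
theorem Profile.hom_ext {c d : Profile C} {f g : c ⟶ d} (h : f.perm = g.perm) : f = g :=
  Profile.Hom.ext h

/-- The profile of length one. -/
def Profile.single (t : C) : Profile C := ⟨1, fun _ => t⟩

/-- The concatenation `b₁ ⊗ ⋯ ⊗ bₘ` of a sequence of profiles. -/
noncomputable def Profile.concat {m : ℕ} (b : Fin m → Profile C) : Profile C where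
  len := sumLen m (fun k => (b k).len)
  col p := (b ((blockEquiv m _).symm p).1).col ((blockEquiv m _).symm p).2

/-- The position in a concatenation of an entry of one of its blocks. -/
noncomputable def Profile.pos {m : ℕ} (b : Fin m → Profile C) :
    ((k : Fin m) × Fin (b k).len) ≃ Fin (concat b).len :=
  blockEquiv m (fun k => (b k).len)

theorem Profile.concat_col {m : ℕ} (b : Fin m → Profile C) (p : (k : Fin m) × Fin (b k).len) :
    (concat b).col (pos b p) = (b p.1).col p.2 := by
  have h := (pos b).symm_apply_apply p
  change (b ((pos b).symm (pos b p)).1).col ((pos b).symm (pos b p)).2 = _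
  rw [h]

/-- The morphism `b₁ ⊗ ⋯ ⊗ bₘ ⟶ d₁ ⊗ ⋯ ⊗ dₙ` given by a permutation `σ` of the blocks
and morphisms `b_{σ i} ⟶ dᵢ`. -/
noncomputable def Profile.concatMap {m n : ℕ} (σ : Fin n ≃ Fin m) {b : Fin m → Profile C}
    {d : Fin n → Profile C} (β : ∀ i, b (σ i) ⟶ d i) : concat b ⟶ concat d where
  perm := (pos d).symm.trans ((Equiv.sigmaCongr σ (fun i => (β i).perm)).trans (pos b))
  col_perm p := by
    obtain ⟨⟨k, l⟩, rfl⟩ := (pos d).surjective p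
    rw [concat_col, Equiv.trans_apply, Equiv.symm_apply_apply, Equiv.trans_apply, concat_col]
    exact (β k).col_perm l

theorem Profile.concatMap_perm_pos {m n : ℕ} (σ : Fin n ≃ Fin m) {b : Fin m → Profile C}
    {d : Fin n → Profile C} (β : ∀ i, b (σ i) ⟶ d i) (k : Fin n) (l : Fin (d k).len) :
    (concatMap σ β).perm (pos d ⟨k, l⟩) = pos b ⟨σ k, (β k).perm l⟩ := by
  simp only [concatMap, Equiv.trans_apply, Equiv.symm_apply_apply]
  rfl

theorem Profile.concatMap_comp {l m n : ℕ} (σ : Fin m ≃ Fin n) (τ : Fin l ≃ Fin m)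
    {b : Fin n → Profile C} {d : Fin m → Profile C} {e : Fin l → Profile C}
    (β : ∀ i, b (σ i) ⟶ d i) (γ : ∀ i, d (τ i) ⟶ e i) :
    concatMap σ β ≫ concatMap τ γ = concatMap (τ.trans σ) (fun i => β (τ i) ≫ γ i) := by
  ext1
  ext1 p
  obtain ⟨⟨k, l⟩, rfl⟩ := (pos e).surjective p
  refine (congrArg (concatMap σ β).perm (concatMap_perm_pos τ γ k l)).trans ?_
  rw [concatMap_perm_pos, concatMap_perm_pos]
  rfl

theorem Profile.concatMap_id {m : ℕ} (b : Fin m → Profile C) :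
    concatMap (Equiv.refl _) (fun i => 𝟙 (b i)) = 𝟙 (concat b) := by
  ext1
  ext1 p
  obtain ⟨⟨k, l⟩, rfl⟩ := (pos b).surjective p
  exact concatMap_perm_pos _ _ k l

/-- A sequence of profiles of length one concatenates to the sequence of its entries. -/
noncomputable def Profile.concatSingle (a : Profile C) :
    concat (fun i => single (a.col i)) ⟶ a where
  perm := (Equiv.sigmaUnique (Fin a.len) (fun _ => Fin 1)).symm.trans
    (pos (fun i => single (a.col i)))
  col_perm i := concat_col (fun i => single (a.col i)) ⟨i, (0 : Fin 1)⟩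

/-- The concatenation of a single profile is this profile. -/
noncomputable def Profile.concatOne (b : Profile C) : concat (fun _ : Fin 1 => b) ⟶ b where
  perm := (Equiv.uniqueSigma (fun _ : Fin 1 => Fin b.len)).symm.trans (pos (fun _ : Fin 1 => b))
  col_perm i := concat_col (fun _ : Fin 1 => b) ⟨0, i⟩

/-- The associativity of concatenation: the profiles `b (k, l)`, indexed by the entries `l` of a
sequence `d k` of profiles, are concatenated first over `l` and then over `k`, or at once. -/
noncomputable def Profile.concatConcat {m : ℕ} (d : Fin m → Profile C)
    (b : Fin (concat d).len → Profile C) :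
    concat b ⟶ concat (fun k => concat (fun l => b (pos d ⟨k, l⟩))) where
  perm := (pos _).symm.trans
    ((Equiv.sigmaCongrRight (fun _ => (pos _).symm)).trans
      ((Equiv.sigmaAssoc (fun k l => Fin (b (pos d ⟨k, l⟩)).len)).symm.trans
        ((Equiv.sigmaCongrLeft (β := fun p => Fin (b p).len) (pos d)).trans (pos b))))
  col_perm p := by
    obtain ⟨⟨k, p⟩, rfl⟩ := (pos _).surjective p
    obtain ⟨⟨l, i⟩, rfl⟩ := (pos _).surjective p
    rw [concat_col]
    simp only [Equiv.trans_apply, Equiv.symm_apply_apply]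
    rw [concat_col, concat_col]
    have h : Equiv.sigmaCongrRight
        (fun x => (pos (fun l => b (pos d ⟨x, l⟩))).symm) ⟨k, pos _ ⟨l, i⟩⟩ = ⟨k, ⟨l, i⟩⟩ :=
      congrArg (Sigma.mk k) (Equiv.symm_apply_apply _ _)
    rw [h]
    rfl

end Profiles

section CircleProduct

variable (C : Type v) (M : Type u) [Category.{v} M]

/-- The category of `C`-colored symmetric sequences with values in `M`. -/
def SymSeq := Profile C × Discrete C ⥤ M

instance : Category (SymSeq C M) := inferInstanceAs (Category (Profile C × Discrete C ⥤ M))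

variable {C M}

/-- The value of a symmetric sequence at the profile `c` and the color `t`. -/
def SymSeq.val (X : SymSeq C M) (t : C) (c : Profile C) : M :=
  CategoryTheory.Functor.obj X (c, Discrete.mk t)

/-- The action of a morphism of profiles, where the color may be replaced by an equal one. -/
def SymSeq.act (X : SymSeq C M) {t t' : C} (h : t = t') {c c' : Profile C} (f : c ⟶ c') :
    X.val t c ⟶ X.val t' c' :=
  CategoryTheory.Functor.map (C := Profile C × Discrete C) X
    (X := (c, Discrete.mk t)) (Y := (c', Discrete.mk t')) (f, Discrete.eqToHom h)

/-- The components of a morphism of symmetric sequences. -/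
def SymSeq.app {X Y : SymSeq C M} (φ : X ⟶ Y) (t : C) (c : Profile C) : X.val t c ⟶ Y.val t c :=
  NatTrans.app φ (c, Discrete.mk t)

theorem SymSeq.act_id (X : SymSeq C M) (t : C) (c : Profile C) :
    X.act rfl (𝟙 c) = 𝟙 (X.val t c) := CategoryTheory.Functor.map_id X _

theorem SymSeq.act_comp (X : SymSeq C M) {t t' t'' : C} (h : t = t') (h' : t' = t'')
    {c c' c'' : Profile C} (f : c ⟶ c') (g : c' ⟶ c'') :
    X.act h f ≫ X.act h' g = X.act (h.trans h') (f ≫ g) :=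
  (CategoryTheory.Functor.map_comp (C := Profile C × Discrete C) X (X := (c, Discrete.mk t))
    (Y := (c', Discrete.mk t')) (Z := (c'', Discrete.mk t'')) (f, Discrete.eqToHom h)
    (g, Discrete.eqToHom h')).symm.trans
    (congrArg (CategoryTheory.Functor.map (C := Profile C × Discrete C) X)
      (Prod.ext rfl (Subsingleton.elim _ _)))

theorem SymSeq.act_app {X Y : SymSeq C M} (φ : X ⟶ Y) {t t' : C} (h : t = t')
    {c c' : Profile C} (f : c ⟶ c') :
    X.act h f ≫ app φ t' c' = app φ t c ≫ Y.act h f :=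
  NatTrans.naturality φ (X := (c, Discrete.mk t)) (Y := (c', Discrete.mk t'))
    (f, Discrete.eqToHom h)

open Profile

/-- The concatenation of morphisms of profiles. -/
noncomputable def blockHom {m : ℕ} {b b' : Fin m → Profile C} (β : b ⟶ b') :
    concat b ⟶ concat b' := concatMap (Equiv.refl _) β

theorem blockHom_id {m : ℕ} (b : Fin m → Profile C) : blockHom (𝟙 b) = 𝟙 (concat b) :=
  concatMap_id b

theorem blockHom_comp {m : ℕ} {b b' b'' : Fin m → Profile C} (β : b ⟶ b') (γ : b' ⟶ b'') :
    blockHom (β ≫ γ) = blockHom β ≫ blockHom γ :=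
  (concatMap_comp (Equiv.refl _) (Equiv.refl _) β γ).symm

section SetTensor

variable [HasColimits M]

/-- The tensoring `S ⊗ m := ∐_{s ∈ S} m` of an object with a set. -/
noncomputable def setTensor (S : Type) (m : M) : M := ∐ fun _ : S => m

/-- The inclusion of a summand. -/
noncomputable def setTensor.ι {S : Type} (s : S) (m : M) : m ⟶ setTensor S m :=
  Sigma.ι (fun _ : S => m) s

/-- The morphisms out of the tensoring. -/
noncomputable def setTensor.desc {S : Type} {m m' : M} (f : S → (m ⟶ m')) :
    setTensor S m ⟶ m' := Sigma.desc f

theorem setTensor.ι_desc {S : Type} {m m' : M} (f : S → (m ⟶ m')) (s : S) :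
    setTensor.ι s m ≫ setTensor.desc f = f s := Sigma.ι_desc _ _

/-- The functoriality of the tensoring. -/
noncomputable def setTensor.map {S S' : Type} (φ : S → S') {m m' : M} (f : m ⟶ m') :
    setTensor S m ⟶ setTensor S' m' :=
  setTensor.desc (fun s => f ≫ setTensor.ι (φ s) m')

theorem setTensor.hom_ext {S : Type} {m m' : M} {f g : setTensor S m ⟶ m'}
    (h : ∀ s, setTensor.ι s m ≫ f = setTensor.ι s m ≫ g) : f = g :=
  Sigma.hom_ext _ _ h

theorem setTensor.ι_map {S S' : Type} (φ : S → S') {m m' : M} (f : m ⟶ m') (s : S) :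
    setTensor.ι s m ≫ setTensor.map φ f = f ≫ setTensor.ι (φ s) m' := by
  exact setTensor.ι_desc _ _

theorem setTensor.ι_map_assoc {S S' : Type} (φ : S → S') {m m' Z : M} (f : m ⟶ m') (s : S)
    (x : setTensor S' m' ⟶ Z) :
    setTensor.ι s m ≫ setTensor.map φ f ≫ x = f ≫ setTensor.ι (φ s) m' ≫ x := by
  rw [← Category.assoc, setTensor.ι_map, Category.assoc]

theorem setTensor.map_comp {S S' S'' : Type} (φ : S → S') (ψ : S' → S'') {m m' m'' : M}
    (f : m ⟶ m') (g : m' ⟶ m'') :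
    setTensor.map φ f ≫ setTensor.map ψ g = setTensor.map (ψ ∘ φ) (f ≫ g) := by
  refine setTensor.hom_ext (fun s => ?_)
  rw [← Category.assoc, setTensor.ι_map, Category.assoc, setTensor.ι_map, setTensor.ι_map,
    Category.assoc]
  rfl

theorem setTensor.map_id {S : Type} (m : M) :
    setTensor.map (fun s : S => s) (𝟙 m) = 𝟙 (setTensor S m) := by
  refine setTensor.hom_ext (fun s => ?_)
  rw [setTensor.ι_map, Category.comp_id, Category.id_comp]

instance hasCoend {J : Type v} [Category.{0} J] (F : Jᵒᵖ ⥤ J ⥤ M) : HasCoend F := by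
  have : HasColimitsOfShape (WalkingMultispan (multispanShapeCoend J)) M := by
    have : HasColimitsOfSize.{0, v} M := hasColimitsOfSizeShrink.{0, v} M
    have : HasColimitsOfSize.{v, v} M := inferInstance
    infer_instance
  unfold HasCoend HasMulticoequalizer
  infer_instance

end SetTensor

variable [MonoidalCategory M]

/-- The tensor product `Y(a₁; b₁) ⊗ ⋯ ⊗ Y(aₘ; bₘ)`. -/
noncomputable abbrev valFam (Y : SymSeq C M) (a : Profile C) (b : Fin a.len → Profile C) : M :=
  tensorFam a.len (fun i => Y.val (a.col i) (b i))

/-- The functoriality of `Y(a₁; b₁) ⊗ ⋯ ⊗ Y(aₘ; bₘ)` in the profiles `bᵢ`. -/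
noncomputable def valFamMap (Y : SymSeq C M) (a : Profile C) {b b' : Fin a.len → Profile C}
    (β : b ⟶ b') : valFam Y a b ⟶ valFam Y a b' :=
  tensorFamMap a.len (fun i => Y.act rfl (β i))

theorem valFamMap_id (Y : SymSeq C M) (a : Profile C) (b : Fin a.len → Profile C) :
    valFamMap Y a (𝟙 b) = 𝟙 (valFam Y a b) :=
  (congrArg _ (funext fun _ => Y.act_id _ _)).trans (tensorFamMap_id _ _)

theorem valFamMap_comp (Y : SymSeq C M) (a : Profile C) {b b' b'' : Fin a.len → Profile C}
    (β : b ⟶ b') (γ : b' ⟶ b'') :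
    valFamMap Y a (β ≫ γ) = valFamMap Y a β ≫ valFamMap Y a γ :=
  (congrArg _ (funext fun _ => (Y.act_comp rfl rfl _ _).symm)).trans
    (tensorFamMap_comp _ _ _).symm

variable [HasColimits M]

/-- The integrand `Σ_C(b'₁ ⊗ ⋯ ⊗ b'ₘ, c) ⊗ P ⊗ Y(a₁; b₁) ⊗ ⋯ ⊗ Y(aₘ; bₘ)` of the inner coend,
as a functor of `b'` and `b`. -/
noncomputable def innerIntegrand (P : M) (Y : SymSeq C M) (c a : Profile C) :
    (Fin a.len → Profile C)ᵒᵖ ⥤ (Fin a.len → Profile C) ⥤ M where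
  obj b' :=
    { obj b := setTensor (concat b'.unop ⟶ c) (P ⊗ valFam Y a b)
      map β := setTensor.map (fun g => g) (P ◁ valFamMap Y a β)
      map_id b := by
        rw [valFamMap_id, whiskerLeft_id, setTensor.map_id]
      map_comp β γ := by
        rw [valFamMap_comp, whiskerLeft_comp, setTensor.map_comp]
        rfl }
  map β :=
    { app b := setTensor.map (fun g => blockHom β.unop ≫ g) (𝟙 _)
      naturality b b' γ := by
        rw [setTensor.map_comp, setTensor.map_comp, Category.id_comp, Category.comp_id]
        rfl }
  map_id b' := by
    ext b
    simp only [unop_id, blockHom_id, Category.id_comp, NatTrans.id_app]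
    exact setTensor.map_id _
  map_comp β γ := by
    ext b
    simp only [unop_comp, blockHom_comp, Category.assoc, NatTrans.comp_app]
    rw [setTensor.map_comp, Category.id_comp]
    rfl

/-- The inner coend
`∫^{(b₁, …, bₘ)} Σ_C(b₁ ⊗ ⋯ ⊗ bₘ, c) ⊗ P ⊗ Y(a₁; b₁) ⊗ ⋯ ⊗ Y(aₘ; bₘ)`. -/
noncomputable def innerCoend (P : M) (Y : SymSeq C M) (c a : Profile C) : M :=
  coend (innerIntegrand P Y c a)

/-- The inclusions into the inner coend. -/
noncomputable def innerι (P : M) (Y : SymSeq C M) (c a : Profile C) (b : Fin a.len → Profile C)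
    (g : concat b ⟶ c) : P ⊗ valFam Y a b ⟶ innerCoend P Y c a :=
  setTensor.ι g _ ≫ coend.ι (innerIntegrand P Y c a) b

theorem innerCoend_hom_ext {P : M} {Y : SymSeq C M} {c a : Profile C} {Z : M}
    {f f' : innerCoend P Y c a ⟶ Z}
    (h : ∀ b g, innerι P Y c a b g ≫ f = innerι P Y c a b g ≫ f') : f = f' :=
  coend.hom_ext (F := innerIntegrand P Y c a) (fun b => setTensor.hom_ext (fun g =>
    (Category.assoc _ _ _).symm.trans ((h b g).trans (Category.assoc _ _ _))))

theorem innerι_condition (P : M) (Y : SymSeq C M) (c a : Profile C)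
    {b b' : Fin a.len → Profile C} (β : b ⟶ b') (g : concat b' ⟶ c) :
    innerι P Y c a b (blockHom β ≫ g) = P ◁ valFamMap Y a β ≫ innerι P Y c a b' g := by
  have h : setTensor.ι g _ ≫ setTensor.map (fun g => blockHom β ≫ g) (𝟙 _) ≫
      coend.ι (innerIntegrand P Y c a) b =
      setTensor.ι g _ ≫ setTensor.map (fun g => g) (P ◁ valFamMap Y a β) ≫
      coend.ι (innerIntegrand P Y c a) b' :=
    congrArg (setTensor.ι g _ ≫ ·) (coend.condition (innerIntegrand P Y c a) β)
  exact (Category.id_comp _).symm.trans ((setTensor.ι_map_assoc _ _ g _).symm.trans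
    (h.trans (setTensor.ι_map_assoc _ _ g _)))

/-- The morphisms out of the inner coend. -/
noncomputable def innerDesc {P : M} {Y : SymSeq C M} {c a : Profile C} {Z : M}
    (f : ∀ b : Fin a.len → Profile C, (concat b ⟶ c) → (P ⊗ valFam Y a b ⟶ Z))
    (hf : ∀ (b b' : Fin a.len → Profile C) (β : b ⟶ b') (g : concat b' ⟶ c),
      f b (blockHom β ≫ g) = P ◁ valFamMap Y a β ≫ f b' g) :
    innerCoend P Y c a ⟶ Z :=
  coend.desc (F := innerIntegrand P Y c a) (fun b => setTensor.desc (fun g => f b g))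
    (fun b b' β => setTensor.hom_ext (fun g => by
      change setTensor.ι g _ ≫ setTensor.map (fun g => blockHom β ≫ g) (𝟙 _) ≫ _ =
        setTensor.ι g _ ≫ setTensor.map (fun g => g) (P ◁ valFamMap Y a β) ≫ _
      rw [← Category.assoc, setTensor.ι_map, ← Category.assoc, setTensor.ι_map,
        Category.assoc, Category.assoc, setTensor.ι_desc, setTensor.ι_desc, hf,
        Category.id_comp]))

theorem innerι_desc {P : M} {Y : SymSeq C M} {c a : Profile C} {Z : M}
    (f : ∀ b : Fin a.len → Profile C, (concat b ⟶ c) → (P ⊗ valFam Y a b ⟶ Z))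
    (hf : ∀ (b b' : Fin a.len → Profile C) (β : b ⟶ b') (g : concat b' ⟶ c),
      f b (blockHom β ≫ g) = P ◁ valFamMap Y a β ≫ f b' g)
    (b : Fin a.len → Profile C) (g : concat b ⟶ c) :
    innerι P Y c a b g ≫ innerDesc f hf = f b g := by
  refine (Category.assoc _ _ _).trans ?_
  refine (congrArg (setTensor.ι g _ ≫ ·)
    (coend.ι_desc (F := innerIntegrand P Y c a) _ _ b)).trans ?_
  exact setTensor.ι_desc _ _

variable [SymmetricCategory M]

theorem SymSeq.id_app (X : SymSeq C M) (t : C) (c : Profile C) :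
    SymSeq.app (𝟙 X) t c = 𝟙 (X.val t c) := rfl

theorem SymSeq.comp_app {X Y Z : SymSeq C M} (φ : X ⟶ Y) (ψ : Y ⟶ Z) (t : C) (c : Profile C) :
    SymSeq.app (φ ≫ ψ) t c = SymSeq.app φ t c ≫ SymSeq.app ψ t c := rfl

/-- A morphism `f : a' ⟶ a` of profiles permutes the factors of a tensor product indexed by the
entries of `a`. -/
noncomputable def valFamPerm {Y Y' : SymSeq C M} (y : Y ⟶ Y') {a a' : Profile C} (f : a' ⟶ a)
    (b : Fin a.len → Profile C) :
    valFam Y a b ⟶ valFam Y' a' (fun j => b (f.perm.symm j)) :=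
  reindex a'.len a.len f.perm.symm (fun j =>
    Y.act ((f.col_perm (f.perm.symm j)).symm.trans
      (congrArg a'.col (f.perm.apply_symm_apply j))) (𝟙 (b (f.perm.symm j))) ≫
    SymSeq.app y (a'.col j) (b (f.perm.symm j)))

theorem valFamPerm_natural {Y Y' : SymSeq C M} (y : Y ⟶ Y') {a a' : Profile C} (f : a' ⟶ a)
    {b b₂ : Fin a.len → Profile C} (β : b ⟶ b₂) :
    valFamMap Y a β ≫ valFamPerm y f b₂ =
      valFamPerm y f b ≫ valFamMap Y' a' (b := fun j => b (f.perm.symm j))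
        (b' := fun j => b₂ (f.perm.symm j)) (fun j => β (f.perm.symm j)) := by
  refine (tensorFamMap_reindex _ _ _ _ _).trans
    (Eq.trans ?_ (reindex_tensorFamMap _ _ _ _ _).symm)
  congr 1
  funext j
  rw [← Category.assoc, SymSeq.act_comp, Category.assoc, ← SymSeq.act_app, ← Category.assoc,
    SymSeq.act_comp, Category.comp_id, Category.id_comp]

theorem valFamPerm_comp {Y Y' Y'' : SymSeq C M} (y : Y ⟶ Y') (y' : Y' ⟶ Y'')
    {a a' a'' : Profile C} (f : a' ⟶ a) (f' : a'' ⟶ a') (b : Fin a.len → Profile C) :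
    valFamPerm y f b ≫ valFamPerm y' f' (fun j => b (f.perm.symm j)) =
      valFamPerm (y ≫ y') (f' ≫ f) b := by
  refine (reindex_reindex _ _ _ _ _ _ _).trans ?_
  refine congrArg (reindex a''.len a.len (f' ≫ f).perm.symm) (funext fun j => ?_)
  change (Y.act _ _ ≫ SymSeq.app y _ _) ≫ (Y'.act _ _ ≫ SymSeq.app y' _ _) =
    Y.act _ (𝟙 (b (f.perm.symm (f'.perm.symm j)))) ≫ SymSeq.app (y ≫ y') (a''.col j)
      (b (f.perm.symm (f'.perm.symm j)))
  rw [SymSeq.comp_app, Category.assoc, ← Category.assoc (SymSeq.app y _ _), ← SymSeq.act_app,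
    Category.assoc, ← Category.assoc, SymSeq.act_comp, Category.comp_id]

theorem valFamPerm_id (Y : SymSeq C M) (a : Profile C) (b : Fin a.len → Profile C) :
    valFamPerm (𝟙 Y) (𝟙 a) b = 𝟙 (valFam Y a b) := by
  refine Eq.trans ?_ ((reindex_refl a.len (fun i => 𝟙 (Y.val (a.col i) (b i)))).trans
    (tensorFamMap_id _ _))
  refine congrArg (reindex a.len a.len (Equiv.refl _)) (funext fun j => ?_)
  refine (Category.comp_id _).trans (Y.act_id _ _)

/-- A morphism `f : a' ⟶ a` of profiles permutes the blocks of a concatenation indexed by the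
entries of `a`. -/
noncomputable def blockPerm {a a' : Profile C} (f : a' ⟶ a) (b : Fin a.len → Profile C) :
    concat (fun j => b (f.perm.symm j)) ⟶ concat b :=
  Groupoid.inv (concatMap f.perm.symm (fun j => 𝟙 (b (f.perm.symm j))))

theorem blockPerm_natural {a a' : Profile C} (f : a' ⟶ a) {b b₂ : Fin a.len → Profile C}
    (β : b ⟶ b₂) :
    blockPerm f b ≫ blockHom β = blockHom (b := fun j => b (f.perm.symm j))
        (b' := fun j => b₂ (f.perm.symm j)) (fun j => β (f.perm.symm j)) ≫ blockPerm f b₂ := by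
  have h : blockHom β ≫ concatMap f.perm.symm (fun j => 𝟙 (b₂ (f.perm.symm j))) =
      concatMap f.perm.symm (fun j => 𝟙 (b (f.perm.symm j))) ≫
        blockHom (b := fun j => b (f.perm.symm j))
        (b' := fun j => b₂ (f.perm.symm j)) (fun j => β (f.perm.symm j)) := by
    refine (concatMap_comp _ _ _ _).trans (Eq.trans ?_ (concatMap_comp _ _ _ _).symm)
    simp
    rfl
  simp only [blockPerm, Groupoid.inv_eq_inv]
  rw [IsIso.inv_comp_eq, ← Category.assoc, IsIso.eq_comp_inv, h]

theorem blockPerm_comp {a a' a'' : Profile C} (f : a' ⟶ a) (f' : a'' ⟶ a')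
    (b : Fin a.len → Profile C) :
    blockPerm f' (fun j => b (f.perm.symm j)) ≫ blockPerm f b = blockPerm (f' ≫ f) b := by
  have h : concatMap (f' ≫ f).perm.symm (fun j => 𝟙 (b ((f' ≫ f).perm.symm j))) =
      concatMap f.perm.symm (fun j => 𝟙 (b (f.perm.symm j))) ≫
      concatMap f'.perm.symm (fun j => 𝟙 (b (f.perm.symm (f'.perm.symm j)))) := by
    refine Eq.trans ?_ (concatMap_comp _ _ _ _).symm
    simp
    rfl
  have h' : ∀ {x y z : Profile C} (p : x ⟶ y) (q : y ⟶ z),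
      Groupoid.inv q ≫ Groupoid.inv p = Groupoid.inv (p ≫ q) := by
    intro x y z p q
    simp only [Groupoid.inv_eq_inv, IsIso.inv_comp]
  exact (h' _ _).trans (congrArg Groupoid.inv h.symm)

theorem blockPerm_id (a : Profile C) (b : Fin a.len → Profile C) :
    blockPerm (𝟙 a) b = 𝟙 (concat b) := by
  have h : concatMap (Equiv.refl _) (fun j => 𝟙 (b j)) = 𝟙 (concat b) := concatMap_id b
  refine (congrArg Groupoid.inv h).trans ?_
  simp

/-- The functoriality of the inner coend in all of its arguments. -/
noncomputable def innerMap {P P' : M} {Y Y' : SymSeq C M} {c c' a a' : Profile C} (x : P ⟶ P')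
    (y : Y ⟶ Y') (h : c ⟶ c') (f : a' ⟶ a) : innerCoend P Y c a ⟶ innerCoend P' Y' c' a' :=
  innerDesc (fun b g => (x ⊗ₘ valFamPerm y f b) ≫
      innerι P' Y' c' a' (fun j => b (f.perm.symm j)) (blockPerm f b ≫ g ≫ h))
    (fun b b₂ β g => by
      have h1 : blockPerm f b ≫ (blockHom β ≫ g) ≫ h =
          blockHom (b := fun j => b (f.perm.symm j))
            (b' := fun j => b₂ (f.perm.symm j)) (fun j => β (f.perm.symm j)) ≫
          (blockPerm f b₂ ≫ g ≫ h) := by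
        simp only [← Category.assoc, blockPerm_natural]
      have h2 : (x ⊗ₘ valFamPerm y f b) ≫ P' ◁ valFamMap Y' a' (b := fun j => b (f.perm.symm j))
          (b' := fun j => b₂ (f.perm.symm j)) (fun j => β (f.perm.symm j)) =
          P ◁ valFamMap Y a β ≫ (x ⊗ₘ valFamPerm y f b₂) := by
        rw [← id_tensorHom, ← id_tensorHom, tensorHom_comp_tensorHom, tensorHom_comp_tensorHom,
          Category.comp_id, Category.id_comp, valFamPerm_natural]
      rw [h1, innerι_condition, ← Category.assoc, h2, Category.assoc])

theorem innerι_map {P P' : M} {Y Y' : SymSeq C M} {c c' a a' : Profile C} (x : P ⟶ P')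
    (y : Y ⟶ Y') (h : c ⟶ c') (f : a' ⟶ a) (b : Fin a.len → Profile C) (g : concat b ⟶ c) :
    innerι P Y c a b g ≫ innerMap x y h f = (x ⊗ₘ valFamPerm y f b) ≫
      innerι P' Y' c' a' (fun j => b (f.perm.symm j)) (blockPerm f b ≫ g ≫ h) :=
  innerι_desc _ _ b g

theorem innerMap_comp {P P' P'' : M} {Y Y' Y'' : SymSeq C M} {c c' c'' a a' a'' : Profile C}
    (x : P ⟶ P') (y : Y ⟶ Y') (h : c ⟶ c') (f : a' ⟶ a)
    (x' : P' ⟶ P'') (y' : Y' ⟶ Y'') (h' : c' ⟶ c'') (f' : a'' ⟶ a') :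
    innerMap x y h f ≫ innerMap x' y' h' f' =
      innerMap (x ≫ x') (y ≫ y') (h ≫ h') (f' ≫ f) := by
  refine innerCoend_hom_ext (fun b g => ?_)
  rw [← Category.assoc, innerι_map, Category.assoc, innerι_map, innerι_map, ← Category.assoc,
    tensorHom_comp_tensorHom, valFamPerm_comp, ← blockPerm_comp]
  simp only [Category.assoc]
  rfl

theorem innerι_map_id {P P' : M} {Y Y' : SymSeq C M} {c c' a : Profile C} (x : P ⟶ P')
    (y : Y ⟶ Y') (h : c ⟶ c') (b : Fin a.len → Profile C) (g : concat b ⟶ c) :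
    innerι P Y c a b g ≫ innerMap x y h (𝟙 a) =
      (x ⊗ₘ tensorFamMap a.len (fun i => SymSeq.app y (a.col i) (b i))) ≫
        innerι P' Y' c' a b (g ≫ h) := by
  have h0 : valFamPerm y (𝟙 a) b = tensorFamMap a.len (fun i => SymSeq.app y (a.col i) (b i)) := by
    refine Eq.trans ?_ (reindex_refl a.len _)
    refine congrArg (reindex a.len a.len (Equiv.refl _)) (funext fun j => ?_)
    exact (congrArg (· ≫ _) (Y.act_id _ _)).trans (Category.id_comp _)
  refine (innerι_map x y h (𝟙 a) b g).trans ?_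
  refine (congrArg₂ (fun A B => (x ⊗ₘ A) ≫ innerι P' Y' c' a b (B ≫ g ≫ h)) h0
    (blockPerm_id a b)).trans ?_
  exact congrArg (fun B => _ ≫ innerι P' Y' c' a b B) (Category.id_comp _)

theorem innerMap_id (P : M) (Y : SymSeq C M) (c a : Profile C) :
    innerMap (𝟙 P) (𝟙 Y) (𝟙 c) (𝟙 a) = 𝟙 (innerCoend P Y c a) := by
  refine innerCoend_hom_ext (fun b g => ?_)
  rw [innerι_map_id]
  simp only [SymSeq.id_app, tensorFamMap_id, Category.comp_id, id_tensorHom_id, Category.id_comp]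

/-- The integrand `∫^{(b₁, …, bₘ)} Σ_C(b₁ ⊗ ⋯ ⊗ bₘ, c) ⊗ X(t; a) ⊗ Y(a'₁; b₁) ⊗ ⋯ ⊗ Y(a'ₘ; bₘ)` of
the outer coend, as a functor of `a'` and `a`. -/
noncomputable def outerIntegrand (X Y : SymSeq C M) (t : C) (c : Profile C) :
    (Profile C)ᵒᵖ ⥤ Profile C ⥤ M where
  obj a' :=
    { obj a := innerCoend (X.val t a) Y c a'.unop
      map f := innerMap (X.act rfl f) (𝟙 Y) (𝟙 c) (𝟙 a'.unop)
      map_id a := by rw [SymSeq.act_id, innerMap_id]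
      map_comp f f' := by
        rw [innerMap_comp, SymSeq.act_comp, Category.comp_id, Category.comp_id, Category.comp_id] }
  map f :=
    { app a := innerMap (𝟙 (X.val t a)) (𝟙 Y) (𝟙 c) f.unop
      naturality a a' g := by
        rw [innerMap_comp, innerMap_comp]
        simp only [Category.comp_id, Category.id_comp] }
  map_id a' := by
    ext a
    exact innerMap_id _ _ _ _
  map_comp f f' := by
    ext a
    rw [NatTrans.comp_app, innerMap_comp]
    simp only [Category.comp_id, unop_comp]

/-- The value of the circle product
`∫^a ∫^{(b₁, …, bₘ)} Σ_C(b₁ ⊗ ⋯ ⊗ bₘ, c) ⊗ X(t; a) ⊗ Y(a₁; b₁) ⊗ ⋯ ⊗ Y(aₘ; bₘ)`. -/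
noncomputable def circleVal (X Y : SymSeq C M) (t : C) (c : Profile C) : M :=
  coend (outerIntegrand X Y t c)

/-- The inclusions into the circle product. -/
noncomputable def circleι (X Y : SymSeq C M) (t : C) (c a : Profile C)
    (b : Fin a.len → Profile C) (g : concat b ⟶ c) :
    X.val t a ⊗ valFam Y a b ⟶ circleVal X Y t c :=
  innerι (X.val t a) Y c a b g ≫ coend.ι (outerIntegrand X Y t c) a

theorem circleVal_hom_ext {X Y : SymSeq C M} {t : C} {c : Profile C} {Z : M}
    {f f' : circleVal X Y t c ⟶ Z}
    (h : ∀ a b g, circleι X Y t c a b g ≫ f = circleι X Y t c a b g ≫ f') : f = f' :=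
  coend.hom_ext (F := outerIntegrand X Y t c) (fun a => innerCoend_hom_ext (fun b g =>
    (Category.assoc _ _ _).symm.trans ((h a b g).trans (Category.assoc _ _ _))))

theorem circleι_condition_inner (X Y : SymSeq C M) (t : C) (c a : Profile C)
    {b b' : Fin a.len → Profile C} (β : b ⟶ b') (g : concat b' ⟶ c) :
    circleι X Y t c a b (blockHom β ≫ g) =
      X.val t a ◁ valFamMap Y a β ≫ circleι X Y t c a b' g := by
  exact (congrArg (· ≫ coend.ι (outerIntegrand X Y t c) a) (innerι_condition _ _ _ _ β g)).trans
    (Category.assoc _ _ _)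

theorem circleι_condition_outer (X Y : SymSeq C M) (t : C) (c : Profile C) {a a' : Profile C}
    (f : a' ⟶ a) (b : Fin a.len → Profile C) (g : concat b ⟶ c) :
    X.val t a' ◁ valFamPerm (𝟙 Y) f b ≫
        circleι X Y t c a' (fun j => b (f.perm.symm j)) (blockPerm f b ≫ g) =
      X.act rfl f ▷ valFam Y a b ≫ circleι X Y t c a b g := by
  have h : innerι (X.val t a') Y c a b g ≫ innerMap (𝟙 (X.val t a')) (𝟙 Y) (𝟙 c) f ≫
      coend.ι (outerIntegrand X Y t c) a' =
      innerι (X.val t a') Y c a b g ≫ innerMap (X.act rfl f) (𝟙 Y) (𝟙 c) (𝟙 a) ≫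
      coend.ι (outerIntegrand X Y t c) a :=
    congrArg (innerι (X.val t a') Y c a b g ≫ ·) (coend.condition (outerIntegrand X Y t c) f)
  have h1 : innerι (X.val t a') Y c a b g ≫ innerMap (𝟙 (X.val t a')) (𝟙 Y) (𝟙 c) f =
      X.val t a' ◁ valFamPerm (𝟙 Y) f b ≫ innerι (X.val t a') Y c a'
        (fun j => b (f.perm.symm j)) (blockPerm f b ≫ g) := by
    rw [innerι_map, id_tensorHom, Category.comp_id]
  have h2 : innerι (X.val t a') Y c a b g ≫ innerMap (X.act rfl f) (𝟙 Y) (𝟙 c) (𝟙 a) =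
      X.act rfl f ▷ valFam Y a b ≫ innerι (X.val t a) Y c a b g := by
    rw [innerι_map_id, ← tensorHom_id]
    simp only [SymSeq.id_app, tensorFamMap_id, Category.comp_id]
  refine (Category.assoc _ _ _).symm.trans (Eq.trans ?_ (Category.assoc _ _ _))
  refine (congrArg (· ≫ coend.ι (outerIntegrand X Y t c) a') h1.symm).trans ?_
  refine Eq.trans ?_ (congrArg (· ≫ coend.ι (outerIntegrand X Y t c) a) h2)
  exact (Category.assoc _ _ _).trans (h.trans (Category.assoc _ _ _).symm)

/-- The functoriality of the values of the circle product in all arguments. -/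
noncomputable def circleMap {X X' Y Y' : SymSeq C M} (x : X ⟶ X') (y : Y ⟶ Y') {t t' : C}
    (ht : t = t') {c c' : Profile C} (h : c ⟶ c') : circleVal X Y t c ⟶ circleVal X' Y' t' c' :=
  coend.map
    { app a' :=
        { app a := innerMap (X.act ht (𝟙 a) ≫ SymSeq.app x t' a) y h (𝟙 a'.unop)
          naturality a a₂ f := by
            refine (innerMap_comp _ _ _ _ _ _ _ _).trans
              (Eq.trans ?_ (innerMap_comp _ _ _ _ _ _ _ _).symm)
            rw [Category.assoc, ← SymSeq.act_app, ← Category.assoc, ← Category.assoc,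
              SymSeq.act_comp, SymSeq.act_comp]
            simp only [Category.comp_id, Category.id_comp] }
      naturality a' a₂' f := by
        ext a
        refine (innerMap_comp _ _ _ _ _ _ _ _).trans
          (Eq.trans ?_ (innerMap_comp _ _ _ _ _ _ _ _).symm)
        simp only [Category.comp_id, Category.id_comp] }

theorem circleι_map {X X' Y Y' : SymSeq C M} (x : X ⟶ X') (y : Y ⟶ Y') {t t' : C}
    (ht : t = t') {c c' : Profile C} (h : c ⟶ c') (a : Profile C) (b : Fin a.len → Profile C)
    (g : concat b ⟶ c) :
    circleι X Y t c a b g ≫ circleMap x y ht h =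
      ((X.act ht (𝟙 a) ≫ SymSeq.app x t' a) ⊗ₘ
          tensorFamMap a.len (fun i => SymSeq.app y (a.col i) (b i))) ≫
        circleι X' Y' t' c' a b (g ≫ h) := by
  have h1 : innerι (X.val t a) Y c a b g ≫
      innerMap (X.act ht (𝟙 a) ≫ SymSeq.app x t' a) y h (𝟙 a) =
      ((X.act ht (𝟙 a) ≫ SymSeq.app x t' a) ⊗ₘ
          tensorFamMap a.len (fun i => SymSeq.app y (a.col i) (b i))) ≫
        innerι (X'.val t' a) Y' c' a b (g ≫ h) := by
    exact innerι_map_id _ _ _ _ _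
  refine (Category.assoc _ _ _).trans ?_
  refine (congrArg (innerι (X.val t a) Y c a b g ≫ ·)
    (coend.ι_map (F := outerIntegrand X Y t c) (F' := outerIntegrand X' Y' t' c') _ a)).trans ?_
  refine (Category.assoc _ _ _).symm.trans ((congrArg (· ≫ _) h1).trans ?_)
  exact Category.assoc _ _ _

theorem circleMap_comp {X X' X'' Y Y' Y'' : SymSeq C M} (x : X ⟶ X') (y : Y ⟶ Y')
    (x' : X' ⟶ X'') (y' : Y' ⟶ Y'') {t t' t'' : C} (ht : t = t') (ht' : t' = t'')
    {c c' c'' : Profile C} (h : c ⟶ c') (h' : c' ⟶ c'') :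
    circleMap x y ht h ≫ circleMap x' y' ht' h' =
      circleMap (x ≫ x') (y ≫ y') (ht.trans ht') (h ≫ h') := by
  subst ht ht'
  refine circleVal_hom_ext (fun a b g => ?_)
  rw [← Category.assoc, circleι_map, Category.assoc, circleι_map, circleι_map, ← Category.assoc,
    tensorHom_comp_tensorHom, tensorFamMap_comp]
  simp only [SymSeq.act_id, Category.id_comp, Category.assoc, SymSeq.comp_app]

theorem circleMap_id (X Y : SymSeq C M) (t : C) (c : Profile C) :
    circleMap (𝟙 X) (𝟙 Y) (rfl : t = t) (𝟙 c) = 𝟙 (circleVal X Y t c) := by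
  refine circleVal_hom_ext (fun a b g => ?_)
  rw [circleι_map, SymSeq.act_id]
  simp only [SymSeq.id_app, tensorFamMap_id, Category.comp_id, id_tensorHom_id, Category.id_comp]

/-- The circle product of symmetric sequences. -/
noncomputable def circle (X Y : SymSeq C M) : SymSeq C M where
  obj p := circleVal X Y p.2.as p.1
  map f := circleMap (𝟙 X) (𝟙 Y) (Discrete.eq_of_hom f.2) f.1
  map_id p := circleMap_id X Y _ _
  map_comp f g := by
    rw [circleMap_comp, Category.comp_id, Category.comp_id]
    rfl

/-- The functoriality of the circle product. -/
noncomputable def circleHom {X X' Y Y' : SymSeq C M} (x : X ⟶ X') (y : Y ⟶ Y') :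
    circle X Y ⟶ circle X' Y' where
  app p := circleMap x y rfl (𝟙 p.1)
  naturality p q f := by
    refine (circleMap_comp _ _ _ _ _ _ _ _).trans
      (Eq.trans ?_ (circleMap_comp _ _ _ _ _ _ _ _).symm)
    simp only [Category.comp_id, Category.id_comp]

/-- The circle unit `I(t; c) = Σ_C(t, c) ⊗ 𝟙`. -/
noncomputable def circleUnit : SymSeq C M where
  obj p := setTensor (single p.2.as ⟶ p.1) (𝟙_ M)
  map {p q} f := setTensor.map
    (fun g => eqToHom (congrArg single (Discrete.eq_of_hom f.2).symm) ≫ g ≫ f.1) (𝟙 _)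
  map_id p := by
    simp only [eqToHom_refl, Category.id_comp]
    have h : ∀ g : single p.2.as ⟶ p.1, g ≫ (𝟙 p : p ⟶ p).1 = g := fun g => Category.comp_id g
    simp only [h]
    exact setTensor.map_id _
  map_comp {p q r} f g := by
    rw [setTensor.map_comp, Category.id_comp]
    congr 1
    funext s
    simp

end CircleProduct

section Shuffles

variable {M : Type u} [Category.{v} M] [MonoidalCategory M]

/-- The tensor product of a family of units is the unit. -/
def unitFam : (n : ℕ) → (𝟙_ M ⟶ tensorFam n (fun _ => 𝟙_ M))
  | 0 => 𝟙 (𝟙_ M)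
  | n + 1 => (λ_ (𝟙_ M)).inv ≫ 𝟙_ M ◁ unitFam n

/-- A tensor product of a family splits as the tensor product of the first `m` factors and of
the remaining ones. -/
def splitFam : (m n : ℕ) → (W : Fin (n + m) → M) →
    (tensorFam (n + m) W ⟶ tensorFam m (fun i => W (Fin.castLE (Nat.le_add_left _ _) i)) ⊗
      tensorFam n (fun i => W (i.addNat m)))
  | 0, _, _ => (λ_ _).inv
  | m + 1, n, W => W 0 ◁ splitFam m n (fun i => W i.succ) ≫ (α_ _ _ _).inv

/-- A tensor product over a concatenation of blocks is the tensor product over the blocks of the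
tensor products over each block. -/
def flattenFam : (m : ℕ) → (n : Fin m → ℕ) → (W : Fin (sumLen m n) → M) →
    (tensorFam (sumLen m n) W ⟶
      tensorFam m (fun k => tensorFam (n k) (fun l => W (blockPos m n k l))))
  | 0, _, _ => 𝟙 (𝟙_ M)
  | m + 1, n, W => splitFam (n 0) (sumLen m (fun k => n k.succ)) W ≫
      _ ◁ flattenFam m (fun k => n k.succ) (fun i => W (i.addNat (n 0)))

/-- The shuffle `(⨂ᵢ Aᵢ) ⊗ (⨂ᵢ Bᵢ) ⟶ ⨂ᵢ (Aᵢ ⊗ Bᵢ)`. -/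
def shuffleFam [BraidedCategory M] : (n : ℕ) → (A B : Fin n → M) →
    (tensorFam n A ⊗ tensorFam n B ⟶ tensorFam n (fun i => A i ⊗ B i))
  | 0, _, _ => (λ_ (𝟙_ M)).hom
  | n + 1, A, B => tensorμ (A 0) _ (B 0) _ ≫
      _ ◁ shuffleFam n (fun i => A i.succ) (fun i => B i.succ)

/-- The iterated structure morphism `⨂ᵢ J Aᵢ ⟶ J (⨂ᵢ Aᵢ)` of a lax monoidal functor. -/
def laxFam (J : M ⥤ M) [J.LaxMonoidal] : (n : ℕ) → (A : Fin n → M) →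
    (tensorFam n (fun i => J.obj (A i)) ⟶ J.obj (tensorFam n A))
  | 0, _ => Functor.LaxMonoidal.ε J
  | n + 1, A => J.obj (A 0) ◁ laxFam J n (fun i => A i.succ) ≫ Functor.LaxMonoidal.μ J _ _

open Functor.LaxMonoidal

theorem tensorFamMap_laxFam (J : M ⥤ M) [J.LaxMonoidal] : (n : ℕ) → {A B : Fin n → M} →
    (f : ∀ i, A i ⟶ B i) →
    tensorFamMap n (fun i => J.map (f i)) ≫ laxFam J n B =
      laxFam J n A ≫ J.map (tensorFamMap n f)
  | 0, _, _, _ => (Category.id_comp _).trans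
      ((Category.comp_id _).symm.trans (congrArg _ (J.map_id _).symm))
  | n + 1, A, B, f => by
    have h := tensorFamMap_laxFam J n (fun i => f i.succ)
    simp only [tensorFamMap, laxFam]
    rw [← id_tensorHom, ← Category.assoc, tensorHom_comp_tensorHom, h, Category.assoc,
      ← μ_natural, ← id_tensorHom, ← Category.assoc, tensorHom_comp_tensorHom,
      Category.comp_id, Category.id_comp]

theorem laxStep_natural (J : M ⥤ M) [J.LaxMonoidal] {P P' Q Q' : M} {A A' : M} (x : P ⟶ P')
    (k : Q ⟶ Q') (L : A ⟶ A') (l : A ⟶ J.obj Q) (l' : A' ⟶ J.obj Q')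
    (h : L ≫ l' = l ≫ J.map k) :
    (J.map x ⊗ₘ L) ≫ J.obj P' ◁ l' ≫ μ J P' Q' =
      (J.obj P ◁ l ≫ μ J P Q) ≫ J.map (x ⊗ₘ k) := by
  rw [Category.assoc, ← μ_natural, ← id_tensorHom, ← id_tensorHom, tensorHom_comp_tensorHom_assoc,
    tensorHom_comp_tensorHom_assoc, Category.comp_id, Category.id_comp, h]

variable [SymmetricCategory M]

theorem interchange_lax (J : M ⥤ M) [J.LaxBraided] (X Y Z : M) :
    J.obj X ◁ μ J Y Z ≫ μ J X (Y ⊗ Z) ≫ J.map (interchange X Y Z) =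
      interchange (J.obj X) (J.obj Y) (J.obj Z) ≫ J.obj Y ◁ μ J X Z ≫ μ J Y (X ⊗ Z) := by
  simp only [interchange, Functor.map_comp, associativity_inv_assoc, Category.assoc]
  rw [← μ_natural_left_assoc, ← comp_whiskerRight_assoc,
    Functor.LaxBraided.braided, comp_whiskerRight_assoc, associativity]

theorem laxFam_step (J : M ⥤ M) [J.LaxBraided] {A X P P' : M} {Q Q' : M} (l : Q ⟶ J.obj P)
    (l' : Q' ⟶ J.obj P') (p : P ⟶ X ⊗ P') (p' : Q ⟶ J.obj X ⊗ Q')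
    (h : l ≫ J.map p = p' ≫ J.obj X ◁ l' ≫ μ J X P') :
    (J.obj A ◁ l ≫ μ J A P) ≫ J.map (A ◁ p ≫ interchange A X P') =
      (J.obj A ◁ p' ≫ interchange (J.obj A) (J.obj X) Q') ≫
        J.obj X ◁ (J.obj A ◁ l' ≫ μ J A P') ≫ μ J X (A ⊗ P') := by
  have h2 := interchange_natural (𝟙 (J.obj A)) (𝟙 (J.obj X)) l'
  simp only [id_tensorHom] at h2
  rw [J.map_comp, Category.assoc, ← μ_natural_right_assoc, ← whiskerLeft_comp_assoc, h,
    whiskerLeft_comp, whiskerLeft_comp, whiskerLeft_comp, Category.assoc, Category.assoc,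
    interchange_lax, reassoc_of% h2]
  simp only [Category.assoc]

theorem laxFam_pull (J : M ⥤ M) [J.LaxBraided] : (n : ℕ) → (k : Fin (n + 1)) →
    (A : Fin (n + 1) → M) → laxFam J (n + 1) A ≫ J.map (pull n k A) =
      pull n k (fun i => J.obj (A i)) ≫
        J.obj (A k) ◁ laxFam J n (fun j => A (skip n k j)) ≫ μ J _ _
  | 0, k, A => by
    refine Fin.cases ?_ (fun k' => k'.elim0) k
    exact (congrArg (laxFam J 1 A ≫ ·) (J.map_id _)).trans
      ((Category.comp_id _).trans (Category.id_comp _).symm)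
  | n + 1, k, A => by
    refine Fin.cases ?_ (fun k' => ?_) k
    · exact (congrArg (laxFam J (n + 2) A ≫ ·) (J.map_id _)).trans
        ((Category.comp_id _).trans (Category.id_comp _).symm)
    · exact laxFam_step J _ _ _ _ (laxFam_pull J n k' (fun i => A i.succ))

theorem reindex_laxFam (J : M ⥤ M) [J.LaxBraided] : (m n : ℕ) → (σ : Fin m ≃ Fin n) →
    {A : Fin n → M} → {B : Fin m → M} → (f : ∀ i, A (σ i) ⟶ B i) →
    reindex m n σ (A := fun i => J.obj (A i)) (fun i => J.map (f i)) ≫ laxFam J m B =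
      laxFam J n A ≫ J.map (reindex m n σ f)
  | 0, 0, _, _, _, _ => (Category.id_comp _).trans
      ((Category.comp_id _).symm.trans (congrArg _ (J.map_id _).symm))
  | 0, _ + 1, σ, _, _, _ => (σ.symm 0).elim0
  | _ + 1, 0, σ, _, _, _ => (σ 0).elim0
  | m + 1, n + 1, σ, A, B, f => by
    have h := reindex_laxFam J m n (residual σ 0) (A := fun j => A (skip n (σ 0) j))
      (fun i => eqToHom (congrArg A ((skip_residual σ 0 i).trans
        (congrArg σ (skip_zero m i)))) ≫ f i.succ)
    simp only [Functor.map_comp, eqToHom_map] at h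
    rw [reindex_succ, reindex_succ, J.map_comp, ← Category.assoc (laxFam J _ _), laxFam_pull,
      Category.assoc, Category.assoc, Category.assoc, ← μ_natural, laxFam, ← id_tensorHom,
      ← id_tensorHom, ← Category.assoc (_ ⊗ₘ _), ← Category.assoc (_ ⊗ₘ _),
      tensorHom_comp_tensorHom, tensorHom_comp_tensorHom, h, Category.comp_id, Category.id_comp]

end Shuffles

section Involutive

/-- An involutive category: an endofunctor `J` and a natural isomorphism `j : Id ≅ J²` with
`j J = J j`. -/
structure InvolutiveCategory (D : Type u) [Category.{v} D] where
  /-- the endofunctor -/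
  J : D ⥤ D
  /-- the natural isomorphism -/
  j : 𝟭 D ≅ J ⋙ J
  j_J : ∀ X : D, j.hom.app (J.obj X) = J.map (j.hom.app X)

/-- An involutive monoidal structure on an involutive category whose underlying category is
monoidal: a lax monoidal structure on `J` for which `j` is a monoidal natural isomorphism. -/
structure InvolutiveMonoidal {D : Type u} [Category.{v} D] [MonoidalCategory D]
    (I : InvolutiveCategory D) where
  /-- the structure morphisms `J₂` (called `μ`) and `J₀` (called `ε`) -/
  lax : I.J.LaxMonoidal
  monoidal_j : NatTrans.IsMonoidal I.j.hom

/-- An involutive symmetric monoidal structure on an involutive category whose underlying category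
is symmetric monoidal: a symmetric lax monoidal structure on `J` for which `j` is a monoidal
natural isomorphism. -/
structure InvolutiveSymmetricMonoidal {D : Type u} [Category.{v} D] [MonoidalCategory D]
    [SymmetricCategory D] (I : InvolutiveCategory D) where
  /-- the structure morphisms `J₂` (called `μ`) and `J₀` (called `ε`) -/
  lax : I.J.LaxBraided
  monoidal_j : NatTrans.IsMonoidal I.j.hom

/-- Post-composition with a functor `J`, on symmetric sequences. -/
def postcomp (C : Type v) {M : Type u} [Category.{v} M] (J : M ⥤ M) : SymSeq C M ⥤ SymSeq C M :=
  (Functor.whiskeringRight (Profile C × Discrete C) M M).obj J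

/-- The involutive category of symmetric sequences: `X` is sent to `J X`, and `j` is whiskered. -/
def InvolutiveCategory.symSeq (C : Type v) {M : Type u} [Category.{v} M]
    (I : InvolutiveCategory M) : InvolutiveCategory (SymSeq C M) where
  J := postcomp C I.J
  j := NatIso.ofComponents
    (fun X => NatIso.ofComponents (F := X) (G := (postcomp C I.J ⋙ postcomp C I.J).obj X)
      (fun p => I.j.app (CategoryTheory.Functor.obj X p))
      (fun f => I.j.hom.naturality (CategoryTheory.Functor.map X f)))
    (fun {X Y} φ => NatTrans.ext (funext fun p => I.j.hom.naturality (NatTrans.app φ p)))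
  j_J X := NatTrans.ext (funext fun p => I.j_J (CategoryTheory.Functor.obj X p))

end Involutive

section CircleInvolution

open Profile Functor.LaxMonoidal

variable {C : Type v} {M : Type u} [Category.{v} M] [MonoidalCategory M] [HasColimits M]
  [SymmetricCategory M]

/-- The morphisms out of the circle product. -/
noncomputable def circleDesc {X Y : SymSeq C M} {t : C} {c : Profile C} {Z : M}
    (f : ∀ (a : Profile C) (b : Fin a.len → Profile C), (concat b ⟶ c) →
      (X.val t a ⊗ valFam Y a b ⟶ Z))
    (hf : ∀ (a : Profile C) (b b' : Fin a.len → Profile C) (β : b ⟶ b') (g : concat b' ⟶ c),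
      f a b (blockHom β ≫ g) = X.val t a ◁ valFamMap Y a β ≫ f a b' g)
    (hf' : ∀ (a a' : Profile C) (p : a' ⟶ a) (b : Fin a.len → Profile C) (g : concat b ⟶ c),
      X.val t a' ◁ valFamPerm (𝟙 Y) p b ≫ f a' (fun j => b (p.perm.symm j)) (blockPerm p b ≫ g) =
        X.act rfl p ▷ valFam Y a b ≫ f a b g) :
    circleVal X Y t c ⟶ Z :=
  coend.desc (F := outerIntegrand X Y t c) (fun a => innerDesc (f a) (hf a))
    (fun a' a p => innerCoend_hom_ext (fun b g => by
      have h1 : innerι (X.val t a') Y c a b g ≫ innerMap (𝟙 (X.val t a')) (𝟙 Y) (𝟙 c) p ≫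
          innerDesc (f a') (hf a') = X.val t a' ◁ valFamPerm (𝟙 Y) p b ≫
          f a' (fun j => b (p.perm.symm j)) (blockPerm p b ≫ g) := by
        rw [← Category.assoc, innerι_map, Category.assoc, innerι_desc, id_tensorHom,
          Category.comp_id]
      have h2 : innerι (X.val t a') Y c a b g ≫ innerMap (X.act rfl p) (𝟙 Y) (𝟙 c) (𝟙 a) ≫
          innerDesc (f a) (hf a) = X.act rfl p ▷ valFam Y a b ≫ f a b g := by
        rw [← Category.assoc, innerι_map_id, Category.assoc, innerι_desc, ← tensorHom_id]
        simp only [SymSeq.id_app, tensorFamMap_id, Category.comp_id]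
      exact h1.trans ((hf' a a' p b g).trans h2.symm)))

theorem circleι_desc {X Y : SymSeq C M} {t : C} {c : Profile C} {Z : M}
    (f : ∀ (a : Profile C) (b : Fin a.len → Profile C), (concat b ⟶ c) →
      (X.val t a ⊗ valFam Y a b ⟶ Z))
    (hf : ∀ (a : Profile C) (b b' : Fin a.len → Profile C) (β : b ⟶ b') (g : concat b' ⟶ c),
      f a b (blockHom β ≫ g) = X.val t a ◁ valFamMap Y a β ≫ f a b' g)
    (hf' : ∀ (a a' : Profile C) (p : a' ⟶ a) (b : Fin a.len → Profile C) (g : concat b ⟶ c),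
      X.val t a' ◁ valFamPerm (𝟙 Y) p b ≫ f a' (fun j => b (p.perm.symm j)) (blockPerm p b ≫ g) =
        X.act rfl p ▷ valFam Y a b ≫ f a b g)
    (a : Profile C) (b : Fin a.len → Profile C) (g : concat b ⟶ c) :
    circleι X Y t c a b g ≫ circleDesc f hf hf' = f a b g := by
  refine (Category.assoc _ _ _).trans ?_
  refine (congrArg (innerι (X.val t a) Y c a b g ≫ ·)
    (coend.ι_desc (F := outerIntegrand X Y t c) _ _ a)).trans ?_
  exact innerι_desc _ _ b g

/-- The `m`-fold iteration
`J X(t; a) ⊗ J Y(a₁; b₁) ⊗ ⋯ ⊗ J Y(aₘ; bₘ) ⟶ J (X(t; a) ⊗ Y(a₁; b₁) ⊗ ⋯ ⊗ Y(aₘ; bₘ))` of `J₂`. -/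
noncomputable def iteratedJ₂ (J : M ⥤ M) [J.LaxMonoidal] (X Y : SymSeq C M) (t : C)
    (a : Profile C) (b : Fin a.len → Profile C) :
    ((postcomp C J).obj X).val t a ⊗ valFam ((postcomp C J).obj Y) a b ⟶
      J.obj (X.val t a ⊗ valFam Y a b) :=
  J.obj (X.val t a) ◁ laxFam J a.len (fun i => Y.val (a.col i) (b i)) ≫ μ J _ _

theorem iteratedJ₂_natural (J : M ⥤ M) [J.LaxMonoidal] {X X' Y Y' : SymSeq C M} {t t' : C}
    {a : Profile C} {b b' : Fin a.len → Profile C}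
    (x : X.val t a ⟶ X'.val t' a) (y : ∀ i, Y.val (a.col i) (b i) ⟶ Y'.val (a.col i) (b' i)) :
    (J.map x ⊗ₘ tensorFamMap a.len (fun i => J.map (y i))) ≫ iteratedJ₂ J X' Y' t' a b' =
      iteratedJ₂ J X Y t a b ≫ J.map (x ⊗ₘ tensorFamMap a.len y) :=
  laxStep_natural J x (tensorFamMap a.len y) _ _ _ (tensorFamMap_laxFam J a.len y)

theorem iteratedJ₂_perm (J : M ⥤ M) [J.LaxBraided] {X Y : SymSeq C M} {t : C}
    {a a' : Profile C} (p : a' ⟶ a) (b : Fin a.len → Profile C) :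
    ((postcomp C J).obj X).val t a' ◁ valFamPerm (𝟙 ((postcomp C J).obj Y)) p b ≫
      iteratedJ₂ J X Y t a' (fun j => b (p.perm.symm j)) =
      (J.obj (X.val t a') ◁ laxFam J a.len (fun i => Y.val (a.col i) (b i)) ≫ μ J _ _) ≫
        J.map (X.val t a' ◁ valFamPerm (𝟙 Y) p b) := by
  have h : valFamPerm (𝟙 ((postcomp C J).obj Y)) p b ≫
      laxFam J a'.len (fun i => Y.val (a'.col i) (b (p.perm.symm i))) =
      laxFam J a.len (fun i => Y.val (a.col i) (b i)) ≫ J.map (valFamPerm (𝟙 Y) p b) := by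
    refine Eq.trans ?_ (reindex_laxFam J a'.len a.len p.perm.symm _)
    refine congrArg (fun f => reindex a'.len a.len p.perm.symm f ≫ _) (funext fun j => ?_)
    exact (Category.comp_id _).trans (congrArg J.map (Category.comp_id _).symm)
  have h2 := laxStep_natural J (𝟙 (X.val t a')) (valFamPerm (𝟙 Y) p b) _ _ _ h
  rw [J.map_id, id_tensorHom, id_tensorHom] at h2
  exact h2

/-- The components of `J_{*2} : J_* X ∘ J_* Y ⟶ J_* (X ∘ Y)`: the morphism of coends that is given
on every summand by the iterated `J₂`, followed by the canonical morphism from the coend of the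
images under `J` to the image of the coend. -/
noncomputable def circleJ₂Val (J : M ⥤ M) [J.LaxBraided] (X Y : SymSeq C M) (t : C)
    (c : Profile C) :
    circleVal ((postcomp C J).obj X) ((postcomp C J).obj Y) t c ⟶ J.obj (circleVal X Y t c) :=
  circleDesc (fun a b g => iteratedJ₂ J X Y t a b ≫ J.map (circleι X Y t c a b g))
    (fun a b b' β g => by
      have h := iteratedJ₂_natural J (X := X) (X' := X) (𝟙 (X.val t a))
        (fun i => Y.act (rfl : a.col i = a.col i) (β i))
      rw [J.map_id, id_tensorHom, id_tensorHom] at h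
      rw [circleι_condition_inner, J.map_comp, ← Category.assoc]
      refine (congrArg (· ≫ J.map (circleι X Y t c a b' g)) h.symm).trans ?_
      exact Category.assoc _ _ _)
    (fun a a' p b g => by
      refine (Category.assoc _ _ _).symm.trans
        ((congrArg (· ≫ J.map _) (iteratedJ₂_perm J p b)).trans ?_)
      have h := laxStep_natural J (X.act (rfl : t = t) p) (𝟙 (valFam Y a b)) (𝟙 _)
        (laxFam J a.len (fun i => Y.val (a.col i) (b i))) _
        ((Category.id_comp _).trans
          ((Category.comp_id _).symm.trans (congrArg _ (J.map_id _).symm)))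
      rw [tensorHom_id, tensorHom_id] at h
      have h2 := congrArg J.map (circleι_condition_outer X Y t c p b g)
      rw [J.map_comp, J.map_comp] at h2
      refine (Category.assoc _ _ _).trans ((congrArg (_ ≫ ·) h2).trans ?_)
      refine (Category.assoc _ _ _).symm.trans ((congrArg (· ≫ _) h.symm).trans ?_)
      exact Category.assoc _ _ _)

theorem circleι_J₂ (J : M ⥤ M) [J.LaxBraided] (X Y : SymSeq C M) (t : C) (c a : Profile C)
    (b : Fin a.len → Profile C) (g : concat b ⟶ c) :
    circleι ((postcomp C J).obj X) ((postcomp C J).obj Y) t c a b g ≫ circleJ₂Val J X Y t c =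
      iteratedJ₂ J X Y t a b ≫ J.map (circleι X Y t c a b g) :=
  circleι_desc _ _ _ a b g

theorem circleJ₂Val_natural (J : M ⥤ M) [J.LaxBraided] (X Y : SymSeq C M) {t t' : C}
    (ht : t = t') {c c' : Profile C} (h : c ⟶ c') :
    circleMap (𝟙 ((postcomp C J).obj X)) (𝟙 ((postcomp C J).obj Y)) ht h ≫
        circleJ₂Val J X Y t' c' =
      circleJ₂Val J X Y t c ≫ J.map (circleMap (𝟙 X) (𝟙 Y) ht h) := by
  subst ht
  refine circleVal_hom_ext (fun a b g => ?_)
  have h1 : ∀ (X Y : SymSeq C M), circleι X Y t c a b g ≫ circleMap (𝟙 X) (𝟙 Y) rfl h =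
      circleι X Y t c' a b (g ≫ h) := by
    intro X Y
    rw [circleι_map]
    simp only [SymSeq.act_id, SymSeq.id_app, tensorFamMap_id, Category.comp_id, id_tensorHom_id,
      Category.id_comp]
  refine (Category.assoc _ _ _).symm.trans ((congrArg (· ≫ _) (h1 _ _)).trans ?_)
  refine (circleι_J₂ J X Y t c' a b (g ≫ h)).trans ?_
  refine Eq.trans ?_ (Category.assoc _ _ _)
  refine Eq.trans ?_ (congrArg (· ≫ _) (circleι_J₂ J X Y t c a b g)).symm
  rw [← h1, J.map_comp]
  exact (Category.assoc _ _ _).symm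

/-- The natural transformation `J_{*2}`. -/
noncomputable def circleJ₂ (J : M ⥤ M) [J.LaxBraided] (X Y : SymSeq C M) :
    circle ((postcomp C J).obj X) ((postcomp C J).obj Y) ⟶ (postcomp C J).obj (circle X Y) where
  app p := circleJ₂Val J X Y p.2.as p.1
  naturality p q f := circleJ₂Val_natural J X Y (Discrete.eq_of_hom f.2) f.1

/-- The morphism `J_{*0} : I ⟶ J_* I`: it is given by `J₀` on every summand, followed by the
canonical morphism from the coproduct of the images under `J` to the image of the coproduct. -/
noncomputable def circleJ₀ (J : M ⥤ M) [J.LaxMonoidal] :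
    (circleUnit : SymSeq C M) ⟶ (postcomp C J).obj circleUnit where
  app p := setTensor.desc (fun s => ε J ≫ J.map (setTensor.ι s (𝟙_ M)))
  naturality p q f := by
    have h1 : ∀ s, setTensor.ι s (𝟙_ M) ≫ CategoryTheory.Functor.map (circleUnit : SymSeq C M) f =
        setTensor.ι (eqToHom (congrArg single (Discrete.eq_of_hom f.2).symm) ≫ s ≫ f.1) (𝟙_ M) :=
      fun s => (setTensor.ι_map _ _ s).trans (Category.id_comp _)
    have h2 : ∀ (r : Profile C × Discrete C) (s : single r.2.as ⟶ r.1), setTensor.ι s (𝟙_ M) ≫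
        setTensor.desc (fun s => ε J ≫ J.map (setTensor.ι s (𝟙_ M))) =
        ε J ≫ J.map (setTensor.ι s (𝟙_ M)) := fun r s => setTensor.ι_desc _ s
    refine setTensor.hom_ext (fun s => ?_)
    refine (Category.assoc _ _ _).symm.trans ((congrArg (· ≫ _) (h1 s)).trans ?_)
    refine (h2 q _).trans (Eq.trans ?_ (Category.assoc _ _ _))
    refine Eq.trans ?_ (congrArg (· ≫ J.map
      (CategoryTheory.Functor.map (circleUnit : SymSeq C M) f)) (h2 p s)).symm
    exact (congrArg (ε J ≫ ·) ((congrArg (fun z => J.map z) (h1 s)).symm.trans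
      (J.map_comp _ _))).trans (Category.assoc _ _ _).symm

end CircleInvolution

section CircleMonoidal

open Profile

variable (C : Type v) (M : Type u) [Category.{v} M] [MonoidalCategory M] [HasColimits M]
  [SymmetricCategory M]

variable {C M} in
/-- The canonical morphism `𝟙 ⟶ I(t; t)` into the circle unit. -/
noncomputable def circleUnitι (t : C) : 𝟙_ M ⟶ (circleUnit : SymSeq C M).val t (single t) :=
  setTensor.ι (𝟙 (single t)) (𝟙_ M)

variable {C M} in
/-- The canonical morphism which distributes the factors `Z(qᵢ; bᵢ)`, indexed by the entries `qᵢ` of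
the concatenation `d₁ ⊗ ⋯ ⊗ dₘ`, over the blocks:
`(Y(e₁; d₁) ⊗ ⋯ ⊗ Y(eₘ; dₘ)) ⊗ ⨂ᵢ Z(qᵢ; bᵢ) ⟶ ⨂ₖ (Y(eₖ; dₖ) ⊗ ⨂ₗ Z(d_{k,l}; b_{k,l}))`. -/
noncomputable def distribute (Y Z : SymSeq C M) (e : Profile C) (d : Fin e.len → Profile C)
    (b : Fin (concat d).len → Profile C) :
    valFam Y e d ⊗ valFam Z (concat d) b ⟶
      tensorFam e.len (fun k => Y.val (e.col k) (d k) ⊗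
        valFam Z (d k) (fun l => b (pos d ⟨k, l⟩))) :=
  valFam Y e d ◁ (flattenFam e.len (fun k => (d k).len) (fun i => Z.val ((concat d).col i) (b i)) ≫
      tensorFamMap e.len (fun k => tensorFamMap (d k).len (fun l =>
        Z.act (concat_col d ⟨k, l⟩) (𝟙 (b (pos d ⟨k, l⟩)))))) ≫
    shuffleFam e.len (fun k => Y.val (e.col k) (d k))
      (fun k => valFam Z (d k) (fun l => b (pos d ⟨k, l⟩)))

/-- The associator and the unitors of the circle product. They are induced by the associator, the
unitors and the braiding of `M`: the first three conditions say what they do on the summands of the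
coends, which determines them. The other conditions are the naturality and coherence laws of a
monoidal category with tensor product `circle` and unit `circleUnit`. -/
structure CircleMonoidal where
  /-- the associator `(X ∘ Y) ∘ Z ≅ X ∘ (Y ∘ Z)` -/
  associator (X Y Z : SymSeq C M) : circle (circle X Y) Z ≅ circle X (circle Y Z)
  /-- the left unitor `I ∘ X ≅ X` -/
  leftUnitor (X : SymSeq C M) : circle circleUnit X ≅ X
  /-- the right unitor `X ∘ I ≅ X` -/
  rightUnitor (X : SymSeq C M) : circle X circleUnit ≅ X
  circleι_associator (X Y Z : SymSeq C M) (t : C) (e : Profile C) (d : Fin e.len → Profile C)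
    (b : Fin (concat d).len → Profile C) :
    circleι X Y t (concat d) e d (𝟙 _) ▷ valFam Z (concat d) b ≫
        circleι (circle X Y) Z t (concat b) (concat d) b (𝟙 _) ≫
        SymSeq.app (associator X Y Z).hom t (concat b) =
      (α_ (X.val t e) (valFam Y e d) (valFam Z (concat d) b)).hom ≫
        X.val t e ◁ (distribute Y Z e d b ≫ tensorFamMap e.len (fun k =>
          circleι Y Z (e.col k) (concat (fun l => b (pos d ⟨k, l⟩))) (d k)
            (fun l => b (pos d ⟨k, l⟩)) (𝟙 _))) ≫
        circleι X (circle Y Z) t (concat b) e (fun k => concat (fun l => b (pos d ⟨k, l⟩)))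
          (Groupoid.inv (concatConcat d b))
  circleι_leftUnitor (X : SymSeq C M) (t : C) (b : Profile C) :
    (λ_ (X.val t b)).inv ≫ (circleUnitι t ⊗ₘ (ρ_ (X.val t b)).inv) ≫
        circleι circleUnit X t b (single t) (fun _ => b) (concatOne b) ≫
        SymSeq.app (leftUnitor X).hom t b = 𝟙 (X.val t b)
  circleι_rightUnitor (X : SymSeq C M) (t : C) (a : Profile C) :
    (ρ_ (X.val t a)).inv ≫
        X.val t a ◁ (unitFam a.len ≫ tensorFamMap a.len (fun i => circleUnitι (a.col i))) ≫
        circleι X circleUnit t a a (fun i => single (a.col i)) (concatSingle a) ≫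
        SymSeq.app (rightUnitor X).hom t a = 𝟙 (X.val t a)
  associator_naturality {X X' Y Y' Z Z' : SymSeq C M} (x : X ⟶ X') (y : Y ⟶ Y') (z : Z ⟶ Z') :
    circleHom (circleHom x y) z ≫ (associator X' Y' Z').hom =
      (associator X Y Z).hom ≫ circleHom x (circleHom y z)
  leftUnitor_naturality {X Y : SymSeq C M} (x : X ⟶ Y) :
    circleHom (𝟙 circleUnit) x ≫ (leftUnitor Y).hom = (leftUnitor X).hom ≫ x
  rightUnitor_naturality {X Y : SymSeq C M} (x : X ⟶ Y) :
    circleHom x (𝟙 circleUnit) ≫ (rightUnitor Y).hom = (rightUnitor X).hom ≫ x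
  pentagon (W X Y Z : SymSeq C M) :
    circleHom (associator W X Y).hom (𝟙 Z) ≫ (associator W (circle X Y) Z).hom ≫
        circleHom (𝟙 W) (associator X Y Z).hom =
      (associator (circle W X) Y Z).hom ≫ (associator W X (circle Y Z)).hom
  triangle (X Y : SymSeq C M) :
    (associator X circleUnit Y).hom ≫ circleHom (𝟙 X) (leftUnitor Y).hom =
      circleHom (rightUnitor X).hom (𝟙 Y)

variable {C M}

theorem circleHom_id (X Y : SymSeq C M) : circleHom (𝟙 X) (𝟙 Y) = 𝟙 (circle X Y) :=
  NatTrans.ext (funext fun _ => circleMap_id X Y _ _)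

theorem circleHom_comp {X X' X'' Y Y' Y'' : SymSeq C M} (x : X ⟶ X') (y : Y ⟶ Y')
    (x' : X' ⟶ X'') (y' : Y' ⟶ Y'') :
    circleHom x y ≫ circleHom x' y' = circleHom (x ≫ x') (y ≫ y') :=
  NatTrans.ext (funext fun _ => (circleMap_comp x y x' y' rfl rfl _ _).trans
    (congrArg (circleMap (x ≫ x') (y ≫ y') rfl) (Category.comp_id _)))

/-- The category of symmetric sequences with the circle product as a monoidal category. -/
@[reducible] noncomputable def CircleMonoidal.monoidalCategory (K : CircleMonoidal C M) :
    MonoidalCategory (SymSeq C M) where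
  tensorObj X Y := circle X Y
  tensorHom x y := circleHom x y
  whiskerLeft X _ _ y := circleHom (𝟙 X) y
  whiskerRight x Y := circleHom x (𝟙 Y)
  tensorUnit := circleUnit
  associator := K.associator
  leftUnitor := K.leftUnitor
  rightUnitor := K.rightUnitor
  tensorHom_def x y := by
    rw [circleHom_comp, Category.comp_id, Category.id_comp]
  id_tensorHom_id := circleHom_id
  tensorHom_comp_tensorHom x y x' y' := circleHom_comp x y x' y'
  whiskerLeft_id := circleHom_id
  id_whiskerRight := circleHom_id
  associator_naturality x y z := K.associator_naturality x y z
  leftUnitor_naturality x := K.leftUnitor_naturality x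
  rightUnitor_naturality x := K.rightUnitor_naturality x
  pentagon := K.pentagon
  triangle := K.triangle

end CircleMonoidal
end CircleSeq

open CircleSeq

set_option linter.unusedSectionVars false
set_option linter.unusedVariables false
set_option linter.unusedSimpArgs false

/-! A morphism out of a circle product is a compatible family of morphisms out of the summands of
its coends. Once the summands of iterated circle products are known, most claims split into an
identity between morphisms of iterated tensor products in `M` and an identity between permutations
of the entries of concatenated profiles. The second kind is checked entry by entry; the first kind
is coherence.

Coherence. A `Shape` records how an object is built from units and labelled leaves. A morphism is
`Canon` if it respects the successive extraction of labelled factors to the front, until only units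
remain. Canonical morphisms compose and tensor, and the associators, unitors, braidings and all
operations on families (`reindex`, `flattenFam`, `shuffleFam`, `unitFam`) are canonical. If no label
occurs twice in the target, extracting one factor and inducting on the number of leaves shows that a
canonical morphism is determined by its effect on the leaves (`Canon.unique`). `LaxCanon` does the
same for morphisms `P ⟶ J Q`, where `J` is a lax symmetric monoidal functor.

Colimits. Since `M` is closed and symmetric, tensoring preserves colimits in each variable, and
hence presentations by generators and relations (`IsPresentation.tensorFam`). So presentations pass
through both variables of the circle product (`Generators.Presents.left`,
`Generators.Presents.right`). It follows that `(X ∘ Y) ∘ Z` is generated by the objects `(X(t; e) ⊗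
⨂ Y(eₖ; dₖ)) ⊗ ⨂ Z(qⱼ; bⱼ)`, where `j` runs over the entries of the concatenation of the `dₖ`, and
that `X ∘ (Y ∘ Z)` is generated by the objects `X(t; e) ⊗ ⨂ₖ (Y(eₖ; dₖ) ⊗ ⨂ₗ Z(dₖₗ; cₖₗ))`.

Monoidal structure. On generators the associator is the invertible rebracketing `assocSummand`,
corrected by the associativity of concatenation; it is compatible with the relations, and so is its
inverse. The explicit maps `X ⟶ I ∘ X` and `X ⟶ X ∘ I` are epimorphisms, because the unit has one
generator for each color, and they have retractions; so they are the inverses of the unitors. The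
pentagon and the triangle hold on generators by `Canon.unique`, together with the matching
identities of permutations.

Closedness. A morphism `X ∘ Y ⟶ Z` is a natural family of morphisms `X(t; a) ⊗ ⨂ Y(aᵢ; bᵢ) ⟶ Z(t; b₁
⊗ ⋯ ⊗ bₘ)`. Transposing, it is a morphism from `X` to the sequence whose value at `(t, a)` is the
limit of the internal homs from `⨂ Y(a'ᵢ; bᵢ)` to `Z(t; b₁ ⊗ ⋯ ⊗ bₘ)` over all `a ⟶ a'` and `b`.

Involution. On generators `J_{*2}` is the iterated `J₂`. Its associativity is an instance of
`LaxCanon.unique`, its unit laws follow from those of `J`, and the monoidality of `j_*` follows by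
iterating the monoidality of `j` over the factors (`involution_tensorFam`). The equation `j_* J_* =
J_* j_*` holds pointwise. -/

namespace CircleSeq

/-! ### Coherence in symmetric monoidal categories by extraction of labelled factors. -/

section Coherence

variable {M : Type u} [Category.{v} M] [MonoidalCategory M] {ι : Type w}

/-- A way to write an object as an iterated tensor product of units and of objects that are
identified with members of the family `A`. -/
inductive Shape (A : ι → M) : M → Type (max u v w)
  | unit : Shape A (𝟙_ M)
  | leaf (i : ι) {P : M} (e : P ≅ A i) : Shape A P
  | tensor {P Q : M} (S : Shape A P) (T : Shape A Q) : Shape A (P ⊗ Q)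

/-- A factor `A i` of `P`, together with the remaining object and its shape. -/
structure Extraction (A : ι → M) (P : M) (i : ι) where
  /-- the remaining object -/
  obj : M
  /-- the shape of the remaining object -/
  shape : Shape A obj
  /-- the isomorphism that moves the factor to the front -/
  iso : P ≅ A i ⊗ obj

section Symmetric

variable [SymmetricCategory M]

/-- The interchange as an isomorphism. -/
@[simps] def interchangeIso (X Y Z : M) : X ⊗ (Y ⊗ Z) ≅ Y ⊗ (X ⊗ Z) where
  hom := interchange X Y Z
  inv := interchange Y X Z
  hom_inv_id := interchange_interchange X Y Z
  inv_hom_id := interchange_interchange Y X Z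

variable {A B D : ι → M}

/-- Extraction from the left factor of a tensor product. -/
@[reducible] def Extraction.left {P : M} {i : ι} (x : Extraction A P i) {Q : M} (T : Shape A Q) :
    Extraction A (P ⊗ Q) i where
  obj := x.obj ⊗ Q
  shape := .tensor x.shape T
  iso := whiskerRightIso x.iso Q ≪≫ α_ _ _ _

/-- Extraction from the right factor of a tensor product. -/
@[reducible] def Extraction.right {P : M} (S : Shape A P) {i : ι} {Q : M} (x : Extraction A Q i) :
    Extraction A (P ⊗ Q) i where
  obj := P ⊗ x.obj
  shape := .tensor S x.shape
  iso := whiskerLeftIso P x.iso ≪≫ interchangeIso _ _ _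

/-- Extraction from a leaf. -/
@[reducible] def Extraction.ofLeaf {P : M} {i j : ι} (e : P ≅ A j) (h : j = i) : Extraction A P i where
  obj := 𝟙_ M
  shape := .unit
  iso := e ≪≫ eqToIso (congrArg A h) ≪≫ (ρ_ _).symm

theorem extraction_step {P P' : M} {i : ι} {x : Extraction A P i} {y : Extraction A P' i}
    {f : P ⟶ P'} {f' : x.obj ⟶ y.obj} (h : x.iso.hom ≫ A i ◁ f' = f ≫ y.iso.hom) :
    f ≫ y.iso.hom = x.iso.hom ≫ (𝟙 (A i) ⊗ₘ f') := by
  rw [id_tensorHom, h]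

/-- The square for an isomorphism, read backwards, is the square for its inverse. Inverse
associators and unitors therefore need no diagrams of their own. -/
theorem extraction_step_inv {P P' : M} {i : ι} {x : Extraction A P i} {y : Extraction A P' i}
    (f : P ≅ P') (f' : x.obj ≅ y.obj) (h : x.iso.hom ≫ A i ◁ f'.hom = f.hom ≫ y.iso.hom) :
    f.inv ≫ x.iso.hom = y.iso.hom ≫ (𝟙 (A i) ⊗ₘ f'.inv) := by
  rw [id_tensorHom, Iso.inv_comp_eq, ← reassoc_of% h, whiskerLeft_hom_inv, Category.comp_id]

namespace Shape

/-- The ways to extract a factor with the label `i`. -/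
def pulls : {P : M} → Shape A P → (i : ι) → Set (Extraction A P i)
  | _, .unit, _ => ∅
  | _, .leaf _ e, _ => {x | ∃ h, x = Extraction.ofLeaf e h}
  | _, .tensor S T, i =>
    {x | (∃ y ∈ S.pulls i, x = y.left T) ∨ (∃ y ∈ T.pulls i, x = y.right S)}

/-- The identifications with the unit of an object that has no leaves. -/
def units : {P : M} → Shape A P → Set (P ≅ 𝟙_ M)
  | _, .unit => {Iso.refl _}
  | _, .leaf _ _ => ∅
  | _, .tensor S T => {x | ∃ u ∈ S.units, ∃ w ∈ T.units, x = (u ⊗ᵢ w) ≪≫ λ_ _}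

/-- The number of leaves. -/
def size : {P : M} → Shape A P → ℕ
  | _, .unit => 0
  | _, .leaf _ _ => 1
  | _, .tensor S T => S.size + T.size

/-- The labels that occur. -/
def labels : {P : M} → Shape A P → Set ι
  | _, .unit => ∅
  | _, .leaf i _ => {i}
  | _, .tensor S T => S.labels ∪ T.labels

/-- No label occurs twice. -/
def Nodup : {P : M} → Shape A P → Prop
  | _, .unit => True
  | _, .leaf _ _ => True
  | _, .tensor S T => S.Nodup ∧ T.Nodup ∧ Disjoint S.labels T.labels

/-- This keeps the counter of `CanonAux` in step with the number of leaves, so that the counter is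
zero when only units remain. -/
theorem size_of_mem_pulls : {P : M} → (S : Shape A P) → {i : ι} → {x : Extraction A P i} →
    x ∈ S.pulls i → x.shape.size + 1 = S.size
  | _, .unit, _, _, h => h.elim
  | _, .leaf _ _, _, _, h => by
    obtain ⟨_, rfl⟩ := h
    rfl
  | _, .tensor S T, _, _, h => by
    obtain ⟨y, hy, rfl⟩ | ⟨y, hy, rfl⟩ := h
    · have := S.size_of_mem_pulls hy
      simp only [Extraction.left, size]
      omega
    · have := T.size_of_mem_pulls hy
      simp only [Extraction.right, size]
      omega

theorem units_nonempty : {P : M} → (S : Shape A P) → S.size = 0 → ∃ u, u ∈ S.units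
  | _, .unit, _ => ⟨_, rfl⟩
  | _, .leaf _ _, h => (Nat.one_ne_zero h).elim
  | _, .tensor S T, h => by
    obtain ⟨u, hu⟩ := S.units_nonempty (Nat.add_eq_zero_iff.1 h).1
    obtain ⟨w, hw⟩ := T.units_nonempty (Nat.add_eq_zero_iff.1 h).2
    exact ⟨_, u, hu, w, hw, rfl⟩

/-- The recursion leaves no choice. Hence the two identifications of the middle object of a
composite with the unit coincide. -/
theorem units_unique : {P : M} → (S : Shape A P) → {u w : P ≅ 𝟙_ M} → u ∈ S.units →
    w ∈ S.units → u = w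
  | _, .unit, _, _, hu, hw => Eq.trans hu (Eq.symm hw)
  | _, .leaf _ _, _, _, hu, _ => hu.elim
  | _, .tensor S T, _, _, hu, hw => by
    obtain ⟨u, hu, u', hu', rfl⟩ := hu
    obtain ⟨w, hw, w', hw', rfl⟩ := hw
    rw [S.units_unique hu hw, T.units_unique hu' hw']

theorem pulls_nonempty : {P : M} → (S : Shape A P) → S.size ≠ 0 → ∃ i, ∃ x, x ∈ S.pulls i
  | _, .unit, h => (h rfl).elim
  | _, .leaf i _, _ => ⟨i, _, rfl, rfl⟩
  | _, .tensor S T, h => by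
    by_cases hS : S.size = 0
    · obtain ⟨i, x, hx⟩ := T.pulls_nonempty (fun hT => h (by simp [size, hS, hT]))
      exact ⟨i, _, Or.inr ⟨x, hx, rfl⟩⟩
    · obtain ⟨i, x, hx⟩ := S.pulls_nonempty hS
      exact ⟨i, _, Or.inl ⟨x, hx, rfl⟩⟩

theorem mem_labels_of_mem_pulls : {P : M} → (S : Shape A P) → {i : ι} →
    {x : Extraction A P i} → x ∈ S.pulls i → i ∈ S.labels ∧ x.shape.labels ⊆ S.labels
  | _, .unit, _, _, h => h.elim
  | _, .leaf _ _, _, _, h => by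
    obtain ⟨rfl, rfl⟩ := h
    exact ⟨rfl, Set.empty_subset _⟩
  | _, .tensor S T, _, _, h => by
    obtain ⟨y, hy, rfl⟩ | ⟨y, hy, rfl⟩ := h
    · have := S.mem_labels_of_mem_pulls hy
      exact ⟨Or.inl this.1, Set.union_subset_union_left _ this.2⟩
    · have := T.mem_labels_of_mem_pulls hy
      exact ⟨Or.inr this.1, Set.union_subset_union_right _ this.2⟩

theorem Nodup.of_mem_pulls : {P : M} → {S : Shape A P} → S.Nodup → {i : ι} →
    {x : Extraction A P i} → x ∈ S.pulls i → x.shape.Nodup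
  | _, .unit, _, _, _, h => h.elim
  | _, .leaf _ _, _, _, _, h => by
    obtain ⟨_, rfl⟩ := h
    trivial
  | _, .tensor S T, h0, _, _, h => by
    obtain ⟨hS, hT, hST⟩ := h0
    obtain ⟨y, hy, rfl⟩ | ⟨y, hy, rfl⟩ := h
    · exact ⟨hS.of_mem_pulls hy, hT, hST.mono_left (S.mem_labels_of_mem_pulls hy).2⟩
    · exact ⟨hS, hT.of_mem_pulls hy, hST.mono_right (T.mem_labels_of_mem_pulls hy).2⟩

/-- A label that occurs once determines its leaf, and the recursion fixes how this leaf is moved to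
the front. With repeated labels uniqueness fails: the identity and the braiding of `A i ⊗ A i` are
both canonical if the two leaves have the label `i`. -/
theorem Nodup.pulls_unique : {P : M} → {S : Shape A P} → S.Nodup → {i : ι} →
    {x y : Extraction A P i} → x ∈ S.pulls i → y ∈ S.pulls i → x = y
  | _, .unit, _, _, _, _, h, _ => h.elim
  | _, .leaf _ _, _, _, _, _, h, h' => by
    obtain ⟨_, rfl⟩ := h
    obtain ⟨_, rfl⟩ := h'
    rfl
  | _, .tensor S T, h0, _, _, _, h, h' => by
    obtain ⟨hS, hT, hST⟩ := h0
    obtain ⟨y, hy, rfl⟩ | ⟨y, hy, rfl⟩ := h <;> obtain ⟨z, hz, rfl⟩ | ⟨z, hz, rfl⟩ := h'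
    · rw [hS.pulls_unique hy hz]
    · exact (Set.disjoint_left.1 hST (S.mem_labels_of_mem_pulls hy).1
        (T.mem_labels_of_mem_pulls hz).1).elim
    · exact (Set.disjoint_left.1 hST (S.mem_labels_of_mem_pulls hz).1
        (T.mem_labels_of_mem_pulls hy).1).elim
    · rw [hT.pulls_unique hy hz]

end Shape

/-- The morphism `f` is compatible with `n` successive extractions of factors, which are mapped by
`φ`, and with the identification of what remains with the unit. -/
def CanonAux (φ : ∀ i, A i ⟶ B i) : ℕ → {P P' : M} → Shape A P → Shape B P' → (P ⟶ P') → Prop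
  | 0, _, _, S, S', f => ∃ a ∈ S.units, ∃ b ∈ S'.units, f ≫ b.hom = a.hom
  | n + 1, _, _, S, S', f => ∀ (i : ι), ∀ x ∈ S.pulls i, ∃ y ∈ S'.pulls i, ∃ f' : x.obj ⟶ y.obj,
      f ≫ y.iso.hom = x.iso.hom ≫ (φ i ⊗ₘ f') ∧ CanonAux φ n x.shape y.shape f'

/-- The morphism `f` between iterated tensor products permutes the factors, through the coherence
isomorphisms of a symmetric monoidal category, and maps them by `φ`. -/
def Canon (φ : ∀ i, A i ⟶ B i) {P P' : M} (S : Shape A P) (S' : Shape B P') (f : P ⟶ P') : Prop :=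
  S'.size = S.size ∧ CanonAux φ S.size S S' f

/-- The condition is universal in the extractions of the source and existential in those of the
target. So the extraction of the middle object that is obtained for `f` can be fed into the
condition for `g`. -/
theorem CanonAux.comp {φ : ∀ i, A i ⟶ B i} {ψ : ∀ i, B i ⟶ D i} : (n : ℕ) → {P Q R : M} →
    {S : Shape A P} → {T : Shape B Q} → {U : Shape D R} → {f : P ⟶ Q} → {g : Q ⟶ R} →
    CanonAux φ n S T f → CanonAux ψ n T U g → CanonAux (fun i => φ i ≫ ψ i) n S U (f ≫ g)
  | 0, _, _, _, _, T, _, f, g, ⟨a, ha, b, hb, hf⟩, ⟨b', hb', c, hc, hg⟩ => by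
    obtain rfl := T.units_unique hb hb'
    exact ⟨a, ha, c, hc, by rw [Category.assoc, hg, hf]⟩
  | n + 1, _, _, _, _, _, _, _, _, hf, hg => by
    intro i x hx
    obtain ⟨y, hy, f', h1, h2⟩ := hf i x hx
    obtain ⟨z, hz, g', h3, h4⟩ := hg i y hy
    refine ⟨z, hz, f' ≫ g', ?_, CanonAux.comp n h2 h4⟩
    rw [Category.assoc, h3, reassoc_of% h1, tensorHom_comp_tensorHom]

theorem Canon.comp' {φ : ∀ i, A i ⟶ B i} {ψ : ∀ i, B i ⟶ D i} {P Q R : M} {S : Shape A P}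
    {T : Shape B Q} {U : Shape D R} {f : P ⟶ Q} {g : Q ⟶ R} (hf : Canon φ S T f)
    (hg : Canon ψ T U g) : Canon (fun i => φ i ≫ ψ i) S U (f ≫ g) :=
  ⟨hg.1.trans hf.1, CanonAux.comp _ hf.2 (hf.1 ▸ hg.2)⟩

theorem Canon.comp_left {φ : ∀ i, A i ⟶ B i} {P Q R : M} {S : Shape A P}
    {T : Shape A Q} {U : Shape B R} {f : P ⟶ Q} {g : Q ⟶ R} (hf : Canon (fun i => 𝟙 (A i)) S T f)
    (hg : Canon φ T U g) : Canon φ S U (f ≫ g) := by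
  have h := hf.comp' hg
  simpa only [Category.id_comp] using h

theorem Canon.comp_right {φ : ∀ i, A i ⟶ B i} {P Q R : M} {S : Shape A P}
    {T : Shape B Q} {U : Shape B R} {f : P ⟶ Q} {g : Q ⟶ R} (hf : Canon φ S T f)
    (hg : Canon (fun i => 𝟙 (B i)) T U g) : Canon φ S U (f ≫ g) := by
  have h := hf.comp' hg
  simpa only [Category.comp_id] using h

/-- Extracting a single leaf is enough: its counterpart in the target is the same for `f` and `g`,
the remaining morphisms agree by induction, and the extraction isomorphism of the target is
cancelled. -/
theorem CanonAux.unique {φ : ∀ i, A i ⟶ B i} : (n : ℕ) → {P Q : M} → {S : Shape A P} →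
    {T : Shape B Q} → {f g : P ⟶ Q} → S.size = n → T.Nodup → CanonAux φ n S T f →
    CanonAux φ n S T g → f = g
  | 0, _, _, S, T, f, g, _, _, ⟨a, ha, b, hb, hf⟩, ⟨a', ha', b', hb', hg⟩ => by
    obtain rfl := S.units_unique ha ha'
    obtain rfl := T.units_unique hb hb'
    rw [← cancel_mono b.hom, hf, hg]
  | n + 1, _, _, S, T, f, g, hn, hT, hf, hg => by
    obtain ⟨i, x, hx⟩ := S.pulls_nonempty (by omega)
    obtain ⟨y, hy, f', h1, h2⟩ := hf i x hx
    obtain ⟨z, hz, g', h3, h4⟩ := hg i x hx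
    obtain rfl := hT.pulls_unique hy hz
    have h := S.size_of_mem_pulls hx
    rw [← cancel_mono y.iso.hom, h1, h3,
      CanonAux.unique n (by omega) (hT.of_mem_pulls hy) h2 h4]

/-- Coherence: canonical morphisms are determined by their source and target, if no label occurs
twice. -/
theorem Canon.unique {φ : ∀ i, A i ⟶ B i} {P Q : M} {S : Shape A P} {T : Shape B Q} {f g : P ⟶ Q}
    (hf : Canon φ S T f) (hg : Canon φ S T g) (hT : T.Nodup) : f = g :=
  CanonAux.unique _ rfl hT hf.2 hg.2

/-- A leaf taken from one side leaves the morphism on the other side untouched. The square closes by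
naturality of the associator for a leaf on the left, and of the interchange for a leaf on the right.
-/
theorem CanonAux.tensor {φ : ∀ i, A i ⟶ B i} : (n k l : ℕ) → {P Q P' Q' : M} →
    {S : Shape A P} → {T : Shape A Q} → {S' : Shape B P'} → {T' : Shape B Q'} → {f : P ⟶ P'} →
    {g : Q ⟶ Q'} → k + l = n → S.size = k → T.size = l → CanonAux φ k S S' f →
    CanonAux φ l T T' g → CanonAux φ n (S.tensor T) (S'.tensor T') (f ⊗ₘ g)
  | 0, k, l, _, _, _, _, _, _, _, _, _, _, hn, _, _, hf, hg => by
    obtain ⟨rfl, rfl⟩ := Nat.add_eq_zero_iff.1 hn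
    obtain ⟨a, ha, b, hb, hf⟩ := hf
    obtain ⟨a', ha', b', hb', hg⟩ := hg
    refine ⟨_, ⟨a, ha, a', ha', rfl⟩, _, ⟨b, hb, b', hb', rfl⟩, ?_⟩
    simp [hf, hg]
  | n + 1, k, l, _, _, _, _, S, T, S', T', f, g, hn, hk, hl, hf, hg => by
    rintro i _ (⟨x, hx, rfl⟩ | ⟨x, hx, rfl⟩)
    · have hs := S.size_of_mem_pulls hx
      obtain ⟨k, rfl⟩ : ∃ k', k = k' + 1 := ⟨_, hk.symm.trans hs.symm⟩
      obtain ⟨y, hy, f', h1, h2⟩ := hf i x hx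
      refine ⟨_, Or.inl ⟨y, hy, rfl⟩, f' ⊗ₘ g, ?_,
        CanonAux.tensor n k l (by omega) (by omega) hl h2 hg⟩
      have := congrArg (· ⊗ₘ g) h1
      simp only [Extraction.left, Iso.trans_hom, whiskerRightIso_hom, Category.assoc]
      rw [← associator_naturality, ← tensorHom_id, ← tensorHom_id, tensorHom_comp_tensorHom_assoc,
        tensorHom_comp_tensorHom_assoc, h1]
      simp
    · have hs := T.size_of_mem_pulls hx
      obtain ⟨l, rfl⟩ : ∃ k', l = k' + 1 := ⟨_, hl.symm.trans hs.symm⟩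
      obtain ⟨y, hy, f', h1, h2⟩ := hg i x hx
      refine ⟨_, Or.inr ⟨y, hy, rfl⟩, f ⊗ₘ f', ?_,
        CanonAux.tensor n k l (by omega) hk (by omega) hf h2⟩
      exact interchange_step _ _ _ _ _ _ h1

theorem Canon.tensor {φ : ∀ i, A i ⟶ B i} {P Q P' Q' : M} {S : Shape A P} {T : Shape A Q}
    {S' : Shape B P'} {T' : Shape B Q'} {f : P ⟶ P'} {g : Q ⟶ Q'} (hf : Canon φ S S' f)
    (hg : Canon φ T T' g) : Canon φ (S.tensor T) (S'.tensor T') (f ⊗ₘ g) :=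
  ⟨congrArg₂ (· + ·) hf.1 hg.1, CanonAux.tensor _ _ _ rfl rfl rfl hf.2 hg.2⟩

theorem CanonAux.id : (n : ℕ) → {P : M} → (S : Shape A P) → S.size = n →
    CanonAux (fun i => 𝟙 (A i)) n S S (𝟙 P)
  | 0, _, S, h => by
    obtain ⟨u, hu⟩ := S.units_nonempty h
    exact ⟨u, hu, u, hu, Category.id_comp _⟩
  | n + 1, _, S, h => fun i x hx => ⟨x, hx, 𝟙 _, by simp,
      CanonAux.id n x.shape (by have := S.size_of_mem_pulls hx; omega)⟩

theorem Canon.id {P : M} (S : Shape A P) : Canon (fun i => 𝟙 (A i)) S S (𝟙 P) :=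
  ⟨rfl, CanonAux.id _ S rfl⟩

theorem Canon.leaf {φ : ∀ i, A i ⟶ B i} {i : ι} {P P' : M} {e : P ≅ A i} {e' : P' ≅ B i}
    {f : P ⟶ P'} (h : f ≫ e'.hom = e.hom ≫ φ i) : Canon φ (.leaf i e) (.leaf i e') f := by
  refine ⟨rfl, ?_⟩
  rintro j _ ⟨rfl, rfl⟩
  refine ⟨_, ⟨rfl, rfl⟩, 𝟙 _, ?_, ⟨_, rfl, _, rfl, Category.id_comp _⟩⟩
  simp [Extraction.ofLeaf, reassoc_of% h]

theorem Canon.unit {φ : ∀ i, A i ⟶ B i} : Canon φ (.unit (A := A)) (.unit (A := B)) (𝟙 (𝟙_ M)) :=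
  ⟨rfl, ⟨_, rfl, _, rfl, Category.id_comp _⟩⟩

/-- The extracted leaf lies in the first, second or third object, and `h1`, `h2`, `h3` are the
corresponding squares. Only in the third does the leaf pass a tensor product of two objects, which
calls for a hexagon. Each square serves both directions. -/
theorem CanonAux.associator : (n : ℕ) → {P Q R : M} → (S : Shape A P) → (T : Shape A Q) →
    (U : Shape A R) → S.size + T.size + U.size = n → CanonAux (fun i => 𝟙 (A i)) n
      ((S.tensor T).tensor U) (S.tensor (T.tensor U)) (α_ P Q R).hom ∧
      CanonAux (fun i => 𝟙 (A i)) n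
      (S.tensor (T.tensor U)) ((S.tensor T).tensor U) (α_ P Q R).inv
  | 0, _, _, _, S, T, U, h => by
    obtain ⟨a, ha⟩ := S.units_nonempty (by omega)
    obtain ⟨b, hb⟩ := T.units_nonempty (by omega)
    obtain ⟨c, hc⟩ := U.units_nonempty (by omega)
    have h1 : ((a ⊗ᵢ b) ≪≫ λ_ _ ⊗ᵢ c) ≪≫ λ_ _ = α_ _ _ _ ≪≫ (a ⊗ᵢ (b ⊗ᵢ c) ≪≫ λ_ _) ≪≫ λ_ _ := by
      ext
      simp only [Iso.trans_hom, tensorIso_hom, MonoidalCategory.tensorHom_def]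
      monoidal
    refine ⟨⟨_, ⟨_, ⟨a, ha, b, hb, rfl⟩, c, hc, rfl⟩, _, ⟨a, ha, _, ⟨b, hb, c, hc, rfl⟩, rfl⟩, ?_⟩,
      ⟨_, ⟨a, ha, _, ⟨b, hb, c, hc, rfl⟩, rfl⟩, _, ⟨_, ⟨a, ha, b, hb, rfl⟩, c, hc, rfl⟩, ?_⟩⟩
    · rw [h1]; rfl
    · rw [h1]; simp
  | n + 1, P, Q, R, S, T, U, h => by
    have h1 : ∀ (i : ι) (x : Extraction A P i),
        ((x.left T).left U).iso.hom ≫ A i ◁ (α_ x.obj Q R).hom =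
          (α_ P Q R).hom ≫ (x.left (T.tensor U)).iso.hom := by
      intro i x
      simp only [Extraction.left, Iso.trans_hom, whiskerRightIso_hom]
      monoidal
    have h2 : ∀ (i : ι) (x : Extraction A Q i),
        ((x.right S).left U).iso.hom ≫ A i ◁ (α_ P x.obj R).hom =
          (α_ P Q R).hom ≫ ((x.left U).right S).iso.hom := by
      intro i x
      simp only [Extraction.left, Extraction.right, Iso.trans_hom, whiskerRightIso_hom,
        whiskerLeftIso_hom, interchangeIso_hom, interchange]
      monoidal
    have h3 : ∀ (i : ι) (x : Extraction A R i),
        (x.right (S.tensor T)).iso.hom ≫ A i ◁ (α_ P Q x.obj).hom =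
          (α_ P Q R).hom ≫ ((x.right T).right S).iso.hom := by
      intro i x
      simp only [Extraction.right, Iso.trans_hom, 
        whiskerLeftIso_hom, interchangeIso_hom, interchange, BraidedCategory.braiding_tensor_left_hom]
      monoidal
    refine ⟨?_, ?_⟩
    · rintro i _ (⟨_, ⟨x, hx, rfl⟩ | ⟨x, hx, rfl⟩, rfl⟩ | ⟨x, hx, rfl⟩)
      · refine ⟨_, Or.inl ⟨x, hx, rfl⟩, _, ?_,
          (CanonAux.associator n x.shape T U (by have := S.size_of_mem_pulls hx; omega)).1⟩
        exact extraction_step (h1 i x)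
      · refine ⟨_, Or.inr ⟨_, Or.inl ⟨x, hx, rfl⟩, rfl⟩, _, ?_,
          (CanonAux.associator n S x.shape U (by have := T.size_of_mem_pulls hx; omega)).1⟩
        exact extraction_step (h2 i x)
      · refine ⟨_, Or.inr ⟨_, Or.inr ⟨x, hx, rfl⟩, rfl⟩, _, ?_,
          (CanonAux.associator n S T x.shape (by have := U.size_of_mem_pulls hx; omega)).1⟩
        exact extraction_step (h3 i x)
    · rintro i _ (⟨x, hx, rfl⟩ | ⟨_, ⟨x, hx, rfl⟩ | ⟨x, hx, rfl⟩, rfl⟩)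
      · refine ⟨_, Or.inl ⟨_, Or.inl ⟨x, hx, rfl⟩, rfl⟩, _, ?_,
          (CanonAux.associator n x.shape T U (by have := S.size_of_mem_pulls hx; omega)).2⟩
        exact extraction_step_inv (x := (x.left T).left U)
          (y := x.left (T.tensor U)) (α_ P Q R) (α_ x.obj Q R) (h1 i x)
      · refine ⟨_, Or.inl ⟨_, Or.inr ⟨x, hx, rfl⟩, rfl⟩, _, ?_,
          (CanonAux.associator n S x.shape U (by have := T.size_of_mem_pulls hx; omega)).2⟩
        exact extraction_step_inv (x := (Extraction.right S x).left U)
          (y := Extraction.right S (x.left U)) (α_ P Q R) (α_ P x.obj R) (h2 i x)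
      · refine ⟨_, Or.inr ⟨x, hx, rfl⟩, _, ?_,
          (CanonAux.associator n S T x.shape (by have := U.size_of_mem_pulls hx; omega)).2⟩
        exact extraction_step_inv (x := Extraction.right (S.tensor T) x)
          (y := Extraction.right S (Extraction.right T x)) (α_ P Q R) (α_ P Q x.obj) (h3 i x)

theorem Canon.associator {P Q R : M} (S : Shape A P) (T : Shape A Q) (U : Shape A R) :
    Canon (fun i => 𝟙 (A i)) ((S.tensor T).tensor U) (S.tensor (T.tensor U)) (α_ P Q R).hom :=
  ⟨(Nat.add_assoc _ _ _).symm, (CanonAux.associator _ S T U rfl).1⟩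

theorem Canon.associator_inv {P Q R : M} (S : Shape A P) (T : Shape A Q) (U : Shape A R) :
    Canon (fun i => 𝟙 (A i)) (S.tensor (T.tensor U)) ((S.tensor T).tensor U) (α_ P Q R).inv :=
  ⟨Nat.add_assoc _ _ _, (CanonAux.associator _ S T U (Nat.add_assoc _ _ _)).2⟩

/-- Each case is one hexagon. For a leaf in `P`, the target extraction moves the leaf back across
`Q`, and this cancels against the braiding by symmetry; a merely braided category would not suffice
here. With no leaves left, the claim is that the two unitors of the unit agree. -/
theorem CanonAux.braiding : (n : ℕ) → {P Q : M} → (S : Shape A P) → (T : Shape A Q) →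
    S.size + T.size = n →
    CanonAux (fun i => 𝟙 (A i)) n (S.tensor T) (T.tensor S) (β_ P Q).hom
  | 0, _, _, S, T, h => by
    obtain ⟨a, ha⟩ := S.units_nonempty (by omega)
    obtain ⟨b, hb⟩ := T.units_nonempty (by omega)
    refine ⟨_, ⟨a, ha, b, hb, rfl⟩, _, ⟨b, hb, a, ha, rfl⟩, ?_⟩
    simp only [Iso.trans_hom, tensorIso_hom]
    rw [← BraidedCategory.braiding_naturality_assoc]
    simp [← unitors_equal]
  | n + 1, P, Q, S, T, h => by
    rintro i _ (⟨x, hx, rfl⟩ | ⟨x, hx, rfl⟩)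
    · refine ⟨_, Or.inr ⟨x, hx, rfl⟩, _, ?_,
          CanonAux.braiding n x.shape T (by have := S.size_of_mem_pulls hx; omega)⟩
      simp only [Extraction.left, Extraction.right, Iso.trans_hom, whiskerRightIso_hom,
        whiskerLeftIso_hom, interchangeIso_hom, interchange, id_tensorHom]
      rw [← BraidedCategory.braiding_naturality_left_assoc,
        BraidedCategory.braiding_tensor_left_hom]
      simp [← comp_whiskerRight_assoc]
    · refine ⟨_, Or.inl ⟨x, hx, rfl⟩, _, ?_,
          CanonAux.braiding n S x.shape (by have := T.size_of_mem_pulls hx; omega)⟩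
      simp only [Extraction.left, Extraction.right, Iso.trans_hom, whiskerRightIso_hom,
        whiskerLeftIso_hom, interchangeIso_hom, interchange, id_tensorHom]
      rw [← BraidedCategory.braiding_naturality_right_assoc,
        BraidedCategory.braiding_tensor_right_hom]
      simp

theorem Canon.braiding {P Q : M} (S : Shape A P) (T : Shape A Q) :
    Canon (fun i => 𝟙 (A i)) (S.tensor T) (T.tensor S) (β_ P Q).hom :=
  ⟨Nat.add_comm _ _, CanonAux.braiding _ S T rfl⟩

theorem CanonAux.leftUnitor : (n : ℕ) → {P : M} → (S : Shape A P) → S.size = n →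
    CanonAux (fun i => 𝟙 (A i)) n (Shape.unit.tensor S) S (λ_ P).hom ∧
    CanonAux (fun i => 𝟙 (A i)) n S (Shape.unit.tensor S) (λ_ P).inv
  | 0, _, S, h => by
    obtain ⟨a, ha⟩ := S.units_nonempty (by omega)
    refine ⟨⟨_, ⟨_, rfl, a, ha, rfl⟩, _, ha, ?_⟩, ⟨_, ha, _, ⟨_, rfl, a, ha, rfl⟩, ?_⟩⟩
    · simp
    · simp
  | n + 1, P, S, h => by
    have h1 : ∀ (i : ι) (x : Extraction A P i),
        (x.right (Shape.unit)).iso.hom ≫ A i ◁ (λ_ x.obj).hom = (λ_ P).hom ≫ x.iso.hom := by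
      intro i x
      simp [Extraction.right, interchange, braiding_tensorUnit_left]
    constructor
    · rintro i _ (⟨x, hx, rfl⟩ | ⟨x, hx, rfl⟩)
      · exact hx.elim
      · exact ⟨x, hx, _, extraction_step (h1 i x),
          (CanonAux.leftUnitor n x.shape (by have := S.size_of_mem_pulls hx; omega)).1⟩
    · intro i x hx
      refine ⟨_, Or.inr ⟨x, hx, rfl⟩, _, ?_,
        (CanonAux.leftUnitor n x.shape (by have := S.size_of_mem_pulls hx; omega)).2⟩
      exact extraction_step_inv (x := Extraction.right Shape.unit x) (y := x) (λ_ P)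
        (λ_ x.obj) (h1 i x)

theorem CanonAux.rightUnitor : (n : ℕ) → {P : M} → (S : Shape A P) → S.size = n →
    CanonAux (fun i => 𝟙 (A i)) n (S.tensor Shape.unit) S (ρ_ P).hom ∧
    CanonAux (fun i => 𝟙 (A i)) n S (S.tensor Shape.unit) (ρ_ P).inv
  | 0, _, S, h => by
    obtain ⟨a, ha⟩ := S.units_nonempty (by omega)
    refine ⟨⟨_, ⟨a, ha, _, rfl, rfl⟩, _, ha, ?_⟩, ⟨_, ha, _, ⟨a, ha, _, rfl, rfl⟩, ?_⟩⟩
    · simp [unitors_equal]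
    · simp [unitors_equal]
  | n + 1, P, S, h => by
    have h1 : ∀ (i : ι) (x : Extraction A P i),
        (x.left (Shape.unit)).iso.hom ≫ A i ◁ (ρ_ x.obj).hom = (ρ_ P).hom ≫ x.iso.hom := by
      intro i x
      simp [Extraction.left]
    constructor
    · rintro i _ (⟨x, hx, rfl⟩ | ⟨x, hx, rfl⟩)
      · exact ⟨x, hx, _, extraction_step (h1 i x),
          (CanonAux.rightUnitor n x.shape (by have := S.size_of_mem_pulls hx; omega)).1⟩
      · exact hx.elim
    · intro i x hx
      refine ⟨_, Or.inl ⟨x, hx, rfl⟩, _, ?_,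
        (CanonAux.rightUnitor n x.shape (by have := S.size_of_mem_pulls hx; omega)).2⟩
      exact extraction_step_inv (x := x.left Shape.unit) (y := x) (ρ_ P)
        (ρ_ x.obj) (h1 i x)

theorem Canon.leftUnitor {P : M} (S : Shape A P) :
    Canon (fun i => 𝟙 (A i)) (Shape.unit.tensor S) S (λ_ P).hom :=
  ⟨(Nat.zero_add _).symm, (CanonAux.leftUnitor _ S (Nat.zero_add _).symm).1⟩

theorem Canon.leftUnitor_inv {P : M} (S : Shape A P) :
    Canon (fun i => 𝟙 (A i)) S (Shape.unit.tensor S) (λ_ P).inv :=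
  ⟨Nat.zero_add _, (CanonAux.leftUnitor _ S rfl).2⟩

theorem Canon.rightUnitor {P : M} (S : Shape A P) :
    Canon (fun i => 𝟙 (A i)) (S.tensor Shape.unit) S (ρ_ P).hom :=
  ⟨rfl, (CanonAux.rightUnitor _ S rfl).1⟩

theorem Canon.rightUnitor_inv {P : M} (S : Shape A P) :
    Canon (fun i => 𝟙 (A i)) S (S.tensor Shape.unit) (ρ_ P).inv :=
  ⟨rfl, (CanonAux.rightUnitor _ S rfl).2⟩

end Symmetric

end Coherence

/-! ### Shapes of tensor products of families, and canonicity of the operations on families. -/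

section CoherenceFam

variable {M : Type u} [Category.{v} M] [MonoidalCategory M] {ι : Type w} {A B : ι → M}

/-- The shape of the tensor product of a family. -/
def Shape.fam : (n : ℕ) → {P : Fin n → M} → (∀ i, Shape A (P i)) → Shape A (tensorFam n P)
  | 0, _, _ => .unit
  | n + 1, _, S => .tensor (S 0) (Shape.fam n (fun i => S i.succ))

theorem Shape.mem_labels_fam : (n : ℕ) → {P : Fin n → M} → (S : ∀ i, Shape A (P i)) → {x : ι} →
    x ∈ (Shape.fam n S).labels → ∃ i, x ∈ (S i).labels
  | n + 1, _, S, x, h => by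
    obtain h | h := h
    · exact ⟨0, h⟩
    · obtain ⟨i, hi⟩ := Shape.mem_labels_fam n _ h
      exact ⟨i.succ, hi⟩

theorem Shape.nodup_fam : (n : ℕ) → {P : Fin n → M} → (S : ∀ i, Shape A (P i)) →
    (∀ i, (S i).Nodup) → (∀ i j x, x ∈ (S i).labels → x ∈ (S j).labels → i = j) →
    (Shape.fam n S).Nodup
  | 0, _, _, _, _ => trivial
  | n + 1, _, S, h, h' => by
    refine ⟨h 0, Shape.nodup_fam n _ (fun i => h i.succ)
      (fun i j x hi hj => Fin.succ_injective _ (h' _ _ x hi hj)), ?_⟩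
    rw [Set.disjoint_left]
    intro x hx hx'
    obtain ⟨i, hi⟩ := Shape.mem_labels_fam n _ hx'
    exact (Fin.succ_ne_zero i) (h' _ _ x hi hx)

variable [SymmetricCategory M] {φ : ∀ i, A i ⟶ B i}

theorem Canon.of_eq {P Q : M} {S : Shape A P} {T : Shape B Q} {f g : P ⟶ Q} (hf : Canon φ S T f)
    (h : f = g) : Canon φ S T g := h ▸ hf

theorem Canon.whiskerLeft {P Q R : M} (S : Shape A P) {T : Shape A Q} {U : Shape A R} {f : Q ⟶ R}
    (hf : Canon (fun i => 𝟙 (A i)) T U f) :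
    Canon (fun i => 𝟙 (A i)) (S.tensor T) (S.tensor U) (P ◁ f) :=
  ((Canon.id S).tensor hf).of_eq (id_tensorHom _ _)

theorem Canon.whiskerRight {P Q R : M} {T : Shape A Q} {U : Shape A R} {f : Q ⟶ R}
    (hf : Canon (fun i => 𝟙 (A i)) T U f) (S : Shape A P) :
    Canon (fun i => 𝟙 (A i)) (T.tensor S) (U.tensor S) (f ▷ P) :=
  (hf.tensor (Canon.id S)).of_eq (tensorHom_id _ _)

theorem Canon.interchange {P Q R : M} (S : Shape A P) (T : Shape A Q) (U : Shape A R) :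
    Canon (fun i => 𝟙 (A i)) (S.tensor (T.tensor U)) (T.tensor (S.tensor U))
      (interchange P Q R) :=
  (Canon.associator_inv S T U).comp_left (((Canon.braiding S T).whiskerRight U).comp_left
    (Canon.associator T S U))

theorem Canon.tensorμ {P Q P' Q' : M} (S : Shape A P) (T : Shape A Q) (S' : Shape A P')
    (T' : Shape A Q') :
    Canon (fun i => 𝟙 (A i)) ((S.tensor T).tensor (S'.tensor T'))
      ((S.tensor S').tensor (T.tensor T')) (tensorμ P Q P' Q') :=
  (Canon.associator S T _).comp_left <| (Canon.whiskerLeft S (Canon.associator_inv T S' T')).comp_left <|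
    (Canon.whiskerLeft S ((Canon.braiding T S').whiskerRight T')).comp_left <|
    (Canon.whiskerLeft S (Canon.associator S' T T')).comp_left <| Canon.associator_inv S S' _

theorem Canon.tensorFamMap : (n : ℕ) → {P Q : Fin n → M} → {S : ∀ i, Shape A (P i)} →
    {T : ∀ i, Shape B (Q i)} → {f : ∀ i, P i ⟶ Q i} → (∀ i, Canon φ (S i) (T i) (f i)) →
    Canon φ (.fam n S) (.fam n T) (tensorFamMap n f)
  | 0, _, _, _, _, _, _ => Canon.unit
  | n + 1, _, _, _, _, _, h => (h 0).tensor (Canon.tensorFamMap n (fun i => h i.succ))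

theorem Canon.eqToHom_fam {n : ℕ} {P : Fin n → M} (S : ∀ i, Shape A (P i)) {i j : Fin n}
    (h : i = j) : Canon (fun i => 𝟙 (A i)) (S i) (S j) (eqToHom (congrArg P h)) := by
  subst h
  exact Canon.id _

theorem Canon.pull : (n : ℕ) → (k : Fin (n + 1)) → {P : Fin (n + 1) → M} →
    (S : ∀ i, Shape A (P i)) → Canon (fun i => 𝟙 (A i)) (.fam (n + 1) S)
      ((S k).tensor (.fam n (fun j => S (skip n k j)))) (pull n k P)
  | 0, k, P, S => by
    refine Fin.cases ?_ (fun k' => k'.elim0) k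
    exact Canon.id _
  | n + 1, k, P, S => by
    refine Fin.cases ?_ (fun k' => ?_) k
    · exact Canon.id _
    · exact (Canon.whiskerLeft (S 0) (Canon.pull n k' (fun i => S i.succ))).comp_left
        (Canon.interchange _ _ _)

/-- The hypothesis relates the shape of the source factor `σ i` to that of the target factor `i`, so
the labels travel with the factors. The proof follows the recursion of `reindex`: one `pull` and the
residual permutation. -/
theorem Canon.reindex : (m n : ℕ) → (σ : Fin m ≃ Fin n) → {P : Fin n → M} → {Q : Fin m → M} →
    {S : ∀ i, Shape A (P i)} → {T : ∀ i, Shape B (Q i)} → {f : ∀ i, P (σ i) ⟶ Q i} →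
    (∀ i, Canon φ (S (σ i)) (T i) (f i)) → Canon φ (.fam n S) (.fam m T) (reindex m n σ f)
  | 0, 0, _, _, _, _, _, _, _ => Canon.unit
  | 0, _ + 1, σ, _, _, _, _, _, _ => (σ.symm 0).elim0
  | _ + 1, 0, σ, _, _, _, _, _, _ => (σ 0).elim0
  | m + 1, n + 1, σ, P, Q, S, T, f, h =>
    (Canon.pull n (σ 0) S).comp_left ((h 0).tensor
      (Canon.reindex m n (residual σ 0) (S := fun j => S (skip n (σ 0) j)) (fun i =>
        (Canon.eqToHom_fam S ((skip_residual σ 0 i).trans (congrArg σ (skip_zero m i)))).comp_left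
          (h i.succ))))

theorem Canon.splitFam : (m n : ℕ) → {W : Fin (n + m) → M} → (S : ∀ i, Shape A (W i)) →
    Canon (fun i => 𝟙 (A i)) (.fam (n + m) S)
      ((Shape.fam m (fun i => S (Fin.castLE (Nat.le_add_left _ _) i))).tensor
        (Shape.fam n (fun i => S (i.addNat m)))) (splitFam m n W)
  | 0, _, _, _ => Canon.leftUnitor_inv _
  | m + 1, n, _, S => (Canon.whiskerLeft (S 0) (Canon.splitFam m n (fun i => S i.succ))).comp_left
      (Canon.associator_inv _ _ _)

theorem Canon.flattenFam : (m : ℕ) → (n : Fin m → ℕ) → {W : Fin (sumLen m n) → M} →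
    (S : ∀ i, Shape A (W i)) → Canon (fun i => 𝟙 (A i)) (.fam (sumLen m n) S)
      (.fam m (fun k => .fam (n k) (fun l => S (blockPos m n k l)))) (flattenFam m n W)
  | 0, _, _, _ => Canon.id _
  | m + 1, n, _, S => (Canon.splitFam (n 0) (sumLen m (fun k => n k.succ)) S).comp_left
      (Canon.whiskerLeft _ (Canon.flattenFam m (fun k => n k.succ) (fun i => S (i.addNat (n 0)))))

theorem Canon.shuffleFam : (n : ℕ) → {P Q : Fin n → M} → (S : ∀ i, Shape A (P i)) →
    (T : ∀ i, Shape A (Q i)) → Canon (fun i => 𝟙 (A i)) ((Shape.fam n S).tensor (.fam n T))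
      (.fam n (fun i => (S i).tensor (T i))) (shuffleFam n P Q)
  | 0, _, _, _, _ => Canon.leftUnitor _
  | n + 1, _, _, S, T => (Canon.tensorμ _ _ _ _).comp_left (Canon.whiskerLeft _
      (Canon.shuffleFam n (fun i => S i.succ) (fun i => T i.succ)))

theorem Canon.unitFam : (n : ℕ) → Canon (fun i => 𝟙 (A i)) Shape.unit
    (.fam n (fun _ => Shape.unit)) (unitFam (M := M) n)
  | 0 => Canon.id _
  | n + 1 => (Canon.leftUnitor_inv _).comp_left (Canon.whiskerLeft _ (Canon.unitFam n))

/-! ### Invertibility of the operations on families. -/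

section Isos

instance isIso_tensorFamMap : (n : ℕ) → {P Q : Fin n → M} → (f : ∀ i, P i ⟶ Q i) →
    [∀ i, IsIso (f i)] → IsIso (tensorFamMap n f)
  | 0, _, _, _, _ => inferInstanceAs (IsIso (𝟙 (𝟙_ M)))
  | n + 1, _, _, f, _ => by
    have := isIso_tensorFamMap n (fun i => f i.succ)
    exact inferInstanceAs (IsIso (f 0 ⊗ₘ tensorFamMap n (fun i => f i.succ)))

instance isIso_splitFam : (m n : ℕ) → (W : Fin (n + m) → M) → IsIso (splitFam m n W)
  | 0, _, _ => inferInstanceAs (IsIso (λ_ _).inv)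
  | m + 1, n, W => by
    have := isIso_splitFam m n (fun i => W i.succ)
    exact inferInstanceAs (IsIso (W 0 ◁ splitFam m n (fun i => W i.succ) ≫ (α_ _ _ _).inv))

instance isIso_flattenFam : (m : ℕ) → (n : Fin m → ℕ) → (W : Fin (sumLen m n) → M) →
    IsIso (flattenFam m n W)
  | 0, _, _ => inferInstanceAs (IsIso (𝟙 (𝟙_ M)))
  | m + 1, n, W => by
    have := isIso_flattenFam m (fun k => n k.succ) (fun i => W (i.addNat (n 0)))
    exact IsIso.comp_isIso' (isIso_splitFam _ _ _)
      (whiskerLeft_isIso _ (flattenFam m (fun k => n k.succ) (fun i => W (i.addNat (n 0)))))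

instance isIso_shuffleFam : (n : ℕ) → (P Q : Fin n → M) → IsIso (shuffleFam n P Q)
  | 0, _, _ => inferInstanceAs (IsIso (λ_ (𝟙_ M)).hom)
  | n + 1, P, Q => by
    have := isIso_shuffleFam n (fun i => P i.succ) (fun i => Q i.succ)
    exact IsIso.comp_isIso' (inferInstanceAs (IsIso (_ ≫ _ ≫ _ ≫ _ ≫ _)))
      (whiskerLeft_isIso _ _)

instance isIso_unitFam : (n : ℕ) → IsIso (unitFam n : 𝟙_ M ⟶ _)
  | 0 => inferInstanceAs (IsIso (𝟙 (𝟙_ M)))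
  | n + 1 => by
    have := isIso_unitFam n
    exact inferInstanceAs (IsIso ((λ_ (𝟙_ M)).inv ≫ 𝟙_ M ◁ unitFam n))

end Isos

end CoherenceFam

/-! ### Coherence for lax symmetric monoidal functors. -/

section CoherenceLax

open Functor.LaxMonoidal

variable {M : Type u} [Category.{v} M] [MonoidalCategory M] [SymmetricCategory M] {ι : Type w}
  {A B D : ι → M} (J : M ⥤ M) [J.LaxBraided]

/-- The morphism `f : P ⟶ J Q` is compatible with `n` successive extractions of factors, which are
mapped by `φ`, and with the identification of what remains with the unit. -/
def LaxCanonAux (φ : ∀ i, A i ⟶ J.obj (B i)) : ℕ → {P Q : M} → Shape A P → Shape B Q →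
    (P ⟶ J.obj Q) → Prop
  | 0, _, _, S, T, f => ∃ a ∈ S.units, ∃ b ∈ T.units, f ≫ J.map b.hom = a.hom ≫ ε J
  | n + 1, _, _, S, T, f => ∀ (i : ι), ∀ x ∈ S.pulls i, ∃ y ∈ T.pulls i,
      ∃ f' : x.obj ⟶ J.obj y.obj,
      f ≫ J.map y.iso.hom = x.iso.hom ≫ (φ i ⊗ₘ f') ≫ μ J _ _ ∧ LaxCanonAux φ n x.shape y.shape f'

/-- The morphism `f : P ⟶ J Q` between iterated tensor products permutes the factors, maps them by
`φ`, and combines them through the structure maps of the lax symmetric monoidal functor `J`. -/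
def LaxCanon (φ : ∀ i, A i ⟶ J.obj (B i)) {P Q : M} (S : Shape A P) (T : Shape B Q)
    (f : P ⟶ J.obj Q) : Prop :=
  T.size = S.size ∧ LaxCanonAux J φ S.size S T f

variable {J}

theorem LaxCanonAux.comp_canon {φ : ∀ i, A i ⟶ J.obj (B i)} : (n : ℕ) → {P Q R : M} →
    {S : Shape A P} → {T : Shape B Q} → {U : Shape B R} → {f : P ⟶ J.obj Q} → {g : Q ⟶ R} →
    LaxCanonAux J φ n S T f → CanonAux (fun i => 𝟙 (B i)) n T U g →
    LaxCanonAux J φ n S U (f ≫ J.map g)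
  | 0, _, _, _, _, T, _, f, g, ⟨a, ha, b, hb, hf⟩, ⟨b', hb', c, hc, hg⟩ => by
    obtain rfl := T.units_unique hb hb'
    exact ⟨a, ha, c, hc, by rw [Category.assoc, ← J.map_comp, hg, hf]⟩
  | n + 1, _, _, _, _, _, _, _, _, hf, hg => by
    intro i x hx
    obtain ⟨y, hy, f', h1, h2⟩ := hf i x hx
    obtain ⟨z, hz, g', h3, h4⟩ := hg i y hy
    refine ⟨z, hz, f' ≫ J.map g', ?_, LaxCanonAux.comp_canon n h2 h4⟩
    rw [Category.assoc, ← J.map_comp, h3, J.map_comp, reassoc_of% h1, ← μ_natural,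
      tensorHom_comp_tensorHom_assoc, J.map_id, Category.comp_id]

theorem LaxCanon.comp_canon {φ : ∀ i, A i ⟶ J.obj (B i)} {P Q R : M} {S : Shape A P}
    {T : Shape B Q} {U : Shape B R} {f : P ⟶ J.obj Q} {g : Q ⟶ R} (hf : LaxCanon J φ S T f)
    (hg : Canon (fun i => 𝟙 (B i)) T U g) : LaxCanon J φ S U (f ≫ J.map g) :=
  ⟨hg.1.trans hf.1, LaxCanonAux.comp_canon _ hf.2 (hf.1 ▸ hg.2)⟩

theorem LaxCanonAux.canon_comp {φ : ∀ i, A i ⟶ J.obj (B i)} : (n : ℕ) → {P Q R : M} →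
    {S : Shape A P} → {T : Shape A Q} → {U : Shape B R} → {f : P ⟶ Q} → {g : Q ⟶ J.obj R} →
    CanonAux (fun i => 𝟙 (A i)) n S T f → LaxCanonAux J φ n T U g →
    LaxCanonAux J φ n S U (f ≫ g)
  | 0, _, _, _, _, T, _, f, g, ⟨a, ha, b, hb, hf⟩, ⟨b', hb', c, hc, hg⟩ => by
    obtain rfl := T.units_unique hb hb'
    exact ⟨a, ha, c, hc, by rw [Category.assoc, hg, reassoc_of% hf]⟩
  | n + 1, _, _, _, _, _, _, _, _, hf, hg => by
    intro i x hx
    obtain ⟨y, hy, f', h1, h2⟩ := hf i x hx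
    obtain ⟨z, hz, g', h3, h4⟩ := hg i y hy
    refine ⟨z, hz, f' ≫ g', ?_, LaxCanonAux.canon_comp n h2 h4⟩
    rw [Category.assoc, h3, reassoc_of% h1, tensorHom_comp_tensorHom_assoc, Category.id_comp]

theorem Canon.comp_lax {φ : ∀ i, A i ⟶ J.obj (B i)} {P Q R : M} {S : Shape A P}
    {T : Shape A Q} {U : Shape B R} {f : P ⟶ Q} {g : Q ⟶ J.obj R}
    (hf : Canon (fun i => 𝟙 (A i)) S T f) (hg : LaxCanon J φ T U g) : LaxCanon J φ S U (f ≫ g) :=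
  ⟨hg.1.trans hf.1, LaxCanonAux.canon_comp _ hf.2 (hf.1 ▸ hg.2)⟩

theorem LaxCanonAux.unique {φ : ∀ i, A i ⟶ J.obj (B i)} : (n : ℕ) → {P Q : M} →
    {S : Shape A P} → {T : Shape B Q} → {f g : P ⟶ J.obj Q} → S.size = n → T.Nodup →
    LaxCanonAux J φ n S T f → LaxCanonAux J φ n S T g → f = g
  | 0, _, _, S, T, f, g, _, _, ⟨a, ha, b, hb, hf⟩, ⟨a', ha', b', hb', hg⟩ => by
    obtain rfl := S.units_unique ha ha'
    obtain rfl := T.units_unique hb hb'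
    rw [← cancel_mono (J.map b.hom), hf, hg]
  | n + 1, _, _, S, T, f, g, hn, hT, hf, hg => by
    obtain ⟨i, x, hx⟩ := S.pulls_nonempty (by omega)
    obtain ⟨y, hy, f', h1, h2⟩ := hf i x hx
    obtain ⟨z, hz, g', h3, h4⟩ := hg i x hx
    obtain rfl := hT.pulls_unique hy hz
    have h := S.size_of_mem_pulls hx
    rw [← cancel_mono (J.map y.iso.hom), h1, h3,
      LaxCanonAux.unique n (by omega) (hT.of_mem_pulls hy) h2 h4]

/-- Coherence for lax symmetric monoidal functors. -/
theorem LaxCanon.unique {φ : ∀ i, A i ⟶ J.obj (B i)} {P Q : M} {S : Shape A P} {T : Shape B Q}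
    {f g : P ⟶ J.obj Q} (hf : LaxCanon J φ S T f) (hg : LaxCanon J φ S T g) (hT : T.Nodup) :
    f = g :=
  LaxCanonAux.unique _ rfl hT hf.2 hg.2

/-- Each case uses one axiom of `J`: left unitality when no leaf remains, associativity of `μ` for a
leaf on the left, and compatibility of `μ` with the interchange, hence with the braiding, for a leaf
on the right. -/
theorem LaxCanonAux.tensor {φ : ∀ i, A i ⟶ J.obj (B i)} : (n k l : ℕ) → {P Q P' Q' : M} →
    {S : Shape A P} → {T : Shape A Q} → {S' : Shape B P'} → {T' : Shape B Q'} →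
    {f : P ⟶ J.obj P'} → {g : Q ⟶ J.obj Q'} → k + l = n → S.size = k → T.size = l →
    LaxCanonAux J φ k S S' f → LaxCanonAux J φ l T T' g →
    LaxCanonAux J φ n (S.tensor T) (S'.tensor T') ((f ⊗ₘ g) ≫ μ J _ _)
  | 0, k, l, _, _, _, _, _, _, _, _, _, _, hn, _, _, hf, hg => by
    obtain ⟨rfl, rfl⟩ := Nat.add_eq_zero_iff.1 hn
    obtain ⟨a, ha, b, hb, hf⟩ := hf
    obtain ⟨a', ha', b', hb', hg⟩ := hg
    refine ⟨_, ⟨a, ha, a', ha', rfl⟩, _, ⟨b, hb, b', hb', rfl⟩, ?_⟩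
    simp only [Iso.trans_hom, tensorIso_hom, J.map_comp, Category.assoc]
    rw [← μ_natural_assoc, tensorHom_comp_tensorHom_assoc, hf, hg,
      ← tensorHom_comp_tensorHom_assoc]
    refine congrArg (_ ≫ ·) ?_
    rw [tensorHom_def', Category.assoc, ← left_unitality, leftUnitor_naturality]
  | n + 1, k, l, P, Q, P', Q', S, T, S', T', f, g, hn, hk, hl, hf, hg => by
    rintro i _ (⟨x, hx, rfl⟩ | ⟨x, hx, rfl⟩)
    · have hs := S.size_of_mem_pulls hx
      obtain ⟨k, rfl⟩ : ∃ k', k = k' + 1 := ⟨_, hk.symm.trans hs.symm⟩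
      obtain ⟨y, hy, f', h1, h2⟩ := hf i x hx
      refine ⟨_, Or.inl ⟨y, hy, rfl⟩, (f' ⊗ₘ g) ≫ μ J _ _, ?_,
        LaxCanonAux.tensor n k l (by omega) (by omega) hl h2 hg⟩
      simp only [Extraction.left, Iso.trans_hom, whiskerRightIso_hom, Category.assoc, J.map_comp]
      have h3 : (x.iso.hom ≫ (φ i ⊗ₘ f') ≫ μ J (B i) y.obj) ⊗ₘ g =
          x.iso.hom ▷ Q ≫ ((φ i ⊗ₘ f') ⊗ₘ g) ≫ μ J (B i) y.obj ▷ J.obj Q' := by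
        simp only [← tensorHom_id, tensorHom_comp_tensorHom, Category.id_comp, Category.comp_id]
      rw [← μ_natural_left_assoc, ← tensorHom_id, tensorHom_comp_tensorHom_assoc, h1,
        Category.comp_id, h3, Category.assoc, Category.assoc, associativity,
        associator_naturality_assoc, ← id_tensorHom, tensorHom_comp_tensorHom_assoc,
        Category.comp_id]
    · have hs := T.size_of_mem_pulls hx
      obtain ⟨l, rfl⟩ : ∃ k', l = k' + 1 := ⟨_, hl.symm.trans hs.symm⟩
      obtain ⟨y, hy, f', h1, h2⟩ := hg i x hx
      refine ⟨_, Or.inr ⟨y, hy, rfl⟩, (f ⊗ₘ f') ≫ μ J _ _, ?_,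
        LaxCanonAux.tensor n k l (by omega) hk (by omega) hf h2⟩
      simp only [Extraction.right, Iso.trans_hom, whiskerLeftIso_hom, Category.assoc, J.map_comp,
        interchangeIso_hom]
      have h3 : f ⊗ₘ (x.iso.hom ≫ (φ i ⊗ₘ f') ≫ μ J (B i) y.obj) =
          P ◁ x.iso.hom ≫ (f ⊗ₘ (φ i ⊗ₘ f')) ≫ J.obj P' ◁ μ J (B i) y.obj := by
        simp only [← id_tensorHom, tensorHom_comp_tensorHom, Category.id_comp, Category.comp_id]
      rw [← μ_natural_right_assoc, ← id_tensorHom, tensorHom_comp_tensorHom_assoc, h1,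
        Category.comp_id, h3, Category.assoc, Category.assoc, interchange_lax,
        reassoc_of% interchange_natural f (φ i) f', ← id_tensorHom (J.obj (B i)),
        tensorHom_comp_tensorHom_assoc, Category.comp_id]

theorem LaxCanon.tensor {φ : ∀ i, A i ⟶ J.obj (B i)} {P Q P' Q' : M} {S : Shape A P}
    {T : Shape A Q} {S' : Shape B P'} {T' : Shape B Q'} {f : P ⟶ J.obj P'} {g : Q ⟶ J.obj Q'}
    (hf : LaxCanon J φ S S' f) (hg : LaxCanon J φ T T' g) :
    LaxCanon J φ (S.tensor T) (S'.tensor T') ((f ⊗ₘ g) ≫ μ J _ _) :=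
  ⟨congrArg₂ (· + ·) hf.1 hg.1, LaxCanonAux.tensor _ _ _ rfl rfl rfl hf.2 hg.2⟩

/-- After the leaf is extracted the unit remains on both sides, and the remaining morphism is `ε`.
The square is then right unitality. -/
theorem LaxCanon.leaf {φ : ∀ i, A i ⟶ J.obj (B i)} {i : ι} {P Q : M} {e : P ≅ A i} {e' : Q ≅ B i}
    {f : P ⟶ J.obj Q} (h : f ≫ J.map e'.hom = e.hom ≫ φ i) :
    LaxCanon J φ (.leaf i e) (.leaf i e') f := by
  refine ⟨rfl, ?_⟩
  rintro j _ ⟨rfl, rfl⟩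
  refine ⟨_, ⟨rfl, rfl⟩, ε J, ?_, ⟨_, rfl, _, rfl, by simp⟩⟩
  simp only [Extraction.ofLeaf, Iso.trans_hom, J.map_comp, reassoc_of% h, eqToIso_refl,
    Iso.refl_hom, Iso.symm_hom, Category.id_comp, J.map_id, Category.assoc]
  rw [← right_unitality_inv, MonoidalCategory.tensorHom_def, Category.assoc,
    rightUnitor_inv_naturality_assoc]

theorem LaxCanon.laxFam {φ : ∀ i, A i ⟶ J.obj (B i)} : (n : ℕ) → {P : Fin n → M} →
    {Q : Fin n → M} →
    {S : ∀ i, Shape A (P i)} → {T : ∀ i, Shape B (Q i)} → {f : ∀ i, P i ⟶ J.obj (Q i)} →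
    (∀ i, LaxCanon J φ (S i) (T i) (f i)) →
    LaxCanon J φ (.fam n S) (.fam n T) (tensorFamMap n f ≫ laxFam J n Q)
  | 0, _, _, _, _, _, _ => ⟨rfl, ⟨_, rfl, _, rfl, by simp [tensorFamMap, CircleSeq.laxFam]⟩⟩
  | n + 1, P, Q, S, T, f, h => by
    have := (h 0).tensor (LaxCanon.laxFam n (fun i => h i.succ))
    simp only [tensorFamMap, CircleSeq.laxFam]
    rw [← id_tensorHom, tensorHom_comp_tensorHom_assoc, Category.comp_id]
    exact this

end CoherenceLax

/-! ### Presentations of objects by generators and relations, and their tensor products. -/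

section Presentations

variable {M : Type u} [Category.{v} M]

/-- The object `P` is the colimit of the objects `A s` along the morphisms that satisfy the
relation `R`. -/
structure IsPresentation {S : Type w} {A : S → M} {P : M} (ι : ∀ s, A s ⟶ P)
    (R : ∀ ⦃s s' : S⦄, (A s ⟶ A s') → Prop) : Prop where
  w : ∀ ⦃s s' : S⦄ ⦃u : A s ⟶ A s'⦄, R u → u ≫ ι s' = ι s
  hom_ext : ∀ {Z : M} {f g : P ⟶ Z}, (∀ s, ι s ≫ f = ι s ≫ g) → f = g
  exists_desc : ∀ {Z : M} (f : ∀ s, A s ⟶ Z),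
    (∀ ⦃s s' : S⦄ ⦃u : A s ⟶ A s'⦄, R u → u ≫ f s' = f s) → ∃ g : P ⟶ Z, ∀ s, ι s ≫ g = f s

variable [MonoidalCategory M]

section

variable [SymmetricCategory M] [MonoidalClosed M]

/-- The internal hom is adjoint to tensoring on the left. The braiding turns this into transposition
for tensoring on the right. -/
theorem exists_uncurry_right {P Q Z : M} (g : P ⟶ (ihom Q).obj Z) : ∃ h : P ⊗ Q ⟶ Z,
    ∀ {X : M} (x : X ⟶ P) (k : X ⊗ Q ⟶ Z),
      MonoidalClosed.curry ((β_ Q X).hom ≫ k) = x ≫ g → x ▷ Q ≫ h = k := by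
  refine ⟨(β_ P Q).hom ≫ MonoidalClosed.uncurry g, fun x k h => ?_⟩
  have h2 := congrArg MonoidalClosed.uncurry h
  rw [MonoidalClosed.uncurry_curry, MonoidalClosed.uncurry_natural_left] at h2
  rw [BraidedCategory.braiding_naturality_left_assoc, ← h2, SymmetricCategory.symmetry_assoc]

/-- Tensoring with `Q` is a left adjoint and preserves colimits: morphisms out of `P ⊗ Q` are
transposed to morphisms out of `P`, where the given presentation applies. -/
theorem IsPresentation.whiskerRight {S : Type w} {A : S → M} {P : M} {ι : ∀ s, A s ⟶ P}
    {R : ∀ ⦃s s' : S⦄, (A s ⟶ A s') → Prop} (h : IsPresentation ι R) (Q : M) :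
    IsPresentation (A := fun s => A s ⊗ Q) (fun s => ι s ▷ Q)
      (fun s s' u => ∃ k : A s ⟶ A s', R k ∧ u = k ▷ Q) where
  w := by
    rintro s s' _ ⟨k, hk, rfl⟩
    rw [← comp_whiskerRight, h.w hk]
  hom_ext {Z f g} hfg := by
    rw [← cancel_epi (β_ Q P).hom]
    apply MonoidalClosed.curry_injective
    refine h.hom_ext (fun s => ?_)
    rw [← MonoidalClosed.curry_natural_left, ← MonoidalClosed.curry_natural_left,
      BraidedCategory.braiding_naturality_right_assoc,
      BraidedCategory.braiding_naturality_right_assoc, hfg]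
  exists_desc {Z} f hf := by
    obtain ⟨g, hg⟩ := h.exists_desc (fun s => MonoidalClosed.curry ((β_ Q (A s)).hom ≫ f s))
      (fun s s' u hu => by
        rw [← MonoidalClosed.curry_natural_left, BraidedCategory.braiding_naturality_right_assoc,
          hf ⟨u, hu, rfl⟩])
    obtain ⟨k, hk⟩ := exists_uncurry_right g
    exact ⟨k, fun s => hk _ _ (hg s).symm⟩

theorem IsPresentation.whiskerLeft {S : Type w} {A : S → M} {P : M} {ι : ∀ s, A s ⟶ P}
    {R : ∀ ⦃s s' : S⦄, (A s ⟶ A s') → Prop} (h : IsPresentation ι R) (Q : M) :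
    IsPresentation (A := fun s => Q ⊗ A s) (fun s => Q ◁ ι s)
      (fun s s' u => ∃ k : A s ⟶ A s', R k ∧ u = Q ◁ k) where
  w := by
    rintro s s' _ ⟨k, hk, rfl⟩
    rw [← MonoidalCategory.whiskerLeft_comp, h.w hk]
  hom_ext {Z f g} hfg := by
    rw [← cancel_epi (β_ P Q).hom]
    refine (h.whiskerRight Q).hom_ext (fun s => ?_)
    rw [BraidedCategory.braiding_naturality_left_assoc,
      BraidedCategory.braiding_naturality_left_assoc, hfg]
  exists_desc {Z} f hf := by
    obtain ⟨g, hg⟩ := (h.whiskerRight Q).exists_desc (fun s => (β_ (A s) Q).hom ≫ f s)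
      (by
        rintro s s' _ ⟨k, hk, rfl⟩
        rw [BraidedCategory.braiding_naturality_left_assoc, hf ⟨k, hk, rfl⟩])
    refine ⟨(β_ Q P).hom ≫ g, fun s => ?_⟩
    rw [BraidedCategory.braiding_naturality_right_assoc, hg, SymmetricCategory.symmetry_assoc]

/-- Descent is done in one variable at a time. The relations with an identity in the other variable
are all that this uses, which is why identities have to be relations. -/
theorem IsPresentation.tensor {S : Type w} {A : S → M} {P : M} {ι : ∀ s, A s ⟶ P}
    {R : ∀ ⦃s s' : S⦄, (A s ⟶ A s') → Prop} (h : IsPresentation ι R) (hR : ∀ s, R (𝟙 (A s)))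
    {S' : Type w'} {A' : S' → M} {P' : M} {ι' : ∀ s, A' s ⟶ P'}
    {R' : ∀ ⦃s s' : S'⦄, (A' s ⟶ A' s') → Prop} (h' : IsPresentation ι' R')
    (hR' : ∀ s, R' (𝟙 (A' s))) :
    IsPresentation (A := fun s : S × S' => A s.1 ⊗ A' s.2) (fun s => ι s.1 ⊗ₘ ι' s.2)
      (fun s s' u => ∃ (k : A s.1 ⟶ A s'.1) (k' : A' s.2 ⟶ A' s'.2), R k ∧ R' k' ∧
        u = k ⊗ₘ k') where
  w := by
    rintro s s' _ ⟨k, k', hk, hk', rfl⟩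
    rw [tensorHom_comp_tensorHom, h.w hk, h'.w hk']
  hom_ext {Z f g} hfg := by
    refine (h.whiskerRight P').hom_ext (fun s => (h'.whiskerLeft (A s)).hom_ext (fun s' => ?_))
    have := hfg (s, s')
    rw [tensorHom_def', Category.assoc, Category.assoc] at this
    exact this
  exists_desc {Z} f hf := by
    have h1 : ∀ s, ∃ g : A s ⊗ P' ⟶ Z, ∀ s', A s ◁ ι' s' ≫ g = f (s, s') := fun s =>
      (h'.whiskerLeft (A s)).exists_desc (fun s' => f (s, s')) (by
        rintro s₁ s₂ _ ⟨k, hk, rfl⟩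
        exact hf (s := (s, s₁)) (s' := (s, s₂)) ⟨𝟙 _, k, hR s, hk, (id_tensorHom _ _).symm⟩)
    choose g hg using h1
    obtain ⟨k, hk⟩ := (h.whiskerRight P').exists_desc g (by
      rintro s₁ s₂ _ ⟨k, hk, rfl⟩
      refine (h'.whiskerLeft (A s₁)).hom_ext (fun s' => ?_)
      rw [whisker_exchange_assoc, hg, hg]
      exact hf (s := (s₁, s')) (s' := (s₂, s')) ⟨k, 𝟙 _, hk, hR' s', (tensorHom_id _ _).symm⟩)
    refine ⟨k, fun s => ?_⟩
    rw [tensorHom_def', Category.assoc, hk, hg]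

/-- The tensor product of a family of presented objects is presented. -/
theorem IsPresentation.tensorFam : (n : ℕ) → {S : Fin n → Type w} → {A : ∀ k, S k → M} →
    {P : Fin n → M} → {ι : ∀ k s, A k s ⟶ P k} →
    {R : ∀ k, ∀ ⦃s s' : S k⦄, (A k s ⟶ A k s') → Prop} →
    (∀ k, IsPresentation (ι k) (R k)) → (∀ k s, R k (𝟙 (A k s))) →
    IsPresentation (S := ∀ k, S k) (A := fun s => tensorFam n (fun k => A k (s k)))
      (fun s => tensorFamMap n (fun k => ι k (s k)))
      (fun s s' u => ∃ k : ∀ i, A i (s i) ⟶ A i (s' i), (∀ i, R i (k i)) ∧ u = tensorFamMap n k)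
  | 0, S, A, P, ι, R, _, _ =>
    { w := by
        rintro s s' _ ⟨k, hk, rfl⟩
        exact Category.comp_id _
      hom_ext := fun {Z f g} hfg => by
        have := hfg (fun k => k.elim0)
        exact (Category.id_comp _).symm.trans (this.trans (Category.id_comp _))
      exists_desc := fun {Z} f hf => by
        refine ⟨f (fun k => k.elim0), fun s => ?_⟩
        obtain rfl : s = (fun k => k.elim0) := funext fun k => k.elim0
        exact Category.id_comp _ }
  | n + 1, S, A, P, ι, R, h, hR => by
    have H := (h 0).tensor (hR 0) (IsPresentation.tensorFam n (fun k => h k.succ)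
      (fun k => hR k.succ)) (fun s => ⟨_, fun i => hR _ _, (tensorFamMap_id _ _).symm⟩)
    refine ⟨?_, fun {Z f g} hfg => ?_, fun {Z} f hf => ?_⟩
    · rintro s s' _ ⟨k, hk, rfl⟩
      rw [tensorFamMap_comp]
      exact congrArg _ (funext fun i => (h i).w (hk i))
    · exact H.hom_ext (fun s => hfg (Fin.cons (α := S) s.1 s.2))
    · obtain ⟨g, hg⟩ := H.exists_desc (fun s => f (Fin.cons (α := S) s.1 s.2)) (by
        rintro ⟨s, s₂⟩ ⟨s', s₂'⟩ _ ⟨k, _, hk, ⟨k', hk', rfl⟩, rfl⟩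
        refine hf (s := Fin.cons (α := S) s s₂) (s' := Fin.cons (α := S) s' s₂')
          ⟨Fin.cases k k', Fin.cases hk hk', rfl⟩)
      refine ⟨g, fun s => ?_⟩
      obtain ⟨s₁, s₂, rfl⟩ : ∃ s₁ s₂, s = Fin.cons (α := S) s₁ s₂ :=
        ⟨s 0, fun i => s i.succ, (Fin.cons_self_tail s).symm⟩
      exact hg (s₁, s₂)

end

end Presentations

/-! ### Naturality of the summands of the circle product in both coend variables. -/

section CircleNatural

open Profile

variable {C : Type v} {M : Type u} [Category.{v} M] [MonoidalCategory M] [SymmetricCategory M]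

/-- The action of a permutation of the blocks and of morphisms of the blocks on
`Y(a₁; b₁) ⊗ ⋯ ⊗ Y(aₘ; bₘ)`. -/
def famMap (Y : SymSeq C M) {a a' : Profile C} (p : a ⟶ a') {b : Fin a.len → Profile C}
    {b' : Fin a'.len → Profile C} (β : ∀ i, b (p.perm i) ⟶ b' i) :
    valFam Y a b ⟶ valFam Y a' b' :=
  reindex a'.len a.len p.perm (fun i => Y.act (p.col_perm i) (β i))

theorem famMap_comp (Y : SymSeq C M) {a a' a'' : Profile C} (p : a ⟶ a') (p' : a' ⟶ a'')
    {b : Fin a.len → Profile C} {b' : Fin a'.len → Profile C} {b'' : Fin a''.len → Profile C}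
    (β : ∀ i, b (p.perm i) ⟶ b' i) (β' : ∀ i, b' (p'.perm i) ⟶ b'' i) :
    famMap Y p β ≫ famMap Y p' β' = famMap Y (p ≫ p') (fun i => β (p'.perm i) ≫ β' i) :=
  (reindex_reindex _ _ _ _ _ _ _).trans
    (congrArg (reindex a''.len a.len (p ≫ p').perm) (funext fun i => Y.act_comp _ _ _ _))

theorem famMap_id_left (Y : SymSeq C M) {a : Profile C} {b b' : Fin a.len → Profile C}
    (β : b ⟶ b') : famMap Y (𝟙 a) β = valFamMap Y a β :=
  reindex_refl _ _

theorem famMap_id (Y : SymSeq C M) (a : Profile C) (b : Fin a.len → Profile C) :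
    famMap Y (𝟙 a) (fun i => 𝟙 (b i)) = 𝟙 (valFam Y a b) :=
  (famMap_id_left Y (𝟙 b)).trans (valFamMap_id Y a b)

theorem valFamPerm_eq_famMap (Y : SymSeq C M) {a a' : Profile C} (f : a' ⟶ a)
    (b : Fin a.len → Profile C) : valFamPerm (𝟙 Y) f b =
      famMap Y (Groupoid.inv f) (b' := fun j => b (f.perm.symm j))
        (fun j => 𝟙 (b (f.perm.symm j))) :=
  congrArg (reindex a'.len a.len f.perm.symm) (funext fun _ => Category.comp_id _)

variable [HasColimits M]

/-- The insertions into the circle product are natural. -/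
theorem circleι_natural (X Y : SymSeq C M) {t t' : C} (ht : t = t') {c a a' : Profile C}
    (p : a ⟶ a')
    {b : Fin a.len → Profile C} {b' : Fin a'.len → Profile C} (β : ∀ i, b (p.perm i) ⟶ b' i)
    (g : concat b' ⟶ c) :
    (X.act ht p ⊗ₘ famMap Y p β) ≫ circleι X Y t' c a' b' g =
      circleι X Y t c a b (concatMap p.perm β ≫ g) ≫ (circle X Y).act ht (𝟙 c) := by
  subst ht
  have h0 : (circle X Y).act (rfl : t = t) (𝟙 c) = 𝟙 _ := SymSeq.act_id _ _ _
  rw [h0]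
  refine Eq.trans ?_ (Category.comp_id _).symm
  -- The outer coend relation is taken at the inverse of `p`. After precomposition with the action
  -- of `p` the two actions on `X` cancel (`h6`), and `β` is split off through the inner coend
  -- relation (`h4`, `h5`).
  have h1 := circleι_condition_outer X Y t c (Groupoid.inv p) b
    (concatMap p.perm (fun i => 𝟙 (b (p.perm i))) ≫
      blockHom (b := fun i => b (p.perm i)) β ≫ g)
  have h2 : blockPerm (Groupoid.inv p) b ≫ (concatMap p.perm (fun i => 𝟙 (b (p.perm i))) ≫
      blockHom (b := fun i => b (p.perm i)) β ≫ g) =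
      blockHom (b := fun i => b (p.perm i)) β ≫ g := by
    refine (Category.assoc _ _ _).symm.trans ((congrArg (· ≫ _) ?_).trans (Category.id_comp _))
    exact Groupoid.inv_comp _
  have h3 : concatMap p.perm (fun i => 𝟙 (b (p.perm i))) ≫
      blockHom (b := fun i => b (p.perm i)) β ≫ g = concatMap p.perm β ≫ g := by
    rw [← Category.assoc]
    refine congrArg (· ≫ g) ((concatMap_comp _ _ _ _).trans ?_)
    exact congrArg (concatMap p.perm) (funext fun i => Category.id_comp _)
  have h4 := circleι_condition_inner X Y t c a' (b := fun i => b (p.perm i)) (b' := b') β g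
  have h5 : famMap Y p β = famMap Y p (b' := fun i => b (p.perm i)) (fun i => 𝟙 (b (p.perm i))) ≫
      valFamMap Y a' (b := fun i => b (p.perm i)) (b' := b') β := by
    refine Eq.trans ?_ (congrArg (_ ≫ ·) (famMap_id_left Y (b := fun i => b (p.perm i)) β))
    refine Eq.trans ?_ (famMap_comp Y p (𝟙 a') (b' := fun i => b (p.perm i))
      (fun i => 𝟙 (b (p.perm i))) β).symm
    exact congrArg (famMap Y p) (funext fun i => (Category.id_comp _).symm)
  have h6 : X.act (rfl : t = t) p ≫ X.act rfl (Groupoid.inv p) = 𝟙 _ := by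
    rw [SymSeq.act_comp, Groupoid.comp_inv, SymSeq.act_id]
  rw [h3] at h1 h2
  have h7 := congrArg (X.act (rfl : t = t) p ▷ valFam Y a b ≫ ·) h1
  simp only [← comp_whiskerRight_assoc] at h7
  rw [h6, id_whiskerRight, Category.id_comp] at h7
  rw [← h7, h5, MonoidalCategory.tensorHom_def, MonoidalCategory.whiskerLeft_comp,
    Category.assoc, Category.assoc, ← h4]
  refine congrArg (_ ≫ ·) ?_
  rw [valFamPerm_eq_famMap]
  exact congrArg (fun z => X.val t a' ◁ famMap Y p (b' := fun i => b (p.perm i))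
    (fun i => 𝟙 (b (p.perm i))) ≫ circleι X Y t c a' (fun i => b (p.perm i)) z) h2.symm

theorem circleι_natural' (X Y : SymSeq C M) (t : C) {c a a' : Profile C}
    (p : a ⟶ a')
    {b : Fin a.len → Profile C} {b' : Fin a'.len → Profile C} (β : ∀ i, b (p.perm i) ⟶ b' i)
    (g : concat b' ⟶ c) :
    (X.act (rfl : t = t) p ⊗ₘ famMap Y p β) ≫ circleι X Y t c a' b' g =
      circleι X Y t c a b (concatMap p.perm β ≫ g) :=
  (circleι_natural X Y rfl p β g).trans
    ((congrArg (circleι X Y t c a b (concatMap p.perm β ≫ g) ≫ ·)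
      (SymSeq.act_id (circle X Y) t c)).trans (Category.comp_id _))

theorem circleι_act (X Y : SymSeq C M) (t : C) {c c' a : Profile C}
    (b : Fin a.len → Profile C) (g : concat b ⟶ c) (h : c ⟶ c') :
    circleι X Y t c a b g ≫ (circle X Y).act rfl h = circleι X Y t c' a b (g ≫ h) := by
  refine (circleι_map (𝟙 X) (𝟙 Y) rfl h a b g).trans ?_
  simp only [SymSeq.act_id, SymSeq.id_app, tensorFamMap_id, Category.comp_id, id_tensorHom_id,
    Category.id_comp]

theorem circleι_app {X X' Y Y' : SymSeq C M} (x : X ⟶ X') (y : Y ⟶ Y') (t : C) {c a : Profile C}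
    (b : Fin a.len → Profile C) (g : concat b ⟶ c) :
    circleι X Y t c a b g ≫ SymSeq.app (circleHom x y) t c =
      (SymSeq.app x t a ⊗ₘ tensorFamMap a.len (fun i => SymSeq.app y (a.col i) (b i))) ≫
        circleι X' Y' t c a b g := by
  refine (circleι_map x y rfl (𝟙 c) a b g).trans ?_
  simp only [SymSeq.act_id, Category.comp_id, Category.id_comp]

/-- The values of the circle product are presented by their summands. -/
theorem isPresentation_circleι (X Y : SymSeq C M) (t : C) (c : Profile C) :
    IsPresentation (S := Σ (a : Profile C) (b : Fin a.len → Profile C), (concat b ⟶ c))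
      (A := fun s => X.val t s.1 ⊗ valFam Y s.1 s.2.1)
      (fun s => circleι X Y t c s.1 s.2.1 s.2.2)
      (fun s s' u => ∃ (p : s.1 ⟶ s'.1) (β : ∀ i, s.2.1 (p.perm i) ⟶ s'.2.1 i),
        concatMap p.perm β ≫ s'.2.2 = s.2.2 ∧ u = X.act rfl p ⊗ₘ famMap Y p β) where
  w := by
    rintro ⟨a, b, g⟩ ⟨a', b', g'⟩ _ ⟨p, β, h, rfl⟩
    exact (circleι_natural' X Y t p β g').trans (congrArg (circleι X Y t c a b) h)
  hom_ext h := circleVal_hom_ext (fun a b g => h ⟨a, b, g⟩)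
  exists_desc {Z} f hf := by
    refine ⟨circleDesc (fun a b g => f ⟨a, b, g⟩) (fun a b b' β g => ?_) (fun a a' p b g => ?_),
      fun s => circleι_desc _ _ _ _ _ _⟩
    · refine (hf (s := ⟨a, b, blockHom β ≫ g⟩) (s' := ⟨a, b', g⟩) ⟨𝟙 a, β, rfl, rfl⟩).symm.trans ?_
      rw [famMap_id_left, SymSeq.act_id, id_tensorHom]
    -- The outer coend relation for `p` is the given relation for the inverse of `p`, with the
    -- entries of `b` permuted; `blockPerm` is by definition the inverse of the block permutation
    -- that occurs there.
    · have h1 := hf (s := ⟨a, b, g⟩) (s' := ⟨a', fun j => b (p.perm.symm j), blockPerm p b ≫ g⟩)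
        ⟨Groupoid.inv p, fun j => 𝟙 (b (p.perm.symm j)), by
          rw [← Category.assoc]
          refine (congrArg (· ≫ g) ?_).trans (Category.id_comp _)
          exact Groupoid.comp_inv _, rfl⟩
      have h6 : X.act (rfl : t = t) p ≫ X.act rfl (Groupoid.inv p) = 𝟙 _ := by
        rw [SymSeq.act_comp, Groupoid.comp_inv, SymSeq.act_id]
      rw [← h1, MonoidalCategory.tensorHom_def, Category.assoc, ← comp_whiskerRight_assoc, h6,
        id_whiskerRight, Category.id_comp, valFamPerm_eq_famMap]

end CircleNatural

open Profile

/-! ### Permutations of the entries of iterated concatenations. -/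

section Combinatorics

variable {C : Type v}

/-- A dependent family can be prescribed along a bijection. -/
theorem exists_family_comp_equiv {α β : Type*} (σ : α ≃ β) {F : β → Type*} (f : ∀ i, F (σ i)) :
    ∃ g : ∀ j, F j, ∀ i, g (σ i) = f i :=
  ⟨Equiv.piCongrLeft F σ f, fun i => Equiv.piCongrLeft_apply_apply F σ f i⟩

namespace Profile

theorem comp_perm {a b c : Profile C} (f : a ⟶ b) (g : b ⟶ c) (i : Fin c.len) :
    (f ≫ g).perm i = f.perm (g.perm i) := rfl

theorem hom_ext_pos {m : ℕ} {b : Fin m → Profile C} {c : Profile C} {f g : c ⟶ concat b}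
    (h : ∀ k l, f.perm (pos b ⟨k, l⟩) = g.perm (pos b ⟨k, l⟩)) : f = g := by
  ext1
  ext1 p
  obtain ⟨⟨k, l⟩, rfl⟩ := (pos b).surjective p
  exact h k l

/-- Positions of blocks are often equal only after a computation, and this comparison shows that the
resulting transports of blocks do not move any entry. -/
theorem pos_eqToHom {m : ℕ} (b : Fin m → Profile C) {x y : Fin m} (h : x = y)
    (i : Fin (b y).len) :
    pos b ⟨x, (eqToHom (congrArg b h) : b x ⟶ b y).perm i⟩ = pos b ⟨y, i⟩ := by
  subst h
  rfl

theorem blockHom_perm_pos {m : ℕ} {b b' : Fin m → Profile C} (β : b ⟶ b') (k : Fin m)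
    (l : Fin (b' k).len) : (blockHom β).perm (pos b' ⟨k, l⟩) = pos b ⟨k, (β k).perm l⟩ :=
  concatMap_perm_pos _ _ _ _

theorem concatConcat_perm_pos {m : ℕ} (d : Fin m → Profile C)
    (b : Fin (concat d).len → Profile C) (k : Fin m) (l : Fin (d k).len)
    (i : Fin (b (pos d ⟨k, l⟩)).len) :
    (concatConcat d b).perm (pos (fun k => concat (fun l => b (pos d ⟨k, l⟩)))
      ⟨k, pos (fun l => b (pos d ⟨k, l⟩)) ⟨l, i⟩⟩) = pos b ⟨pos d ⟨k, l⟩, i⟩ := by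
  simp only [concatConcat, Equiv.trans_apply, Equiv.symm_apply_apply]
  have h : Equiv.sigmaCongrRight
      (fun x => (pos (fun l => b (pos d ⟨x, l⟩))).symm) ⟨k, pos _ ⟨l, i⟩⟩ = ⟨k, ⟨l, i⟩⟩ :=
    congrArg (Sigma.mk k) (Equiv.symm_apply_apply _ _)
  rw [h]
  rfl

/-- The associativity of concatenation, followed by morphisms of the blocks. -/
noncomputable def concatAssoc {m : ℕ} {d : Fin m → Profile C}
    {b : Fin (concat d).len → Profile C} {c : ∀ k, Fin (d k).len → Profile C}
    (ζ : ∀ k l, b (pos d ⟨k, l⟩) ⟶ c k l) : concat b ⟶ concat (fun k => concat (c k)) :=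
  concatConcat d b ≫ blockHom (b := fun k => concat (fun l => b (pos d ⟨k, l⟩)))
    (b' := fun k => concat (c k))
    (fun k => blockHom (b := fun l => b (pos d ⟨k, l⟩)) (b' := c k) (ζ k))

theorem concatAssoc_perm_pos {m : ℕ} {d : Fin m → Profile C}
    {b : Fin (concat d).len → Profile C} {c : ∀ k, Fin (d k).len → Profile C}
    (ζ : ∀ k l, b (pos d ⟨k, l⟩) ⟶ c k l) (k : Fin m) (l : Fin (d k).len) (i : Fin (c k l).len) :
    (concatAssoc ζ).perm (pos (fun k => concat (c k)) ⟨k, pos (c k) ⟨l, i⟩⟩) =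
      pos b ⟨pos d ⟨k, l⟩, (ζ k l).perm i⟩ := by
  rw [concatAssoc, comp_perm, blockHom_perm_pos, blockHom_perm_pos, concatConcat_perm_pos]

theorem concatAssoc_id {m : ℕ} (d : Fin m → Profile C) (b : Fin (concat d).len → Profile C) :
    concatAssoc (fun k l => 𝟙 (b (pos d ⟨k, l⟩))) = concatConcat d b := by
  have h : ∀ k, blockHom (b := fun l => b (pos d ⟨k, l⟩)) (b' := fun l => b (pos d ⟨k, l⟩))
      (fun l => 𝟙 (b (pos d ⟨k, l⟩))) = 𝟙 _ := fun k => blockHom_id _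
  refine (congrArg (concatConcat d b ≫ ·) ?_).trans (Category.comp_id _)
  exact (congrArg (blockHom (b := fun k => concat (fun l => b (pos d ⟨k, l⟩)))
    (b' := fun k => concat (fun l => b (pos d ⟨k, l⟩)))) (funext h)).trans (blockHom_id _)

theorem hom_ext_pos_pos {m : ℕ} {d : Fin m → Profile C} {c : ∀ k, Fin (d k).len → Profile C}
    {x : Profile C} {f g : x ⟶ concat (fun k => concat (c k))}
    (h : ∀ k l i, f.perm (pos (fun k => concat (c k)) ⟨k, pos (c k) ⟨l, i⟩⟩) =
      g.perm (pos (fun k => concat (c k)) ⟨k, pos (c k) ⟨l, i⟩⟩)) : f = g := by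
  refine hom_ext_pos (fun k j => ?_)
  obtain ⟨⟨l, i⟩, rfl⟩ := (pos (c k)).surjective j
  exact h k l i

/-- Both sides are permutations, so it is enough to follow the entry `i` of the block `(k, l)`. The
hypothesis contains a transport because the block permutation maps the position `(k, l)` of `d'` to
a position of `d` that is only computed by `concatMap_perm_pos`. -/
theorem concatAssoc_natural {m m' : ℕ} (σ : Fin m' ≃ Fin m) {d : Fin m → Profile C}
    {d' : Fin m' → Profile C}
    (δ : ∀ k, d (σ k) ⟶ d' k) {b : Fin (concat d).len → Profile C}
    {b' : Fin (concat d').len → Profile C} (β : ∀ j, b ((concatMap σ δ).perm j) ⟶ b' j)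
    {c : ∀ k, Fin (d k).len → Profile C} {c' : ∀ k, Fin (d' k).len → Profile C}
    (ζ : ∀ k l, b (pos d ⟨k, l⟩) ⟶ c k l) (ζ' : ∀ k l, b' (pos d' ⟨k, l⟩) ⟶ c' k l)
    (γ : ∀ k l, c (σ k) ((δ k).perm l) ⟶ c' k l)
    (h : ∀ k l, β (pos d' ⟨k, l⟩) ≫ ζ' k l =
      eqToHom (congrArg b (concatMap_perm_pos σ δ k l)) ≫ ζ _ _ ≫ γ k l) :
    concatMap (concatMap σ δ).perm β ≫ concatAssoc ζ' =
      concatAssoc ζ ≫ concatMap σ (fun k => concatMap (δ k).perm (γ k)) := by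
  refine hom_ext_pos_pos (fun k l i => ?_)
  have h1 := congrArg (concatMap (concatMap σ δ).perm β).perm (concatAssoc_perm_pos ζ' k l i)
  have h2 := concatMap_perm_pos (concatMap σ δ).perm β (pos d' ⟨k, l⟩) ((ζ' k l).perm i)
  have h3 := congrArg (concatAssoc ζ).perm ((concatMap_perm_pos σ
    (fun k => concatMap (δ k).perm (γ k)) k (pos (c' k) ⟨l, i⟩)).trans
      (congrArg (fun x => pos (fun k => concat (c k)) ⟨σ k, x⟩)
        (concatMap_perm_pos (δ k).perm (γ k) l i)))
  have h4 := concatAssoc_perm_pos ζ (σ k) ((δ k).perm l) ((γ k l).perm i)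
  refine (h1.trans h2).trans (Eq.trans ?_ (h3.trans h4).symm)
  have h5 : (β (pos d' ⟨k, l⟩)).perm ((ζ' k l).perm i) =
      (eqToHom (congrArg b (concatMap_perm_pos σ δ k l))).perm
        ((ζ (σ k) ((δ k).perm l)).perm ((γ k l).perm i)) :=
    congrArg (fun f : b ((concatMap σ δ).perm (pos d' ⟨k, l⟩)) ⟶ c' k l => f.perm i) (h k l)
  exact (congrArg (fun x => pos b ⟨(concatMap σ δ).perm (pos d' ⟨k, l⟩), x⟩) h5).trans
    (pos_eqToHom b (concatMap_perm_pos σ δ k l) _)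

end Profile

end Combinatorics

/-! ### Distribution of the factors over the blocks of a concatenation. -/

section Distribute

variable {C : Type v} {M : Type u} [Category.{v} M] [MonoidalCategory M] [SymmetricCategory M]

/-- The action of a morphism of profiles is an isomorphism. -/
def SymSeq.actIso (X : SymSeq C M) {t t' : C} (h : t = t') {c c' : Profile C}
    (f : c ⟶ c') : X.val t c ≅ X.val t' c' where
  hom := X.act h f
  inv := X.act h.symm (Groupoid.inv f)
  hom_inv_id := by rw [SymSeq.act_comp, Groupoid.comp_inv, SymSeq.act_id]
  inv_hom_id := by rw [SymSeq.act_comp, Groupoid.inv_comp, SymSeq.act_id]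

instance (X : SymSeq C M) {t t' : C} (h : t = t') {c c' : Profile C} (f : c ⟶ c') :
    IsIso (X.act h f) := (X.actIso h f).isIso_hom

/-- Transports between values of `X` become actions, and can then be merged with neighbouring
actions by `SymSeq.act_comp`. -/
theorem SymSeq.eqToHom_eq_act (X : SymSeq C M) {ι : Type*} (t : ι → C) (c : ι → Profile C)
    {i j : ι} (h : i = j) :
    eqToHom (congrArg (fun i => X.val (t i) (c i)) h) =
      X.act (congrArg t h) (eqToHom (congrArg c h)) := by
  subst h
  exact (X.act_id _ _).symm

theorem Canon.eqToHom_family {κ : Type*} {ι : Type*} {A : ι → M} {P : κ → M}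
    (S : ∀ i, Shape A (P i)) {i j : κ} (h : i = j) :
    Canon (fun i => 𝟙 (A i)) (S i) (S j) (eqToHom (congrArg P h)) := by
  subst h
  exact Canon.id _

theorem Canon.leaf_id {ι : Type*} {A : ι → M} {i : ι} {P P' : M} {e : P ≅ A i} {e' : P' ≅ A i}
    {f : P ⟶ P'} (h : f ≫ e'.hom = e.hom) :
    Canon (fun i => 𝟙 (A i)) (.leaf i e) (.leaf i e') f :=
  Canon.leaf (h.trans (Category.comp_id _).symm)

/-- Every factor serves as its own label and the leaves are mapped by `f`. Both sides are canonical,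
and no label is repeated because different positions in blocks are different positions in the
concatenation. -/
theorem tensorFamMap_flattenFam (m : ℕ) (n : Fin m → ℕ) {W W' : Fin (sumLen m n) → M}
    (f : ∀ i, W i ⟶ W' i) :
    tensorFamMap _ f ≫ flattenFam m n W' =
      flattenFam m n W ≫ tensorFamMap m (fun k => tensorFamMap (n k)
        (fun l => f (blockPos m n k l))) := by
  have hl : ∀ i, Canon f (.leaf i (Iso.refl (W i))) (.leaf i (Iso.refl (W' i))) (f i) :=
    fun i => Canon.leaf ((Category.comp_id _).trans (Category.id_comp _).symm)
  refine Canon.unique (((Canon.tensorFamMap _ hl).comp_right (Canon.flattenFam m n _)))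
    ((Canon.flattenFam m n _).comp_left (Canon.tensorFamMap _ (fun k => Canon.tensorFamMap _
      (fun l => hl _)))) ?_
  refine Shape.nodup_fam _ _ (fun k => Shape.nodup_fam _ _ (fun _ => trivial) ?_) ?_
  · rintro l l' x h h'
    have h1 : blockPos m n k l = blockPos m n k l' := (Eq.symm h).trans h'
    have := blockPos_injective m n (a₁ := ⟨k, l⟩) (a₂ := ⟨k, l'⟩) h1
    simpa using this
  · rintro k k' x h h'
    obtain ⟨l, hl⟩ := Shape.mem_labels_fam _ _ h
    obtain ⟨l', hl'⟩ := Shape.mem_labels_fam _ _ h'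
    have h1 : blockPos m n k l = blockPos m n k' l' := (Eq.symm hl).trans hl'
    have := blockPos_injective m n (a₁ := ⟨k, l⟩) (a₂ := ⟨k', l'⟩) h1
    exact congrArg Sigma.fst this

theorem shuffleFam_natural : (n : ℕ) → {P P' Q Q' : Fin n → M} → (p : ∀ i, P i ⟶ P' i) →
    (q : ∀ i, Q i ⟶ Q' i) → (tensorFamMap n p ⊗ₘ tensorFamMap n q) ≫ shuffleFam n P' Q' =
      shuffleFam n P Q ≫ tensorFamMap n (fun i => p i ⊗ₘ q i)
  | 0, _, _, _, _, _, _ => by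
    simp only [tensorFamMap, shuffleFam, id_tensorHom_id, Category.id_comp, Category.comp_id]
  | n + 1, P, P', Q, Q', p, q => by
    have h := shuffleFam_natural n (fun i => p i.succ) (fun i => q i.succ)
    simp only [tensorFamMap, shuffleFam]
    rw [← Category.assoc, tensorμ_natural, Category.assoc, Category.assoc, ← id_tensorHom,
      ← id_tensorHom, tensorHom_comp_tensorHom, tensorHom_comp_tensorHom, h, Category.comp_id,
      Category.id_comp]

/-- A tensor product over the entries of a concatenation `d₁ ⊗ ⋯ ⊗ dₘ` is written as a tensor
product over the blocks, and the factors are mapped. -/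
noncomputable def flattenMap {m : ℕ} (d : Fin m → Profile C) {Q : Fin (concat d).len → M}
    {Q' : ∀ k, Fin (d k).len → M} (q : ∀ k l, Q (pos d ⟨k, l⟩) ⟶ Q' k l) :
    tensorFam (concat d).len Q ⟶ tensorFam m (fun k => tensorFam (d k).len (Q' k)) :=
  flattenFam m (fun k => (d k).len) Q ≫
    tensorFamMap m (fun k => tensorFamMap (d k).len (fun l => q k l))

theorem isIso_flattenMap {m : ℕ} (d : Fin m → Profile C) {Q : Fin (concat d).len → M}
    {Q' : ∀ k, Fin (d k).len → M} (q : ∀ k l, Q (pos d ⟨k, l⟩) ⟶ Q' k l) [∀ k l, IsIso (q k l)] :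
    IsIso (flattenMap d q) := by
  have h : ∀ k, IsIso (tensorFamMap (d k).len (fun l => q k l)) :=
    fun k => isIso_tensorFamMap _ _
  exact IsIso.comp_isIso' (isIso_flattenFam _ _ _) (isIso_tensorFamMap m
    (P := fun k => tensorFam (d k).len (fun l => Q (pos d ⟨k, l⟩)))
    (fun k => tensorFamMap (d k).len (fun l => q k l)))

theorem flattenMap_natural {m : ℕ} (d : Fin m → Profile C)
    {Q R : Fin (concat d).len → M} {Q' R' : ∀ k, Fin (d k).len → M}
    (r : ∀ j, Q j ⟶ R j) (q : ∀ k l, Q (pos d ⟨k, l⟩) ⟶ Q' k l)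
    (q' : ∀ k l, R (pos d ⟨k, l⟩) ⟶ R' k l) (s : ∀ k l, Q' k l ⟶ R' k l)
    (h : ∀ k l, r (pos d ⟨k, l⟩) ≫ q' k l = q k l ≫ s k l) :
    tensorFamMap (concat d).len r ≫ flattenMap d q' =
      flattenMap d q ≫ tensorFamMap m (fun k => tensorFamMap (d k).len (s k)) := by
  have h1 := tensorFamMap_flattenFam m (fun k => (d k).len) r
  refine (Category.assoc _ _ _).symm.trans ((congrArg (· ≫ _) h1).trans ?_)
  refine (Category.assoc _ _ _).trans (Eq.trans ?_ (Category.assoc _ _ _).symm)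
  refine congrArg (_ ≫ ·) ((tensorFamMap_comp _ _ _).trans
    (Eq.trans ?_ (tensorFamMap_comp _ _ _).symm))
  refine congrArg (tensorFamMap m) (funext fun k => (tensorFamMap_comp _ _ _).trans
    (Eq.trans ?_ (tensorFamMap_comp _ _ _).symm))
  exact congrArg (tensorFamMap (d k).len) (funext fun l => h k l)

theorem Canon.flattenMap {ι : Type*} {A : ι → M} {m : ℕ} (d : Fin m → Profile C)
    {Q : Fin (concat d).len → M} {Q' : ∀ k, Fin (d k).len → M}
    {q : ∀ k l, Q (pos d ⟨k, l⟩) ⟶ Q' k l} (T : ∀ j, Shape A (Q j)) {T' : ∀ k l, Shape A (Q' k l)}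
    (h : ∀ k l, Canon (fun i => 𝟙 (A i)) (T (pos d ⟨k, l⟩)) (T' k l) (q k l)) :
    Canon (fun i => 𝟙 (A i)) (.fam (concat d).len T) (.fam m (fun k => .fam (d k).len (T' k)))
      (flattenMap d q) :=
  (Canon.flattenFam m (fun k => (d k).len) T).comp_left
    (Canon.tensorFamMap m (fun k => Canon.tensorFamMap (d k).len (fun l => h k l)))

/-- The canonical morphism which distributes the factors of a tensor product, indexed by the
entries of a concatenation `d₁ ⊗ ⋯ ⊗ dₘ`, over the blocks. -/
noncomputable def distributeFam {m : ℕ} (d : Fin m → Profile C) (P : Fin m → M)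
    {Q : Fin (concat d).len → M}
    {Q' : ∀ k, Fin (d k).len → M} (q : ∀ k l, Q (pos d ⟨k, l⟩) ⟶ Q' k l) :
    tensorFam m P ⊗ tensorFam (concat d).len Q ⟶
      tensorFam m (fun k => P k ⊗ tensorFam (d k).len (Q' k)) :=
  tensorFam m P ◁ flattenMap d q ≫ shuffleFam m P (fun k => tensorFam (d k).len (Q' k))

instance {m : ℕ} (d : Fin m → Profile C) (P : Fin m → M) {Q : Fin (concat d).len → M}
    {Q' : ∀ k, Fin (d k).len → M} (q : ∀ k l, Q (pos d ⟨k, l⟩) ⟶ Q' k l) [∀ k l, IsIso (q k l)] :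
    IsIso (distributeFam d P q) := by
  have := isIso_flattenMap d q
  exact IsIso.comp_isIso' (whiskerLeft_isIso _ _) (isIso_shuffleFam _ _ _)

theorem distributeFam_natural {m : ℕ} (d : Fin m → Profile C) {P P' : Fin m → M}
    {Q R : Fin (concat d).len → M} {Q' R' : ∀ k, Fin (d k).len → M} (p : ∀ k, P k ⟶ P' k)
    (r : ∀ j, Q j ⟶ R j) (q : ∀ k l, Q (pos d ⟨k, l⟩) ⟶ Q' k l)
    (q' : ∀ k l, R (pos d ⟨k, l⟩) ⟶ R' k l) (s : ∀ k l, Q' k l ⟶ R' k l)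
    (h : ∀ k l, r (pos d ⟨k, l⟩) ≫ q' k l = q k l ≫ s k l) :
    (tensorFamMap m p ⊗ₘ tensorFamMap (concat d).len r) ≫ distributeFam d P' q' =
      distributeFam d P q ≫ tensorFamMap m (fun k => p k ⊗ₘ tensorFamMap (d k).len (s k)) := by
  rw [distributeFam, distributeFam, Category.assoc, ← shuffleFam_natural, ← id_tensorHom,
    ← id_tensorHom, tensorHom_comp_tensorHom_assoc, tensorHom_comp_tensorHom_assoc,
    flattenMap_natural d r q q' s h, Category.comp_id, Category.id_comp]

theorem Canon.distributeFam {ι : Type*} {A : ι → M} {m : ℕ} (d : Fin m → Profile C) {P : Fin m → M}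
    {Q : Fin (concat d).len → M} {Q' : ∀ k, Fin (d k).len → M}
    {q : ∀ k l, Q (pos d ⟨k, l⟩) ⟶ Q' k l}
    (S : ∀ k, Shape A (P k)) (T : ∀ j, Shape A (Q j)) {T' : ∀ k l, Shape A (Q' k l)}
    (h : ∀ k l, Canon (fun i => 𝟙 (A i)) (T (pos d ⟨k, l⟩)) (T' k l) (q k l)) :
    Canon (fun i => 𝟙 (A i)) ((Shape.fam m S).tensor (.fam (concat d).len T))
      (.fam m (fun k => (S k).tensor (.fam (d k).len (T' k)))) (distributeFam d P q) :=
  (Canon.whiskerLeft _ (Canon.flattenMap d T h)).comp_left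
    (Canon.shuffleFam m S (fun k => .fam (d k).len (T' k)))

/-- The distribution of factors over blocks is natural with respect to permutations. -/
theorem distributeFam_reindex {m m' : ℕ} (σ : Fin m' ≃ Fin m) {d : Fin m → Profile C}
    {d' : Fin m' → Profile C} (δ : ∀ k, d (σ k) ⟶ d' k) {P : Fin m → M} {P' : Fin m' → M}
    (p : ∀ k, P (σ k) ⟶ P' k) [hpi : ∀ k, IsIso (p k)] {Q : Fin (concat d).len → M}
    {R : Fin (concat d').len → M} (r : ∀ j, Q ((concatMap σ δ).perm j) ⟶ R j) [∀ j, IsIso (r j)]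
    {Q' : ∀ k, Fin (d k).len → M} (q : ∀ k l, Q (pos d ⟨k, l⟩) ⟶ Q' k l)
    {R' : ∀ k, Fin (d' k).len → M} (q' : ∀ k l, R (pos d' ⟨k, l⟩) ⟶ R' k l)
    [∀ k l, IsIso (q' k l)]
    (s : ∀ k l, Q' (σ k) ((δ k).perm l) ⟶ R' k l) [∀ k l, IsIso (s k l)]
    (h : ∀ k l, eqToHom (congrArg Q (concatMap_perm_pos σ δ k l)) ≫ q _ _ ≫ s k l =
      r (pos d' ⟨k, l⟩) ≫ q' k l) :
    (reindex m' m σ p ⊗ₘ reindex _ _ (concatMap σ δ).perm r) ≫ distributeFam d' P' q' =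
      distributeFam d P q ≫ reindex m' m σ
        (fun k => p k ⊗ₘ reindex _ _ (δ k).perm (s k)) := by
  -- The labels are the factors of the final target: one for each block, and one for each entry of a
  -- block.
  let A : Fin m' ⊕ ((k : Fin m') × Fin (d' k).len) → M := Sum.elim P' (fun x => R' x.1 x.2)
  let eP : ∀ k, P (σ k) ≅ A (Sum.inl k) := fun k => (asIso (p k) : P (σ k) ≅ P' k)
  let eR : ∀ x, R (pos d' x) ≅ A (Sum.inr x) := 
    fun x => (asIso (q' x.1 x.2) : R (pos d' x) ≅ R' x.1 x.2)
  let eQ : ∀ x, Q ((concatMap σ δ).perm (pos d' x)) ≅ A (Sum.inr x) :=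
    fun x => asIso (r (pos d' x)) ≪≫ (asIso (q' x.1 x.2) : R (pos d' x) ≅ R' x.1 x.2)
  let eS : ∀ x : (k : Fin m') × Fin (d' k).len, Q' (σ x.1) ((δ x.1).perm x.2) ≅ A (Sum.inr x) :=
    fun x => (asIso (s x.1 x.2) : Q' (σ x.1) ((δ x.1).perm x.2) ≅ R' x.1 x.2)
  let τ : ((k : Fin m') × Fin (d' k).len) ≃ ((k : Fin m) × Fin (d k).len) :=
    Equiv.sigmaCongr σ (fun k => (δ k).perm)
  obtain ⟨S, hS⟩ := exists_family_comp_equiv σ (F := fun k => Shape A (P k))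
    (fun k => .leaf (Sum.inl k) (eP k))
  obtain ⟨TR, hTR⟩ := exists_family_comp_equiv (pos d') (F := fun j => Shape A (R j))
    (fun x => .leaf (Sum.inr x) (eR x))
  -- The entries of the source are labelled by their destinations in `d'`; a leaf is identified with
  -- its target along the composite of `r` and `q'`.
  obtain ⟨T, hT⟩ := exists_family_comp_equiv ((pos d').trans (concatMap σ δ).perm)
    (F := fun j => Shape A (Q j))
    (fun x => .leaf (Sum.inr x) (eQ x))
  obtain ⟨T', hT'⟩ := exists_family_comp_equiv τ
    (F := fun x => Shape A (Q' x.1 x.2)) (fun x => .leaf (Sum.inr x) (eS x))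
  have hp : ∀ k, Canon (fun i => 𝟙 (A i)) (S (σ k)) (.leaf (Sum.inl k) (Iso.refl (A (Sum.inl k))))
      (p k) := fun k => by
    rw [hS]
    exact Canon.leaf_id (Category.comp_id _)
  have hr : ∀ j, Canon (fun i => 𝟙 (A i)) (T ((concatMap σ δ).perm j)) (TR j) (r j) := fun j => by
    obtain ⟨x, rfl⟩ := (pos d').surjective j
    have := hT x
    rw [hTR]
    refine (congrArg (fun z => Canon (fun i => 𝟙 (A i)) z _ _) this).mpr ?_
    exact Canon.leaf_id rfl
  have hq' : ∀ k l, Canon (fun i => 𝟙 (A i)) (TR (pos d' ⟨k, l⟩))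
      (.leaf (Sum.inr ⟨k, l⟩) (Iso.refl (A (Sum.inr ⟨k, l⟩)))) (q' k l) := fun k l => by
    rw [hTR]
    exact Canon.leaf_id (Category.comp_id _)
  have hs : ∀ k l, Canon (fun i => 𝟙 (A i)) (T' ⟨σ k, (δ k).perm l⟩)
      (.leaf (Sum.inr ⟨k, l⟩) (Iso.refl (A (Sum.inr ⟨k, l⟩)))) (s k l) := fun k l => by
    refine (congrArg (fun z => Canon (fun i => 𝟙 (A i)) z _ _) (hT' ⟨k, l⟩)).mpr ?_
    exact Canon.leaf_id (Category.comp_id _)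
  -- The hypothesis `h` enters here: the route through `q` and `s` gives a leaf the same
  -- identification with its target as the route through `r` and `q'`.
  have hq : ∀ x, Canon (fun i => 𝟙 (A i)) (T (pos d x)) (T' x) (q x.1 x.2) := fun x => by
    obtain ⟨⟨k, l⟩, rfl⟩ := τ.surjective x
    refine (congrArg (fun z => Canon (fun i => 𝟙 (A i)) _ z _) (hT' ⟨k, l⟩)).mpr ?_
    have h1 := Canon.eqToHom_family T (concatMap_perm_pos σ δ k l).symm
    refine (h1.comp_left ((congrArg (fun z => Canon (fun i => 𝟙 (A i)) z
      (.leaf (Sum.inr ⟨k, l⟩) (eS ⟨k, l⟩)) (eqToHom (congrArg Q (concatMap_perm_pos σ δ k l)) ≫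
        q (σ k) ((δ k).perm l))) (hT ⟨k, l⟩)).mpr ?_)).of_eq ?_
    · refine Canon.leaf_id ?_
      refine (Category.assoc _ _ _).trans (h k l)
    · simp
      rfl
  refine Canon.unique (((Canon.reindex _ _ σ hp).tensor
    (Canon.reindex _ _ _ hr)).comp_left (Canon.distributeFam d' _ TR hq'))
    ((Canon.distributeFam d S T (T' := fun k l => T' ⟨k, l⟩) (fun k l => hq ⟨k, l⟩)).comp_left
      (Canon.reindex _ _ σ (fun k => (hp k).tensor (Canon.reindex _ _ _ (hs k))))) ?_
  -- The target shape repeats no label: the blocks and the entries form separate summands of the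
  -- label type, and an entry label determines its block and its position.
  refine Shape.nodup_fam _ _ (fun k => ⟨trivial, Shape.nodup_fam _ _ (fun _ => trivial) ?_, ?_⟩) ?_
  · rintro l l' x h h'
    have : (⟨k, l⟩ : (k : Fin m') × Fin (d' k).len) = ⟨k, l'⟩ :=
      Sum.inr_injective ((Eq.symm h).trans h')
    simpa using this
  · rw [Set.disjoint_left]
    rintro x h h'
    obtain ⟨l, hl⟩ := Shape.mem_labels_fam _ _ h'
    exact Sum.inl_ne_inr ((Eq.symm h).trans hl)
  · rintro k k' x (h | h) (h' | h')
    · exact Sum.inl_injective ((Eq.symm h).trans h')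
    · obtain ⟨l, hl⟩ := Shape.mem_labels_fam _ _ h'
      exact (Sum.inl_ne_inr ((Eq.symm h).trans hl)).elim
    · obtain ⟨l, hl⟩ := Shape.mem_labels_fam _ _ h
      exact (Sum.inl_ne_inr ((Eq.symm h').trans hl)).elim
    · obtain ⟨l, hl⟩ := Shape.mem_labels_fam _ _ h
      obtain ⟨l', hl'⟩ := Shape.mem_labels_fam _ _ h'
      exact congrArg Sigma.fst (Sum.inr_injective ((Eq.symm hl).trans hl'))

variable [HasColimits M]

/-- The distribution of factors over blocks, followed by morphisms of the profiles. -/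
noncomputable def distributeTo (Y Z : SymSeq C M) (e : Profile C) {d : Fin e.len → Profile C}
    {b : Fin (concat d).len → Profile C} {c : ∀ k, Fin (d k).len → Profile C}
    (ζ : ∀ k l, b (pos d ⟨k, l⟩) ⟶ c k l) :
    valFam Y e d ⊗ valFam Z (concat d) b ⟶
      tensorFam e.len (fun k => Y.val (e.col k) (d k) ⊗ valFam Z (d k) (c k)) :=
  distributeFam d (fun k => Y.val (e.col k) (d k)) (fun k l => Z.act (concat_col d ⟨k, l⟩) (ζ k l))

theorem distributeTo_id (Y Z : SymSeq C M) (e : Profile C) (d : Fin e.len → Profile C)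
    (b : Fin (concat d).len → Profile C) :
    distributeTo Y Z e (fun k l => 𝟙 (b (pos d ⟨k, l⟩))) = distribute Y Z e d b := rfl

theorem distributeTo_comp (Y Z : SymSeq C M) (e : Profile C) {d : Fin e.len → Profile C}
    {b : Fin (concat d).len → Profile C} {c c' : ∀ k, Fin (d k).len → Profile C}
    (ζ : ∀ k l, b (pos d ⟨k, l⟩) ⟶ c k l) (γ : ∀ k l, c k l ⟶ c' k l) :
    distributeTo Y Z e ζ ≫ tensorFamMap e.len (fun k => Y.val (e.col k) (d k) ◁
      valFamMap Z (d k) (γ k)) = distributeTo Y Z e (fun k l => ζ k l ≫ γ k l) := by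
  have h := distributeFam_natural d (fun k => 𝟙 (Y.val (e.col k) (d k)))
    (fun j => 𝟙 (Z.val ((concat d).col j) (b j))) (fun k l => Z.act (concat_col d ⟨k, l⟩) (ζ k l))
    (fun k l => Z.act (concat_col d ⟨k, l⟩) (ζ k l ≫ γ k l))
    (fun k l => Z.act (rfl : (d k).col l = (d k).col l) (γ k l))
    (fun k l => by rw [SymSeq.act_comp, Category.id_comp])
  rw [tensorFamMap_id, tensorFamMap_id, id_tensorHom_id, Category.id_comp] at h
  simp only [id_tensorHom] at h
  exact h.symm

instance (Y Z : SymSeq C M) (e : Profile C) {d : Fin e.len → Profile C}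
    {b : Fin (concat d).len → Profile C} {c : ∀ k, Fin (d k).len → Profile C}
    (ζ : ∀ k l, b (pos d ⟨k, l⟩) ⟶ c k l) : IsIso (distributeTo Y Z e ζ) :=
  inferInstanceAs (IsIso (distributeFam _ _ _))

/-- The distribution of factors over blocks is natural. -/
theorem distributeTo_natural (Y Z : SymSeq C M) {e e' : Profile C} (p : e ⟶ e')
    {d : Fin e.len → Profile C} {d' : Fin e'.len → Profile C}
    (δ : ∀ k, d (p.perm k) ⟶ d' k) {b : Fin (concat d).len → Profile C}
    {b' : Fin (concat d').len → Profile C} (β : ∀ j, b ((concatMap p.perm δ).perm j) ⟶ b' j)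
    {c : ∀ k, Fin (d k).len → Profile C} {c' : ∀ k, Fin (d' k).len → Profile C}
    (ζ : ∀ k l, b (pos d ⟨k, l⟩) ⟶ c k l) (ζ' : ∀ k l, b' (pos d' ⟨k, l⟩) ⟶ c' k l)
    (γ : ∀ k l, c (p.perm k) ((δ k).perm l) ⟶ c' k l)
    (h : ∀ k l, β (pos d' ⟨k, l⟩) ≫ ζ' k l =
      eqToHom (congrArg b (concatMap_perm_pos p.perm δ k l)) ≫ ζ _ _ ≫ γ k l) :
    (famMap Y p δ ⊗ₘ famMap Z (concatMap p.perm δ) β) ≫ distributeTo Y Z e' ζ' =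
      distributeTo Y Z e ζ ≫ reindex e'.len e.len p.perm
        (fun k => Y.act (p.col_perm k) (δ k) ⊗ₘ famMap Z (δ k) (γ k)) := by
  refine distributeFam_reindex p.perm δ (P := fun k => Y.val (e.col k) (d k))
    (P' := fun k => Y.val (e'.col k) (d' k)) (fun k => Y.act (p.col_perm k) (δ k))
    (Q := fun j => Z.val ((concat d).col j) (b j)) (R := fun j => Z.val ((concat d').col j) (b' j))
    (fun j => Z.act ((concatMap p.perm δ).col_perm j) (β j))
    (Q' := fun k l => Z.val ((d k).col l) (c k l))
    (fun k l => Z.act (concat_col d ⟨k, l⟩) (ζ k l))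
    (R' := fun k l => Z.val ((d' k).col l) (c' k l))
    (fun k l => Z.act (concat_col d' ⟨k, l⟩) (ζ' k l))
    (fun k l => Z.act ((δ k).col_perm l) (γ k l)) (fun k l => ?_)
  have h1 := Z.eqToHom_eq_act (concat d).col b (concatMap_perm_pos p.perm δ k l)
  refine (congrArg (· ≫ _) h1).trans ?_
  rw [SymSeq.act_comp, SymSeq.act_comp, SymSeq.act_comp]
  exact congrArg (Z.act _) (h k l).symm

end Distribute

/-! ### Permuting factors is invertible. -/

section ReindexIso

variable {M : Type u} [Category.{v} M] [MonoidalCategory M] [SymmetricCategory M]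

instance (X Y Z : M) : IsIso (interchange X Y Z) := (interchangeIso X Y Z).isIso_hom

theorem isIso_pull : (n : ℕ) → (k : Fin (n + 1)) → (A : Fin (n + 1) → M) → IsIso (pull n k A)
  | 0, k, A => by
    refine Fin.cases ?_ (fun k' => k'.elim0) k
    exact inferInstanceAs (IsIso (𝟙 _))
  | n + 1, k, A => by
    refine Fin.cases ?_ (fun k' => ?_) k
    · exact inferInstanceAs (IsIso (𝟙 _))
    · have := isIso_pull n k' (fun i => A i.succ)
      exact inferInstanceAs (IsIso (A 0 ◁ pull n k' (fun i => A i.succ) ≫ interchange _ _ _))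

theorem isIso_reindex : (m n : ℕ) → (σ : Fin m ≃ Fin n) → {A : Fin n → M} → {B : Fin m → M} →
    (f : ∀ i, A (σ i) ⟶ B i) → (∀ i, IsIso (f i)) → IsIso (reindex m n σ f)
  | 0, 0, _, _, _, _, _ => inferInstanceAs (IsIso (𝟙 (𝟙_ M)))
  | 0, _ + 1, σ, _, _, _, _ => (σ.symm 0).elim0
  | _ + 1, 0, σ, _, _, _, _ => (σ 0).elim0
  | m + 1, n + 1, σ, A, B, f, h => by
    have h1 := isIso_reindex m n (residual σ 0) (A := fun j => A (skip n (σ 0) j))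
      (fun i => eqToHom (congrArg A ((skip_residual σ 0 i).trans
        (congrArg σ (skip_zero m i)))) ≫ f i.succ) (fun i => inferInstance)
    have h2 := isIso_pull n (σ 0) A
    rw [reindex_succ]
    infer_instance

instance isIso_famMap {C : Type v} (Y : SymSeq C M) {a a' : Profile C} (p : a ⟶ a')
    {b : Fin a.len → Profile C} {b' : Fin a'.len → Profile C} (β : ∀ i, b (p.perm i) ⟶ b' i) :
    IsIso (famMap Y p β) :=
  isIso_reindex _ _ _ _ (fun _ => inferInstance)

end ReindexIso

/-! ### Presentations of symmetric sequences, and their behaviour in the left variable of the circle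
product. -/

section Generators

variable {C : Type v} {M : Type u} [Category.{v} M] [MonoidalCategory M] [SymmetricCategory M]

/-- A family of profiles indexed by the entries of `a` is the restriction along `h : c ⟶ a` of a
family indexed by the entries of `c`. -/
theorem exists_eq_comp_perm {c a : Profile C} (h : c ⟶ a) (b : Fin a.len → Profile C) :
    ∃ b' : Fin c.len → Profile C, b = fun i => b' (h.perm i) :=
  ⟨fun i => b (h.perm.symm i), funext fun i => congrArg b (h.perm.symm_apply_apply i).symm⟩

section Gen

variable [HasColimits M]

/-- The insertions into the values of the circle product. -/
noncomputable def circleIn (X Y : SymSeq C M) (t : C) {c a : Profile C} (b : Fin a.len → Profile C)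
    (g : concat b ⟶ c) : X.val t a ⊗ valFam Y a b ⟶ (circle X Y).val t c :=
  circleι X Y t c a b g

theorem circleIn_natural (X Y : SymSeq C M) (t : C) {c a a' : Profile C} (p : a ⟶ a')
    {b : Fin a.len → Profile C} {b' : Fin a'.len → Profile C} (β : ∀ i, b (p.perm i) ⟶ b' i)
    (g : concat b' ⟶ c) :
    (X.act (rfl : t = t) p ⊗ₘ famMap Y p β) ≫ circleIn X Y t b' g =
      circleIn X Y t b (concatMap p.perm β ≫ g) :=
  circleι_natural' X Y t p β g

theorem circleIn_act (X Y : SymSeq C M) (t : C) {a c c' : Profile C} (b : Fin a.len → Profile C)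
    (g : concat b ⟶ c) (h : c ⟶ c') :
    circleIn X Y t b g ≫ (circle X Y).act rfl h = circleIn X Y t b (g ≫ h) :=
  circleι_act X Y t b g h

theorem isPresentation_circleIn (X Y : SymSeq C M) (t : C) (c : Profile C) :
    IsPresentation (S := Σ (a : Profile C) (b : Fin a.len → Profile C), (concat b ⟶ c))
      (A := fun s => X.val t s.1 ⊗ valFam Y s.1 s.2.1) (P := (circle X Y).val t c)
      (fun s => circleIn X Y t s.2.1 s.2.2)
      (fun s s' u => ∃ (p : s.1 ⟶ s'.1) (β : ∀ i, s.2.1 (p.perm i) ⟶ s'.2.1 i),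
        concatMap p.perm β ≫ s'.2.2 = s.2.2 ∧ u = X.act rfl p ⊗ₘ famMap Y p β) :=
  isPresentation_circleι X Y t c

/-- The canonical morphism `X(t; a) ⊗ Y(a₁; b₁) ⊗ ⋯ ⊗ Y(aₘ; bₘ) ⟶ (X ∘ Y)(t; b₁ ⊗ ⋯ ⊗ bₘ)`. -/
noncomputable def circleGen (X Y : SymSeq C M) (t : C) (a : Profile C) (b : Fin a.len → Profile C) :
    X.val t a ⊗ valFam Y a b ⟶ (circle X Y).val t (concat b) :=
  circleIn X Y t b (𝟙 _)

theorem circleGen_act (X Y : SymSeq C M) (t : C) {a c : Profile C} (b : Fin a.len → Profile C)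
    (g : concat b ⟶ c) :
    circleGen X Y t a b ≫ (circle X Y).act rfl g = circleIn X Y t b g :=
  (circleIn_act X Y t b (𝟙 _) g).trans (congrArg (circleIn X Y t b) (Category.id_comp g))

theorem circleGen_natural (X Y : SymSeq C M) {t t' : C} (ht : t = t') {a a' : Profile C}
    (p : a ⟶ a') {b : Fin a.len → Profile C} {b' : Fin a'.len → Profile C}
    (β : ∀ i, b (p.perm i) ⟶ b' i) :
    (X.act ht p ⊗ₘ famMap Y p β) ≫ circleGen X Y t' a' b' =
      circleGen X Y t a b ≫ (circle X Y).act ht (concatMap p.perm β) := by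
  subst ht
  rw [circleGen, circleIn_natural, circleGen_act, Category.comp_id]

theorem circleGen_app {X X' Y Y' : SymSeq C M} (x : X ⟶ X') (y : Y ⟶ Y') (t : C) (a : Profile C)
    (b : Fin a.len → Profile C) :
    circleGen X Y t a b ≫ SymSeq.app (circleHom x y) t (concat b) =
      (SymSeq.app x t a ⊗ₘ tensorFamMap a.len (fun i => SymSeq.app y (a.col i) (b i))) ≫
        circleGen X' Y' t a b :=
  circleι_app x y t b (𝟙 _)

end Gen

variable (C M)

/-- The index data of a presentation of a symmetric sequence by generators and relations. -/
structure Generators where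
  /-- the indices of the generators -/
  index : C → Type v
  /-- the profile of a generator -/
  prof : ∀ t, index t → Profile C
  /-- the object of a generator -/
  obj : ∀ t, index t → M
  /-- the relations -/
  rel : ∀ {t t' : C} (h : t = t') (s : index t) (s' : index t'), (prof t s ⟶ prof t' s') →
    (obj t s ⟶ obj t' s') → Prop

variable {C M}

/-- The symmetric sequence `U` is presented by the generators `g` and the relations of `G`. -/
structure Generators.Presents (G : Generators C M) (U : SymSeq C M)
    (g : ∀ t s, G.obj t s ⟶ U.val t (G.prof t s)) : Prop where
  refl : ∀ t s, G.rel (rfl : t = t) s s (𝟙 _) (𝟙 _)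
  pres : ∀ t a, IsPresentation (S := Σ s : G.index t, (G.prof t s ⟶ a)) (A := fun x => G.obj t x.1)
    (fun x => g t x.1 ≫ U.act rfl x.2)
    (fun x x' u => ∃ q, q ≫ x'.2 = x.2 ∧ G.rel rfl x.1 x'.1 q u)

namespace Generators.Presents

variable {G : Generators C M} {U : SymSeq C M} {g : ∀ t s, G.obj t s ⟶ U.val t (G.prof t s)}

/-- The presentations are taken at one color at a time. Relations between equal colors are reduced
to this case, since permuting the entries of a profile produces colors that are equal but not
syntactically the same. -/
theorem w (P : G.Presents U g) {t t' : C} (h : t = t') {s : G.index t} {s' : G.index t'}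
    {q : G.prof t s ⟶ G.prof t' s'} {u : G.obj t s ⟶ G.obj t' s'} (hu : G.rel h s s' q u) :
    u ≫ g t' s' = g t s ≫ U.act h q := by
  subst h
  have := (P.pres t _).w (s := ⟨s, q⟩) (s' := ⟨s', 𝟙 _⟩) ⟨q, Category.comp_id _, hu⟩
  simpa only [SymSeq.act_id, Category.comp_id] using this

/-- The values of `U` are generated by the images of the generators under the action of the profile
morphisms, so naturality reduces the equality to the generators themselves. -/
theorem hom_ext (P : G.Presents U g) {W : SymSeq C M} {F F' : U ⟶ W}
    (h : ∀ t s, g t s ≫ SymSeq.app F t _ = g t s ≫ SymSeq.app F' t _) : F = F' := by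
  refine NatTrans.ext (funext fun x => ?_)
  refine (P.pres x.2.as x.1).hom_ext (fun s => ?_)
  refine (Category.assoc _ _ _).trans (Eq.trans ?_ (Category.assoc _ _ _).symm)
  refine (congrArg (_ ≫ ·) (SymSeq.act_app F rfl s.2)).trans
    (Eq.trans ?_ (congrArg (_ ≫ ·) (SymSeq.act_app F' rfl s.2)).symm)
  rw [← Category.assoc, h, Category.assoc]

/-- The descent is carried out at each profile separately. The chosen components are natural because
both composites have the same effect on generators. -/
theorem exists_desc (P : G.Presents U g) {W : SymSeq C M}
    (f : ∀ t s, G.obj t s ⟶ W.val t (G.prof t s))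
    (hf : ∀ t (s s' : G.index t) q u, G.rel rfl s s' q u → u ≫ f t s' = f t s ≫ W.act rfl q) :
    ∃ F : U ⟶ W, ∀ t s, g t s ≫ SymSeq.app F t (G.prof t s) = f t s := by
  have h1 : ∀ t a, ∃ k : U.val t a ⟶ W.val t a,
      ∀ s : Σ s : G.index t, (G.prof t s ⟶ a), (g t s.1 ≫ U.act rfl s.2) ≫ k =
        f t s.1 ≫ W.act rfl s.2 := fun t a =>
    (P.pres t a).exists_desc (fun s => f t s.1 ≫ W.act rfl s.2) (by
      rintro ⟨s, h⟩ ⟨s', h'⟩ u ⟨q, hq, hu⟩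
      dsimp only at hq u ⊢
      rw [← hq, ← Category.assoc, hf t s s' q u hu, Category.assoc, SymSeq.act_comp])
  choose k hk using h1
  have hn : ∀ t a a' (q : a ⟶ a'), U.act (rfl : t = t) q ≫ k t a' = k t a ≫ W.act rfl q := by
    intro t a a' q
    refine (P.pres t a).hom_ext (fun s => ?_)
    have h2 : (g t s.1 ≫ U.act rfl (s.2 ≫ q)) ≫ k t a' = f t s.1 ≫ W.act rfl (s.2 ≫ q) :=
      hk t a' ⟨s.1, s.2 ≫ q⟩
    rw [← SymSeq.act_comp U rfl rfl, ← SymSeq.act_comp W rfl rfl, ← Category.assoc,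
      ← Category.assoc (f t s.1), ← hk, Category.assoc, Category.assoc] at h2
    exact (Category.assoc _ _ _).trans (h2.trans (Category.assoc _ _ _))
  refine ⟨{ app := fun x => k x.2.as x.1, naturality := ?_ }, fun t s => ?_⟩
  · rintro ⟨a, ⟨t⟩⟩ ⟨a', ⟨t'⟩⟩ ⟨q, h⟩
    obtain rfl : t = t' := Discrete.eq_of_hom h
    exact hn t a a' q
  · have := hk t _ ⟨s, 𝟙 _⟩
    rw [SymSeq.act_id, SymSeq.act_id, Category.comp_id, Category.comp_id] at this
    exact this

end Generators.Presents

/-- The presentation of a symmetric sequence by all of its values. -/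
@[reducible] def Generators.self (X : SymSeq C M) : Generators C M where
  index _ := Profile C
  prof _ a := a
  obj t a := X.val t a
  rel h _ _ q u := u = X.act h q

/-- This is the co-Yoneda lemma: acting on a generator is itself a relation, so a compatible family
is determined by its member at the identity of `a`. -/
theorem Generators.presents_self (X : SymSeq C M) :
    (Generators.self X).Presents X (fun t a => 𝟙 (X.val t a)) where
  refl t s := (X.act_id _ _).symm
  pres t a :=
    { w := by
        rintro ⟨s, h⟩ ⟨s', h'⟩ _ ⟨q, hq, rfl⟩
        dsimp only [Generators.self] at s s' h h' q hq ⊢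
        rw [← hq, Category.id_comp, Category.id_comp, SymSeq.act_comp]
      hom_ext := fun {Z f f'} h => by
        have := h ⟨a, 𝟙 a⟩
        dsimp only [Generators.self] at this
        simpa only [SymSeq.act_id, Category.id_comp] using this
      exists_desc := fun {Z} f hf => by
        refine ⟨f ⟨a, 𝟙 a⟩, fun s => ?_⟩
        rw [Category.id_comp]
        exact hf (s := s) (s' := ⟨a, 𝟙 a⟩) ⟨s.2, Category.comp_id _, rfl⟩ }

variable [HasColimits M]

/-- The presentation of the circle unit by its canonical elements. -/
@[reducible] def Generators.unit : Generators C M where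
  index _ := PUnit
  prof t _ := single t
  obj _ _ := 𝟙_ M
  rel _ _ _ _ u := u = 𝟙 (𝟙_ M)

theorem single_hom_subsingleton {t t' : C} (f g : single t ⟶ single t') : f = g := by
  ext1
  ext1 i
  exact Subsingleton.elim (α := Fin 1) _ _

theorem circleUnitι_act {t : C} {a : Profile C} (h : single t ⟶ a) :
    circleUnitι t ≫ (circleUnit : SymSeq C M).act rfl h = setTensor.ι h (𝟙_ M) := by
  refine (setTensor.ι_map _ _ _).trans ((Category.id_comp _).trans ?_)
  refine congrArg (fun x => setTensor.ι x (𝟙_ M)) ?_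
  exact (Category.id_comp _).trans (Category.id_comp _)

/-- The morphisms `single t ⟶ a` index the summands of the value of the unit at `a`. No relation
other than the identity remains, because a profile of length one has only the trivial automorphism.
-/
theorem Generators.presents_unit :
    (Generators.unit : Generators C M).Presents circleUnit (fun t _ => circleUnitι t) where
  refl t s := rfl
  pres t a :=
    { w := by
        rintro ⟨s, h⟩ ⟨s', h'⟩ _ ⟨q, hq, rfl⟩
        dsimp only [Generators.unit] at s s' h h' q hq ⊢
        obtain rfl : q = 𝟙 _ := single_hom_subsingleton _ _
        rw [← hq, Category.id_comp, Category.id_comp]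
      hom_ext := fun {Z f f'} h => by
        refine setTensor.hom_ext (fun s => ?_)
        have := h ⟨⟨⟩, s⟩
        dsimp only [Generators.unit] at this
        rw [circleUnitι_act] at this
        exact this
      exists_desc := fun {Z} f hf => by
        refine ⟨setTensor.desc (fun s => f ⟨⟨⟩, s⟩), fun s => ?_⟩
        rw [circleUnitι_act]
        exact setTensor.ι_desc _ _ }

/-- The presentation of `U ∘ Z` that is induced by a presentation of `U`. -/
@[reducible] noncomputable def Generators.left (G : Generators C M) (Z : SymSeq C M) : Generators C M where
  index t := Σ s : G.index t, (Fin (G.prof t s).len → Profile C)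
  prof t s := concat s.2
  obj t s := G.obj t s.1 ⊗ valFam Z (G.prof t s.1) s.2
  rel h s s' q' u' := ∃ (q : G.prof _ s.1 ⟶ G.prof _ s'.1) (u : G.obj _ s.1 ⟶ G.obj _ s'.1)
    (β : ∀ i, s.2 (q.perm i) ⟶ s'.2 i), G.rel h s.1 s'.1 q u ∧ q' = concatMap q.perm β ∧
      u' = u ⊗ₘ famMap Z q β

/-- The presentation of `X ∘ V` that is induced by a presentation of `V`. -/
@[reducible] noncomputable def Generators.right (G : Generators C M) (X : SymSeq C M) : Generators C M where
  index t := Σ e : Profile C, ∀ k, G.index (e.col k)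
  prof t s := concat (fun k => G.prof _ (s.2 k))
  obj t s := X.val t s.1 ⊗ tensorFam s.1.len (fun k => G.obj _ (s.2 k))
  rel h s s' q' u' := ∃ (p : s.1 ⟶ s'.1)
    (q : ∀ k, G.prof _ (s.2 (p.perm k)) ⟶ G.prof _ (s'.2 k))
    (u : ∀ k, G.obj _ (s.2 (p.perm k)) ⟶ G.obj _ (s'.2 k)),
    (∀ k, G.rel (p.col_perm k) (s.2 (p.perm k)) (s'.2 k) (q k) (u k)) ∧
      q' = concatMap p.perm q ∧ u' = X.act h p ⊗ₘ reindex _ _ p.perm u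

/-- The family `f` is indexed by profiles over the entries of a generator, while the summands of `U
∘ Z` are indexed by profiles over the entries of `a`. A morphism from the profile of the generator
to `a` identifies the two. This extends `f` to all summands, and the presentation of `U`, tensored
with the factors of `Z`, gives the descent. -/
theorem Generators.Presents.exists_desc_whiskerRight [MonoidalClosed M] {G : Generators C M}
    {U : SymSeq C M} {g : ∀ t s, G.obj t s ⟶ U.val t (G.prof t s)} (P : G.Presents U g)
    (Z : SymSeq C M) {t : C} {c : Profile C} {T : M}
    (f : ∀ (s : G.index t) (b : Fin (G.prof t s).len → Profile C), (concat b ⟶ c) →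
      (G.obj t s ⊗ valFam Z (G.prof t s) b ⟶ T))
    (hf : ∀ (s s' : G.index t) (q : G.prof t s ⟶ G.prof t s') (u : G.obj t s ⟶ G.obj t s')
      (b : Fin (G.prof t s).len → Profile C) (b' : Fin (G.prof t s').len → Profile C)
      (β : ∀ i, b (q.perm i) ⟶ b' i) (k : concat b' ⟶ c), G.rel rfl s s' q u →
      (u ⊗ₘ famMap Z q β) ≫ f s' b' k = f s b (concatMap q.perm β ≫ k))
    (a : Profile C) (b : Fin a.len → Profile C) (k : concat b ⟶ c) :
    ∃ F : U.val t a ⊗ valFam Z a b ⟶ T, ∀ (s : G.index t) (h : G.prof t s ⟶ a)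
      (b' : Fin (G.prof t s).len → Profile C) (β : ∀ i, b' (h.perm i) ⟶ b i),
      ((g t s ≫ U.act rfl h) ⊗ₘ famMap Z h β) ≫ F = f s b' (concatMap h.perm β ≫ k) := by
  -- Permuting the factors of `Z` along `h` is invertible, so the required equation for one choice
  -- of `b'` defines `v`. The relation of `s` with itself by identities gives the equation for all
  -- other choices.
  have h1 : ∀ (s : G.index t) (h : G.prof t s ⟶ a), ∃ v : G.obj t s ⊗ valFam Z a b ⟶ T,
      ∀ (b' : Fin (G.prof t s).len → Profile C) (β : ∀ i, b' (h.perm i) ⟶ b i),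
        G.obj t s ◁ famMap Z h β ≫ v = f s b' (concatMap h.perm β ≫ k) := by
    intro s h
    obtain ⟨b₀, rfl⟩ := exists_eq_comp_perm h b
    refine ⟨inv (G.obj t s ◁ famMap Z h (b := b₀) (fun i => 𝟙 (b₀ (h.perm i)))) ≫
      f s b₀ (concatMap h.perm (b := b₀) (fun i => 𝟙 (b₀ (h.perm i))) ≫ k), fun b' β => ?_⟩
    obtain ⟨β', hβ'⟩ := exists_family_comp_equiv h.perm (F := fun i => b' i ⟶ b₀ i) β
    have h2 := hf s s (𝟙 _) (𝟙 _) b' b₀ β' (concatMap h.perm (b := b₀)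
      (fun i => 𝟙 (b₀ (h.perm i))) ≫ k) (P.refl t s)
    have h3 : famMap Z h β = famMap Z (𝟙 _) β' ≫ famMap Z h (b := b₀)
        (fun i => 𝟙 (b₀ (h.perm i))) := by
      refine Eq.trans ?_ (famMap_comp _ _ _ _ _).symm
      exact congrArg (famMap Z h) (funext fun i => (hβ' i).symm.trans (Category.comp_id _).symm)
    have h4 : concatMap h.perm β = concatMap (Equiv.refl _) β' ≫ concatMap h.perm (b := b₀)
        (fun i => 𝟙 (b₀ (h.perm i))) := by
      refine Eq.trans ?_ (concatMap_comp _ _ _ _).symm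
      exact congrArg (concatMap h.perm) (funext fun i =>
        (hβ' i).symm.trans (Category.comp_id _).symm)
    rw [h3, h4, MonoidalCategory.whiskerLeft_comp, Category.assoc, IsIso.hom_inv_id_assoc,
      ← id_tensorHom, Category.assoc]
    exact h2
  choose v hv using h1
  -- The family `v` respects the relations of `U`. Writing the profiles as restrictions along `h'`
  -- and `q` makes the reindexings composable without transports.
  have key : ∀ (s s' : G.index t) (q : G.prof t s ⟶ G.prof t s') (u : G.obj t s ⟶ G.obj t s')
      (h' : G.prof t s' ⟶ a), G.rel rfl s s' q u →
      u ▷ valFam Z a b ≫ v s' h' = v s (q ≫ h') := by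
    intro s s' q u h' hu
    obtain ⟨b', rfl⟩ := exists_eq_comp_perm h' b
    obtain ⟨b₀, rfl⟩ := exists_eq_comp_perm q b'
    have h2 := hv s (q ≫ h') b₀ (fun i => 𝟙 (b₀ (q.perm (h'.perm i))))
    have h3 := hv s' h' (fun i => b₀ (q.perm i)) (fun i => 𝟙 (b₀ (q.perm (h'.perm i))))
    have h4 := hf s s' q u b₀ (fun i => b₀ (q.perm i)) (fun i => 𝟙 (b₀ (q.perm i)))
      (concatMap h'.perm (b := fun i => b₀ (q.perm i)) (fun i => 𝟙 (b₀ (q.perm (h'.perm i)))) ≫ k) hu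
    have h5 : famMap Z (q ≫ h') (b := b₀) (fun i => 𝟙 (b₀ (q.perm (h'.perm i)))) =
        famMap Z q (fun i => 𝟙 (b₀ (q.perm i))) ≫ famMap Z h' (b := fun i => b₀ (q.perm i))
          (fun i => 𝟙 (b₀ (q.perm (h'.perm i)))) := by
      refine Eq.trans ?_ (famMap_comp _ _ _ _ _).symm
      exact congrArg (famMap Z (q ≫ h')) (funext fun i => (Category.comp_id _).symm)
    have h6 : concatMap (q ≫ h').perm (b := b₀) (fun i => 𝟙 (b₀ (q.perm (h'.perm i)))) =
        concatMap q.perm (fun i => 𝟙 (b₀ (q.perm i))) ≫ concatMap h'.perm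
          (b := fun i => b₀ (q.perm i)) (fun i => 𝟙 (b₀ (q.perm (h'.perm i)))) := by
      refine Eq.trans ?_ (concatMap_comp _ _ _ _).symm
      exact congrArg (concatMap (q ≫ h').perm) (funext fun i => (Category.comp_id _).symm)
    have h7 : IsIso (famMap Z (q ≫ h') (b := b₀) (b' := fun i => b₀ (q.perm (h'.perm i)))
      (fun i => 𝟙 (b₀ (q.perm (h'.perm i))))) := isIso_famMap _ _ _
    rw [← cancel_epi (G.obj t s ◁ famMap Z (q ≫ h') (b := b₀)
      (fun i => 𝟙 (b₀ (q.perm (h'.perm i)))))]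
    refine Eq.trans ?_ h2.symm
    refine Eq.trans ?_ (h4.trans ?_)
    · rw [h5, ← h3, ← Category.assoc, ← Category.assoc, ← id_tensorHom, ← tensorHom_id,
        ← id_tensorHom, tensorHom_comp_tensorHom, tensorHom_comp_tensorHom, Category.comp_id,
        Category.id_comp]
      simp only [Category.comp_id]
    · rw [h6, Category.assoc]
  obtain ⟨F, hF⟩ := ((P.pres t a).whiskerRight (valFam Z a b)).exists_desc (fun x => v x.1 x.2) (by
    rintro ⟨s, h⟩ ⟨s', h'⟩ _ ⟨u, ⟨q, hq, hu⟩, rfl⟩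
    exact (key s s' q u h' hu).trans (congrArg (v s) hq))
  refine ⟨F, fun s h b' β => ?_⟩
  rw [MonoidalCategory.tensorHom_def', Category.assoc, hF ⟨s, h⟩]
  exact hv s h b' β

/-- A presentation of `U` induces a presentation of `U ∘ Z`. -/
theorem Generators.Presents.left [MonoidalClosed M] {G : Generators C M} {U : SymSeq C M}
    {g : ∀ t s, G.obj t s ⟶ U.val t (G.prof t s)} (P : G.Presents U g) (Z : SymSeq C M) :
    (G.left Z).Presents (circle U Z) (fun t s => g t s.1 ▷ valFam Z (G.prof t s.1) s.2 ≫
      circleGen U Z t (G.prof t s.1) s.2) := by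
  have hw : ∀ {t : C} {c : Profile C} (s : G.index t) (b : Fin (G.prof t s).len → Profile C)
      (k : concat b ⟶ c), (g t s ▷ valFam Z (G.prof t s) b ≫ circleGen U Z t (G.prof t s) b) ≫
        (circle U Z).act rfl k = g t s ▷ valFam Z (G.prof t s) b ≫
          circleIn U Z t b k := by
    intro t c s b k
    rw [Category.assoc, circleGen_act]
  refine ⟨fun t s => ⟨𝟙 _, 𝟙 _, fun i => 𝟙 _, P.refl t s.1, (concatMap_id s.2).symm, ?_⟩,
    fun t c => ⟨?_, ?_, ?_⟩⟩
  · exact (id_tensorHom_id _ _).symm.trans (congrArg (_ ⊗ₘ ·) (famMap_id Z _ s.2).symm)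
  · rintro ⟨⟨s, b⟩, k⟩ ⟨⟨s', b'⟩, k'⟩ _ ⟨_, hk, q, u, β, hu, rfl, rfl⟩
    dsimp only at hk q u β hu ⊢
    refine (congrArg (_ ≫ ·) (hw s' b' k')).trans (Eq.trans ?_ (hw s b k).symm)
    rw [← tensorHom_id, tensorHom_comp_tensorHom_assoc, P.w rfl hu, Category.comp_id]
    refine Eq.trans ?_ (congrArg (_ ≫ circleIn U Z t b ·) hk)
    refine Eq.trans ?_ (congrArg (_ ≫ ·) (circleIn_natural U Z t q β k'))
    rw [← tensorHom_id, tensorHom_comp_tensorHom_assoc, Category.id_comp]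
  · intro T f f' h
    refine (isPresentation_circleIn U Z t c).hom_ext (fun ⟨a, b, k⟩ => ?_)
    refine ((P.pres t a).whiskerRight (valFam Z a b)).hom_ext (fun x => ?_)
    obtain ⟨s, l⟩ := x
    dsimp only at l ⊢
    -- The summand at `(a, b)` is reached from the summand at the generator's own profile by an
    -- invertible permutation of the factors of `Z`, so it suffices to compare the morphisms on the
    -- latter.
    obtain ⟨b₀, rfl⟩ := exists_eq_comp_perm l b
    have h2 := h ⟨⟨s, b₀⟩, concatMap l.perm (b := b₀) (fun i => 𝟙 (b₀ (l.perm i))) ≫ k⟩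
    have h3 := circleIn_natural U Z t l (b := b₀) (fun i => 𝟙 (b₀ (l.perm i))) k
    have h4 := (hw s b₀ (concatMap l.perm (b := b₀) (fun i => 𝟙 (b₀ (l.perm i))) ≫ k)).trans
      (congrArg (_ ≫ ·) h3.symm)
    dsimp only [Generators.left] at h2
    rw [h4] at h2
    rw [← cancel_epi (G.obj t s ◁ famMap Z l (b := b₀) (fun i => 𝟙 (b₀ (l.perm i))))]
    rw [← tensorHom_id, tensorHom_comp_tensorHom_assoc, Category.id_comp] at h2
    rw [← tensorHom_id, ← id_tensorHom, tensorHom_comp_tensorHom_assoc,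
      tensorHom_comp_tensorHom_assoc, Category.id_comp, Category.comp_id]
    simpa only [Category.assoc] using h2
  · intro T f hf
    let f' : ∀ (s : G.index t) (b : Fin (G.prof t s).len → Profile C), (concat b ⟶ c) →
      (G.obj t s ⊗ valFam Z (G.prof t s) b ⟶ T) := fun s b k => f ⟨⟨s, b⟩, k⟩
    have h1 := P.exists_desc_whiskerRight Z (t := t) (c := c) f'
      (fun s s' q u b b' β k hu => hf (s := ⟨⟨s, b⟩, concatMap q.perm β ≫ k⟩)
        (s' := ⟨⟨s', b'⟩, k⟩) ⟨_, rfl, q, u, β, hu, rfl, rfl⟩)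
    choose F hF using h1
    -- The morphisms `F` on the summands are compatible with the relations of the two coends, since
    -- this can be tested on the generators of `U`.
    obtain ⟨Φ, hΦ⟩ := (isPresentation_circleIn U Z t c).exists_desc
      (fun x => F x.1 x.2.1 x.2.2) (by
        rintro ⟨a, b, k⟩ ⟨a', b', k'⟩ _ ⟨p, β, hk, rfl⟩
        dsimp only at hk p β ⊢
        refine ((P.pres t a).whiskerRight (valFam Z a b)).hom_ext (fun x => ?_)
        obtain ⟨s, l⟩ := x
        dsimp only at l ⊢
        obtain ⟨b₀, rfl⟩ := exists_eq_comp_perm l b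
        rw [← cancel_epi (G.obj t s ◁ famMap Z l (b := b₀) (fun i => 𝟙 (b₀ (l.perm i))))]
        have h2 := hF a _ k s l b₀ (fun i => 𝟙 (b₀ (l.perm i)))
        have h3 := hF a' b' k' s (l ≫ p) b₀ (fun i => 𝟙 (b₀ (l.perm (p.perm i))) ≫ β i)
        rw [← tensorHom_id, ← id_tensorHom, tensorHom_comp_tensorHom_assoc,
          tensorHom_comp_tensorHom_assoc, tensorHom_comp_tensorHom_assoc]
        simp only [Category.id_comp, Category.comp_id, Category.assoc]
        rw [h2, SymSeq.act_comp]
        refine (congrArg (fun z => (_ ⊗ₘ z) ≫ F a' b' k') (famMap_comp Z l p (b := b₀) (b' := fun i => b₀ (l.perm i)) (fun i => 𝟙 (b₀ (l.perm i))) β)).trans ?_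
        refine h3.trans (congrArg (f' s b₀) ?_)
        rw [← hk, ← Category.assoc]
        exact congrArg (· ≫ k') (concatMap_comp _ _ (b := b₀) (d := fun i => b₀ (l.perm i)) (fun i => 𝟙 (b₀ (l.perm i))) β).symm)
    refine ⟨Φ, ?_⟩
    rintro ⟨⟨s, b⟩, k⟩
    refine (congrArg (· ≫ Φ) (hw s b k)).trans ?_
    refine (Category.assoc _ _ _).trans ((congrArg (_ ≫ ·) (hΦ ⟨_, b, k⟩)).trans ?_)
    have h2 := hF _ b k s (𝟙 _) b (fun i => 𝟙 (b i))
    rw [SymSeq.act_id, famMap_id, Category.comp_id, tensorHom_id] at h2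
    refine h2.trans (congrArg (f' s b) ?_)
    exact (congrArg (· ≫ k) (concatMap_id b)).trans (Category.id_comp k)

end Generators

/-! ### Presentations in the right variable of the circle product. -/

section RightPresentation

variable {C : Type v} {M : Type u} [Category.{v} M] [MonoidalCategory M] [SymmetricCategory M]

/-- A permutation of the entries of a profile replaces colors by equal ones; this lemma carries a
generator along such an equality. -/
theorem Generators.Presents.exists_rel {G : Generators C M} {U : SymSeq C M}
    {g : ∀ t s, G.obj t s ⟶ U.val t (G.prof t s)} (P : G.Presents U g) {t t' : C} (h : t = t')
    (s : G.index t) : ∃ s' q u, G.rel h s s' q u := by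
  subst h
  exact ⟨s, _, _, P.refl t s⟩

theorem concatMap_blockHom {m n : ℕ} (σ : Fin n ≃ Fin m) {b : Fin m → Profile C}
    {d d' : Fin n → Profile C} (β : ∀ i, b (σ i) ⟶ d i) (γ : d ⟶ d') :
    concatMap σ β ≫ blockHom γ = concatMap σ (fun i => β i ≫ γ i) :=
  concatMap_comp _ _ _ _

theorem blockHom_concatMap {m n : ℕ} (σ : Fin n ≃ Fin m) {b b' : Fin m → Profile C}
    {d : Fin n → Profile C} (β : b ⟶ b') (γ : ∀ i, b' (σ i) ⟶ d i) :
    blockHom β ≫ concatMap σ γ = concatMap σ (fun i => β (σ i) ≫ γ i) :=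
  concatMap_comp _ _ _ _

variable [HasColimits M]

theorem circleIn_valFamMap (X Y : SymSeq C M) (t : C) {c a : Profile C}
    {b b' : Fin a.len → Profile C} (β : b ⟶ b') (g : concat b' ⟶ c) :
    X.val t a ◁ valFamMap Y a β ≫ circleIn X Y t b' g = circleIn X Y t b (blockHom β ≫ g) :=
  (circleι_condition_inner X Y t c a β g).symm

theorem circleGen_valFamMap (X Y : SymSeq C M) (t : C) {a : Profile C}
    {b b' : Fin a.len → Profile C} (β : b ⟶ b') :
    X.val t a ◁ valFamMap Y a β ≫ circleGen X Y t a b' =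
      circleGen X Y t a b ≫ (circle X Y).act rfl (blockHom β) :=
  (circleIn_valFamMap X Y t β (𝟙 _)).trans ((congrArg (circleIn X Y t b)
    (Category.comp_id _)).trans (circleGen_act X Y t b _).symm)

/-- A presentation of `V` induces a presentation of `X ∘ V`. -/
theorem Generators.Presents.right [MonoidalClosed M] {G : Generators C M} {V : SymSeq C M}
    {g : ∀ t s, G.obj t s ⟶ V.val t (G.prof t s)} (P : G.Presents V g) (X : SymSeq C M) :
    (G.right X).Presents (circle X V) (fun t s =>
      X.val t s.1 ◁ tensorFamMap s.1.len (fun k => g _ (s.2 k)) ≫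
        circleGen X V t s.1 (fun k => G.prof _ (s.2 k))) := by
  have hw : ∀ {t : C} {c e : Profile C} (s : ∀ k, G.index (e.col k))
      (h : concat (fun k => G.prof _ (s k)) ⟶ c),
      (X.val t e ◁ tensorFamMap e.len (fun k => g _ (s k)) ≫
        circleGen X V t e (fun k => G.prof _ (s k))) ≫ (circle X V).act rfl h =
      X.val t e ◁ tensorFamMap e.len (fun k => g _ (s k)) ≫ circleIn X V t _ h := by
    intro t c e s h
    rw [Category.assoc, circleGen_act]
  have hb : ∀ {t : C} {c e : Profile C} (s : ∀ k, G.index (e.col k)) {b : Fin e.len → Profile C}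
      (h : ∀ k, G.prof _ (s k) ⟶ b k) (k : concat b ⟶ c),
      X.val t e ◁ tensorFamMap e.len (fun k => g _ (s k) ≫ V.act rfl (h k)) ≫ circleIn X V t b k =
      X.val t e ◁ tensorFamMap e.len (fun k => g _ (s k)) ≫
        circleIn X V t _ (blockHom (b := fun k => G.prof _ (s k)) h ≫ k) := by
    intro t c e s b h k
    rw [← circleIn_valFamMap, ← whiskerLeft_comp_assoc, valFamMap, tensorFamMap_comp]
  have hu : ∀ {t t' : C} (ht : t = t') {e e' : Profile C} (p : e ⟶ e')
      (s : ∀ k, G.index (e.col k)) (s' : ∀ k, G.index (e'.col k))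
      (q : ∀ k, G.prof _ (s (p.perm k)) ⟶ G.prof _ (s' k))
      (u : ∀ k, G.obj _ (s (p.perm k)) ⟶ G.obj _ (s' k)),
      (∀ k, G.rel (p.col_perm k) (s (p.perm k)) (s' k) (q k) (u k)) →
      (X.act ht p ⊗ₘ reindex _ _ p.perm u) ≫
        X.val t' e' ◁ tensorFamMap e'.len (fun k => g _ (s' k)) =
      X.val t e ◁ tensorFamMap e.len (fun k => g _ (s k)) ≫ (X.act ht p ⊗ₘ famMap V p q) := by
    intro t t' ht e e' p s s' q u h
    rw [← id_tensorHom, ← id_tensorHom, tensorHom_comp_tensorHom, tensorHom_comp_tensorHom,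
      Category.comp_id, Category.id_comp, reindex_tensorFamMap, famMap, tensorFamMap_reindex]
    exact congrArg (fun z => X.act ht p ⊗ₘ reindex _ _ p.perm z) (funext fun k => P.w _ (h k))
  refine ⟨fun t s => ⟨𝟙 _, fun k => 𝟙 _, fun k => 𝟙 _, fun k => P.refl _ _,
    (concatMap_id _).symm, ?_⟩, fun t c => ⟨?_, ?_, ?_⟩⟩
  · exact ((congrArg₂ (· ⊗ₘ ·) (X.act_id t s.1) ((reindex_refl _ _).trans
      (tensorFamMap_id _ _))).trans (id_tensorHom_id _ _)).symm
  · rintro ⟨⟨e, s⟩, h⟩ ⟨⟨e', s'⟩, h'⟩ _ ⟨_, hk, p, q, u, hr, rfl, rfl⟩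
    dsimp only at hk p q u hr h h' ⊢
    refine (congrArg (_ ≫ ·) (hw s' h')).trans (Eq.trans ?_ (hw s h).symm)
    rw [← Category.assoc, hu rfl p s s' q u hr, Category.assoc, circleIn_natural]
    exact congrArg (_ ≫ circleIn X V t _ ·) hk
  · intro T f f' h
    refine (isPresentation_circleIn X V t c).hom_ext (fun ⟨a, b, k⟩ => ?_)
    -- A generator of a summand is a choice, for every entry of `a`, of a generator of `V` and a
    -- morphism from its profile to the corresponding block.
    refine ((IsPresentation.tensorFam a.len (fun i => P.pres (a.col i) (b i)) (fun i s =>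
      ⟨𝟙 _, Category.id_comp _, P.refl _ _⟩)).whiskerLeft (X.val t a)).hom_ext (fun x => ?_)
    have h2 := h ⟨⟨a, fun i => (x i).1⟩, blockHom (b := fun k => G.prof _ (x k).1)
      (fun i => (x i).2) ≫ k⟩
    dsimp only at h2 ⊢
    rw [hw, ← hb] at h2
    exact (Category.assoc _ _ _).symm.trans (h2.trans (Category.assoc _ _ _))
  · intro T f hf
    let f' : ∀ (e : Profile C) (s : ∀ k, G.index (e.col k)),
      (concat (fun k => G.prof _ (s k)) ⟶ c) →
      (X.val t e ⊗ tensorFam e.len (fun k => G.obj _ (s k)) ⟶ T) := fun e s h => f ⟨⟨e, s⟩, h⟩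
    have hf' : ∀ (e e' : Profile C) (p : e ⟶ e') (s : ∀ k, G.index (e.col k))
        (s' : ∀ k, G.index (e'.col k)) (q : ∀ k, G.prof _ (s (p.perm k)) ⟶ G.prof _ (s' k))
        (u : ∀ k, G.obj _ (s (p.perm k)) ⟶ G.obj _ (s' k)) (h),
        (∀ k, G.rel (p.col_perm k) (s (p.perm k)) (s' k) (q k) (u k)) →
        (X.act rfl p ⊗ₘ reindex _ _ p.perm u) ≫ f' e' s' h =
          f' e s (concatMap p.perm (b := fun k => G.prof _ (s k)) q ≫ h) := by
      intro e e' p s s' q u h hr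
      exact hf (s := ⟨⟨e, s⟩, concatMap p.perm (b := fun k => G.prof _ (s k)) q ≫ h⟩)
        (s' := ⟨⟨e', s'⟩, h⟩) ⟨_, rfl, p, q, u, hr, rfl, rfl⟩
    have h1 : ∀ (a : Profile C) (b : Fin a.len → Profile C) (k : concat b ⟶ c),
        ∃ F : X.val t a ⊗ valFam V a b ⟶ T, ∀ (s : ∀ i, G.index (a.col i))
          (h : ∀ i, G.prof _ (s i) ⟶ b i),
          X.val t a ◁ tensorFamMap a.len (fun i => g _ (s i) ≫ V.act rfl (h i)) ≫ F =
            f' a s (blockHom (b := fun k => G.prof _ (s k)) h ≫ k) := by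
      intro a b k
      obtain ⟨F, hF⟩ := ((IsPresentation.tensorFam a.len (fun i => P.pres (a.col i) (b i))
        (fun i s => ⟨𝟙 _, Category.id_comp _, P.refl _ _⟩)).whiskerLeft (X.val t a)).exists_desc
          (fun x => f' a (fun i => (x i).1) (blockHom (b := fun k => G.prof _ (x k).1)
            (fun i => (x i).2) ≫ k)) (by
          rintro x x' _ ⟨_, ⟨u, hu, rfl⟩, rfl⟩
          choose q hq hr using hu
          have h2 := hf' a a (𝟙 a) (fun i => (x i).1) (fun i => (x' i).1) q u
            (blockHom (b := fun k => G.prof _ (x' k).1) (fun i => (x' i).2) ≫ k) hr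
          have h3 : reindex _ _ (𝟙 a : a ⟶ a).perm u = tensorFamMap a.len u := reindex_refl _ _
          rw [SymSeq.act_id, id_tensorHom] at h2
          refine (congrArg (fun z => X.val t a ◁ z ≫ _) h3.symm).trans (h2.trans ?_)
          refine congrArg (f' a (fun i => (x i).1)) ?_
          refine (Category.assoc _ _ _).symm.trans (congrArg (· ≫ k) ?_)
          refine (concatMap_comp _ _ _ _).trans ?_
          exact congrArg (concatMap _) (funext hq))
      exact ⟨F, fun s h => hF (fun i => ⟨s i, h i⟩)⟩
    choose F hF using h1
    obtain ⟨Φ, hΦ⟩ := (isPresentation_circleIn X V t c).exists_desc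
      (fun x => F x.1 x.2.1 x.2.2) (by
        rintro ⟨a, b, k⟩ ⟨a', b', k'⟩ _ ⟨p, β, hk, rfl⟩
        dsimp only at hk p β ⊢
        refine ((IsPresentation.tensorFam a.len (fun i => P.pres (a.col i) (b i)) (fun i s =>
          ⟨𝟙 _, Category.id_comp _, P.refl _ _⟩)).whiskerLeft (X.val t a)).hom_ext (fun x => ?_)
        -- The generators are carried along `p` to generators `s'` over the entries of `a'`. Their
        -- morphisms to the blocks are obtained by undoing `q` and continuing with the old morphism
        -- and `β`, so that both ways around the square have the same underlying profile morphism.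
        have h2 : ∀ i, ∃ s' q u, G.rel (p.col_perm i) (x (p.perm i)).1 s' q u :=
          fun i => P.exists_rel _ _
        choose s' q u hr using h2
        have h3 := hF a b k (fun i => (x i).1) (fun i => (x i).2)
        have h4 := hF a' b' k' s' (fun i => inv (q i) ≫ (x (p.perm i)).2 ≫ β i)
        have h5 := hf' a a' p (fun i => (x i).1) s' q u (blockHom (b := fun k => G.prof _ (s' k))
          (fun i => inv (q i) ≫ (x (p.perm i)).2 ≫ β i) ≫ k') hr
        have h6 : tensorFamMap a.len (fun i => g _ (x i).1 ≫ V.act rfl (x i).2) ≫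
            famMap V p β = reindex _ _ p.perm u ≫ tensorFamMap a'.len
              (fun i => g _ (s' i) ≫ V.act rfl (inv (q i) ≫ (x (p.perm i)).2 ≫ β i)) := by
          rw [reindex_tensorFamMap, famMap, tensorFamMap_reindex]
          refine congrArg (reindex _ _ p.perm) (funext fun i => ?_)
          rw [← Category.assoc (u i), P.w _ (hr i), Category.assoc, Category.assoc,
            SymSeq.act_comp, SymSeq.act_comp, IsIso.hom_inv_id_assoc]
        refine Eq.trans ?_ (Eq.trans h5 (Eq.trans ?_ h3.symm))
        · rw [← h4, ← id_tensorHom, ← id_tensorHom, tensorHom_comp_tensorHom_assoc,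
            tensorHom_comp_tensorHom_assoc, Category.comp_id, Category.id_comp, h6]
        · refine congrArg (f' a (fun i => (x i).1)) ?_
          rw [← hk, ← Category.assoc, ← Category.assoc, concatMap_blockHom, blockHom_concatMap]
          simp only [IsIso.hom_inv_id_assoc])
    refine ⟨Φ, ?_⟩
    rintro ⟨⟨e, s⟩, h⟩
    refine (congrArg (· ≫ Φ) (hw s h)).trans ?_
    refine (Category.assoc _ _ _).trans ((congrArg (_ ≫ ·) (hΦ ⟨_, _, h⟩)).trans ?_)
    have h2 := hF _ _ h s (fun i => 𝟙 _)
    simp only [SymSeq.act_id, Category.comp_id] at h2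
    refine h2.trans (congrArg (f' e s) ?_)
    exact (congrArg (· ≫ h) (blockHom_id _)).trans (Category.id_comp h)

end RightPresentation

/-! ### Generators of threefold circle products, and the associator. -/

section Associator

variable {C : Type v} {M : Type u} [Category.{v} M] [MonoidalCategory M] [SymmetricCategory M]
  [HasColimits M] [MonoidalClosed M]

theorem presents_circle (X Y : SymSeq C M) :
    ((Generators.self X).left Y).Presents (circle X Y) (fun t s => circleGen X Y t s.1 s.2) := by
  have h := (Generators.presents_self X).left Y
  simp only [id_whiskerRight, Category.id_comp] at h
  exact h

theorem circle_hom_ext {X Y W : SymSeq C M} {F F' : circle X Y ⟶ W}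
    (h : ∀ t a b, circleGen X Y t a b ≫ SymSeq.app F t (concat b) =
      circleGen X Y t a b ≫ SymSeq.app F' t (concat b)) : F = F' :=
  (presents_circle X Y).hom_ext (fun t s => h t s.1 s.2)

theorem exists_circle_desc {X Y W : SymSeq C M}
    (f : ∀ t a (b : Fin a.len → Profile C), X.val t a ⊗ valFam Y a b ⟶ W.val t (concat b))
    (hf : ∀ t (a a' : Profile C) (p : a ⟶ a') (b : Fin a.len → Profile C)
      (b' : Fin a'.len → Profile C) (β : ∀ i, b (p.perm i) ⟶ b' i),
      (X.act rfl p ⊗ₘ famMap Y p β) ≫ f t a' b' = f t a b ≫ W.act rfl (concatMap p.perm β)) :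
    ∃ F : circle X Y ⟶ W, ∀ t a b, circleGen X Y t a b ≫ SymSeq.app F t (concat b) = f t a b := by
  obtain ⟨F, hF⟩ := (presents_circle X Y).exists_desc (W := W) (fun t s => f t s.1 s.2) (by
    rintro t ⟨a, b⟩ ⟨a', b'⟩ _ _ ⟨p, _, β, rfl, rfl, rfl⟩
    exact hf t a a' p b b' β)
  exact ⟨F, fun t a b => hF t ⟨a, b⟩⟩

/-- The canonical morphisms into `(X ∘ Y) ∘ Z`. -/
noncomputable def leftGen (X Y Z : SymSeq C M) (t : C) (e : Profile C) (d : Fin e.len → Profile C)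
    (b : Fin (concat d).len → Profile C) :
    (X.val t e ⊗ valFam Y e d) ⊗ valFam Z (concat d) b ⟶
      (circle (circle X Y) Z).val t (concat b) :=
  circleGen X Y t e d ▷ valFam Z (concat d) b ≫ circleGen (circle X Y) Z t (concat d) b

theorem presents_left (X Y Z : SymSeq C M) :
    (((Generators.self X).left Y).left Z).Presents (circle (circle X Y) Z)
      (fun t s => leftGen X Y Z t s.1.1 s.1.2 s.2) :=
  (presents_circle X Y).left Z

theorem leftGen_natural (X Y Z : SymSeq C M) {t t' : C} (ht : t = t') {e e' : Profile C}
    (p : e ⟶ e') {d : Fin e.len → Profile C} {d' : Fin e'.len → Profile C}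
    (δ : ∀ k, d (p.perm k) ⟶ d' k) {b : Fin (concat d).len → Profile C}
    {b' : Fin (concat d').len → Profile C} (β : ∀ j, b ((concatMap p.perm δ).perm j) ⟶ b' j) :
    ((X.act ht p ⊗ₘ famMap Y p δ) ⊗ₘ famMap Z (concatMap p.perm δ) β) ≫
        leftGen X Y Z t' e' d' b' =
      leftGen X Y Z t e d b ≫
        (circle (circle X Y) Z).act ht (concatMap (concatMap p.perm δ).perm β) :=
  (presents_left X Y Z).w ht (s := ⟨⟨e, d⟩, b⟩) (s' := ⟨⟨e', d'⟩, b'⟩)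
    ⟨_, _, β, ⟨p, _, δ, rfl, rfl, rfl⟩, rfl, rfl⟩

theorem leftGen_hom_ext {X Y Z W : SymSeq C M} {F F' : circle (circle X Y) Z ⟶ W}
    (h : ∀ t e d b, leftGen X Y Z t e d b ≫ SymSeq.app F t (concat b) =
      leftGen X Y Z t e d b ≫ SymSeq.app F' t (concat b)) : F = F' :=
  (presents_left X Y Z).hom_ext (fun t s => h t s.1.1 s.1.2 s.2)

theorem exists_leftGen_desc {X Y Z W : SymSeq C M}
    (f : ∀ t (e : Profile C) (d : Fin e.len → Profile C) (b : Fin (concat d).len → Profile C),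
      (X.val t e ⊗ valFam Y e d) ⊗ valFam Z (concat d) b ⟶ W.val t (concat b))
    (hf : ∀ t (e e' : Profile C) (p : e ⟶ e') (d : Fin e.len → Profile C)
      (d' : Fin e'.len → Profile C) (δ : ∀ k, d (p.perm k) ⟶ d' k)
      (b : Fin (concat d).len → Profile C) (b' : Fin (concat d').len → Profile C)
      (β : ∀ j, b ((concatMap p.perm δ).perm j) ⟶ b' j),
      ((X.act rfl p ⊗ₘ famMap Y p δ) ⊗ₘ famMap Z (concatMap p.perm δ) β) ≫ f t e' d' b' =
        f t e d b ≫ W.act rfl (concatMap (concatMap p.perm δ).perm β)) :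
    ∃ F : circle (circle X Y) Z ⟶ W,
      ∀ t e d b, leftGen X Y Z t e d b ≫ SymSeq.app F t (concat b) = f t e d b := by
  obtain ⟨F, hF⟩ := (presents_left X Y Z).exists_desc (W := W)
    (fun t s => f t s.1.1 s.1.2 s.2) (by
    rintro t ⟨⟨e, d⟩, b⟩ ⟨⟨e', d'⟩, b'⟩ _ _ ⟨_, _, β, ⟨p, _, δ, rfl, rfl, rfl⟩, rfl, rfl⟩
    exact hf t e e' p d d' δ b b' β)
  exact ⟨F, fun t e d b => hF t ⟨⟨e, d⟩, b⟩⟩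

/-- The canonical morphisms into `X ∘ (Y ∘ Z)`. -/
noncomputable def rightGen (X Y Z : SymSeq C M) (t : C) (e : Profile C) (d : Fin e.len → Profile C)
    (c : ∀ k, Fin (d k).len → Profile C) :
    X.val t e ⊗ tensorFam e.len (fun k => Y.val (e.col k) (d k) ⊗ valFam Z (d k) (c k)) ⟶
      (circle X (circle Y Z)).val t (concat (fun k => concat (c k))) :=
  X.val t e ◁ tensorFamMap e.len (fun k => circleGen Y Z (e.col k) (d k) (c k)) ≫
    circleGen X (circle Y Z) t e (fun k => concat (c k))

theorem presents_right (X Y Z : SymSeq C M) :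
    (((Generators.self Y).left Z).right X).Presents (circle X (circle Y Z))
      (fun t s => rightGen X Y Z t s.1 (fun k => (s.2 k).1) (fun k => (s.2 k).2)) :=
  (presents_circle Y Z).right X

theorem rightGen_natural (X Y Z : SymSeq C M) {t t' : C} (ht : t = t') {e e' : Profile C}
    (p : e ⟶ e') {d : Fin e.len → Profile C} {d' : Fin e'.len → Profile C}
    (δ : ∀ k, d (p.perm k) ⟶ d' k) {c : ∀ k, Fin (d k).len → Profile C}
    {c' : ∀ k, Fin (d' k).len → Profile C} (γ : ∀ k l, c (p.perm k) ((δ k).perm l) ⟶ c' k l) :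
    (X.act ht p ⊗ₘ reindex e'.len e.len p.perm
        (fun k => Y.act (p.col_perm k) (δ k) ⊗ₘ famMap Z (δ k) (γ k))) ≫
        rightGen X Y Z t' e' d' c' =
      rightGen X Y Z t e d c ≫ (circle X (circle Y Z)).act ht
        (concatMap p.perm (fun k => concatMap (δ k).perm (γ k))) :=
  (presents_right X Y Z).w ht (s := ⟨e, fun k => ⟨d k, c k⟩⟩) (s' := ⟨e', fun k => ⟨d' k, c' k⟩⟩)
    ⟨p, _, _, fun k => ⟨δ k, _, γ k, rfl, rfl, rfl⟩, rfl, rfl⟩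

theorem rightGen_hom_ext {X Y Z W : SymSeq C M} {F F' : circle X (circle Y Z) ⟶ W}
    (h : ∀ t e d c, rightGen X Y Z t e d c ≫ SymSeq.app F t _ =
      rightGen X Y Z t e d c ≫ SymSeq.app F' t _) : F = F' :=
  (presents_right X Y Z).hom_ext (fun t s => h t s.1 (fun k => (s.2 k).1) (fun k => (s.2 k).2))

theorem exists_rightGen_desc {X Y Z W : SymSeq C M}
    (f : ∀ t (e : Profile C) (d : Fin e.len → Profile C) (c : ∀ k, Fin (d k).len → Profile C),
      X.val t e ⊗ tensorFam e.len (fun k => Y.val (e.col k) (d k) ⊗ valFam Z (d k) (c k)) ⟶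
        W.val t (concat (fun k => concat (c k))))
    (hf : ∀ t (e e' : Profile C) (p : e ⟶ e') (d : Fin e.len → Profile C)
      (d' : Fin e'.len → Profile C) (δ : ∀ k, d (p.perm k) ⟶ d' k)
      (c : ∀ k, Fin (d k).len → Profile C) (c' : ∀ k, Fin (d' k).len → Profile C)
      (γ : ∀ k l, c (p.perm k) ((δ k).perm l) ⟶ c' k l),
      (X.act rfl p ⊗ₘ reindex e'.len e.len p.perm
        (fun k => Y.act (p.col_perm k) (δ k) ⊗ₘ famMap Z (δ k) (γ k))) ≫ f t e' d' c' =
        f t e d c ≫ W.act rfl (concatMap p.perm (fun k => concatMap (δ k).perm (γ k)))) :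
    ∃ F : circle X (circle Y Z) ⟶ W,
      ∀ t e d c, rightGen X Y Z t e d c ≫ SymSeq.app F t _ = f t e d c := by
  obtain ⟨F, hF⟩ := (presents_right X Y Z).exists_desc (W := W)
    (fun t s => f t s.1 (fun k => (s.2 k).1) (fun k => (s.2 k).2)) (by
    rintro t ⟨e, s⟩ ⟨e', s'⟩ _ _ ⟨p, q, u, h, rfl, rfl⟩
    choose δ u' γ hu hq hu' using h
    obtain rfl : u = _ := funext hu'
    obtain rfl : q = _ := funext hq
    obtain rfl : u' = _ := funext hu
    exact hf t e e' p (fun k => (s k).1) (fun k => (s' k).1) δ (fun k => (s k).2)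
      (fun k => (s' k).2) γ)
  exact ⟨F, fun t e d c => hF t ⟨e, fun k => ⟨d k, c k⟩⟩⟩

/-- Families indexed by the entries of the blocks of a concatenation. -/
noncomputable def blockFamilies {m : ℕ} (d : Fin m → Profile C) :
    (Fin (concat d).len → Profile C) ≃ (∀ k, Fin (d k).len → Profile C) :=
  ((pos d).arrowCongr (Equiv.refl _)).symm.trans (Equiv.piCurry (fun (k : Fin m) (_ : Fin (d k).len) => Profile C))

/-- The summand of the associator of the circle product. -/
noncomputable def assocSummand (X Y Z : SymSeq C M) (t : C) (e : Profile C)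
    {d : Fin e.len → Profile C} {b : Fin (concat d).len → Profile C}
    {c : ∀ k, Fin (d k).len → Profile C} (ζ : ∀ k l, b (pos d ⟨k, l⟩) ⟶ c k l) :
    (X.val t e ⊗ valFam Y e d) ⊗ valFam Z (concat d) b ⟶
      X.val t e ⊗ tensorFam e.len (fun k => Y.val (e.col k) (d k) ⊗ valFam Z (d k) (c k)) :=
  (α_ _ _ _).hom ≫ X.val t e ◁ distributeTo Y Z e ζ

instance (X Y Z : SymSeq C M) (t : C) (e : Profile C)
    {d : Fin e.len → Profile C} {b : Fin (concat d).len → Profile C}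
    {c : ∀ k, Fin (d k).len → Profile C} (ζ : ∀ k l, b (pos d ⟨k, l⟩) ⟶ c k l) :
    IsIso (assocSummand X Y Z t e ζ) :=
  inferInstanceAs (IsIso (_ ≫ _))

theorem assocSummand_natural (X Y Z : SymSeq C M) {t t' : C} (ht : t = t') {e e' : Profile C}
    (p : e ⟶ e')
    {d : Fin e.len → Profile C} {d' : Fin e'.len → Profile C}
    (δ : ∀ k, d (p.perm k) ⟶ d' k) {b : Fin (concat d).len → Profile C}
    {b' : Fin (concat d').len → Profile C} (β : ∀ j, b ((concatMap p.perm δ).perm j) ⟶ b' j)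
    {c : ∀ k, Fin (d k).len → Profile C} {c' : ∀ k, Fin (d' k).len → Profile C}
    (ζ : ∀ k l, b (pos d ⟨k, l⟩) ⟶ c k l) (ζ' : ∀ k l, b' (pos d' ⟨k, l⟩) ⟶ c' k l)
    (γ : ∀ k l, c (p.perm k) ((δ k).perm l) ⟶ c' k l)
    (h : ∀ k l, β (pos d' ⟨k, l⟩) ≫ ζ' k l =
      eqToHom (congrArg b (concatMap_perm_pos p.perm δ k l)) ≫ ζ _ _ ≫ γ k l) :
    ((X.act ht p ⊗ₘ famMap Y p δ) ⊗ₘ famMap Z (concatMap p.perm δ) β) ≫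
        assocSummand X Y Z t' e' ζ' =
      assocSummand X Y Z t e ζ ≫ (X.act ht p ⊗ₘ reindex e'.len e.len p.perm
        (fun k => Y.act (p.col_perm k) (δ k) ⊗ₘ famMap Z (δ k) (γ k))) := by
  have h1 := distributeTo_natural Y Z p δ β ζ ζ' γ h
  rw [assocSummand, assocSummand, associator_naturality_assoc, Category.assoc, ← id_tensorHom,
    ← id_tensorHom, tensorHom_comp_tensorHom, tensorHom_comp_tensorHom, h1, Category.comp_id,
    Category.id_comp]

/-- On a generator the summands are rebracketed; the inverse of the associativity of concatenation
then leads back to the profile of the source. The relations are respected because both operations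
are natural for permutations. -/
theorem exists_assocHom (X Y Z : SymSeq C M) :
    ∃ F : circle (circle X Y) Z ⟶ circle X (circle Y Z), ∀ t e d b,
      leftGen X Y Z t e d b ≫ SymSeq.app F t (concat b) =
        assocSummand X Y Z t e (fun k l => 𝟙 (b (pos d ⟨k, l⟩))) ≫ rightGen X Y Z t e d _ ≫
          (circle X (circle Y Z)).act rfl (inv (concatAssoc (fun k l => 𝟙 (b (pos d ⟨k, l⟩))))) := by
  refine exists_leftGen_desc _ (fun t e e' p d d' δ b b' β => ?_)
  -- As the comparison morphisms are identities, the morphism of the innermost profiles is forced: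
  -- it is `β` up to the transport of its source.
  have h : ∀ k l, β (pos d' ⟨k, l⟩) ≫ 𝟙 (b' (pos d' ⟨k, l⟩)) =
      eqToHom (congrArg b (concatMap_perm_pos p.perm δ k l)) ≫ 𝟙 (b (pos d _)) ≫
        eqToHom (congrArg b (concatMap_perm_pos p.perm δ k l)).symm ≫ β (pos d' ⟨k, l⟩) := by
    simp
  have h3 := rightGen_natural X Y Z (rfl : t = t) p δ (c := fun k l => b (pos d ⟨k, l⟩))
    (c' := fun k l => b' (pos d' ⟨k, l⟩))
    (fun k l => eqToHom (congrArg b (concatMap_perm_pos p.perm δ k l)).symm ≫ β (pos d' ⟨k, l⟩))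
  rw [← Category.assoc, assocSummand_natural X Y Z rfl p δ β (fun k l => 𝟙 (b (pos d ⟨k, l⟩)))
    (fun k l => 𝟙 (b' (pos d' ⟨k, l⟩)))
    (fun k l => eqToHom (congrArg b (concatMap_perm_pos p.perm δ k l)).symm ≫ β (pos d' ⟨k, l⟩)) h,
    Category.assoc]
  refine (congrArg (_ ≫ ·) ((Category.assoc _ _ _).symm.trans (congrArg (· ≫ _) h3))).trans ?_
  rw [Category.assoc, Category.assoc, Category.assoc, SymSeq.act_comp, SymSeq.act_comp]
  have h2 := concatAssoc_natural p.perm δ β (fun k l => 𝟙 (b (pos d ⟨k, l⟩)))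
    (fun k l => 𝟙 (b' (pos d' ⟨k, l⟩)))
    (fun k l => eqToHom (congrArg b (concatMap_perm_pos p.perm δ k l)).symm ≫ β (pos d' ⟨k, l⟩)) h
  refine congrArg (fun z => _ ≫ _ ≫ (circle X (circle Y Z)).act rfl z) ?_
  rw [IsIso.comp_inv_eq, Category.assoc]
  refine Eq.trans ?_ (congrArg (inv _ ≫ ·) h2).symm
  exact (IsIso.inv_hom_id_assoc _ _).symm

/-- The associator of the circle product. -/
noncomputable def assocHom (X Y Z : SymSeq C M) :
    circle (circle X Y) Z ⟶ circle X (circle Y Z) := (exists_assocHom X Y Z).choose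

/-- The comparison `ζ` need not be the identity: naturality of the right-hand generators absorbs it.
This makes the formula usable when the restriction of `b` to the blocks is only identified with `c`
by transports, as in the triangle and the pentagon. -/
theorem leftGen_assocHom (X Y Z : SymSeq C M) (t : C) (e : Profile C) {d : Fin e.len → Profile C}
    {b : Fin (concat d).len → Profile C} {c : ∀ k, Fin (d k).len → Profile C}
    (ζ : ∀ k l, b (pos d ⟨k, l⟩) ⟶ c k l) :
    leftGen X Y Z t e d b ≫ SymSeq.app (assocHom X Y Z) t (concat b) =
      assocSummand X Y Z t e ζ ≫ rightGen X Y Z t e d c ≫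
        (circle X (circle Y Z)).act rfl (inv (concatAssoc ζ)) := by
  obtain ⟨b, rfl⟩ : ∃ b', b = b' := ⟨b, rfl⟩
  refine ((exists_assocHom X Y Z).choose_spec t e d b).trans ?_
  have h1 := distributeTo_comp Y Z e (fun k l => 𝟙 (b (pos d ⟨k, l⟩))) ζ
  simp only [Category.id_comp] at h1
  have h2 := rightGen_natural X Y Z (rfl : t = t) (𝟙 e) (fun k => 𝟙 (d k))
    (c := fun k l => b (pos d ⟨k, l⟩)) (c' := c) ζ
  have h3 : X.act (rfl : t = t) (𝟙 e) ⊗ₘ reindex e.len e.len (𝟙 e : e ⟶ e).perm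
      (fun k => Y.act ((𝟙 e : e ⟶ e).col_perm k) (𝟙 (d k)) ⊗ₘ famMap Z (𝟙 (d k)) (ζ k)) =
      X.val t e ◁ tensorFamMap e.len (fun k => Y.val (e.col k) (d k) ◁ valFamMap Z (d k) (ζ k)) := by
    rw [SymSeq.act_id, id_tensorHom]
    refine congrArg (_ ◁ ·) ((reindex_refl _ _).trans (congrArg _ (funext fun k => ?_)))
    exact (congrArg₂ (· ⊗ₘ ·) (SymSeq.act_id _ _ _) (famMap_id_left Z (ζ k))).trans
      (id_tensorHom _ _)
  have h4 : concatAssoc ζ = concatAssoc (fun k l => 𝟙 (b (pos d ⟨k, l⟩))) ≫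
      concatMap (𝟙 e : e ⟶ e).perm (b := fun k => concat (fun l => b (pos d ⟨k, l⟩)))
        (d := fun k => concat (c k)) (fun k => concatMap (𝟙 (d k) : d k ⟶ d k).perm (ζ k)) := by
    rw [concatAssoc_id]
    rfl
  rw [assocSummand, assocSummand, ← h1, MonoidalCategory.whiskerLeft_comp, Category.assoc,
    Category.assoc, Category.assoc]
  refine congrArg (_ ≫ _ ≫ ·) ?_
  rw [← Category.assoc (_ ◁ _)]
  refine Eq.trans ?_ (congrArg (· ≫ _) (h2.symm.trans (congrArg (· ≫ _) h3))) 
  rw [Category.assoc, SymSeq.act_comp]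
  refine congrArg (fun z => _ ≫ (circle X (circle Y Z)).act rfl z) ?_
  rw [IsIso.eq_comp_inv, h4, IsIso.inv_hom_id_assoc]
  rfl

/-- This is the naturality behind the associator, solved for the inverses. It lets the inverse of
the associator respect the relations of `X ∘ (Y ∘ Z)`. -/
theorem assocInv_natural (X Y Z : SymSeq C M) {t : C} {e e' : Profile C} (p : e ⟶ e')
    {d : Fin e.len → Profile C} {d' : Fin e'.len → Profile C}
    (δ : ∀ k, d (p.perm k) ⟶ d' k) (b : Fin (concat d).len → Profile C)
    (b' : Fin (concat d').len → Profile C)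
    (γ : ∀ k l, b (pos d ⟨p.perm k, (δ k).perm l⟩) ⟶ b' (pos d' ⟨k, l⟩)) :
    (X.act (rfl : t = t) p ⊗ₘ reindex e'.len e.len p.perm
        (fun k => Y.act (p.col_perm k) (δ k) ⊗ₘ famMap Z (δ k) (γ k))) ≫
        inv (assocSummand X Y Z t e' (fun k l => 𝟙 (b' (pos d' ⟨k, l⟩)))) ≫
          leftGen X Y Z t e' d' b' ≫ (circle (circle X Y) Z).act rfl
            (concatAssoc (fun k l => 𝟙 (b' (pos d' ⟨k, l⟩)))) =
      (inv (assocSummand X Y Z t e (fun k l => 𝟙 (b (pos d ⟨k, l⟩)))) ≫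
          leftGen X Y Z t e d b ≫ (circle (circle X Y) Z).act rfl
            (concatAssoc (fun k l => 𝟙 (b (pos d ⟨k, l⟩))))) ≫
        (circle (circle X Y) Z).act rfl
          (concatMap p.perm (fun k => concatMap (δ k).perm (γ k))) := by
  -- Here `γ` is given on pairs of a block and an entry, and `β` is recovered from it, since every
  -- entry of the concatenation is of this form.
  obtain ⟨β, hβ⟩ := exists_family_comp_equiv (pos d')
    (F := fun j => b ((concatMap p.perm δ).perm j) ⟶ b' j)
    (fun x => eqToHom (congrArg b (concatMap_perm_pos p.perm δ x.1 x.2)) ≫ γ x.1 x.2)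
  have h : ∀ k l, β (pos d' ⟨k, l⟩) ≫ 𝟙 (b' (pos d' ⟨k, l⟩)) =
      eqToHom (congrArg b (concatMap_perm_pos p.perm δ k l)) ≫ 𝟙 (b (pos d _)) ≫ γ k l :=
    fun k l => (Category.comp_id _).trans
      ((hβ ⟨k, l⟩).trans (congrArg (_ ≫ ·) (Category.id_comp _).symm))
  have h1 := assocSummand_natural X Y Z (rfl : t = t) p δ β (fun k l => 𝟙 (b (pos d ⟨k, l⟩)))
    (fun k l => 𝟙 (b' (pos d' ⟨k, l⟩))) γ h
  have h2 := concatAssoc_natural p.perm δ β (fun k l => 𝟙 (b (pos d ⟨k, l⟩)))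
    (fun k l => 𝟙 (b' (pos d' ⟨k, l⟩))) γ h
  have h3 := leftGen_natural X Y Z (rfl : t = t) p δ β
  rw [← cancel_epi (assocSummand X Y Z t e (fun k l => 𝟙 (b (pos d ⟨k, l⟩)))),
    ← Category.assoc]
  refine (congrArg (· ≫ _) h1.symm).trans ?_
  rw [Category.assoc, IsIso.hom_inv_id_assoc, ← Category.assoc, h3, Category.assoc,
    SymSeq.act_comp, Category.assoc, IsIso.hom_inv_id_assoc, Category.assoc, SymSeq.act_comp]
  exact congrArg (fun z => _ ≫ (circle (circle X Y) Z).act rfl z) h2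

/-- Every family of profiles over the entries of the blocks is the restriction of a unique family
over the concatenation (`blockFamilies`). The inverse may therefore be prescribed on generators
indexed by the latter. -/
theorem exists_assocInv (X Y Z : SymSeq C M) :
    ∃ F : circle X (circle Y Z) ⟶ circle (circle X Y) Z, ∀ t e d
      (b : Fin (concat d).len → Profile C), rightGen X Y Z t e d (fun k l => b (pos d ⟨k, l⟩)) ≫
        SymSeq.app F t _ =
        inv (assocSummand X Y Z t e (fun k l => 𝟙 (b (pos d ⟨k, l⟩)))) ≫
          leftGen X Y Z t e d b ≫ (circle (circle X Y) Z).act rfl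
            (concatAssoc (fun k l => 𝟙 (b (pos d ⟨k, l⟩)))) := by
  have h : ∀ t (e : Profile C) (d : Fin e.len → Profile C),
      ∃ f : ∀ c : ∀ k, Fin (d k).len → Profile C,
        X.val t e ⊗ tensorFam e.len (fun k => Y.val (e.col k) (d k) ⊗ valFam Z (d k) (c k)) ⟶
          (circle (circle X Y) Z).val t (concat (fun k => concat (c k))),
      ∀ b, f (blockFamilies d b) =
        inv (assocSummand X Y Z t e (fun k l => 𝟙 (b (pos d ⟨k, l⟩)))) ≫
          leftGen X Y Z t e d b ≫ (circle (circle X Y) Z).act rfl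
            (concatAssoc (fun k l => 𝟙 (b (pos d ⟨k, l⟩)))) := fun t e d =>
    exists_family_comp_equiv (blockFamilies d) _
  choose f hf using h
  obtain ⟨F, hF⟩ := exists_rightGen_desc f (fun t e e' p d d' δ c c' γ => by
    obtain ⟨b, rfl⟩ := (blockFamilies d).surjective c
    obtain ⟨b', rfl⟩ := (blockFamilies d').surjective c'
    exact (congrArg (_ ≫ ·) (hf t e' d' b')).trans
      ((assocInv_natural X Y Z p δ b b' γ).trans (congrArg (· ≫ _) (hf t e d b)).symm))
  exact ⟨F, fun t e d b => (hF t e d _).trans (hf t e d b)⟩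

/-- The associator of the circle product, as an isomorphism. -/
noncomputable def assocIso (X Y Z : SymSeq C M) :
    circle (circle X Y) Z ≅ circle X (circle Y Z) where
  hom := assocHom X Y Z
  inv := (exists_assocInv X Y Z).choose
  hom_inv_id := by
    refine leftGen_hom_ext (fun t e d b => ?_)
    have h := (exists_assocInv X Y Z).choose_spec t e d b
    rw [SymSeq.comp_app, ← Category.assoc, leftGen_assocHom X Y Z t e
      (fun k l => 𝟙 (b (pos d ⟨k, l⟩))), Category.assoc, Category.assoc, SymSeq.act_app,
      ← Category.assoc (rightGen _ _ _ _ _ _ _), h, Category.assoc, Category.assoc,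
      SymSeq.act_comp, IsIso.hom_inv_id_assoc, IsIso.hom_inv_id, SymSeq.act_id]
    rfl
  inv_hom_id := by
    refine rightGen_hom_ext (fun t e d c => ?_)
    obtain ⟨b, rfl⟩ := (blockFamilies d).surjective c
    have h := (exists_assocInv X Y Z).choose_spec t e d b
    have h2 := leftGen_assocHom X Y Z t e (fun k l => 𝟙 (b (pos d ⟨k, l⟩)))
    rw [SymSeq.comp_app, ← Category.assoc]
    refine (congrArg (· ≫ SymSeq.app (assocHom X Y Z) t _) h).trans ?_
    rw [Category.assoc, Category.assoc, SymSeq.act_app, ← Category.assoc (leftGen _ _ _ _ _ _ _),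
      h2, Category.assoc, Category.assoc, SymSeq.act_comp, IsIso.inv_hom_id_assoc,
      IsIso.inv_hom_id, SymSeq.act_id]
    rfl

end Associator

/-! ### The unitors of the circle product. -/

section Unitors

variable {C : Type v} {M : Type u} [Category.{v} M] [MonoidalCategory M] [SymmetricCategory M]
  [HasColimits M]

theorem circleIn_app {X X' Y Y' : SymSeq C M} (x : X ⟶ X') (y : Y ⟶ Y') (t : C) {a c : Profile C}
    (b : Fin a.len → Profile C) (g : concat b ⟶ c) :
    circleIn X Y t b g ≫ SymSeq.app (circleHom x y) t c =
      (SymSeq.app x t a ⊗ₘ tensorFamMap a.len (fun i => SymSeq.app y (a.col i) (b i))) ≫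
        circleIn X' Y' t b g :=
  circleι_app x y t b g

/-- The morphism of profiles of length one that is given by an equality of colors. -/
def singleHom {t t' : C} (h : t = t') : single t ⟶ single t' := ⟨Equiv.refl _, fun _ => h⟩

theorem circleUnitι_act' {t t' : C} (h : t = t') (q : single t ⟶ single t') :
    circleUnitι t ≫ (circleUnit : SymSeq C M).act h q = circleUnitι t' :=
  (Generators.presents_unit.w (M := M) h (s := ⟨⟩) (s' := ⟨⟩) (q := q) rfl).symm.trans
    (Category.id_comp _)

theorem concatOne_natural {b b' : Profile C} (f : b ⟶ b') :
    concatMap (Equiv.refl (Fin 1)) (b := fun _ => b) (d := fun _ => b') (fun _ => f) ≫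
      concatOne b' = concatOne b ≫ f := by
  ext1
  ext1 i
  exact concatMap_perm_pos _ _ _ _

/-- The canonical morphism `U(t; s) ⊗ X(s; b) ⟶ (U ∘ X)(t; b)`. -/
noncomputable def circleOne (U X : SymSeq C M) (t s : C) (b : Profile C) :
    U.val t (single s) ⊗ (X.val s b ⊗ 𝟙_ M) ⟶ (circle U X).val t b :=
  circleIn U X t (a := single s) (fun _ => b) (concatOne b)

theorem circleOne_act (U X : SymSeq C M) (t s : C) {b b' : Profile C} (f : b ⟶ b') :
    U.val t (single s) ◁ (X.act rfl f ▷ 𝟙_ M) ≫ circleOne U X t s b' =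
      circleOne U X t s b ≫ (circle U X).act rfl f := by
  have h := circleIn_natural U X t (𝟙 (single s)) (b := fun _ => b) (b' := fun _ => b')
    (fun _ => f) (concatOne b')
  refine Eq.trans (congrArg (· ≫ circleOne U X t s b') ?_) (h.trans ?_)
  · rw [famMap_id_left, SymSeq.act_id, id_tensorHom, ← tensorHom_id]
    rfl
  · refine (congrArg (circleIn U X t (a := single s) (fun _ => b)) (concatOne_natural f)).trans ?_
    exact (circleIn_act U X t (a := single s) (fun _ => b) (concatOne b) f).symm

theorem circleOne_app {U U' X X' : SymSeq C M} (u : U ⟶ U') (x : X ⟶ X') (t s : C) (b : Profile C) :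
    circleOne U X t s b ≫ SymSeq.app (circleHom u x) t b =
      (SymSeq.app u t (single s) ⊗ₘ (SymSeq.app x s b ▷ 𝟙_ M)) ≫ circleOne U' X' t s b := by
  refine (circleIn_app u x t (a := single s) (fun _ => b) (concatOne b)).trans ?_
  rw [← tensorHom_id]
  rfl

theorem circleGen_single (U X : SymSeq C M) (t s : C) (b : Profile C) :
    circleGen U X t (single s) (fun _ => b) =
      circleOne U X t s b ≫ (circle U X).act rfl (inv (concatOne b)) := by
  exact (congrArg (circleIn U X t (a := single s) (fun _ => b))
    (IsIso.hom_inv_id (concatOne b)).symm).trans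
    (circleIn_act U X t (a := single s) (fun _ => b) (concatOne b) _).symm

/-- The canonical morphism `X(t; b) ⟶ (I ∘ X)(t; b)`. -/
noncomputable def leftUnitGen (X : SymSeq C M) (t : C) (b : Profile C) :
    X.val t b ⟶ (circle circleUnit X).val t b :=
  (λ_ (X.val t b)).inv ≫ (circleUnitι t ⊗ₘ (ρ_ (X.val t b)).inv) ≫ circleOne circleUnit X t t b

theorem leftUnitGen_natural (X : SymSeq C M) {t t' : C} (h : t = t') {b b' : Profile C}
    (f : b ⟶ b') :
    X.act h f ≫ leftUnitGen X t' b' = leftUnitGen X t b ≫ (circle circleUnit X).act h f := by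
  subst h
  rw [leftUnitGen, leftUnitGen, leftUnitor_inv_naturality_assoc, Category.assoc, Category.assoc,
    ← circleOne_act, ← id_tensorHom, ← id_tensorHom, tensorHom_comp_tensorHom_assoc,
    tensorHom_comp_tensorHom_assoc, Category.id_comp, Category.comp_id, rightUnitor_inv_naturality]

theorem leftUnitGen_app {X Y : SymSeq C M} (x : X ⟶ Y) (t : C) (b : Profile C) :
    leftUnitGen X t b ≫ SymSeq.app (circleHom (𝟙 circleUnit) x) t b =
      SymSeq.app x t b ≫ leftUnitGen Y t b := by
  rw [leftUnitGen, leftUnitGen, leftUnitor_inv_naturality_assoc, Category.assoc, Category.assoc,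
    circleOne_app, SymSeq.id_app, ← id_tensorHom, tensorHom_comp_tensorHom_assoc,
    tensorHom_comp_tensorHom_assoc, Category.comp_id, Category.id_comp, rightUnitor_inv_naturality]

/-- The inverse of the left unitor of the circle product. -/
noncomputable def leftUnitorInv (X : SymSeq C M) : X ⟶ circle circleUnit X where
  app x := leftUnitGen X x.2.as x.1
  naturality := by
    rintro ⟨a, ⟨t⟩⟩ ⟨a', ⟨t'⟩⟩ ⟨q, h⟩
    obtain rfl : t = t' := Discrete.eq_of_hom h
    exact leftUnitGen_natural X (rfl : t = t) q

/-- Up to the unitors of `M`, the generators of `I ∘ X` are the components of the candidate inverse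
of the left unitor. -/
theorem circleUnitι_circleOne (X : SymSeq C M) (t : C) (b : Profile C) :
    circleUnitι t ▷ (X.val t b ⊗ 𝟙_ M) ≫ circleOne circleUnit X t t b =
      (λ_ (X.val t b ⊗ 𝟙_ M)).hom ≫ (ρ_ (X.val t b)).hom ≫ leftUnitGen X t b := by
  rw [leftUnitGen, MonoidalCategory.tensorHom_def', Category.assoc,
    ← leftUnitor_inv_naturality_assoc, Iso.hom_inv_id_assoc, Iso.hom_inv_id_assoc]

theorem circleUnitι_circleOne_app {X W : SymSeq C M} (F : circle circleUnit X ⟶ W) (t : C)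
    {b c : Profile C} (k : b ⟶ c) :
    (circleUnitι t ▷ (X.val t b ⊗ 𝟙_ M) ≫ circleOne circleUnit X t t b ≫
        (circle circleUnit X).act rfl k) ≫ SymSeq.app F t c =
      (λ_ (X.val t b ⊗ 𝟙_ M)).hom ≫ (ρ_ (X.val t b)).hom ≫
        (leftUnitGen X t b ≫ SymSeq.app F t b) ≫ W.act rfl k := by
  rw [← Category.assoc (circleUnitι t ▷ _), circleUnitι_circleOne]
  simp only [Category.assoc]
  rw [SymSeq.act_app]

theorem whiskerLeft_whiskerRight_unitors (X : SymSeq C M) (t : C) {b b' c c' : Profile C}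
    (β : b ⟶ b') (k : b ⟶ c) (k' : b' ⟶ c') (m : c ⟶ c') (h : β ≫ k' = k ≫ m) :
    𝟙_ M ◁ (X.act (rfl : t = t) β ▷ 𝟙_ M) ≫ (λ_ (X.val t b' ⊗ 𝟙_ M)).hom ≫
        (ρ_ (X.val t b')).hom ≫ X.act rfl k' =
      ((λ_ (X.val t b ⊗ 𝟙_ M)).hom ≫ (ρ_ (X.val t b)).hom ≫ X.act rfl k) ≫ X.act rfl m := by
  rw [leftUnitor_naturality_assoc, rightUnitor_naturality_assoc, Category.assoc, Category.assoc,
    SymSeq.act_comp, SymSeq.act_comp, h]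

theorem exists_eq_const {t : C} {A : Type*} (b : Fin (single t).len → A) : ∃ c, b = fun _ => c :=
  ⟨b (0 : Fin 1), funext fun i => congrArg b (Subsingleton.elim (α := Fin 1) _ _)⟩

/-- The candidate inverse is an epimorphism: the unit has one generator for each color, so by
`circleUnitι_circleOne_app` a morphism out of `I ∘ X` is determined on its image. -/
theorem leftUnitorInv_hom_ext [MonoidalClosed M] {X W : SymSeq C M}
    {F F' : circle circleUnit X ⟶ W} (h : leftUnitorInv X ≫ F = leftUnitorInv X ≫ F') : F = F' := by
  refine (Generators.presents_unit.left X).hom_ext (fun t s => ?_)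
  obtain ⟨⟨⟩, b⟩ := s
  obtain ⟨b, rfl⟩ := exists_eq_const b
  have h1 : leftUnitGen X t b ≫ SymSeq.app F t b = leftUnitGen X t b ≫ SymSeq.app F' t b :=
    congrArg (fun f => SymSeq.app f t b) h
  have h2 : ∀ F : circle circleUnit X ⟶ W, (circleUnitι t ▷ valFam X (single t) (fun _ => b) ≫
      circleGen circleUnit X t (single t) (fun _ => b)) ≫ SymSeq.app F t _ =
      (λ_ (X.val t b ⊗ 𝟙_ M)).hom ≫ (ρ_ (X.val t b)).hom ≫ (leftUnitGen X t b ≫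
        SymSeq.app F t b) ≫ W.act rfl (inv (concatOne b)) := by
    intro F
    rw [circleGen_single]
    exact circleUnitι_circleOne_app F t _
  exact (h2 F).trans ((congrArg (fun z => _ ≫ _ ≫ z ≫ _) h1).trans (h2 F').symm)

/-- A retraction of the candidate inverse. Being an epimorphism, the candidate is then an
isomorphism. -/
theorem exists_leftUnitorHom [MonoidalClosed M] (X : SymSeq C M) :
    ∃ F : circle circleUnit X ⟶ X, leftUnitorInv X ≫ F = 𝟙 X := by
  have h1 : ∀ t, ∃ f : ∀ b : Fin (single t).len → Profile C,
      𝟙_ M ⊗ valFam X (single t) b ⟶ X.val t (concat b),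
      ∀ b : Profile C, f (fun _ => b) = (λ_ (X.val t b ⊗ 𝟙_ M)).hom ≫ (ρ_ (X.val t b)).hom ≫
        X.act rfl (inv (concatOne b)) := fun t =>
    -- A family over the single entry is constant, so it is enough to prescribe the morphism on
    -- constant families.
    exists_family_comp_equiv (Equiv.funUnique (Fin 1) (Profile C)).symm _
  choose f hf using h1
  obtain ⟨F, hF⟩ := (Generators.presents_unit.left X).exists_desc (W := X)
    (fun t s => f t s.2) (by
      rintro t ⟨⟨⟩, b⟩ ⟨⟨⟩, b'⟩ _ _ ⟨q, _, β, rfl, rfl, rfl⟩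
      obtain rfl : q = 𝟙 _ := single_hom_subsingleton _ _
      obtain ⟨b, rfl⟩ := exists_eq_const b
      obtain ⟨b', rfl⟩ := exists_eq_const b'
      obtain ⟨β, rfl⟩ := exists_eq_const (A := b ⟶ b') β
      have h2 : (𝟙 (𝟙_ M) ⊗ₘ famMap X (𝟙 (single t)) (b := fun _ => b) (b' := fun _ => b')
          (fun _ => β)) = 𝟙_ M ◁ (X.act rfl β ▷ 𝟙_ M) := by
        rw [famMap_id_left, id_tensorHom, ← tensorHom_id]
        rfl
      refine (congrArg₂ (· ≫ ·) h2 (hf t b')).trans (Eq.trans ?_ (congrArg (· ≫ _) (hf t b)).symm)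
      refine whiskerLeft_whiskerRight_unitors X t β _ _ _ ?_
      refine (IsIso.eq_inv_comp _).2 ((Category.assoc _ _ _).symm.trans ?_)
      refine (congrArg (· ≫ _) (concatOne_natural β).symm).trans ?_
      refine (Category.assoc _ _ _).trans ?_
      refine (congrArg (_ ≫ ·) (IsIso.hom_inv_id (concatOne b'))).trans ?_
      exact Category.comp_id _)
  refine ⟨F, NatTrans.ext (funext fun ⟨b, ⟨t⟩⟩ => ?_)⟩
  have h := (hF t ⟨⟨⟩, fun _ => b⟩).trans (hf t b)
  change leftUnitGen X t b ≫ SymSeq.app F t b = 𝟙 (X.val t b)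
  dsimp only at h
  rw [circleGen_single] at h
  have h2 := (circleUnitι_circleOne_app F t (inv (concatOne b))).symm.trans h
  simp only [cancel_epi] at h2
  exact (cancel_mono _).1 (h2.trans (Category.id_comp _).symm)

/-- The left unitor of the circle product. -/
noncomputable def leftUnitorIso [MonoidalClosed M] (X : SymSeq C M) : circle circleUnit X ≅ X where
  hom := (exists_leftUnitorHom X).choose
  inv := leftUnitorInv X
  hom_inv_id := leftUnitorInv_hom_ext (by
    rw [← Category.assoc, (exists_leftUnitorHom X).choose_spec, Category.id_comp, Category.comp_id])
  inv_hom_id := (exists_leftUnitorHom X).choose_spec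

/-- Naturality is proved for the inverse, which has explicit components, and passes to the unitor.
-/
theorem leftUnitorIso_naturality [MonoidalClosed M] {X Y : SymSeq C M} (x : X ⟶ Y) :
    circleHom (𝟙 circleUnit) x ≫ (leftUnitorIso Y).hom = (leftUnitorIso X).hom ≫ x := by
  rw [← Iso.inv_comp_eq, ← Category.assoc, ← Iso.eq_comp_inv]
  exact NatTrans.ext (funext fun ⟨b, ⟨t⟩⟩ => leftUnitGen_app x t b)

/-- The tensor product of the canonical morphisms into the circle unit. -/
noncomputable def unitsFam (a : Profile C) :
    𝟙_ M ⟶ valFam (circleUnit : SymSeq C M) a (fun i => single (a.col i)) :=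
  unitFam a.len ≫ tensorFamMap a.len (fun i => circleUnitι (a.col i))

/-- Tensor products of units have shapes without leaves, so coherence applies with an empty set of
labels. -/
theorem unitFam_reindex {m n : ℕ} (σ : Fin m ≃ Fin n) :
    unitFam n ≫ reindex m n σ (fun _ => 𝟙 (𝟙_ M)) = unitFam m :=
  ((Canon.unitFam (A := (PEmpty.elim : PEmpty.{1} → M)) n).comp_left
    (Canon.reindex m n σ (fun _ => Canon.id _))).unique (Canon.unitFam m)
    (Shape.nodup_fam _ _ (fun _ => trivial) (fun _ _ (x : PEmpty) => x.elim))

theorem unitsFam_famMap {a a' : Profile C} (p : a ⟶ a') :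
    unitsFam a ≫ famMap (circleUnit : SymSeq C M) p (fun i => singleHom (p.col_perm i)) =
      unitsFam a' := by
  rw [unitsFam, unitsFam, famMap, Category.assoc, tensorFamMap_reindex, ← unitFam_reindex p.perm,
    Category.assoc, reindex_tensorFamMap]
  refine congrArg (fun f => _ ≫ reindex _ _ _ f) (funext fun i => ?_)
  exact (circleUnitι_act' _ _).trans (Category.id_comp _).symm

theorem concatSingle_natural {a a' : Profile C} (p : a ⟶ a') :
    concatMap p.perm (b := fun i => single (a.col i)) (d := fun i => single (a'.col i))
      (fun i => singleHom (p.col_perm i)) ≫ concatSingle a' = concatSingle a ≫ p := by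
  ext1
  ext1 i
  exact concatMap_perm_pos _ _ _ _

/-- The canonical morphism `X(t; a) ⟶ (X ∘ I)(t; a)`. -/
noncomputable def rightUnitGen (X : SymSeq C M) (t : C) (a : Profile C) :
    X.val t a ⟶ (circle X circleUnit).val t a :=
  (ρ_ (X.val t a)).inv ≫ X.val t a ◁ unitsFam a ≫
    circleIn X circleUnit t (fun i => single (a.col i)) (concatSingle a)

theorem rightUnitGen_natural (X : SymSeq C M) {t t' : C} (h : t = t') {a a' : Profile C}
    (p : a ⟶ a') :
    X.act h p ≫ rightUnitGen X t' a' = rightUnitGen X t a ≫ (circle X circleUnit).act h p := by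
  subst h
  have h1 := circleIn_natural X circleUnit t p (b := fun i => single (a.col i))
    (b' := fun i => single (a'.col i)) (fun i => singleHom (p.col_perm i)) (concatSingle a')
  rw [rightUnitGen, rightUnitGen, Category.assoc, Category.assoc, circleIn_act,
    ← concatSingle_natural, ← h1, rightUnitor_inv_naturality_assoc, ← tensorHom_id, ← id_tensorHom,
    ← id_tensorHom, tensorHom_comp_tensorHom_assoc, tensorHom_comp_tensorHom_assoc,
    unitsFam_famMap]
  simp only [Category.id_comp, Category.comp_id]

theorem rightUnitGen_app {X Y : SymSeq C M} (x : X ⟶ Y) (t : C) (a : Profile C) :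
    rightUnitGen X t a ≫ SymSeq.app (circleHom x (𝟙 circleUnit)) t a =
      SymSeq.app x t a ≫ rightUnitGen Y t a := by
  rw [rightUnitGen, rightUnitGen, Category.assoc, Category.assoc, circleIn_app,
    rightUnitor_inv_naturality_assoc, ← tensorHom_id, ← id_tensorHom,
    ← id_tensorHom, tensorHom_comp_tensorHom_assoc, tensorHom_comp_tensorHom_assoc]
  simp only [SymSeq.id_app, tensorFamMap_id, Category.id_comp, Category.comp_id]

/-- The inverse of the right unitor of the circle product. -/
noncomputable def rightUnitorInv (X : SymSeq C M) : X ⟶ circle X circleUnit where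
  app x := rightUnitGen X x.2.as x.1
  naturality := by
    rintro ⟨a, ⟨t⟩⟩ ⟨a', ⟨t'⟩⟩ ⟨q, h⟩
    obtain rfl : t = t' := Discrete.eq_of_hom h
    exact rightUnitGen_natural X (rfl : t = t) q

instance (n : ℕ) : IsIso (unitFam n : 𝟙_ M ⟶ _) := isIso_unitFam n

theorem circleUnitι_circleGen (X : SymSeq C M) (t : C) (a : Profile C) :
    X.val t a ◁ tensorFamMap a.len (fun i => circleUnitι (a.col i)) ≫
        circleGen X circleUnit t a (fun i => single (a.col i)) =
      X.val t a ◁ inv (unitFam a.len) ≫ (ρ_ _).hom ≫ rightUnitGen X t a ≫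
        (circle X circleUnit).act rfl (inv (concatSingle a)) := by
  rw [rightUnitGen, Category.assoc, Category.assoc, circleIn_act, IsIso.hom_inv_id,
    Iso.hom_inv_id_assoc, ← MonoidalCategory.whiskerLeft_comp_assoc, unitsFam,
    IsIso.inv_hom_id_assoc]
  rfl

/-- As on the left: a generator of `X ∘ I` has a unit in every block, and the tensor product of
these units is removed by the inverse of `unitFam`. What remains is the candidate inverse. -/
theorem rightUnitorInv_hom_ext [MonoidalClosed M] {X W : SymSeq C M}
    {F F' : circle X circleUnit ⟶ W} (h : rightUnitorInv X ≫ F = rightUnitorInv X ≫ F') :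
    F = F' := by
  refine (Generators.presents_unit.right X).hom_ext (fun t s => ?_)
  obtain ⟨a, s⟩ := s
  have h1 : rightUnitGen X t a ≫ SymSeq.app F t a = rightUnitGen X t a ≫ SymSeq.app F' t a :=
    congrArg (fun f => SymSeq.app f t a) h
  have h2 : ∀ F : circle X circleUnit ⟶ W,
      (X.val t a ◁ tensorFamMap a.len (fun i => circleUnitι (a.col i)) ≫
        circleGen X circleUnit t a (fun i => single (a.col i))) ≫ SymSeq.app F t _ =
      X.val t a ◁ inv (unitFam a.len) ≫ (ρ_ _).hom ≫ (rightUnitGen X t a ≫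
        SymSeq.app F t a) ≫ W.act rfl (inv (concatSingle a)) := by
    intro F
    rw [circleUnitι_circleGen]
    simp only [Category.assoc]
    rw [SymSeq.act_app]
  exact (h2 F).trans ((congrArg (fun z => _ ≫ _ ≫ z ≫ _) h1).trans (h2 F').symm)

/-- The retraction collapses the units on each generator. A relation permutes them, which is
invisible by `unitFam_reindex`. -/
theorem exists_rightUnitorHom [MonoidalClosed M] (X : SymSeq C M) :
    ∃ F : circle X circleUnit ⟶ X, rightUnitorInv X ≫ F = 𝟙 X := by
  obtain ⟨F, hF⟩ := (Generators.presents_unit.right X).exists_desc (W := X)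
    (fun t s => X.val t s.1 ◁ inv (unitFam s.1.len) ≫ (ρ_ _).hom ≫
      X.act rfl (inv (concatSingle s.1))) (by
      rintro t ⟨a, s⟩ ⟨a', s'⟩ _ _ ⟨p, q, u, h, rfl, rfl⟩
      obtain rfl : q = fun i => singleHom (p.col_perm i) :=
        funext fun i => single_hom_subsingleton _ _
      obtain rfl : u = fun i => 𝟙 _ := funext h
      dsimp only
      rw [← cancel_epi (X.val t a ◁ unitFam a.len), ← id_tensorHom, ← id_tensorHom, ← id_tensorHom,
        tensorHom_comp_tensorHom_assoc, Category.id_comp]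
      have h1 : unitFam a.len ≫ reindex a'.len a.len p.perm (fun _ => 𝟙 (𝟙_ M)) = unitFam a'.len :=
        unitFam_reindex p.perm
      refine (congrArg (fun z => (_ ⊗ₘ z) ≫ _) h1).trans ?_
      rw [tensorHom_comp_tensorHom_assoc, Category.assoc, Category.assoc,
        tensorHom_comp_tensorHom_assoc, IsIso.hom_inv_id, IsIso.hom_inv_id, Category.comp_id,
        Category.comp_id, tensorHom_id, rightUnitor_naturality_assoc, id_tensorHom_id,
        Category.id_comp]
      refine congrArg (_ ≫ ·) ((X.act_comp rfl rfl _ _).trans (Eq.trans (congrArg _ ?_)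
        (X.act_comp rfl rfl _ _).symm))
      refine (IsIso.eq_inv_comp _).2 ?_
      rw [← Category.assoc, IsIso.comp_inv_eq]
      exact (concatSingle_natural p).symm)
  refine ⟨F, NatTrans.ext (funext fun ⟨a, ⟨t⟩⟩ => ?_)⟩
  have h := hF t ⟨a, fun _ => ⟨⟩⟩
  change rightUnitGen X t a ≫ SymSeq.app F t a = 𝟙 (X.val t a)
  dsimp only at h
  rw [circleUnitι_circleGen] at h
  simp only [Category.assoc, cancel_epi] at h
  rw [SymSeq.act_app, ← Category.assoc] at h
  exact (cancel_mono _).1 (h.trans (Category.id_comp _).symm)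

/-- The right unitor of the circle product. -/
noncomputable def rightUnitorIso [MonoidalClosed M] (X : SymSeq C M) : circle X circleUnit ≅ X where
  hom := (exists_rightUnitorHom X).choose
  inv := rightUnitorInv X
  hom_inv_id := rightUnitorInv_hom_ext (by
    rw [← Category.assoc, (exists_rightUnitorHom X).choose_spec, Category.id_comp,
      Category.comp_id])
  inv_hom_id := (exists_rightUnitorHom X).choose_spec

theorem rightUnitorIso_naturality [MonoidalClosed M] {X Y : SymSeq C M} (x : X ⟶ Y) :
    circleHom x (𝟙 circleUnit) ≫ (rightUnitorIso Y).hom = (rightUnitorIso X).hom ≫ x := by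
  rw [← Iso.inv_comp_eq, ← Category.assoc, ← Iso.eq_comp_inv]
  exact NatTrans.ext (funext fun ⟨b, ⟨t⟩⟩ => rightUnitGen_app x t b)

end Unitors

/-! ### Naturality of the associator in the three sequences. -/

section AssociatorNaturality

variable {C : Type v} {M : Type u} [Category.{v} M] [MonoidalCategory M] [SymmetricCategory M]
  [HasColimits M]

theorem leftGen_app {X X' Y Y' Z Z' : SymSeq C M} (x : X ⟶ X') (y : Y ⟶ Y') (z : Z ⟶ Z') (t : C)
    (e : Profile C) (d : Fin e.len → Profile C) (b : Fin (concat d).len → Profile C) :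
    leftGen X Y Z t e d b ≫ SymSeq.app (circleHom (circleHom x y) z) t (concat b) =
      ((SymSeq.app x t e ⊗ₘ tensorFamMap e.len (fun k => SymSeq.app y (e.col k) (d k))) ⊗ₘ
        tensorFamMap (concat d).len (fun j => SymSeq.app z ((concat d).col j) (b j))) ≫
        leftGen X' Y' Z' t e d b := by
  rw [leftGen, leftGen, Category.assoc, circleGen_app, ← tensorHom_id, ← tensorHom_id,
    tensorHom_comp_tensorHom_assoc, tensorHom_comp_tensorHom_assoc, circleGen_app,
    Category.id_comp, Category.comp_id]

theorem rightGen_app {X X' Y Y' Z Z' : SymSeq C M} (x : X ⟶ X') (y : Y ⟶ Y') (z : Z ⟶ Z') (t : C)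
    (e : Profile C) (d : Fin e.len → Profile C) (c : ∀ k, Fin (d k).len → Profile C) :
    rightGen X Y Z t e d c ≫
        SymSeq.app (circleHom x (circleHom y z)) t (concat (fun k => concat (c k))) =
      (SymSeq.app x t e ⊗ₘ tensorFamMap e.len (fun k => SymSeq.app y (e.col k) (d k) ⊗ₘ
        tensorFamMap (d k).len (fun l => SymSeq.app z ((d k).col l) (c k l)))) ≫
        rightGen X' Y' Z' t e d c := by
  rw [rightGen, rightGen, Category.assoc, circleGen_app, ← id_tensorHom, ← id_tensorHom,
    tensorHom_comp_tensorHom_assoc, tensorHom_comp_tensorHom_assoc, tensorFamMap_comp,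
    tensorFamMap_comp, Category.id_comp, Category.comp_id]
  simp only [circleGen_app]

theorem assocSummand_app {X X' Y Y' Z Z' : SymSeq C M} (x : X ⟶ X') (y : Y ⟶ Y') (z : Z ⟶ Z')
    (t : C) (e : Profile C) {d : Fin e.len → Profile C} {b : Fin (concat d).len → Profile C}
    {c : ∀ k, Fin (d k).len → Profile C} (ζ : ∀ k l, b (pos d ⟨k, l⟩) ⟶ c k l) :
    ((SymSeq.app x t e ⊗ₘ tensorFamMap e.len (fun k => SymSeq.app y (e.col k) (d k))) ⊗ₘ
        tensorFamMap (concat d).len (fun j => SymSeq.app z ((concat d).col j) (b j))) ≫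
        assocSummand X' Y' Z' t e ζ =
      assocSummand X Y Z t e ζ ≫ (SymSeq.app x t e ⊗ₘ tensorFamMap e.len
        (fun k => SymSeq.app y (e.col k) (d k) ⊗ₘ
          tensorFamMap (d k).len (fun l => SymSeq.app z ((d k).col l) (c k l)))) := by
  have h := distributeFam_natural d (fun k => SymSeq.app y (e.col k) (d k))
    (fun j => SymSeq.app z ((concat d).col j) (b j))
    (fun k l => Z.act (concat_col d ⟨k, l⟩) (ζ k l))
    (fun k l => Z'.act (concat_col d ⟨k, l⟩) (ζ k l)) (fun k l => SymSeq.app z ((d k).col l) (c k l))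
    (fun k l => (SymSeq.act_app z _ _).symm)
  rw [assocSummand, assocSummand, associator_naturality_assoc, Category.assoc, ← id_tensorHom,
    ← id_tensorHom, tensorHom_comp_tensorHom, tensorHom_comp_tensorHom, distributeTo, distributeTo,
    h, Category.comp_id, Category.id_comp]

theorem assocIso_naturality [MonoidalClosed M] {X X' Y Y' Z Z' : SymSeq C M} (x : X ⟶ X')
    (y : Y ⟶ Y') (z : Z ⟶ Z') :
    circleHom (circleHom x y) z ≫ (assocIso X' Y' Z').hom =
      (assocIso X Y Z).hom ≫ circleHom x (circleHom y z) := by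
  refine leftGen_hom_ext (fun t e d b => ?_)
  have h1 := leftGen_assocHom X Y Z t e (fun k l => 𝟙 (b (pos d ⟨k, l⟩)))
  have h2 := leftGen_assocHom X' Y' Z' t e (fun k l => 𝟙 (b (pos d ⟨k, l⟩)))
  rw [SymSeq.comp_app, SymSeq.comp_app, ← Category.assoc, leftGen_app, Category.assoc]
  refine (congrArg (_ ≫ ·) h2).trans ?_
  rw [← Category.assoc, assocSummand_app, ← Category.assoc (leftGen _ _ _ _ _ _ _)]
  refine Eq.trans ?_ (congrArg (· ≫ _) h1.symm)
  rw [Category.assoc, Category.assoc, Category.assoc, SymSeq.act_app,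
    ← Category.assoc (rightGen _ _ _ _ _ _ _), rightGen_app, Category.assoc]

end AssociatorNaturality

/-! ### The tensor product half of the pentagon. -/

section CoherencePentagon

variable {C : Type v} {M : Type u} [Category.{v} M] [MonoidalCategory M] [SymmetricCategory M]

/-- The two ways of distributing factors over blocks of blocks agree. -/
theorem distributeFam_pentagon {m : ℕ} {d : Fin m → Profile C} {c : Fin (concat d).len → Profile C}
    (κ : concat c ⟶ concat (fun k => concat (fun l => c (pos d ⟨k, l⟩))))
    (hκ : ∀ k l n, κ.perm (pos (fun k => concat (fun l => c (pos d ⟨k, l⟩)))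
      ⟨k, pos (fun l => c (pos d ⟨k, l⟩)) ⟨l, n⟩⟩) = pos c ⟨pos d ⟨k, l⟩, n⟩)
    (w : M) (P : Fin m → M) {Q : Fin (concat d).len → M} {Q' : ∀ k, Fin (d k).len → M}
    (q : ∀ k l, Q (pos d ⟨k, l⟩) ⟶ Q' k l) [∀ k l, IsIso (q k l)]
    {R : Fin (concat c).len → M} {S : Fin (concat fun k => concat (fun l => c (pos d ⟨k, l⟩))).len → M}
    (r : ∀ j, R (κ.perm j) ⟶ S j) [∀ j, IsIso (r j)]
    {S' : ∀ k, Fin (concat (fun l => c (pos d ⟨k, l⟩))).len → M}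
    (s : ∀ k j, S (pos (fun k => concat (fun l => c (pos d ⟨k, l⟩))) ⟨k, j⟩) ⟶ S' k j)
    [∀ k j, IsIso (s k j)]
    {R' : ∀ k l, Fin (c (pos d ⟨k, l⟩)).len → M}
    (s' : ∀ k l n, S' k (pos (fun l => c (pos d ⟨k, l⟩)) ⟨l, n⟩) ⟶ R' k l n)
    [∀ k l n, IsIso (s' k l n)]
    {R₁ : ∀ j, Fin (c j).len → M} (r₁ : ∀ j n, R (pos c ⟨j, n⟩) ⟶ R₁ j n) [∀ j n, IsIso (r₁ j n)]
    (r₂ : ∀ k l n, R₁ (pos d ⟨k, l⟩) n ⟶ R' k l n) [∀ k l n, IsIso (r₂ k l n)]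
    (h : ∀ k l n, eqToHom (congrArg R (hκ k l n)) ≫ r₁ (pos d ⟨k, l⟩) n ≫ r₂ k l n =
      r _ ≫ s k _ ≫ s' k l n) :
    ((α_ w (tensorFam m P) (tensorFam (concat d).len Q)).hom ≫ w ◁ distributeFam d P q) ▷
        tensorFam (concat c).len R ≫
      (_ ◁ reindex _ _ κ.perm r) ≫ (α_ _ _ _).hom ≫
      w ◁ (distributeFam (fun k => concat (fun l => c (pos d ⟨k, l⟩)))
        (fun k => P k ⊗ tensorFam (d k).len (Q' k)) s ≫
        tensorFamMap m (fun k => (α_ _ _ _).hom ≫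
          P k ◁ distributeFam (fun l => c (pos d ⟨k, l⟩)) (Q' k) (s' k))) =
    (α_ _ _ _).hom ≫ (w ⊗ tensorFam m P) ◁ distributeFam c Q r₁ ≫ (α_ _ _ _).hom ≫
      w ◁ distributeFam d P (Q := fun j => Q j ⊗ tensorFam (c j).len (R₁ j))
        (fun k l => q k l ⊗ₘ tensorFamMap _ (r₂ k l)) := by
  -- There are four kinds of labels: `w`, the objects `P k`, the factors indexed by pairs of a block
  -- and an entry, and the innermost factors indexed by triples. The leaves are identified with the
  -- objects of the final target.
  let A : Unit ⊕ Fin m ⊕ ((k : Fin m) × Fin (d k).len) ⊕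
      ((k : Fin m) × (l : Fin (d k).len) × Fin (c (pos d ⟨k, l⟩)).len) → M :=
    Sum.elim (fun _ => w) (Sum.elim P (Sum.elim (fun x => Q' x.1 x.2) (fun x => R' x.1 x.2.1 x.2.2)))
  let lw := (Shape.leaf (A := A) (Sum.inl ()) (Iso.refl w))
  let lP : ∀ k, Shape A (P k) := fun k => .leaf (Sum.inr (Sum.inl k)) (Iso.refl (P k))
  let lQ' : ∀ k l, Shape A (Q' k l) := fun k l =>
    .leaf (Sum.inr (Sum.inr (Sum.inl (⟨k, l⟩ : (k : Fin m) × Fin (d k).len)))) (Iso.refl (Q' k l))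
  let lR : ∀ k l n {V : M} (i : V ≅ R' k l n), Shape A V := fun k l n {V} i =>
    .leaf (Sum.inr (Sum.inr (Sum.inr
      (⟨k, l, n⟩ : (k : Fin m) × (l : Fin (d k).len) × Fin (c (pos d ⟨k, l⟩)).len)))) i
  let iq : ∀ k l, Q (pos d ⟨k, l⟩) ≅ Q' k l := fun k l => asIso (q k l)
  let is' : ∀ k l n, S' k (pos (fun l => c (pos d ⟨k, l⟩)) ⟨l, n⟩) ≅ R' k l n := fun k l n =>
    asIso (s' k l n)
  let is : ∀ k j, S (pos (fun k => concat (fun l => c (pos d ⟨k, l⟩))) ⟨k, j⟩) ≅ S' k j :=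
    fun k j => asIso (s k j)
  let ir₁ : ∀ j n, R (pos c ⟨j, n⟩) ≅ R₁ j n := fun j n => asIso (r₁ j n)
  let ir₂ : ∀ k l n, R₁ (pos d ⟨k, l⟩) n ≅ R' k l n := fun k l n => asIso (r₂ k l n)
  have hlR : ∀ {k l n} {V V' : M} {i : V ≅ R' k l n} {i' : V' ≅ R' k l n} {f : V ⟶ V'},
    f ≫ i'.hom = i.hom → Canon (fun i => 𝟙 (A i)) (lR k l n i) (lR k l n i') f :=
    fun h => Canon.leaf_id h
  obtain ⟨TQ, hQ⟩ := exists_family_comp_equiv (pos d) (F := fun j => Shape A (Q j))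
    (fun x => .leaf (Sum.inr (Sum.inr (Sum.inl x))) (iq x.1 x.2))
  -- The triples enumerate the entries of `concat c`, and through `es` below those of the nested
  -- concatenation. In this way both sides give the same labels to the innermost factors.
  let ec := (Equiv.sigmaAssoc (fun k l => Fin (c (pos d ⟨k, l⟩)).len)).symm.trans
    ((Equiv.sigmaCongrLeft (β := fun p => Fin (c p).len) (pos d)).trans (pos c))
  obtain ⟨TR, hR⟩ := exists_family_comp_equiv ec (F := fun j => Shape A (R j))
    (fun x => lR x.1 x.2.1 x.2.2 (ir₁ (pos d ⟨x.1, x.2.1⟩) x.2.2 ≪≫ ir₂ x.1 x.2.1 x.2.2))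
  obtain ⟨TR₁, hR₁⟩ := exists_family_comp_equiv (pos d) (F := fun j => ∀ n, Shape A (R₁ j n))
    (fun x n => lR x.1 x.2 n (ir₂ x.1 x.2 n))
  have h1 : ∀ k, ∃ T : ∀ j, Shape A (S' k j), ∀ x : (l : Fin (d k).len) × Fin (c (pos d ⟨k, l⟩)).len,
      T (pos (fun l => c (pos d ⟨k, l⟩)) x) = lR k x.1 x.2 (is' k x.1 x.2) := fun k =>
    exists_family_comp_equiv (pos (fun l => c (pos d ⟨k, l⟩))) _
  choose TS' hS' using h1
  let es := (Equiv.sigmaCongrRight (fun k => pos (fun l => c (pos d ⟨k, l⟩)))).trans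
    (pos (fun k => concat (fun l => c (pos d ⟨k, l⟩))))
  obtain ⟨TS, hS⟩ := exists_family_comp_equiv es (F := fun j => Shape A (S j))
    (fun x => lR x.1 x.2.1 x.2.2 (is x.1 (pos (fun l => c (pos d ⟨x.1, l⟩)) x.2) ≪≫
      is' x.1 x.2.1 x.2.2))
  have cq : ∀ k l, Canon (fun i => 𝟙 (A i)) (TQ (pos d ⟨k, l⟩)) (lQ' k l) (q k l) := fun k l => by
    rw [hQ]
    exact Canon.leaf_id (Category.comp_id _)
  have cs' : ∀ k l n, Canon (fun i => 𝟙 (A i)) (TS' k (pos _ ⟨l, n⟩)) (lR k l n (Iso.refl _))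
      (s' k l n) := fun k l n => by
    rw [hS' k ⟨l, n⟩]
    exact hlR (i := is' k l n) (Category.comp_id _)
  have cs : ∀ k j, Canon (fun i => 𝟙 (A i)) (TS (pos _ ⟨k, j⟩)) (TS' k j) (s k j) := fun k j => by
    obtain ⟨x, rfl⟩ := (pos (fun l => c (pos d ⟨k, l⟩))).surjective j
    rw [hS']
    refine (congrArg (fun z => Canon (fun i => 𝟙 (A i)) z _ _) (hS ⟨k, x⟩)).mpr ?_
    exact hlR (i := is k _ ≪≫ is' k x.1 x.2) (i' := is' k x.1 x.2) rfl
  have cr₂ : ∀ k l n, Canon (fun i => 𝟙 (A i)) (TR₁ (pos d ⟨k, l⟩) n) (lR k l n (Iso.refl _))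
      (r₂ k l n) := fun k l n => by
    rw [hR₁]
    exact hlR (i := ir₂ k l n) (Category.comp_id _)
  have cr₁ : ∀ j n, Canon (fun i => 𝟙 (A i)) (TR (pos c ⟨j, n⟩)) (TR₁ j n) (r₁ j n) := fun j n => by
    obtain ⟨⟨k, l⟩, rfl⟩ := (pos d).surjective j
    rw [hR₁]
    refine (congrArg (fun z => Canon (fun i => 𝟙 (A i)) z _ _) (hR ⟨k, l, n⟩)).mpr ?_
    exact hlR (i := ir₁ _ n ≪≫ ir₂ k l n) (i' := ir₂ k l n) rfl
  -- The only knowledge of `κ` that is needed is that it matches the two enumerations by triples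
  -- (`hκ`), up to transport; `h` says that the identifications of the leaves match too.
  have cr : ∀ j, Canon (fun i => 𝟙 (A i)) (TR (κ.perm j)) (TS j) (r j) := fun j => by
    obtain ⟨⟨k, l, n⟩, rfl⟩ := es.surjective j
    rw [hS]
    have h2 := Canon.eqToHom_family TR (hκ k l n)
    refine (h2.comp_left ((congrArg (fun z => Canon (fun i => 𝟙 (A i)) z _
      (eqToHom (congrArg R (hκ k l n)).symm ≫ r (es ⟨k, l, n⟩))) (hR ⟨k, l, n⟩)).mpr ?_)).of_eq ?_
    · refine hlR (i := ir₁ _ n ≪≫ ir₂ k l n) (i' := is k _ ≪≫ is' k l n) ?_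
      refine (Category.assoc _ _ _).trans ?_
      exact (eqToHom_comp_iff (congrArg R (hκ k l n)).symm _ _).2 (h k l n).symm
    · refine (Category.assoc _ _ _).symm.trans ?_
      rw [eqToHom_trans, eqToHom_refl]
      exact Category.id_comp _
  have cL := ((Canon.whiskerRight ((Canon.associator lw (.fam m lP) (.fam _ TQ)).comp_left
      (Canon.whiskerLeft lw (Canon.distributeFam d lP TQ cq))) (.fam _ TR)).comp_left
    ((Canon.whiskerLeft (lw.tensor (.fam m (fun k => (lP k).tensor (.fam _ (lQ' k)))))
      (Canon.reindex _ _ κ.perm cr)).comp_left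
    ((Canon.associator _ _ _).comp_left (Canon.whiskerLeft lw
      ((Canon.distributeFam (fun k => concat (fun l => c (pos d ⟨k, l⟩)))
        (fun k => (lP k).tensor (.fam _ (lQ' k))) TS cs).comp_left
      (Canon.tensorFamMap m (fun k => (Canon.associator (lP k) _ _).comp_left
        (Canon.whiskerLeft (lP k) (Canon.distributeFam (fun l => c (pos d ⟨k, l⟩)) (lQ' k) (TS' k)
          (cs' k))))))))))
  have cR := (Canon.associator (lw.tensor (.fam m lP)) (.fam _ TQ) (.fam _ TR)).comp_left
    ((Canon.whiskerLeft (lw.tensor (.fam m lP)) (Canon.distributeFam c TQ TR cr₁)).comp_left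
    ((Canon.associator _ _ _).comp_left (Canon.whiskerLeft lw
      (Canon.distributeFam d lP (fun j => (TQ j).tensor (.fam _ (TR₁ j)))
        (fun k l => (cq k l).tensor (Canon.tensorFamMap _ (cr₂ k l)))))))
  have m1 : ∀ k l x, x ∈ (Shape.fam _ (fun n => lR k l n (Iso.refl _))).labels → ∃ n,
      x = Sum.inr (Sum.inr (Sum.inr ⟨k, l, n⟩)) := fun k l x hx => Shape.mem_labels_fam _ _ hx
  have m2 : ∀ k x, x ∈ (Shape.fam _ (fun l => (lQ' k l).tensor
      (.fam _ (fun n => lR k l n (Iso.refl _))))).labels →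
      ∃ l, x = Sum.inr (Sum.inr (Sum.inl ⟨k, l⟩)) ∨
        ∃ n, x = Sum.inr (Sum.inr (Sum.inr ⟨k, l, n⟩)) := fun k x hx => by
    obtain ⟨l, hl⟩ := Shape.mem_labels_fam _ _ hx
    exact ⟨l, hl.imp (fun h => h) (m1 k l x)⟩
  have n1 : ∀ k l, (Shape.fam _ (fun n => lR k l n (Iso.refl _))).Nodup := fun k l =>
    Shape.nodup_fam _ _ (fun _ => trivial) (fun n n' x h h' => by
      have := Sum.inr_injective (Sum.inr_injective (Sum.inr_injective ((Eq.symm h).trans h')))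
      simpa using this)
  -- Both composites are canonical. No label is repeated in the target, as labels of different kinds
  -- are distinct and the indices can be read off from the label.
  refine cL.unique cR ⟨trivial, Shape.nodup_fam _ _ (fun k => ⟨trivial, Shape.nodup_fam _ _
    (fun l => ⟨trivial, n1 k l, ?_⟩) ?_, ?_⟩) ?_, ?_⟩
  · refine Set.disjoint_left.2 (fun x h h' => ?_)
    obtain ⟨n, hn⟩ := m1 _ _ _ h'
    cases (Eq.symm h).trans hn
  · rintro l l' x (h | h) (h' | h')
    · cases (Eq.symm h).trans h'
      rfl
    · obtain ⟨n, hn⟩ := m1 _ _ _ h'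
      cases (Eq.symm h).trans hn
    · obtain ⟨n, hn⟩ := m1 _ _ _ h
      cases (Eq.symm h').trans hn
    · obtain ⟨n, hn⟩ := m1 _ _ _ h
      obtain ⟨n', hn'⟩ := m1 _ _ _ h'
      cases hn.symm.trans hn'
      rfl
  · refine Set.disjoint_left.2 (fun x h h' => ?_)
    obtain ⟨l, hl | ⟨n, hl⟩⟩ := m2 _ _ h' <;> cases (Eq.symm h).trans hl
  · rintro k k' x (h | h) (h' | h')
    · cases (Eq.symm h).trans h'
      rfl
    · obtain ⟨l, hl | ⟨n, hl⟩⟩ := m2 _ _ h' <;> cases (Eq.symm h).trans hl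
    · obtain ⟨l, hl | ⟨n, hl⟩⟩ := m2 _ _ h <;> cases (Eq.symm h').trans hl
    · obtain ⟨l, hl | ⟨n, hl⟩⟩ := m2 _ _ h <;> obtain ⟨l', hl' | ⟨n', hl'⟩⟩ := m2 _ _ h' <;>
        cases hl.symm.trans hl' <;> rfl
  · refine Set.disjoint_left.2 (fun x h h' => ?_)
    obtain ⟨k, hk | hk⟩ := Shape.mem_labels_fam _ _ h'
    · cases (Eq.symm h).trans hk
    · obtain ⟨l, hl | ⟨n, hl⟩⟩ := m2 _ _ hk <;> cases (Eq.symm h).trans hl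

end CoherencePentagon

/-! ### The triangle. -/

section Triangle

variable {C : Type v} {M : Type u} [Category.{v} M] [MonoidalCategory M] [SymmetricCategory M]

/-- A profile as the concatenation of one block. -/
noncomputable def oneConcat (t : C) (b : Profile C) :
    b ⟶ concat (fun _ : Fin (single t).len => b) :=
  show b ⟶ concat (fun _ : Fin 1 => b) from inv (concatOne b)

theorem oneConcat_perm_pos (t : C) (b : Profile C) (l : Fin (single t).len) (i : Fin b.len) :
    (oneConcat t b).perm (pos (fun _ : Fin (single t).len => b) ⟨l, i⟩) = i := by
  obtain rfl : l = (0 : Fin 1) := Subsingleton.elim (α := Fin 1) _ _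
  exact congrArg (fun f : b ⟶ b => f.perm i) (IsIso.inv_hom_id (concatOne b))

theorem whiskerRight_associator_whiskerLeft {V w A B R T T' : M} (f : V ⟶ w ⊗ A) (g : A ⟶ B)
    {D : B ⊗ R ⟶ T} {D' : A ⊗ R ⟶ T'} {E : T' ⟶ T} (h : g ▷ R ≫ D = D' ≫ E) :
    (f ≫ w ◁ g) ▷ R ≫ (α_ _ _ _).hom ≫ w ◁ D = (f ▷ R ≫ (α_ _ _ _).hom ≫ w ◁ D') ≫ w ◁ E := by
  simp only [comp_whiskerRight, Category.assoc, associator_naturality_middle_assoc,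
    ← MonoidalCategory.whiskerLeft_comp, h]

theorem comp_eq_of_comp_eq_id {D : Type*} [Category* D] {A B B' E F G : D} {p : A ⟶ B} {q : B ⟶ E}
    {r : E ⟶ F} {u : A ⟶ B'} {v : B' ⟶ G} {w : G ⟶ F} {z : F ⟶ G}
    (h : p ≫ q ≫ r = u ≫ v ≫ w) (h' : w ≫ z = 𝟙 G) : p ≫ q ≫ r ≫ z = u ≫ v := by
  have h1 := congrArg (· ≫ z) h
  simpa only [Category.assoc, h', Category.comp_id] using h1

/-- The projection of a tensor product with one nontrivial factor to this factor. -/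
def oneProj (t : C) (S : M) : 𝟙_ M ⊗ tensorFam (single t).len (fun _ => S) ⟶ S :=
  (λ_ (S ⊗ 𝟙_ M)).hom ≫ (ρ_ S).hom

theorem Canon.oneProj {ι : Type*} {A : ι → M} {S : M} (t : C) (T : Shape A S) :
    Canon (fun i => 𝟙 (A i)) (Shape.unit.tensor (.fam (single t).len (fun _ => T))) T
      (oneProj t S) :=
  (Canon.leftUnitor (T.tensor .unit)).comp_left (Canon.rightUnitor T)

/-- The distribution of factors over blocks of length one. -/
theorem distributeFam_triangle (a : Profile C) (w : M)
    {R : Fin (concat (fun k => single (a.col k))).len → M} {S : Fin a.len → M}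
    (q : ∀ (k : Fin a.len) (l : Fin (single (a.col k)).len),
      R (pos (fun k => single (a.col k)) ⟨k, l⟩) ⟶ S k) (hq : ∀ k l, IsIso (q k l))
    (r : ∀ k, R ((concatSingle a).perm k) ⟶ S k) [∀ k, IsIso (r k)]
    (h : ∀ k, q k (0 : Fin 1) = r k) :
    ((ρ_ w).inv ≫ w ◁ unitFam a.len) ▷ tensorFam _ R ≫ (α_ _ _ _).hom ≫
        w ◁ (distributeFam (fun k => single (a.col k)) (fun _ => 𝟙_ M) q ≫
          tensorFamMap a.len (fun k => oneProj (a.col k) (S k))) =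
      w ◁ reindex _ _ (concatSingle a).perm r := by
  let A : Unit ⊕ Fin a.len → M := Sum.elim (fun _ => w) S
  let lw := (Shape.leaf (A := A) (Sum.inl ()) (Iso.refl w))
  let lS : ∀ k, Shape A (S k) := fun k => .leaf (Sum.inr k) (Iso.refl (S k))
  let ir : ∀ k, R ((concatSingle a).perm k) ≅ S k := fun k => asIso (r k)
  obtain ⟨TR, hR⟩ := exists_family_comp_equiv (concatSingle a).perm (F := fun j => Shape A (R j))
    (fun k => .leaf (Sum.inr k) (ir k))
  have cr : ∀ k, Canon (fun i => 𝟙 (A i)) (TR ((concatSingle a).perm k)) (lS k) (r k) := fun k => by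
    rw [hR]
    exact Canon.leaf_id (Category.comp_id _)
  have cq : ∀ k l, Canon (fun i => 𝟙 (A i)) (TR (pos (fun k => single (a.col k)) ⟨k, l⟩)) (lS k)
      (q k l) := fun k l => by
    obtain rfl : l = (0 : Fin 1) := Subsingleton.elim (α := Fin 1) _ _
    rw [h]
    exact cr k
  refine Canon.unique ((Canon.whiskerRight ((Canon.rightUnitor_inv lw).comp_left
    (Canon.whiskerLeft lw (Canon.unitFam a.len))) (.fam _ TR)).comp_left
    ((Canon.associator _ _ _).comp_left (Canon.whiskerLeft lw
      ((Canon.distributeFam (fun k => single (a.col k)) (fun _ => Shape.unit) TR cq).comp_left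
        (Canon.tensorFamMap _ (fun k => Canon.oneProj (a.col k) (lS k)))))))
    (Canon.whiskerLeft lw (Canon.reindex _ _ (concatSingle a).perm cr)) ?_
  refine ⟨trivial, Shape.nodup_fam _ _ (fun _ => trivial) ?_, Set.disjoint_left.2 ?_⟩
  · intro k k' x h h'
    exact Sum.inr_injective ((Eq.symm h).trans h')
  · intro x h h'
    obtain ⟨k, hk⟩ := Shape.mem_labels_fam _ _ h'
    cases (Eq.symm h).trans hk

variable [HasColimits M]

/-- Reindexing the factors of `Y` along `concatSingle a` turns the inserted map `X ⟶ X ∘ I` into a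
generator of `(X ∘ I) ∘ Y`, to which the formula for the associator applies. -/
theorem rightUnitGen_circleGen (X Y : SymSeq C M) (t : C) (a : Profile C)
    (b : Fin (concat (fun k => single (a.col k))).len → Profile C) :
    X.val t a ◁ famMap Y (concatSingle a) (b := b) (b' := fun k => b ((concatSingle a).perm k))
        (fun k => 𝟙 (b ((concatSingle a).perm k))) ≫
      rightUnitGen X t a ▷ valFam Y a (fun k => b ((concatSingle a).perm k)) ≫
      circleGen (circle X circleUnit) Y t a (fun k => b ((concatSingle a).perm k)) =
    ((ρ_ (X.val t a)).inv ≫ X.val t a ◁ unitsFam a) ▷ valFam Y _ b ≫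
      leftGen X circleUnit Y t a (fun k => single (a.col k)) b ≫
      (circle (circle X circleUnit) Y).act rfl (concatMap (concatSingle a).perm (b := b)
        (d := fun k => b ((concatSingle a).perm k))
        (fun k => 𝟙 (b ((concatSingle a).perm k)))) := by
  have h := circleGen_natural (circle X circleUnit) Y (rfl : t = t) (concatSingle a) (b := b)
    (b' := fun k => b ((concatSingle a).perm k)) (fun k => 𝟙 (b ((concatSingle a).perm k)))
  rw [leftGen, Category.assoc, ← h, rightUnitGen, ← circleGen_act, ← id_tensorHom, ← tensorHom_id,
    ← tensorHom_id, ← tensorHom_id]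
  simp only [tensorHom_comp_tensorHom_assoc, Category.id_comp, Category.comp_id, Category.assoc]

/-- In each block the left unitor collapses a unit and a single factor of `Y` to this factor (`h1`);
the resulting changes of the block profiles are then moved out of the generator. -/
theorem rightGen_oneProj [MonoidalClosed M] (X Y : SymSeq C M) (t : C) (a : Profile C)
    (b : Fin a.len → Profile C) :
    X.val t a ◁ tensorFamMap a.len (fun k => circleUnitι (a.col k) ▷
          valFam Y (single (a.col k)) (fun _ => b k)) ≫
        rightGen X circleUnit Y t a (fun k => single (a.col k)) (fun k _ => b k) ≫
        SymSeq.app (circleHom (𝟙 X) (leftUnitorIso Y).hom) t _ =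
      X.val t a ◁ tensorFamMap a.len (fun k => oneProj (a.col k) (Y.val (a.col k) (b k))) ≫
        circleGen X Y t a b ≫ (circle X Y).act rfl
          (blockHom (b := b) (b' := fun k => concat (fun _ : Fin (single (a.col k)).len => b k))
            (fun k => oneConcat (a.col k) (b k))) := by
  have h1 : ∀ k, circleUnitι (a.col k) ▷ valFam Y (single (a.col k)) (fun _ => b k) ≫
      circleGen circleUnit Y (a.col k) (single (a.col k)) (fun _ => b k) ≫
      SymSeq.app (leftUnitorIso Y).hom (a.col k) _ =
      oneProj (a.col k) (Y.val (a.col k) (b k)) ≫ Y.act rfl (oneConcat (a.col k) (b k)) := by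
    intro k
    rw [circleGen_single]
    have h2 : leftUnitGen Y (a.col k) (b k) ≫ SymSeq.app (leftUnitorIso Y).hom (a.col k) (b k) =
        𝟙 _ := congrArg (fun f => SymSeq.app f (a.col k) (b k)) (leftUnitorIso Y).inv_hom_id
    have h3 := circleUnitι_circleOne_app (leftUnitorIso Y).hom (a.col k)
      (inv (concatOne (b k)))
    rw [h2, Category.id_comp] at h3
    exact (Category.assoc _ _ _).symm.trans (h3.trans (Category.assoc
      (λ_ (Y.val (a.col k) (b k) ⊗ 𝟙_ M)).hom (ρ_ (Y.val (a.col k) (b k))).hom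
      (Y.act rfl (oneConcat (a.col k) (b k)))).symm)
  have h2 := circleGen_valFamMap X Y t (a := a) (b := b)
    (b' := fun k => concat (fun _ : Fin (single (a.col k)).len => b k))
    (fun k => oneConcat (a.col k) (b k))
  rw [rightGen, Category.assoc, circleGen_app, SymSeq.id_app, id_tensorHom,
    ← MonoidalCategory.whiskerLeft_comp_assoc, ← MonoidalCategory.whiskerLeft_comp_assoc,
    tensorFamMap_comp, tensorFamMap_comp, ← h2, valFamMap, ← MonoidalCategory.whiskerLeft_comp_assoc,
    tensorFamMap_comp]
  exact congrArg (fun f => (X.val t a ◁ tensorFamMap a.len f) ≫ circleGen X Y t a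
    (fun k => concat (fun _ : Fin (single (a.col k)).len => b k)))
    (funext fun k => (Category.assoc _ _ _).trans (h1 k))

/-- The triangle precomposed with the inverse of the right unitor, which is the version that can be
evaluated on generators. -/
theorem circle_triangle_aux [MonoidalClosed M] (X Y : SymSeq C M) :
    circleHom (rightUnitorInv X) (𝟙 Y) ≫ assocHom X circleUnit Y ≫
      circleHom (𝟙 X) (leftUnitorIso Y).hom = 𝟙 (circle X Y) := by
  refine circle_hom_ext (fun t a b => ?_)
  -- The blocks are viewed as indexed by the entries of the concatenation of the singletons of `a`,
  -- which is the form that a generator of `(X ∘ I) ∘ Y` requires.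
  obtain ⟨b, rfl⟩ := exists_eq_comp_perm (concatSingle a) b
  have hi : IsIso (famMap Y (concatSingle a) (b := b) (b' := fun k => b ((concatSingle a).perm k))
    (fun k => 𝟙 (b ((concatSingle a).perm k)))) := isIso_famMap _ _ _
  rw [← cancel_epi (X.val t a ◁ famMap Y (concatSingle a) (b := b)
    (b' := fun k => b ((concatSingle a).perm k)) (fun k => 𝟙 (b ((concatSingle a).perm k))))]
  have hpos : ∀ (k : Fin a.len) (l : Fin (single (a.col k)).len),
      pos (fun k => single (a.col k)) ⟨k, l⟩ = (concatSingle a).perm k := by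
    intro k l
    obtain rfl : l = (0 : Fin 1) := Subsingleton.elim (α := Fin 1) _ _
    rfl
  -- The comparison for the associator: the one entry of the `k`-th singleton and the `k`-th entry
  -- of `a` are the same position.
  let ζ : ∀ (k : Fin a.len) (l : Fin (single (a.col k)).len),
      b (pos (fun k => single (a.col k)) ⟨k, l⟩) ⟶ b ((concatSingle a).perm k) :=
    fun k l => eqToHom (congrArg b (hpos k l))
  have h1 := leftGen_assocHom X circleUnit Y t a (d := fun k => single (a.col k)) (b := b)
    (c := fun k _ => b ((concatSingle a).perm k)) ζ
  have h2 := rightUnitGen_circleGen X Y t a b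
  have h3 := rightGen_oneProj X Y t a (fun k => b ((concatSingle a).perm k))
  have h4 := distributeFam_natural (fun k => single (a.col k))
    (fun k => circleUnitι (M := M) (a.col k)) (fun j => 𝟙 (Y.val ((concat _).col j) (b j)))
    (fun k l => Y.act (concat_col (fun k => single (a.col k)) ⟨k, l⟩) (ζ k l))
    (fun k l => Y.act (concat_col (fun k => single (a.col k)) ⟨k, l⟩) (ζ k l))
    (fun k l => 𝟙 (Y.val ((single (a.col k)).col l) (b ((concatSingle a).perm k))))
    (fun k l => (Category.id_comp _).trans (Category.comp_id _).symm)
  have h5 := distributeFam_triangle a (X.val t a) (R := fun j => Y.val ((concat _).col j) (b j))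
    (S := fun k => Y.val (a.col k) (b ((concatSingle a).perm k)))
    (fun k l => Y.act (concat_col (fun k => single (a.col k)) ⟨k, l⟩) (ζ k l))
    (fun k l => inferInstanceAs
      (IsIso (Y.act (concat_col (fun k => single (a.col k)) ⟨k, l⟩) (ζ k l))))
    (fun k => Y.act ((concatSingle a).col_perm k) (𝟙 (b ((concatSingle a).perm k))))
    (fun k => rfl)
  -- The profile half of the triangle: both permutations send an entry of a one-block concatenation
  -- to the same entry of the original block.
  have h6 : concatMap (concatSingle a).perm (b := b) (d := fun k => b ((concatSingle a).perm k))
        (fun k => 𝟙 (b ((concatSingle a).perm k))) ≫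
      blockHom (b := fun k => b ((concatSingle a).perm k))
        (b' := fun k => concat (fun _ : Fin (single (a.col k)).len => b ((concatSingle a).perm k)))
        (fun k => oneConcat (a.col k) (b ((concatSingle a).perm k))) = concatAssoc ζ := by
    refine hom_ext_pos_pos (d := fun k => single (a.col k)) (fun k l i => ?_)
    refine Eq.trans ?_ (concatAssoc_perm_pos ζ k l i).symm
    have h7 := blockHom_perm_pos (b := fun k => b ((concatSingle a).perm k))
      (b' := fun k => concat (fun _ : Fin (single (a.col k)).len => b ((concatSingle a).perm k)))
      (fun k => oneConcat (a.col k) (b ((concatSingle a).perm k))) k (pos _ ⟨l, i⟩)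
    refine (congrArg (concatMap (concatSingle a).perm (b := b)
      (d := fun k => b ((concatSingle a).perm k))
      (fun k => 𝟙 (b ((concatSingle a).perm k)))).perm (h7.trans (congrArg (fun x => pos _ ⟨k, x⟩)
      (oneConcat_perm_pos (a.col k) (b ((concatSingle a).perm k)) l i)))).trans ?_
    refine (concatMap_perm_pos (concatSingle a).perm (b := b)
      (d := fun k => b ((concatSingle a).perm k))
      (fun k => 𝟙 (b ((concatSingle a).perm k))) k i).trans ?_
    exact (pos_eqToHom b (hpos k l) i).symm
  rw [SymSeq.comp_app, SymSeq.comp_app, ← Category.assoc (circleGen _ _ _ _ _), circleGen_app,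
    SymSeq.id_app]
  simp only [SymSeq.id_app, tensorFamMap_id, tensorHom_id, Category.comp_id]
  refine (Category.assoc _ _ _).symm.trans ((congrArg (· ≫ _) h2).trans ?_)
  -- The tensor product half: the units are carried through the rebracketing, after which `h5`
  -- identifies the result with the reindexing along `concatSingle a`.
  have h7 : ((ρ_ (X.val t a)).inv ≫ X.val t a ◁ unitsFam a) ▷ valFam Y _ b ≫
      assocSummand X circleUnit Y t a ζ =
      (((ρ_ (X.val t a)).inv ≫ X.val t a ◁ unitFam a.len) ▷ valFam Y _ b ≫ (α_ _ _ _).hom ≫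
        X.val t a ◁ distributeFam (fun k => single (a.col k)) (fun _ => 𝟙_ M)
          (fun k l => Y.act (concat_col (fun k => single (a.col k)) ⟨k, l⟩) (ζ k l))) ≫
        X.val t a ◁ tensorFamMap a.len (fun k => circleUnitι (a.col k) ▷
          valFam Y (single (a.col k)) (fun _ => b ((concatSingle a).perm k))) := by
    simp only [tensorFamMap_id, tensorHom_id] at h4
    rw [unitsFam, MonoidalCategory.whiskerLeft_comp, ← Category.assoc (ρ_ (X.val t a)).inv]
    exact whiskerRight_associator_whiskerLeft _ _ h4
  have h8 : (X.val t a ◁ famMap Y (concatSingle a) (b := b)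
      (b' := fun k => b ((concatSingle a).perm k)) (fun k => 𝟙 (b ((concatSingle a).perm k)))) = _ :=
    h5.symm
  have h9 : blockHom (b := fun k => b ((concatSingle a).perm k))
        (b' := fun k => concat (fun _ : Fin (single (a.col k)).len => b ((concatSingle a).perm k)))
        (fun k => oneConcat (a.col k) (b ((concatSingle a).perm k))) ≫ inv (concatAssoc ζ) ≫
      concatMap (concatSingle a).perm (b := b) (d := fun k => b ((concatSingle a).perm k))
        (fun k => 𝟙 (b ((concatSingle a).perm k))) = 𝟙 _ := by
    rw [← Category.assoc, ← IsIso.eq_comp_inv, Category.id_comp, IsIso.comp_inv_eq,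
      IsIso.eq_inv_comp]
    exact h6
  rw [h8, MonoidalCategory.whiskerLeft_comp]
  simp only [Category.assoc]
  rw [← Category.assoc (SymSeq.act _ _ _), SymSeq.act_app, Category.assoc, SymSeq.act_app,
    reassoc_of% h1, ← Category.assoc (SymSeq.act _ _ _), SymSeq.act_app, reassoc_of% h7]
  simp only [Category.assoc]
  rw [SymSeq.act_comp]
  have h10 := (SymSeq.act_comp (circle X Y) (rfl : t = t) rfl _ _).trans
    ((congrArg (SymSeq.act (circle X Y) rfl) h9).trans (SymSeq.act_id _ _ _))
  exact congrArg (fun z => _ ≫ _ ≫ _ ≫ z) (comp_eq_of_comp_eq_id h3 h10)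

theorem circle_triangle [MonoidalClosed M] (X Y : SymSeq C M) :
    (assocIso X circleUnit Y).hom ≫ circleHom (𝟙 X) (leftUnitorIso Y).hom =
      circleHom (rightUnitorIso X).hom (𝟙 Y) := by
  have h1 : circleHom (rightUnitorIso X).hom (𝟙 Y) ≫ circleHom (rightUnitorInv X) (𝟙 Y) = 𝟙 _ := by
    rw [circleHom_comp, Category.comp_id]
    exact (congrArg (circleHom · (𝟙 Y)) (rightUnitorIso X).hom_inv_id).trans (circleHom_id _ _)
  rw [← Category.comp_id (circleHom (rightUnitorIso X).hom (𝟙 Y)), ← circle_triangle_aux X Y,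
    ← Category.assoc, h1, Category.id_comp]
  rfl

end Triangle

/-! ### Generators of fourfold circle products, and the five edges of the pentagon. -/

section Pentagon

variable {C : Type v} {M : Type u} [Category.{v} M] [MonoidalCategory M] [SymmetricCategory M]
  [HasColimits M]

/-- The canonical morphisms into `((W ∘ X) ∘ Y) ∘ Z`. -/
noncomputable def leftLeftGen (W X Y Z : SymSeq C M) (t : C) (e : Profile C)
    (d : Fin e.len → Profile C) (c : Fin (concat d).len → Profile C)
    (b : Fin (concat c).len → Profile C) :
    ((W.val t e ⊗ valFam X e d) ⊗ valFam Y (concat d) c) ⊗ valFam Z (concat c) b ⟶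
      (circle (circle (circle W X) Y) Z).val t (concat b) :=
  leftGen W X Y t e d c ▷ valFam Z (concat c) b ≫ circleGen (circle (circle W X) Y) Z t (concat c) b

/-- The canonical morphisms into `W ∘ (X ∘ (Y ∘ Z))`. -/
noncomputable def rightRightGen (W X Y Z : SymSeq C M) (t : C) (e : Profile C)
    (d : Fin e.len → Profile C) (c : ∀ k, Fin (d k).len → Profile C)
    (b : ∀ k l, Fin (c k l).len → Profile C) :
    W.val t e ⊗ tensorFam e.len (fun k => X.val (e.col k) (d k) ⊗ tensorFam (d k).len
        (fun l => Y.val ((d k).col l) (c k l) ⊗ valFam Z (c k l) (b k l))) ⟶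
      (circle W (circle X (circle Y Z))).val t
        (concat (fun k => concat (fun l => concat (b k l)))) :=
  W.val t e ◁ tensorFamMap e.len (fun k => rightGen X Y Z (e.col k) (d k) (c k) (b k)) ≫
    circleGen W (circle X (circle Y Z)) t e (fun k => concat (fun l => concat (b k l)))

/-- The canonical morphisms into `(W ∘ (X ∘ Y)) ∘ Z`. -/
noncomputable def rightLeftGen (W X Y Z : SymSeq C M) (t : C) (e : Profile C)
    (d : Fin e.len → Profile C) (c : ∀ k, Fin (d k).len → Profile C)
    (b : Fin (concat (fun k => concat (c k))).len → Profile C) :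
    (W.val t e ⊗ tensorFam e.len (fun k => X.val (e.col k) (d k) ⊗ valFam Y (d k) (c k))) ⊗
        valFam Z _ b ⟶ (circle (circle W (circle X Y)) Z).val t (concat b) :=
  rightGen W X Y t e d c ▷ valFam Z _ b ≫ circleGen (circle W (circle X Y)) Z t _ b

/-- The canonical morphisms into `W ∘ ((X ∘ Y) ∘ Z)`. -/
noncomputable def leftRightGen (W X Y Z : SymSeq C M) (t : C) (e : Profile C)
    (d : Fin e.len → Profile C) (c : ∀ k, Fin (d k).len → Profile C)
    (b : ∀ k, Fin (concat (c k)).len → Profile C) :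
    W.val t e ⊗ tensorFam e.len (fun k => (X.val (e.col k) (d k) ⊗ valFam Y (d k) (c k)) ⊗
        valFam Z (concat (c k)) (b k)) ⟶
      (circle W (circle (circle X Y) Z)).val t (concat (fun k => concat (b k))) :=
  W.val t e ◁ tensorFamMap e.len (fun k => leftGen X Y Z (e.col k) (d k) (c k) (b k)) ≫
    circleGen W (circle (circle X Y) Z) t e (fun k => concat (b k))

/-- The canonical morphisms into `(W ∘ X) ∘ (Y ∘ Z)`. -/
noncomputable def middleGen (W X Y Z : SymSeq C M) (t : C) (e : Profile C)
    (d : Fin e.len → Profile C) (c : Fin (concat d).len → Profile C)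
    (b : ∀ j, Fin (c j).len → Profile C) :
    (W.val t e ⊗ valFam X e d) ⊗ tensorFam (concat d).len
        (fun j => Y.val ((concat d).col j) (c j) ⊗ valFam Z (c j) (b j)) ⟶
      (circle (circle W X) (circle Y Z)).val t (concat (fun j => concat (b j))) :=
  circleGen W X t e d ▷ _ ≫ rightGen (circle W X) Y Z t (concat d) c b

variable [MonoidalClosed M]

theorem leftLeftGen_hom_ext {W X Y Z V : SymSeq C M}
    {F F' : circle (circle (circle W X) Y) Z ⟶ V}
    (h : ∀ t e d c b, leftLeftGen W X Y Z t e d c b ≫ SymSeq.app F t (concat b) =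
      leftLeftGen W X Y Z t e d c b ≫ SymSeq.app F' t (concat b)) : F = F' :=
  ((presents_left W X Y).left Z).hom_ext (fun t s => h t s.1.1.1 s.1.1.2 s.1.2 s.2)

/-- The associator of `W`, `X`, `Y` changes the profile over which the factors of `Z` are indexed.
These factors are reindexed along `concatAssoc ζ`, and the profile of the whole generator is
corrected accordingly. -/
theorem leftLeftGen_whiskerRight (W X Y Z : SymSeq C M) (t : C) (e : Profile C)
    {d : Fin e.len → Profile C} {c : Fin (concat d).len → Profile C}
    {c' : ∀ k, Fin (d k).len → Profile C} (ζ : ∀ k l, c (pos d ⟨k, l⟩) ⟶ c' k l)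
    {b : Fin (concat c).len → Profile C} {b' : Fin (concat fun k => concat (c' k)).len → Profile C}
    (β : ∀ i, b ((concatAssoc ζ).perm i) ⟶ b' i) :
    leftLeftGen W X Y Z t e d c b ≫
        SymSeq.app (circleHom (assocHom W X Y) (𝟙 Z)) t (concat b) =
      assocSummand W X Y t e ζ ▷ valFam Z (concat c) b ≫ _ ◁ famMap Z (concatAssoc ζ) β ≫
        rightLeftGen W X Y Z t e d c' b' ≫ (circle (circle W (circle X Y)) Z).act rfl
          (inv (concatMap (concatAssoc ζ).perm β)) := by
  have h1 := leftGen_assocHom W X Y t e ζ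
  have h2 := circleGen_natural (circle W (circle X Y)) Z (rfl : t = t) (concatAssoc ζ) β
  -- An action on the left variable of `∘` is traded for a permutation of the factors of `Z`, by
  -- naturality of the generators.
  have h3 : (circle W (circle X Y)).act (rfl : t = t) (inv (concatAssoc ζ)) ▷ valFam Z (concat c) b ≫
      circleGen (circle W (circle X Y)) Z t (concat c) b =
      _ ◁ famMap Z (concatAssoc ζ) β ≫ circleGen (circle W (circle X Y)) Z t _ b' ≫
        (circle (circle W (circle X Y)) Z).act rfl (inv (concatMap (concatAssoc ζ).perm β)) := by
    have h4 := congrArg (fun z => (circle W (circle X Y)).act (rfl : t = t) (inv (concatAssoc ζ)) ▷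
      valFam Z (concat c) b ≫ z ≫ (circle (circle W (circle X Y)) Z).act rfl
        (inv (concatMap (concatAssoc ζ).perm β))) h2
    simp only [Category.assoc, SymSeq.act_comp, IsIso.hom_inv_id, SymSeq.act_id,
      Category.comp_id] at h4
    rw [← h4, ← tensorHom_id, tensorHom_comp_tensorHom_assoc, SymSeq.act_comp, IsIso.inv_hom_id,
      SymSeq.act_id, id_tensorHom, Category.id_comp]
  rw [leftLeftGen, Category.assoc, circleGen_app]
  simp only [SymSeq.id_app, tensorFamMap_id, tensorHom_id]
  rw [← comp_whiskerRight_assoc, h1, comp_whiskerRight, comp_whiskerRight, Category.assoc,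
    Category.assoc, h3, rightLeftGen, Category.assoc, ← whisker_exchange_assoc]

/-- The formula for the associator of `W`, `X ∘ Y`, `Z`, where the middle factors come from
generators of `X ∘ Y`; `h4` moves their insertions past the distribution of the factors of `Z`. -/
theorem rightLeftGen_assocHom (W X Y Z : SymSeq C M) (t : C) (e : Profile C)
    {d : Fin e.len → Profile C} {c : ∀ k, Fin (d k).len → Profile C}
    {b : Fin (concat (fun k => concat (c k))).len → Profile C}
    {b' : ∀ k, Fin (concat (c k)).len → Profile C}
    (ζ : ∀ k j, b (pos (fun k => concat (c k)) ⟨k, j⟩) ⟶ b' k j) :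
    rightLeftGen W X Y Z t e d c b ≫ SymSeq.app (assocHom W (circle X Y) Z) t (concat b) =
      (α_ _ _ _).hom ≫ W.val t e ◁ distributeFam (fun k => concat (c k))
          (fun k => X.val (e.col k) (d k) ⊗ valFam Y (d k) (c k))
          (fun k j => Z.act (concat_col (fun k => concat (c k)) ⟨k, j⟩) (ζ k j)) ≫
        leftRightGen W X Y Z t e d c b' ≫ (circle W (circle (circle X Y) Z)).act rfl
          (inv (concatAssoc ζ)) := by
  have h1 := leftGen_assocHom W (circle X Y) Z t e ζ
  have h2 : rightLeftGen W X Y Z t e d c b =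
      (W.val t e ◁ tensorFamMap e.len (fun k => circleGen X Y (e.col k) (d k) (c k))) ▷ valFam Z _ b ≫
        leftGen W (circle X Y) Z t e (fun k => concat (c k)) b := by
    rw [rightLeftGen, leftGen, rightGen, comp_whiskerRight, Category.assoc]
  have h3 : ∀ k, leftGen X Y Z (e.col k) (d k) (c k) (b' k) =
      (circleGen X Y (e.col k) (d k) (c k) ⊗ₘ tensorFamMap _
        (fun j => 𝟙 (Z.val ((concat (c k)).col j) (b' k j)))) ≫
        circleGen (circle X Y) Z (e.col k) (concat (c k)) (b' k) := fun k => by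
    rw [tensorFamMap_id, tensorHom_id, leftGen]
  have h4 := distributeFam_natural (fun k => concat (c k))
    (fun k => circleGen X Y (e.col k) (d k) (c k)) (fun j => 𝟙 (Z.val ((concat _).col j) (b j)))
    (fun k j => Z.act (concat_col (fun k => concat (c k)) ⟨k, j⟩) (ζ k j))
    (fun k j => Z.act (concat_col (fun k => concat (c k)) ⟨k, j⟩) (ζ k j))
    (fun k j => 𝟙 (Z.val ((concat (c k)).col j) (b' k j)))
    (fun k l => (Category.id_comp _).trans (Category.comp_id _).symm)
  rw [tensorFamMap_id, tensorHom_id] at h4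
  have h5 : tensorFamMap e.len (fun k => leftGen X Y Z (e.col k) (d k) (c k) (b' k)) =
      tensorFamMap e.len (fun k => circleGen X Y (e.col k) (d k) (c k) ⊗ₘ tensorFamMap _
        (fun j => 𝟙 (Z.val ((concat (c k)).col j) (b' k j)))) ≫
        tensorFamMap e.len (fun k => circleGen (circle X Y) Z (e.col k) (concat (c k)) (b' k)) := by
    rw [tensorFamMap_comp]
    exact congrArg _ (funext h3)
  rw [h2, Category.assoc]
  refine (congrArg (_ ≫ ·) h1).trans ?_
  rw [assocSummand, Category.assoc, associator_naturality_middle_assoc, distributeTo,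
    ← MonoidalCategory.whiskerLeft_comp_assoc]
  refine (congrArg (fun z => (α_ _ _ _).hom ≫ W.val t e ◁ z ≫ _) h4).trans ?_
  rw [leftRightGen, rightGen, h5]
  simp only [MonoidalCategory.whiskerLeft_comp, Category.assoc]

/-- The associator acts in every block separately. The profile corrections of the blocks are
collected into one correction of the whole generator. -/
theorem leftRightGen_whiskerLeft (W X Y Z : SymSeq C M) (t : C) (e : Profile C)
    {d : Fin e.len → Profile C} {c : ∀ k, Fin (d k).len → Profile C}
    {b : ∀ k, Fin (concat (c k)).len → Profile C} {b' : ∀ k l, Fin (c k l).len → Profile C}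
    (ζ : ∀ k l n, b k (pos (c k) ⟨l, n⟩) ⟶ b' k l n) :
    leftRightGen W X Y Z t e d c b ≫
        SymSeq.app (circleHom (𝟙 W) (assocHom X Y Z)) t (concat fun k => concat (b k)) =
      W.val t e ◁ tensorFamMap e.len (fun k => assocSummand X Y Z (e.col k) (d k) (ζ k)) ≫
        rightRightGen W X Y Z t e d c b' ≫ (circle W (circle X (circle Y Z))).act rfl
          (blockHom (b := fun k => concat (fun l => concat (b' k l))) (b' := fun k => concat (b k))
            (fun k => inv (concatAssoc (ζ k)))) := by
  have h2 := circleGen_valFamMap W (circle X (circle Y Z)) t (a := e)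
    (b := fun k => concat (fun l => concat (b' k l))) (b' := fun k => concat (b k))
    (fun k => inv (concatAssoc (ζ k)))
  rw [leftRightGen, rightRightGen, Category.assoc, circleGen_app, SymSeq.id_app, id_tensorHom,
    Category.assoc, ← h2, valFamMap]
  simp only [← MonoidalCategory.whiskerLeft_comp_assoc, tensorFamMap_comp]
  simp only [leftGen_assocHom X Y Z _ _ (ζ _)]

theorem leftLeftGen_assocHom (W X Y Z : SymSeq C M) (t : C) (e : Profile C)
    {d : Fin e.len → Profile C} {c : Fin (concat d).len → Profile C}
    {b : Fin (concat c).len → Profile C} {b' : ∀ j, Fin (c j).len → Profile C}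
    (ζ : ∀ j n, b (pos c ⟨j, n⟩) ⟶ b' j n) :
    leftLeftGen W X Y Z t e d c b ≫ SymSeq.app (assocHom (circle W X) Y Z) t (concat b) =
      (α_ _ _ _).hom ≫ _ ◁ distributeTo Y Z (concat d) ζ ≫ middleGen W X Y Z t e d c b' ≫
        (circle (circle W X) (circle Y Z)).act rfl (inv (concatAssoc ζ)) := by
  have h1 := leftGen_assocHom (circle W X) Y Z t (concat d) ζ
  have h2 : leftLeftGen W X Y Z t e d c b = (circleGen W X t e d ▷ valFam Y (concat d) c) ▷
      valFam Z (concat c) b ≫ leftGen (circle W X) Y Z t (concat d) c b := by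
    rw [leftLeftGen, leftGen, leftGen, comp_whiskerRight, Category.assoc]
  rw [h2, Category.assoc, h1, assocSummand, Category.assoc, associator_naturality_left_assoc,
    middleGen, Category.assoc, whisker_exchange_assoc]

/-- The last variable is `Y ∘ Z`, so the factors that are distributed are themselves generators. The
colors computed by `concat_col` act on `Y` and leave `Z` alone (`h3`). -/
theorem middleGen_assocHom (W X Y Z : SymSeq C M) (t : C) (e : Profile C)
    (d : Fin e.len → Profile C) (c : Fin (concat d).len → Profile C)
    (b : ∀ j, Fin (c j).len → Profile C) :
    middleGen W X Y Z t e d c b ≫ SymSeq.app (assocHom W X (circle Y Z)) t _ =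
      (α_ _ _ _).hom ≫ W.val t e ◁ distributeFam d (fun k => X.val (e.col k) (d k))
          (Q := fun j => Y.val ((concat d).col j) (c j) ⊗ valFam Z (c j) (b j))
          (fun k l => Y.act (concat_col d ⟨k, l⟩) (𝟙 (c (pos d ⟨k, l⟩))) ⊗ₘ
            tensorFamMap _ (fun n => 𝟙 (Z.val _ (b (pos d ⟨k, l⟩) n)))) ≫
        rightRightGen W X Y Z t e d (fun k l => c (pos d ⟨k, l⟩)) (fun k l => b (pos d ⟨k, l⟩)) ≫
        (circle W (circle X (circle Y Z))).act rfl (inv (concatAssoc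
          (b := fun j => concat (b j)) (fun k l => 𝟙 (concat (b (pos d ⟨k, l⟩)))))) := by
  have h1 := leftGen_assocHom W X (circle Y Z) t e (d := d) (b := fun j => concat (b j))
    (fun k l => 𝟙 (concat (b (pos d ⟨k, l⟩))))
  have h2 : middleGen W X Y Z t e d c b = ((W.val t e ⊗ valFam X e d) ◁ tensorFamMap (concat d).len
      (fun j => circleGen Y Z ((concat d).col j) (c j) (b j))) ≫
        leftGen W X (circle Y Z) t e d (fun j => concat (b j)) := by
    rw [middleGen, leftGen, rightGen, whisker_exchange_assoc]
  have h3 : ∀ k l, circleGen Y Z ((concat d).col (pos d ⟨k, l⟩)) (c (pos d ⟨k, l⟩))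
        (b (pos d ⟨k, l⟩)) ≫ (circle Y Z).act (concat_col d ⟨k, l⟩)
          (𝟙 (concat (b (pos d ⟨k, l⟩)))) =
      (Y.act (concat_col d ⟨k, l⟩) (𝟙 (c (pos d ⟨k, l⟩))) ⊗ₘ
        tensorFamMap _ (fun n => 𝟙 (Z.val _ (b (pos d ⟨k, l⟩) n)))) ≫
        circleGen Y Z ((d k).col l) (c (pos d ⟨k, l⟩)) (b (pos d ⟨k, l⟩)) := fun k l => by
    have h := circleGen_natural Y Z (concat_col d ⟨k, l⟩) (𝟙 (c (pos d ⟨k, l⟩)))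
      (b := b (pos d ⟨k, l⟩)) (b' := b (pos d ⟨k, l⟩)) (fun n => 𝟙 _)
    refine Eq.trans ?_ (h.symm.trans ?_)
    · exact congrArg (fun z => circleGen Y Z _ _ _ ≫ (circle Y Z).act _ z) (concatMap_id _).symm
    · refine congrArg (fun z => (_ ⊗ₘ z) ≫ _) ?_
      exact (famMap_id_left Z _).trans ((valFamMap_id Z _ _).trans (tensorFamMap_id _ _).symm)
  have h4 := distributeFam_natural d (fun k => 𝟙 (X.val (e.col k) (d k)))
    (fun j => circleGen Y Z ((concat d).col j) (c j) (b j)) _ _ _ h3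
  rw [tensorFamMap_id, id_tensorHom] at h4
  rw [h2, Category.assoc]
  refine (congrArg (_ ≫ ·) h1).trans ?_
  rw [assocSummand, Category.assoc, associator_naturality_right_assoc, distributeTo,
    ← MonoidalCategory.whiskerLeft_comp_assoc]
  refine (congrArg (fun z => (α_ _ _ _).hom ≫ W.val t e ◁ z ≫ _) h4).trans ?_
  have h5 : tensorFamMap e.len (fun k => 𝟙 (X.val (e.col k) (d k)) ⊗ₘ tensorFamMap (d k).len
      (fun l => circleGen Y Z ((d k).col l) (c (pos d ⟨k, l⟩)) (b (pos d ⟨k, l⟩)))) ≫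
        tensorFamMap e.len (fun k => circleGen X (circle Y Z) (e.col k) (d k)
          (fun l => concat (b (pos d ⟨k, l⟩)))) =
      tensorFamMap e.len (fun k => rightGen X Y Z (e.col k) (d k) (fun l => c (pos d ⟨k, l⟩))
        (fun l => b (pos d ⟨k, l⟩))) := by
    rw [tensorFamMap_comp]
    exact congrArg _ (funext fun k => by rw [id_tensorHom, rightGen])
  rw [rightRightGen, ← h5, rightGen]
  simp only [MonoidalCategory.whiskerLeft_comp, Category.assoc]

end Pentagon

/-! ### The profile half of the pentagon. -/

section PentagonProfiles

variable {C : Type v}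

theorem hom_ext_pos_pos_pos {m : ℕ} {d : Fin m → Profile C} {c : ∀ k, Fin (d k).len → Profile C}
    {b : ∀ k l, Fin (c k l).len → Profile C}
    {x : Profile C} {f g : x ⟶ concat (fun k => concat (fun l => concat (b k l)))}
    (h : ∀ k l n i,
      f.perm (pos (fun k => concat (fun l => concat (b k l))) ⟨k, pos (fun l => concat (b k l))
        ⟨l, pos (b k l) ⟨n, i⟩⟩⟩) =
      g.perm (pos (fun k => concat (fun l => concat (b k l))) ⟨k, pos (fun l => concat (b k l))
        ⟨l, pos (b k l) ⟨n, i⟩⟩⟩)) : f = g := by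
  refine hom_ext_pos_pos (c := fun k l => concat (b k l)) (fun k l j => ?_)
  obtain ⟨⟨n, i⟩, rfl⟩ := (pos (b k l)).surjective j
  exact h k l n i

theorem comp_perm_eq {a b c : Profile C} {f : a ⟶ b} {g : b ⟶ c} {x : Fin c.len} {y : Fin b.len}
    {z : Fin a.len} (hg : g.perm x = y) (hf : f.perm y = z) : (f ≫ g).perm x = z := by
  subst hg
  exact hf

/-- The pentagon of the associativity isomorphisms of concatenation. -/
theorem concatAssoc_pentagon {m : ℕ} {d : Fin m → Profile C} {c : Fin (concat d).len → Profile C}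
    (b : Fin (concat c).len → Profile C)
    (κ : concat c ⟶ concat (fun k => concat (fun l => c (pos d ⟨k, l⟩))))
    (hκ : ∀ k l n, κ.perm (pos (fun k => concat (fun l => c (pos d ⟨k, l⟩)))
      ⟨k, pos (fun l => c (pos d ⟨k, l⟩)) ⟨l, n⟩⟩) = pos c ⟨pos d ⟨k, l⟩, n⟩) :
    concatMap κ.perm (fun i => 𝟙 (b (κ.perm i))) ≫
      concatAssoc (b := fun i => b (κ.perm i)) (fun k j => 𝟙 (b (κ.perm (pos _ ⟨k, j⟩)))) ≫
      blockHom (b' := fun k => concat (fun l => concat (fun n => b (pos c ⟨pos d ⟨k, l⟩, n⟩))))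
        (fun k => concatAssoc (d := fun l => c (pos d ⟨k, l⟩))
          (b := fun j => b (κ.perm (pos (fun k => concat (fun l => c (pos d ⟨k, l⟩))) ⟨k, j⟩)))
          (c := fun l n => b (pos c ⟨pos d ⟨k, l⟩, n⟩))
          (fun l n => eqToHom (congrArg b (hκ k l n)))) =
    concatAssoc (fun j n => 𝟙 (b (pos c ⟨j, n⟩))) ≫
      concatAssoc (b := fun j => concat (fun n => b (pos c ⟨j, n⟩)))
        (fun k l => 𝟙 (concat (fun n => b (pos c ⟨pos d ⟨k, l⟩, n⟩)))) := by
  refine hom_ext_pos_pos_pos (c := fun k l => c (pos d ⟨k, l⟩))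
    (b := fun k l n => b (pos c ⟨pos d ⟨k, l⟩, n⟩)) (fun k l n i => ?_)
  -- An entry is traced through both composites. The right-hand side (`h1`, `h2`) and the left-hand
  -- side (`h3`, `h4`, `h5`) reach the same position of `concat b`.
  have h1 : (concatAssoc (b := fun j => concat (fun n => b (pos c ⟨j, n⟩)))
      (fun k l => 𝟙 (concat (fun n => b (pos c ⟨pos d ⟨k, l⟩, n⟩))))).perm
        (pos (fun k => concat (fun l => concat (fun n => b (pos c ⟨pos d ⟨k, l⟩, n⟩))))
          ⟨k, pos (fun l => concat (fun n => b (pos c ⟨pos d ⟨k, l⟩, n⟩)))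
            ⟨l, pos (fun n => b (pos c ⟨pos d ⟨k, l⟩, n⟩)) ⟨n, i⟩⟩⟩) =
      pos (fun j => concat (fun n => b (pos c ⟨j, n⟩))) ⟨pos d ⟨k, l⟩,
        pos (fun n => b (pos c ⟨pos d ⟨k, l⟩, n⟩)) ⟨n, i⟩⟩ :=
    concatAssoc_perm_pos (b := fun j => concat (fun n => b (pos c ⟨j, n⟩))) _ k l _
  have h2 : (concatAssoc (fun j n => 𝟙 (b (pos c ⟨j, n⟩)))).perm
      (pos (fun j => concat (fun n => b (pos c ⟨j, n⟩))) ⟨pos d ⟨k, l⟩,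
        pos (fun n => b (pos c ⟨pos d ⟨k, l⟩, n⟩)) ⟨n, i⟩⟩) = pos b ⟨pos c ⟨pos d ⟨k, l⟩, n⟩, i⟩ :=
    concatAssoc_perm_pos (fun j n => 𝟙 (b (pos c ⟨j, n⟩))) (pos d ⟨k, l⟩) n i
  have h3 : (blockHom (b' := fun k => concat (fun l => concat (fun n => b (pos c ⟨pos d ⟨k, l⟩, n⟩))))
        (fun k => concatAssoc (d := fun l => c (pos d ⟨k, l⟩))
          (b := fun j => b (κ.perm (pos (fun k => concat (fun l => c (pos d ⟨k, l⟩))) ⟨k, j⟩)))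
          (c := fun l n => b (pos c ⟨pos d ⟨k, l⟩, n⟩))
          (fun l n => eqToHom (congrArg b (hκ k l n))))).perm
      (pos (fun k => concat (fun l => concat (fun n => b (pos c ⟨pos d ⟨k, l⟩, n⟩))))
          ⟨k, pos (fun l => concat (fun n => b (pos c ⟨pos d ⟨k, l⟩, n⟩)))
            ⟨l, pos (fun n => b (pos c ⟨pos d ⟨k, l⟩, n⟩)) ⟨n, i⟩⟩⟩) =
      pos (fun k => concat (fun j => b (κ.perm (pos (fun k => concat (fun l => c (pos d ⟨k, l⟩)))
        ⟨k, j⟩)))) ⟨k, pos (fun j => b (κ.perm (pos (fun k => concat (fun l => c (pos d ⟨k, l⟩)))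
        ⟨k, j⟩))) ⟨pos (fun l => c (pos d ⟨k, l⟩)) ⟨l, n⟩,
          (eqToHom (congrArg b (hκ k l n)) : b _ ⟶ b _).perm i⟩⟩ :=
    (blockHom_perm_pos _ _ _).trans (congrArg (fun z => pos _ ⟨k, z⟩)
      (concatAssoc_perm_pos (d := fun l => c (pos d ⟨k, l⟩))
          (b := fun j => b (κ.perm (pos (fun k => concat (fun l => c (pos d ⟨k, l⟩))) ⟨k, j⟩)))
          (c := fun l n => b (pos c ⟨pos d ⟨k, l⟩, n⟩)) _ l n i))
  have h4 : (concatAssoc (b := fun i => b (κ.perm i))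
      (fun k j => 𝟙 (b (κ.perm (pos (fun k => concat (fun l => c (pos d ⟨k, l⟩))) ⟨k, j⟩))))).perm
      (pos (fun k => concat (fun j => b (κ.perm (pos (fun k => concat (fun l => c (pos d ⟨k, l⟩)))
        ⟨k, j⟩)))) ⟨k, pos (fun j => b (κ.perm (pos (fun k => concat (fun l => c (pos d ⟨k, l⟩)))
        ⟨k, j⟩))) ⟨pos (fun l => c (pos d ⟨k, l⟩)) ⟨l, n⟩,
          (eqToHom (congrArg b (hκ k l n)) : b _ ⟶ b _).perm i⟩⟩) =
      pos (fun i => b (κ.perm i)) ⟨pos (fun k => concat (fun l => c (pos d ⟨k, l⟩)))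
        ⟨k, pos (fun l => c (pos d ⟨k, l⟩)) ⟨l, n⟩⟩,
          (eqToHom (congrArg b (hκ k l n)) : b _ ⟶ b _).perm i⟩ :=
    concatAssoc_perm_pos (d := fun k => concat (fun l => c (pos d ⟨k, l⟩)))
      (b := fun i => b (κ.perm i)) _ k _ _
  have h5 : (concatMap κ.perm (fun i => 𝟙 (b (κ.perm i)))).perm
      (pos (fun i => b (κ.perm i)) ⟨pos (fun k => concat (fun l => c (pos d ⟨k, l⟩)))
        ⟨k, pos (fun l => c (pos d ⟨k, l⟩)) ⟨l, n⟩⟩,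
          (eqToHom (congrArg b (hκ k l n)) : b _ ⟶ b _).perm i⟩) =
      pos b ⟨pos c ⟨pos d ⟨k, l⟩, n⟩, i⟩ :=
    (concatMap_perm_pos κ.perm (d := fun i => b (κ.perm i)) _ _ _).trans (pos_eqToHom b (hκ k l n) i)
  exact (comp_perm_eq (comp_perm_eq h3 h4) h5).trans (comp_perm_eq h1 h2).symm

end PentagonProfiles

/-! ### Assembly of the pentagon. -/

section Pentagon

variable {C : Type v} {M : Type u} [Category.{v} M] [MonoidalCategory M] [SymmetricCategory M]
  [HasColimits M]

theorem comp_inv_comp_inv_eq {A : Type*} [Groupoid A] {x y z w y' : A} {f : x ⟶ y} {g : y ⟶ z}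
    {h : z ⟶ w} {f' : x ⟶ y'} {g' : y' ⟶ w} {k : w ⟶ z} (e : f ≫ g ≫ h = f' ≫ g')
    (hk : k ≫ h = 𝟙 w) : k ≫ inv g ≫ inv f = inv g' ≫ inv f' := by
  have h1 : k = inv h := IsIso.eq_inv_of_inv_hom_id hk
  subst h1
  rw [← IsIso.inv_comp, ← IsIso.inv_comp, ← IsIso.inv_comp, IsIso.inv_eq_inv, Category.assoc, e]

/-- The two ways of rebracketing the summands of a fourfold circle product agree. -/
theorem assocSummand_pentagon (W X Y Z : SymSeq C M) (t : C) (e : Profile C)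
    {d : Fin e.len → Profile C} {c : Fin (concat d).len → Profile C}
    (b : Fin (concat c).len → Profile C)
    (κ : concat c ⟶ concat (fun k => concat (fun l => c (pos d ⟨k, l⟩))))
    (hκ : ∀ k l n, κ.perm (pos (fun k => concat (fun l => c (pos d ⟨k, l⟩)))
      ⟨k, pos (fun l => c (pos d ⟨k, l⟩)) ⟨l, n⟩⟩) = pos c ⟨pos d ⟨k, l⟩, n⟩) :
    assocSummand W X Y t e (fun k l => 𝟙 (c (pos d ⟨k, l⟩))) ▷ valFam Z (concat c) b ≫
      (_ ◁ famMap Z κ (fun i => 𝟙 (b (κ.perm i)))) ≫ (α_ _ _ _).hom ≫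
      W.val t e ◁ (distributeFam (fun k => concat (fun l => c (pos d ⟨k, l⟩)))
        (fun k => X.val (e.col k) (d k) ⊗ valFam Y (d k) (fun l => c (pos d ⟨k, l⟩)))
        (fun k j => Z.act (concat_col (fun k => concat (fun l => c (pos d ⟨k, l⟩))) ⟨k, j⟩)
          (𝟙 (b (κ.perm (pos _ ⟨k, j⟩))))) ≫
        tensorFamMap e.len (fun k => assocSummand X Y Z (e.col k) (d k)
          (b := fun j => b (κ.perm (pos (fun k => concat (fun l => c (pos d ⟨k, l⟩))) ⟨k, j⟩)))
          (c := fun l n => b (pos c ⟨pos d ⟨k, l⟩, n⟩))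
          (fun l n => eqToHom (congrArg b (hκ k l n))))) =
    (α_ _ _ _).hom ≫ _ ◁ distributeTo Y Z (concat d) (fun j n => 𝟙 (b (pos c ⟨j, n⟩))) ≫
      (α_ _ _ _).hom ≫ W.val t e ◁ distributeFam d (fun k => X.val (e.col k) (d k))
        (Q := fun j => Y.val ((concat d).col j) (c j) ⊗ valFam Z (c j) (fun n => b (pos c ⟨j, n⟩)))
        (fun k l => Y.act (concat_col d ⟨k, l⟩) (𝟙 (c (pos d ⟨k, l⟩))) ⊗ₘ
          tensorFamMap _ (fun n => 𝟙 (Z.val _ (b (pos c ⟨pos d ⟨k, l⟩, n⟩))))) := by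
  refine distributeFam_pentagon κ hκ (W.val t e) (fun k => X.val (e.col k) (d k))
    (Q := fun j => Y.val ((concat d).col j) (c j))
    (Q' := fun k l => Y.val ((d k).col l) (c (pos d ⟨k, l⟩)))
    (R := fun j => Z.val ((concat c).col j) (b j))
    (S := fun j => Z.val _ (b (κ.perm j)))
    (S' := fun k j => Z.val ((concat (fun l => c (pos d ⟨k, l⟩))).col j)
      (b (κ.perm (pos (fun k => concat (fun l => c (pos d ⟨k, l⟩))) ⟨k, j⟩))))
    (R' := fun k l n => Z.val ((c (pos d ⟨k, l⟩)).col n) (b (pos c ⟨pos d ⟨k, l⟩, n⟩)))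
    (R₁ := fun j n => Z.val ((c j).col n) (b (pos c ⟨j, n⟩)))
    (fun k l => Y.act (concat_col d ⟨k, l⟩) (𝟙 (c (pos d ⟨k, l⟩))))
    (fun j => Z.act (κ.col_perm j) (𝟙 (b (κ.perm j))))
    (fun k j => Z.act (concat_col (fun k => concat (fun l => c (pos d ⟨k, l⟩))) ⟨k, j⟩)
      (𝟙 (b (κ.perm (pos _ ⟨k, j⟩)))))
    (fun k l n => Z.act (concat_col (fun l => c (pos d ⟨k, l⟩)) ⟨l, n⟩)
      (eqToHom (congrArg b (hκ k l n))))
    (fun j n => Z.act (concat_col c ⟨j, n⟩) (𝟙 (b (pos c ⟨j, n⟩))))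
    (fun k l n => 𝟙 (Z.val _ (b (pos c ⟨pos d ⟨k, l⟩, n⟩)))) (fun k l n => ?_)
  rw [SymSeq.act_comp, SymSeq.act_comp]
  refine (congrArg (· ≫ _) (SymSeq.eqToHom_eq_act Z _ b (hκ k l n))).trans ?_
  rw [Category.comp_id, SymSeq.act_comp, Category.comp_id, Category.id_comp, Category.id_comp]

/-- The known effects of two successive edges on generators are pasted into that of their composite;
`u` is the profile correction that has to pass the second edge. -/
theorem comp_comp_eq_of_comp_eq {A : Type*} [Category A] {a a' a'' b b' b'' c c' : A} {l : a ⟶ b}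
    {f : b ⟶ b'} {p : a ⟶ a'} {g : a' ⟶ c} {u : c ⟶ b'} {f' : b' ⟶ b''} {f'' : c ⟶ c'}
    {u' : c' ⟶ b''} {q : a' ⟶ a''} {d : A} {k : a'' ⟶ d} {w : d ⟶ c'}
    (h : l ≫ f = p ≫ g ≫ u) (h' : u ≫ f' = f'' ≫ u') (h'' : g ≫ f'' = q ≫ k ≫ w) :
    l ≫ f ≫ f' = (p ≫ q) ≫ k ≫ w ≫ u' := by
  rw [reassoc_of% h, h', reassoc_of% h'', Category.assoc]

variable [MonoidalClosed M]

/-- On a fourfold generator each route is a morphism of tensor products, a generator of `W ∘ (X ∘ (Y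
∘ Z))`, and a profile correction. The tensor product parts agree by `assocSummand_pentagon`, the
corrections by `concatAssoc_pentagon`. -/
theorem circle_pentagon (W X Y Z : SymSeq C M) :
    circleHom (assocHom W X Y) (𝟙 Z) ≫ assocHom W (circle X Y) Z ≫
        circleHom (𝟙 W) (assocHom X Y Z) =
      assocHom (circle W X) Y Z ≫ assocHom W X (circle Y Z) := by
  refine leftLeftGen_hom_ext (fun t e d c b => ?_)
  have hκ : ∀ k l n, (concatAssoc (fun k l => 𝟙 (c (pos d ⟨k, l⟩)))).perm
      (pos (fun k => concat (fun l => c (pos d ⟨k, l⟩)))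
        ⟨k, pos (fun l => c (pos d ⟨k, l⟩)) ⟨l, n⟩⟩) = pos c ⟨pos d ⟨k, l⟩, n⟩ :=
    fun k l n => concatAssoc_perm_pos (fun k l => 𝟙 (c (pos d ⟨k, l⟩))) k l n
  have hl := leftLeftGen_whiskerRight W X Y Z t e (fun k l => 𝟙 (c (pos d ⟨k, l⟩)))
    (b := b) (fun i => 𝟙 (b ((concatAssoc (fun k l => 𝟙 (c (pos d ⟨k, l⟩)))).perm i)))
  have hp := concatAssoc_pentagon b (concatAssoc (fun k l => 𝟙 (c (pos d ⟨k, l⟩)))) hκ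
  have hs := assocSummand_pentagon W X Y Z t e b (concatAssoc (fun k l => 𝟙 (c (pos d ⟨k, l⟩)))) hκ
  have hl2 := rightLeftGen_assocHom W X Y Z t e (c := fun k l => c (pos d ⟨k, l⟩))
    (b := fun i => b ((concatAssoc (fun k l => 𝟙 (c (pos d ⟨k, l⟩)))).perm i))
    (fun k j => 𝟙 (b ((concatAssoc (fun k l => 𝟙 (c (pos d ⟨k, l⟩)))).perm (pos _ ⟨k, j⟩))))
  have hl3 := leftRightGen_whiskerLeft W X Y Z t e (c := fun k l => c (pos d ⟨k, l⟩))
    (b := fun k j => b ((concatAssoc (fun k l => 𝟙 (c (pos d ⟨k, l⟩)))).perm (pos _ ⟨k, j⟩)))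
    (b' := fun k l n => b (pos c ⟨pos d ⟨k, l⟩, n⟩))
    (fun k l n => eqToHom (congrArg b (hκ k l n)))
  have hr := leftLeftGen_assocHom W X Y Z t e (d := d) (fun j n => 𝟙 (b (pos c ⟨j, n⟩)))
  have hr2 := middleGen_assocHom W X Y Z t e d c (fun j n => b (pos c ⟨j, n⟩))
  -- From here on only the effect of this permutation on the entries is used, and `hκ` records it.
  generalize concatAssoc (fun k l => 𝟙 (c (pos d ⟨k, l⟩))) = κ at *
  have hL := comp_comp_eq_of_comp_eq (comp_comp_eq_of_comp_eq (hl.trans (Category.assoc _ _ _).symm)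
    (SymSeq.act_app _ _ _) (hl2.trans (Category.assoc _ _ _).symm))
    ((congrArg (· ≫ _) (SymSeq.act_comp _ _ _ _ _)).trans (SymSeq.act_app _ _ _)) hl3
  have hR := comp_comp_eq_of_comp_eq (hr.trans (Category.assoc _ _ _).symm) (SymSeq.act_app _ _ _)
    (hr2.trans (Category.assoc _ _ _).symm)
  refine (congrArg (_ ≫ ·) (Category.assoc _ _ _).symm).trans (hL.trans (Eq.trans ?_ hR.symm))
  refine congrArg₂ (· ≫ ·) ?_ (congrArg (_ ≫ ·) ?_)
  · simp only [MonoidalCategory.whiskerLeft_comp, Category.assoc] at hs ⊢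
    exact hs
  · refine (SymSeq.act_comp _ _ _ _ _).trans (Eq.trans ?_ (SymSeq.act_comp _ _ _ _ _).symm)
    refine congrArg (SymSeq.act _ _) (comp_inv_comp_inv_eq hp ?_)
    refine (blockHom_comp _ _).symm.trans (Eq.trans ?_ (blockHom_id _))
    exact congrArg blockHom (funext fun k => IsIso.inv_hom_id (concatAssoc
      (d := fun l => c (pos d ⟨k, l⟩)) (b := fun j => b (κ.perm (pos _ ⟨k, j⟩)))
      (c := fun l n => b (pos c ⟨pos d ⟨k, l⟩, n⟩)) (fun l n => eqToHom (congrArg b (hκ k l n)))))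

end Pentagon

/-! ### The circle product as a monoidal structure. -/

section Monoidal

variable {C : Type v} {M : Type u} [Category.{v} M] [MonoidalCategory M] [SymmetricCategory M]
  [HasColimits M] [MonoidalClosed M]

theorem circleι_assocIso (X Y Z : SymSeq C M) (t : C) (e : Profile C) (d : Fin e.len → Profile C)
    (b : Fin (concat d).len → Profile C) :
    circleι X Y t (concat d) e d (𝟙 _) ▷ valFam Z (concat d) b ≫
        circleι (circle X Y) Z t (concat b) (concat d) b (𝟙 _) ≫
        SymSeq.app (assocIso X Y Z).hom t (concat b) =
      (α_ (X.val t e) (valFam Y e d) (valFam Z (concat d) b)).hom ≫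
        X.val t e ◁ (distribute Y Z e d b ≫ tensorFamMap e.len (fun k =>
          circleι Y Z (e.col k) (concat (fun l => b (pos d ⟨k, l⟩))) (d k)
            (fun l => b (pos d ⟨k, l⟩)) (𝟙 _))) ≫
        circleι X (circle Y Z) t (concat b) e (fun k => concat (fun l => b (pos d ⟨k, l⟩)))
          (Groupoid.inv (concatConcat d b)) := by
  have h := leftGen_assocHom X Y Z t e (fun k l => 𝟙 (b (pos d ⟨k, l⟩)))
  rw [leftGen, Category.assoc] at h
  refine h.trans ?_
  have h2 : circleGen X (circle Y Z) t e (fun k => concat (fun l => b (pos d ⟨k, l⟩))) ≫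
      (circle X (circle Y Z)).act rfl (inv (concatAssoc (fun k l => 𝟙 (b (pos d ⟨k, l⟩))))) =
      circleIn X (circle Y Z) t (fun k => concat (fun l => b (pos d ⟨k, l⟩)))
        (Groupoid.inv (concatConcat d b)) := by
    rw [circleGen_act, concatAssoc_id, Groupoid.inv_eq_inv]
  rw [assocSummand, rightGen, Category.assoc, Category.assoc, h2, distributeTo_id,
    ← MonoidalCategory.whiskerLeft_comp_assoc]
  rfl

theorem circleι_leftUnitorIso (X : SymSeq C M) (t : C) (b : Profile C) :
    (λ_ (X.val t b)).inv ≫ (circleUnitι t ⊗ₘ (ρ_ (X.val t b)).inv) ≫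
        circleι circleUnit X t b (single t) (fun _ => b) (concatOne b) ≫
        SymSeq.app (leftUnitorIso X).hom t b = 𝟙 (X.val t b) := by
  have h : leftUnitGen X t b ≫ SymSeq.app (leftUnitorIso X).hom t b = 𝟙 (X.val t b) :=
    congrArg (fun f => SymSeq.app f t b) (leftUnitorIso X).inv_hom_id
  rw [leftUnitGen, Category.assoc, Category.assoc] at h
  exact h

theorem circleι_rightUnitorIso (X : SymSeq C M) (t : C) (a : Profile C) :
    (ρ_ (X.val t a)).inv ≫
        X.val t a ◁ (unitFam a.len ≫ tensorFamMap a.len (fun i => circleUnitι (a.col i))) ≫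
        circleι X circleUnit t a a (fun i => single (a.col i)) (concatSingle a) ≫
        SymSeq.app (rightUnitorIso X).hom t a = 𝟙 (X.val t a) := by
  have h : rightUnitGen X t a ≫ SymSeq.app (rightUnitorIso X).hom t a = 𝟙 (X.val t a) :=
    congrArg (fun f => SymSeq.app f t a) (rightUnitorIso X).inv_hom_id
  rw [rightUnitGen, Category.assoc, Category.assoc] at h
  exact h

/-- The associator and the unitors of the circle product. -/
noncomputable def circleMonoidal : CircleMonoidal C M where
  associator := assocIso
  leftUnitor := leftUnitorIso
  rightUnitor := rightUnitorIso
  circleι_associator := circleι_assocIso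
  circleι_leftUnitor := circleι_leftUnitorIso
  circleι_rightUnitor := circleι_rightUnitorIso
  associator_naturality := assocIso_naturality
  leftUnitor_naturality := leftUnitorIso_naturality
  rightUnitor_naturality := rightUnitorIso_naturality
  pentagon := circle_pentagon
  triangle := circle_triangle

end Monoidal

open Profile Functor.LaxMonoidal

/-! ### Compatibility of distribution and unit families with a lax symmetric monoidal functor. -/

section LaxCoherence

variable {C : Type v} {M : Type u} [Category.{v} M] [MonoidalCategory M] [SymmetricCategory M]
  {J : M ⥤ M} [J.LaxBraided]

theorem LaxCanon.whiskerLeft {ι : Type*} {A B : ι → M} {φ : ∀ i, A i ⟶ J.obj (B i)} {Q P' Q' : M}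
    {S : Shape A (J.obj P')} {T : Shape A Q} {S' : Shape B P'} {T' : Shape B Q'} {g : Q ⟶ J.obj Q'}
    (hf : LaxCanon J φ S S' (𝟙 (J.obj P'))) (hg : LaxCanon J φ T T' g) :
    LaxCanon J φ (S.tensor T) (S'.tensor T') (J.obj P' ◁ g ≫ μ J _ _) := by
  rw [← id_tensorHom]
  exact hf.tensor hg

theorem LaxCanon.tensor' {ι : Type*} {A B : ι → M} {φ : ∀ i, A i ⟶ J.obj (B i)} {P Q P' Q' : M}
    {S : Shape A P} {T : Shape A Q} {S' : Shape B P'} {T' : Shape B Q'} {f : P ⟶ J.obj P'}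
    {g : Q ⟶ J.obj Q'} (hf : LaxCanon J φ S S' f) (hg : LaxCanon J φ T T' g) :
    LaxCanon J φ (S.tensor T) (S'.tensor T') (f ▷ Q ≫ J.obj P' ◁ g ≫ μ J _ _) := by
  rw [← MonoidalCategory.tensorHom_def_assoc]
  exact hf.tensor hg

theorem LaxCanon.fam {ι : Type*} {A B : ι → M} {φ : ∀ i, A i ⟶ J.obj (B i)} (n : ℕ)
    {Q : Fin n → M} {S : ∀ i, Shape A (J.obj (Q i))} {T : ∀ i, Shape B (Q i)}
    (h : ∀ i, LaxCanon J φ (S i) (T i) (𝟙 (J.obj (Q i)))) :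
    LaxCanon J φ (.fam n S) (.fam n T) (CircleSeq.laxFam J n Q) := by
  have h1 := LaxCanon.laxFam n h
  rwa [tensorFamMap_id, Category.id_comp] at h1

/-- Distributing factors over blocks is compatible with a lax symmetric monoidal functor. -/
theorem distributeFam_lax {m : ℕ} (d : Fin m → Profile C) (w : M) (P : Fin m → M)
    {Q : Fin (concat d).len → M} {Q' : ∀ k, Fin (d k).len → M}
    (q : ∀ k l, Q (pos d ⟨k, l⟩) ⟶ Q' k l) [∀ k l, IsIso (q k l)] :
    ((α_ (J.obj w) (tensorFam m (fun k => J.obj (P k)))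
        (tensorFam (concat d).len (fun j => J.obj (Q j)))).hom ≫
        J.obj w ◁ distributeFam d (fun k => J.obj (P k)) (Q := fun j => J.obj (Q j))
          (Q' := fun k l => J.obj (Q' k l)) (fun k l => J.map (q k l))) ≫
      J.obj w ◁ (tensorFamMap m (fun k => J.obj (P k) ◁ laxFam J (d k).len (Q' k) ≫ μ J _ _) ≫
        laxFam J m (fun k => P k ⊗ tensorFam (d k).len (Q' k))) ≫ μ J _ _ =
    ((J.obj w ◁ laxFam J m P ≫ μ J _ _) ▷ _ ≫
        J.obj (w ⊗ tensorFam m P) ◁ laxFam J (concat d).len Q ≫ μ J _ _) ≫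
      J.map ((α_ _ _ _).hom ≫ w ◁ distributeFam d P q) := by
  let B : Unit ⊕ Fin m ⊕ ((k : Fin m) × Fin (d k).len) → M :=
    Sum.elim (fun _ => w) (Sum.elim P (fun x => Q' x.1 x.2))
  -- The labels on the source are the images under `J` of those on the target, so the leaves are
  -- mapped by identities. The difference between the two sides then lies only in the order in which
  -- `μ` and the symmetries are applied.
  let A : Unit ⊕ Fin m ⊕ ((k : Fin m) × Fin (d k).len) → M := fun i => J.obj (B i)
  let lw : Shape B w := .leaf (Sum.inl ()) (Iso.refl w)
  let lP : ∀ k, Shape B (P k) := fun k => .leaf (Sum.inr (Sum.inl k)) (Iso.refl (P k))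
  let lQ : ∀ k l {V : M} (i : V ≅ Q' k l), Shape B V := fun k l {V} i =>
    .leaf (Sum.inr (Sum.inr (⟨k, l⟩ : (k : Fin m) × Fin (d k).len))) i
  let lw' : Shape A (J.obj w) := .leaf (Sum.inl ()) (Iso.refl (J.obj w))
  let lP' : ∀ k, Shape A (J.obj (P k)) := fun k =>
    .leaf (Sum.inr (Sum.inl k)) (Iso.refl (J.obj (P k)))
  let lQ' : ∀ k l {V : M} (i : V ≅ J.obj (Q' k l)), Shape A V := fun k l {V} i =>
    .leaf (Sum.inr (Sum.inr (⟨k, l⟩ : (k : Fin m) × Fin (d k).len))) i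
  let iq : ∀ k l, Q (pos d ⟨k, l⟩) ≅ Q' k l := fun k l => asIso (q k l)
  obtain ⟨TQ, hQ⟩ := exists_family_comp_equiv (pos d) (F := fun j => Shape B (Q j))
    (fun x => lQ x.1 x.2 (iq x.1 x.2))
  obtain ⟨TQ', hQ'⟩ := exists_family_comp_equiv (pos d) (F := fun j => Shape A (J.obj (Q j)))
    (fun x => lQ' x.1 x.2 (J.mapIso (iq x.1 x.2)))
  have hl : ∀ i (V : M) (e : V ≅ B i), LaxCanon J (fun i => 𝟙 (A i)) (.leaf i (J.mapIso e))
      (.leaf i e) (𝟙 (J.obj V)) := fun i V e => LaxCanon.leaf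
    ((Category.id_comp _).trans (Category.comp_id _).symm)
  have hl' : ∀ i, LaxCanon J (fun i => 𝟙 (A i)) (.leaf i (Iso.refl (J.obj (B i))))
      (.leaf i (Iso.refl (B i))) (𝟙 (J.obj (B i))) := fun i => LaxCanon.leaf
    (congrArg (𝟙 _ ≫ ·) (J.map_id _))
  have cq : ∀ k l, Canon (fun i => 𝟙 (B i)) (TQ (pos d ⟨k, l⟩)) (lQ k l (Iso.refl _)) (q k l) :=
    fun k l => by
      rw [hQ]
      exact Canon.leaf_id (Category.comp_id _)
  have cq' : ∀ k l, Canon (fun i => 𝟙 (A i)) (TQ' (pos d ⟨k, l⟩)) (lQ' k l (Iso.refl _))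
      (J.map (q k l)) := fun k l => by
    rw [hQ']
    exact Canon.leaf_id (Category.comp_id _)
  have cQ : ∀ j, LaxCanon J (fun i => 𝟙 (A i)) (TQ' j) (TQ j) (𝟙 (J.obj (Q j))) := fun j => by
    obtain ⟨⟨k, l⟩, rfl⟩ := (pos d).surjective j
    rw [hQ, hQ']
    exact hl _ _ _
  have cL := ((Canon.associator lw' (.fam m lP') (.fam _ TQ')).comp_left
    (Canon.whiskerLeft lw' (Canon.distributeFam d lP' TQ' cq'))).comp_lax
    (LaxCanon.whiskerLeft (hl' (Sum.inl ())) (LaxCanon.laxFam m (fun k => LaxCanon.whiskerLeft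
      (hl' (Sum.inr (Sum.inl k))) (LaxCanon.fam (d k).len
        (fun l => hl' (Sum.inr (Sum.inr ⟨k, l⟩)))))))
  have cR := (LaxCanon.tensor' (LaxCanon.whiskerLeft (hl' (Sum.inl ()))
      (LaxCanon.fam m (fun k => hl' (Sum.inr (Sum.inl k))))) (LaxCanon.fam _ cQ)).comp_canon
    ((Canon.associator lw (.fam m lP) (.fam _ TQ)).comp_left
      (Canon.whiskerLeft lw (Canon.distributeFam d lP TQ cq)))
  refine cL.unique cR ⟨trivial, Shape.nodup_fam _ _ (fun k => ⟨trivial, Shape.nodup_fam _ _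
    (fun _ => trivial) ?_, ?_⟩) ?_, ?_⟩
  · rintro l l' x h h'
    cases (Eq.symm h).trans h'
    rfl
  · refine Set.disjoint_left.2 (fun x h h' => ?_)
    obtain ⟨l, hl⟩ := Shape.mem_labels_fam _ _ h'
    cases (Eq.symm h).trans hl
  · rintro k k' x (h | h) (h' | h')
    · cases (Eq.symm h).trans h'
      rfl
    · obtain ⟨l, hl⟩ := Shape.mem_labels_fam _ _ h'
      cases (Eq.symm h).trans hl
    · obtain ⟨l, hl⟩ := Shape.mem_labels_fam _ _ h
      cases (Eq.symm h').trans hl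
    · obtain ⟨l, hl⟩ := Shape.mem_labels_fam _ _ h
      obtain ⟨l', hl'⟩ := Shape.mem_labels_fam _ _ h'
      cases hl.symm.trans hl'
      rfl
  · refine Set.disjoint_left.2 (fun x h h' => ?_)
    obtain ⟨k, hk | hk⟩ := Shape.mem_labels_fam _ _ h'
    · cases (Eq.symm h).trans hk
    · obtain ⟨l, hl⟩ := Shape.mem_labels_fam _ _ hk
      cases (Eq.symm h).trans hl

/-- Left unitality of `J` removes one unit in each step of the induction. -/
theorem unitFam_laxFam : (n : ℕ) →
    unitFam n ≫ tensorFamMap n (fun _ => ε J) ≫ laxFam J n (fun _ => 𝟙_ M) =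
      ε J ≫ J.map (unitFam n)
  | 0 => by
    simp only [unitFam, laxFam, tensorFamMap, J.map_id, Category.id_comp, Category.comp_id]
  | n + 1 => by
    have h := unitFam_laxFam n
    have h1 : 𝟙_ M ◁ unitFam n ≫ (ε J ⊗ₘ tensorFamMap n (fun _ => ε J)) ≫
        J.obj (𝟙_ M) ◁ laxFam J n (fun _ => 𝟙_ M) ≫ μ J _ _ =
        (𝟙_ M ◁ ε J) ≫ ε J ▷ _ ≫ μ J _ _ ≫ J.map (𝟙_ M ◁ unitFam n) := by
      rw [← μ_natural_right, ← id_tensorHom, ← id_tensorHom, ← id_tensorHom, ← id_tensorHom,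
        ← tensorHom_id, tensorHom_comp_tensorHom_assoc, tensorHom_comp_tensorHom_assoc,
        tensorHom_comp_tensorHom_assoc, tensorHom_comp_tensorHom_assoc]
      simp only [Category.id_comp, Category.comp_id, Category.assoc, h]
    have h2 : (λ_ (𝟙_ M)).inv ≫ 𝟙_ M ◁ ε J = ε J ≫ (λ_ (J.obj (𝟙_ M))).inv :=
      (leftUnitor_inv_naturality _).symm
    simp only [unitFam, tensorFamMap, laxFam, Category.assoc, J.map_comp]
    rw [h1, reassoc_of% h2, left_unitality_inv_assoc]

end LaxCoherence

open Profile Functor.LaxMonoidal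

/-! ### Pasting of commutative squares. -/

section Squares

variable {D : Type*} [Category D]

theorem comp_comp_eq_of_squares {a b c a' b' c' s w : D} {z : a ⟶ s} {f : s ⟶ b} {f' : b ⟶ c}
    {x : a ⟶ a'} {g : a' ⟶ b} {i' : a' ⟶ b'} {k' : b' ⟶ c} {i : a ⟶ c'} {y : c' ⟶ b'} {l : s ⟶ w}
    {k : c' ⟶ w} {m : w ⟶ c} (h1 : z ≫ f = x ≫ g) (h2 : g ≫ f' = i' ≫ k') (h3 : x ≫ i' = i ≫ y)
    (h4 : z ≫ l = i ≫ k) (h5 : y ≫ k' = k ≫ m) : z ≫ f ≫ f' = z ≫ l ≫ m := by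
  rw [reassoc_of% h1, reassoc_of% h4, h2, reassoc_of% h3, h5]

/-- The pasting scheme of the associativity of `J_{*2}`: `h1`, `h2`, `h3`, `h5` evaluate the edges
on generators, `h4` is naturality for the profile correction, and `h6` is the remaining identity in
`M`. -/
theorem comp_comp_eq_of_comp_eq_comp {a b c d a' b' c' e p q : D} {z : a ⟶ b} {F : b ⟶ c}
    {jα : c ⟶ d} {lx : a ⟶ a'} {jl : a' ⟶ c} {js : a' ⟶ b'} {jr : b' ⟶ c'} {jk : c' ⟶ d} {α : b ⟶ e}
    {s : a ⟶ p} {r : p ⟶ q} {k : q ⟶ e} {G : e ⟶ d} {G' : q ⟶ c'} {rx : p ⟶ b'}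
    (h1 : z ≫ F = lx ≫ jl) (h2 : jl ≫ jα = js ≫ jr ≫ jk) (h3 : z ≫ α = s ≫ r ≫ k)
    (h4 : k ≫ G = G' ≫ jk) (h5 : r ≫ G' = rx ≫ jr) (h6 : s ≫ rx = lx ≫ js) :
    z ≫ F ≫ jα = z ≫ α ≫ G := by
  rw [reassoc_of% h1, h2, reassoc_of% h3, h4, reassoc_of% h5, reassoc_of% h6]

theorem comp_comp_eq_of_whiskerRight [MonoidalCategory D] {a b c p q r s R d e n : D} {z : a ⟶ b}
    {f : b ⟶ c} {f' : c ⟶ n} {u : p ⟶ q} {v : q ⟶ r} {g : r ⊗ R ⟶ c} {i : p ⟶ s} {w : s ⟶ r}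
    {i2 : r ⊗ R ⟶ d} {k2 : d ⟶ n} {i3 : s ⊗ R ⟶ e} {m : e ⟶ d} {k : e ⟶ n} {x : a ⟶ p ⊗ R}
    (h1 : z ≫ f = x ≫ (u ≫ v) ▷ R ≫ g) (h2 : u ≫ v = i ≫ w) (h3 : g ≫ f' = i2 ≫ k2)
    (h4 : w ▷ R ≫ i2 = i3 ≫ m) (h5 : m ≫ k2 = k) : z ≫ f ≫ f' = x ≫ (i ▷ R ≫ i3) ≫ k := by
  rw [reassoc_of% h1, h2, h3, comp_whiskerRight, Category.assoc, Category.assoc, reassoc_of% h4, h5]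

theorem comp_comp_eq_of_whiskerLeft [MonoidalCategory D] {a b c p q s R d d' e n : D} {z : a ⟶ b}
    {f : b ⟶ c} {f' : c ⟶ n} {u : p ⟶ q} {u1 : p ⟶ s} {u2 : s ⟶ q} {g : R ⊗ q ⟶ c}
    {i2 : R ⊗ q ⟶ d} {k2 : d ⟶ n} {l : s ⟶ d'} {ν : R ⊗ d' ⟶ e} {m : e ⟶ d} {k : e ⟶ n}
    {x : a ⟶ R ⊗ p}
    (h1 : z ≫ f = x ≫ R ◁ u ≫ g) (h2 : u = u1 ≫ u2) (h3 : g ≫ f' = i2 ≫ k2)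
    (h4 : R ◁ u2 ≫ i2 = (R ◁ l ≫ ν) ≫ m) (h5 : m ≫ k2 = k) :
    z ≫ f ≫ f' = x ≫ (R ◁ (u1 ≫ l) ≫ ν) ≫ k := by
  rw [reassoc_of% h1, h2, h3, MonoidalCategory.whiskerLeft_comp, Category.assoc, reassoc_of% h4, h5,
    MonoidalCategory.whiskerLeft_comp]
  simp only [Category.assoc]

end Squares

/-! ### The structure morphism `J_{*2}` on generators, its naturality and associativity. -/

section LaxCircle

variable {C : Type v} {M : Type u} [Category.{v} M] [MonoidalCategory M] [SymmetricCategory M]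
  [HasColimits M] (J : M ⥤ M) [J.LaxBraided]

theorem circleIn_circleJ₂ (X Y : SymSeq C M) (t : C) {a c : Profile C} (b : Fin a.len → Profile C)
    (g : concat b ⟶ c) :
    circleIn ((postcomp C J).obj X) ((postcomp C J).obj Y) t b g ≫
        SymSeq.app (circleJ₂ J X Y) t c =
      iteratedJ₂ J X Y t a b ≫ J.map (circleIn X Y t b g) :=
  circleι_J₂ J X Y t c a b g

theorem circleGen_circleJ₂ (X Y : SymSeq C M) (t : C) (a : Profile C) (b : Fin a.len → Profile C) :
    circleGen ((postcomp C J).obj X) ((postcomp C J).obj Y) t a b ≫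
        SymSeq.app (circleJ₂ J X Y) t (concat b) =
      iteratedJ₂ J X Y t a b ≫ J.map (circleGen X Y t a b) :=
  circleIn_circleJ₂ J X Y t b (𝟙 _)

theorem circleUnitι_circleJ₀ (t : C) :
    circleUnitι t ≫ SymSeq.app (circleJ₀ J : (circleUnit : SymSeq C M) ⟶ _) t (single t) =
      ε J ≫ J.map (circleUnitι t) :=
  setTensor.ι_desc _ _

variable [MonoidalClosed M]

theorem circleJ₂_natural {X X' Y Y' : SymSeq C M} (x : X ⟶ X') (y : Y ⟶ Y') :
    circleHom ((postcomp C J).map x) ((postcomp C J).map y) ≫ circleJ₂ J X' Y' =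
      circleJ₂ J X Y ≫ (postcomp C J).map (circleHom x y) := by
  refine circle_hom_ext (fun t a b => ?_)
  exact comp_comp_eq_of_squares (circleGen_app _ _ t a b) (circleGen_circleJ₂ J X' Y' t a b)
    (iteratedJ₂_natural J (SymSeq.app x t a) (fun i => SymSeq.app y (a.col i) (b i)))
    (circleGen_circleJ₂ J X Y t a b) ((J.map_comp _ _).symm.trans
      ((congrArg J.map (circleGen_app x y t a b).symm).trans (J.map_comp _ _)))

/-- Applying `J_{*2}` twice combines the factors of `X` and `Y` first, and then those of `Z` with
the result; naturality of `μ` moves the insertions under `J`. -/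
theorem leftGen_circleJ₂ (X Y Z : SymSeq C M) (t : C) (e : Profile C) (d : Fin e.len → Profile C)
    (b : Fin (concat d).len → Profile C) :
    leftGen ((postcomp C J).obj X) ((postcomp C J).obj Y) ((postcomp C J).obj Z) t e d b ≫
        SymSeq.app (circleHom (circleJ₂ J X Y) (𝟙 ((postcomp C J).obj Z)) ≫
          circleJ₂ J (circle X Y) Z) t (concat b) =
      (iteratedJ₂ J X Y t e d ▷ _ ≫ J.obj (X.val t e ⊗ valFam Y e d) ◁
        laxFam J (concat d).len (fun j => Z.val ((concat d).col j) (b j)) ≫ μ J _ _) ≫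
        J.map (leftGen X Y Z t e d b) := by
  have h1 : leftGen ((postcomp C J).obj X) ((postcomp C J).obj Y) ((postcomp C J).obj Z) t e d b ≫
      SymSeq.app (circleHom (circleJ₂ J X Y) (𝟙 ((postcomp C J).obj Z))) t (concat b) =
      (circleGen ((postcomp C J).obj X) ((postcomp C J).obj Y) t e d ≫
        SymSeq.app (circleJ₂ J X Y) t (concat d)) ▷ valFam ((postcomp C J).obj Z) (concat d) b ≫
      circleGen ((postcomp C J).obj (circle X Y)) ((postcomp C J).obj Z) t (concat d) b := by
    rw [leftGen, Category.assoc, circleGen_app, comp_whiskerRight, Category.assoc]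
    simp only [SymSeq.id_app, tensorFamMap_id, tensorHom_id]
  have h2 := laxStep_natural J (circleGen X Y t e d) (𝟙 (valFam Z (concat d) b)) (𝟙 _)
    (laxFam J (concat d).len (fun j => Z.val ((concat d).col j) (b j))) _
    ((Category.id_comp _).trans ((Category.comp_id _).symm.trans (congrArg _ (J.map_id _).symm)))
  rw [tensorHom_id, tensorHom_id] at h2
  exact (comp_comp_eq_of_whiskerRight (h1.trans (Category.id_comp _).symm) (circleGen_circleJ₂ J X Y t e d)
    (circleGen_circleJ₂ J (circle X Y) Z t (concat d) b) h2 (J.map_comp _ _).symm).trans (Category.id_comp _)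

theorem rightGen_circleJ₂ (X Y Z : SymSeq C M) (t : C) (e : Profile C) (d : Fin e.len → Profile C)
    (c : ∀ k, Fin (d k).len → Profile C) :
    rightGen ((postcomp C J).obj X) ((postcomp C J).obj Y) ((postcomp C J).obj Z) t e d c ≫
        SymSeq.app (circleHom (𝟙 ((postcomp C J).obj X)) (circleJ₂ J Y Z) ≫
          circleJ₂ J X (circle Y Z)) t (concat fun k => concat (c k)) =
      (J.obj (X.val t e) ◁ (tensorFamMap e.len (fun k => iteratedJ₂ J Y Z (e.col k) (d k) (c k)) ≫
        laxFam J e.len (fun k => Y.val (e.col k) (d k) ⊗ valFam Z (d k) (c k))) ≫ μ J _ _) ≫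
        J.map (rightGen X Y Z t e d c) := by
  have h1 : rightGen ((postcomp C J).obj X) ((postcomp C J).obj Y) ((postcomp C J).obj Z) t e d c ≫
      SymSeq.app (circleHom (𝟙 ((postcomp C J).obj X)) (circleJ₂ J Y Z)) t
        (concat fun k => concat (c k)) =
      ((postcomp C J).obj X).val t e ◁ tensorFamMap e.len (fun k =>
        circleGen ((postcomp C J).obj Y) ((postcomp C J).obj Z) (e.col k) (d k) (c k) ≫
          SymSeq.app (circleJ₂ J Y Z) (e.col k) (concat (c k))) ≫
      circleGen ((postcomp C J).obj X) ((postcomp C J).obj (circle Y Z)) t e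
        (fun k => concat (c k)) := by
    rw [rightGen, Category.assoc, circleGen_app, SymSeq.id_app, id_tensorHom,
      ← MonoidalCategory.whiskerLeft_comp_assoc, tensorFamMap_comp]
  have h2 : tensorFamMap e.len (fun k =>
      circleGen ((postcomp C J).obj Y) ((postcomp C J).obj Z) (e.col k) (d k) (c k) ≫
          SymSeq.app (circleJ₂ J Y Z) (e.col k) (concat (c k))) =
      tensorFamMap e.len (fun k => iteratedJ₂ J Y Z (e.col k) (d k) (c k)) ≫
        tensorFamMap e.len (fun k => J.map (circleGen Y Z (e.col k) (d k) (c k))) := by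
    rw [tensorFamMap_comp]
    exact congrArg _ (funext fun k => circleGen_circleJ₂ J Y Z (e.col k) (d k) (c k))
  have h3 := laxStep_natural J (𝟙 (X.val t e))
    (tensorFamMap e.len (fun k => circleGen Y Z (e.col k) (d k) (c k))) _ _ _
    (tensorFamMap_laxFam J e.len (fun k => circleGen Y Z (e.col k) (d k) (c k)))
  rw [J.map_id, id_tensorHom, id_tensorHom] at h3
  exact (comp_comp_eq_of_whiskerLeft (h1.trans (Category.id_comp _).symm) h2
    (circleGen_circleJ₂ J X (circle Y Z) t e (fun k => concat (c k))) h3 (J.map_comp _ _).symm).trans (Category.id_comp _)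

/-- On generators both routes end in the image under `J` of a generator of `X ∘ (Y ∘ Z)`. The
morphisms in front of it agree by `distributeFam_lax`. -/
theorem circleJ₂_associativity (X Y Z : SymSeq C M) :
    circleHom (circleJ₂ J X Y) (𝟙 ((postcomp C J).obj Z)) ≫ circleJ₂ J (circle X Y) Z ≫
        (postcomp C J).map (assocHom X Y Z) =
      assocHom ((postcomp C J).obj X) ((postcomp C J).obj Y) ((postcomp C J).obj Z) ≫
        circleHom (𝟙 ((postcomp C J).obj X)) (circleJ₂ J Y Z) ≫ circleJ₂ J X (circle Y Z) := by
  rw [← Category.assoc]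
  refine leftGen_hom_ext (fun t e d b => ?_)
  have h1 := distributeFam_lax (J := J) d (X.val t e) (fun k => Y.val (e.col k) (d k))
    (Q := fun j => Z.val ((concat d).col j) (b j))
    (Q' := fun k l => Z.val ((d k).col l) (b (pos d ⟨k, l⟩))) (fun k l => Z.act (concat_col d ⟨k, l⟩) (𝟙 (b (pos d ⟨k, l⟩))))
  exact comp_comp_eq_of_comp_eq_comp (leftGen_circleJ₂ J X Y Z t e d b)
    ((J.map_comp _ _).symm.trans ((congrArg J.map (leftGen_assocHom X Y Z t e
      (fun k l => 𝟙 (b (pos d ⟨k, l⟩))))).trans ((J.map_comp _ _).trans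
        (congrArg (_ ≫ ·) (J.map_comp _ _)))))
    (leftGen_assocHom ((postcomp C J).obj X) ((postcomp C J).obj Y) ((postcomp C J).obj Z) t e
      (fun k l => 𝟙 (b (pos d ⟨k, l⟩))))
    (SymSeq.act_app (circleHom (𝟙 ((postcomp C J).obj X)) (circleJ₂ J Y Z) ≫
      circleJ₂ J X (circle Y Z)) (rfl : t = t)
      (inv (concatAssoc (fun k l => 𝟙 (b (pos d ⟨k, l⟩))))))
    (rightGen_circleJ₂ J X Y Z t e d (fun k l => b (pos d ⟨k, l⟩))) h1

end LaxCircle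

open Profile Functor.LaxMonoidal

/-! ### The unit laws of `J_{*2}` and `J_{*0}`. -/

section LaxUnits

variable {C : Type v} {M : Type u} [Category.{v} M] [MonoidalCategory M]

theorem leftUnitor_rightUnitor_inv_lax (J : M ⥤ M) [J.LaxMonoidal] {U : M} (u : 𝟙_ M ⟶ U) (V : M) :
    (λ_ (J.obj V)).inv ≫ (ε J ≫ J.map u ⊗ₘ (ρ_ (J.obj V)).inv) ≫
        J.obj U ◁ (J.obj V ◁ ε J ≫ μ J _ _) ≫ μ J _ _ =
      J.map ((λ_ V).inv ≫ (u ⊗ₘ (ρ_ V).inv)) := by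
  rw [← id_tensorHom, tensorHom_comp_tensorHom_assoc, right_unitality_inv, Category.comp_id,
    J.map_comp, ← left_unitality_inv, Category.assoc, Category.assoc, ← μ_natural, ← tensorHom_id,
    tensorHom_comp_tensorHom_assoc, Category.id_comp]

variable [SymmetricCategory M] [HasColimits M] (J : M ⥤ M) [J.LaxBraided]

theorem circleOne_circleJ₂ (U X : SymSeq C M) (t s : C) (b : Profile C) :
    circleOne ((postcomp C J).obj U) ((postcomp C J).obj X) t s b ≫
        SymSeq.app (circleJ₂ J U X) t b =
      (J.obj (U.val t (single s)) ◁ (J.obj (X.val s b) ◁ ε J ≫ μ J _ _) ≫ μ J _ _) ≫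
        J.map (circleOne U X t s b) :=
  circleIn_circleJ₂ J U X t (a := single s) (fun _ => b) (concatOne b)

theorem comp_comp_eq_of_whiskerRight_id {D : Type*} [Category D] [MonoidalCategory D]
    {v u u' w n c d b : D} {l : v ⟶ 𝟙_ D ⊗ v} {ι : 𝟙_ D ⟶ u} {ρ : v ⟶ w ⊗ 𝟙_ D}
    {z : u ⊗ (w ⊗ 𝟙_ D) ⟶ b} {f : b ⟶ c} {f' : c ⟶ n} {j : u ⟶ u'} {z' : u' ⊗ (w ⊗ 𝟙_ D) ⟶ c}
    {L : u' ⊗ (w ⊗ 𝟙_ D) ⟶ d} {k : d ⟶ n} {ι' : 𝟙_ D ⟶ u'} {m : v ⟶ d} {x : v ⟶ n}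
    (h1 : z ≫ f = (j ⊗ₘ (𝟙 w ▷ 𝟙_ D)) ≫ z') (h2 : z' ≫ f' = L ≫ k) (h3 : ι ≫ j = ι')
    (h4 : l ≫ (ι' ⊗ₘ ρ) ≫ L = m) (h5 : m ≫ k = x) : (l ≫ (ι ⊗ₘ ρ) ≫ z) ≫ f ≫ f' = x := by
  rw [← h5, ← h4, ← h3, Category.assoc, Category.assoc, Category.assoc, Category.assoc,
    reassoc_of% h1, h2, id_whiskerRight, tensorHom_comp_tensorHom_assoc, Category.comp_id]

theorem leftUnitGen_circleJ₂ (X : SymSeq C M) (t : C) (b : Profile C) :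
    leftUnitGen ((postcomp C J).obj X) t b ≫ SymSeq.app (circleHom (circleJ₀ J)
        (𝟙 ((postcomp C J).obj X)) ≫ circleJ₂ J circleUnit X) t b =
      J.map (leftUnitGen X t b) :=
  comp_comp_eq_of_whiskerRight_id (circleOne_app (circleJ₀ J) (𝟙 ((postcomp C J).obj X)) t t b)
    (circleOne_circleJ₂ J circleUnit X t t b) (circleUnitι_circleJ₀ J t)
    (leftUnitor_rightUnitor_inv_lax J (circleUnitι t) (X.val t b))
    ((J.map_comp _ _).symm.trans (congrArg J.map (by rw [leftUnitGen, Category.assoc])))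

theorem unitsFam_laxFam (a : Profile C) :
    unitsFam a ≫ tensorFamMap a.len (fun i => SymSeq.app (circleJ₀ J : (circleUnit : SymSeq C M) ⟶ _)
        (a.col i) (single (a.col i))) ≫
        laxFam J a.len (fun i => (circleUnit : SymSeq C M).val (a.col i) (single (a.col i))) =
      ε J ≫ J.map (unitsFam a) := by
  have h := tensorFamMap_laxFam J a.len
    (fun i => (circleUnitι (a.col i) : 𝟙_ M ⟶ (circleUnit : SymSeq C M).val _ _))
  have h1 : unitsFam a ≫ tensorFamMap a.len (fun i => SymSeq.app
      (circleJ₀ J : (circleUnit : SymSeq C M) ⟶ _) (a.col i) (single (a.col i))) =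
      unitFam a.len ≫ tensorFamMap a.len (fun i => ε J) ≫
        tensorFamMap a.len (fun i => J.map (circleUnitι (a.col i))) := by
    rw [unitsFam, Category.assoc, tensorFamMap_comp, tensorFamMap_comp]
    exact congrArg (fun f => unitFam a.len ≫ tensorFamMap a.len f)
      (funext fun i => circleUnitι_circleJ₀ J (a.col i))
  have h2 : (unitFam a.len ≫ tensorFamMap a.len (fun i => ε J) ≫
      tensorFamMap a.len (fun i => J.map (circleUnitι (a.col i)))) ≫
        laxFam J a.len (fun i => (circleUnit : SymSeq C M).val (a.col i) (single (a.col i))) =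
      ε J ≫ J.map (unitsFam a) := by
    rw [Category.assoc, Category.assoc, h, reassoc_of% unitFam_laxFam (J := J), unitsFam, J.map_comp]
  exact (Category.assoc _ _ _).symm.trans ((congrArg (· ≫ _) h1).trans h2)

theorem comp_comp_eq_of_whiskerLeft_lax {V U A' b c n : M} {A : M} {L : U ⟶ A'}
    {ι : 𝟙_ M ⟶ U} {lf : A' ⟶ J.obj A} {ι' : 𝟙_ M ⟶ A}
    {z : J.obj V ⊗ U ⟶ b} {f : b ⟶ c} {f' : c ⟶ J.obj n} {z' : J.obj V ⊗ A' ⟶ c}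
    {k : V ⊗ A ⟶ n}
    (h1 : z ≫ f = (𝟙 _ ⊗ₘ L) ≫ z') (h2 : z' ≫ f' = (J.obj V ◁ lf ≫ μ J _ _) ≫ J.map k)
    (h3 : ι ≫ L ≫ lf = ε J ≫ J.map ι') :
    ((ρ_ (J.obj V)).inv ≫ J.obj V ◁ ι ≫ z) ≫ f ≫ f' = J.map ((ρ_ V).inv ≫ V ◁ ι' ≫ k) := by
  rw [Category.assoc, Category.assoc, reassoc_of% h1, h2, id_tensorHom,
    ← MonoidalCategory.whiskerLeft_comp_assoc, Category.assoc,
    ← MonoidalCategory.whiskerLeft_comp_assoc, Category.assoc, h3,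
    MonoidalCategory.whiskerLeft_comp, Category.assoc, μ_natural_right_assoc,
    right_unitality_inv_assoc, J.map_comp, J.map_comp]

theorem rightUnitGen_circleJ₂ (X : SymSeq C M) (t : C) (a : Profile C) :
    rightUnitGen ((postcomp C J).obj X) t a ≫ SymSeq.app (circleHom (𝟙 ((postcomp C J).obj X))
        (circleJ₀ J) ≫ circleJ₂ J X circleUnit) t a =
      J.map (rightUnitGen X t a) :=
  comp_comp_eq_of_whiskerLeft_lax J (circleIn_app (𝟙 ((postcomp C J).obj X)) (circleJ₀ J) t
    (fun i => single (a.col i)) (concatSingle a))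
    (circleIn_circleJ₂ J X circleUnit t (fun i => single (a.col i)) (concatSingle a))
    (unitsFam_laxFam J a)

variable [MonoidalClosed M]

/-- The inverse of the left unitor is an epimorphism with explicit components. Precomposing with it
reduces the law to `leftUnitGen_circleJ₂`, which is an instance of the unit laws of `J`. -/
theorem circleJ₂_left_unitality (X : SymSeq C M) :
    (leftUnitorIso ((postcomp C J).obj X)).hom = circleHom (circleJ₀ J)
      (𝟙 ((postcomp C J).obj X)) ≫ circleJ₂ J circleUnit X ≫
        (postcomp C J).map (leftUnitorIso X).hom := by
  have h : leftUnitorInv ((postcomp C J).obj X) ≫ circleHom (circleJ₀ J)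
      (𝟙 ((postcomp C J).obj X)) ≫ circleJ₂ J circleUnit X =
      (postcomp C J).map (leftUnitorIso X).inv :=
    NatTrans.ext (funext fun ⟨b, ⟨t⟩⟩ => leftUnitGen_circleJ₂ J X t b)
  refine leftUnitorInv_hom_ext ((leftUnitorIso ((postcomp C J).obj X)).inv_hom_id.trans ?_)
  rw [← Category.assoc (circleHom _ _), ← Category.assoc, h, ← CategoryTheory.Functor.map_comp,
    Iso.inv_hom_id, CategoryTheory.Functor.map_id]

theorem circleJ₂_right_unitality (X : SymSeq C M) :
    (rightUnitorIso ((postcomp C J).obj X)).hom = circleHom (𝟙 ((postcomp C J).obj X))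
      (circleJ₀ J) ≫ circleJ₂ J X circleUnit ≫ (postcomp C J).map (rightUnitorIso X).hom := by
  have h : rightUnitorInv ((postcomp C J).obj X) ≫ circleHom (𝟙 ((postcomp C J).obj X))
      (circleJ₀ J) ≫ circleJ₂ J X circleUnit = (postcomp C J).map (rightUnitorIso X).inv :=
    NatTrans.ext (funext fun ⟨b, ⟨t⟩⟩ => rightUnitGen_circleJ₂ J X t b)
  refine rightUnitorInv_hom_ext ((rightUnitorIso ((postcomp C J).obj X)).inv_hom_id.trans ?_)
  rw [← Category.assoc (circleHom _ _), ← Category.assoc, h, ← CategoryTheory.Functor.map_comp,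
    Iso.inv_hom_id, CategoryTheory.Functor.map_id]

end LaxUnits

open Profile Functor.LaxMonoidal

/-! ### Monoidality of the involution. -/

section Involution

variable {C : Type v} {M : Type u} [Category.{v} M] [MonoidalCategory M]

section

variable {J : M ⥤ M} [J.LaxMonoidal] (j : 𝟭 M ⟶ J ⋙ J) [NatTrans.IsMonoidal j]

theorem involution_unit : j.app (𝟙_ M) = ε J ≫ J.map (ε J) :=
  (Category.id_comp _).symm.trans (NatTrans.IsMonoidal.unit (τ := j))

theorem involution_tensor (X Y : M) :
    j.app (X ⊗ Y) = (j.app X ⊗ₘ j.app Y) ≫ μ J _ _ ≫ J.map (μ J X Y) :=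
  (Category.id_comp _).symm.trans (NatTrans.IsMonoidal.tensor (τ := j) X Y)

/-- The step of the induction over the factors: a factorization of `j` at `Y` is extended by one
factor `X`, by the monoidality of `j` and the naturality of `μ`. -/
theorem involution_step (X Y : M) {Q : M} {q : Y ⟶ Q} {B : M}
    {l₁ : Q ⟶ J.obj B} {l₂ : B ⟶ J.obj Y} (h : j.app Y = q ≫ l₁ ≫ J.map l₂) :
    j.app (X ⊗ Y) = (j.app X ⊗ₘ q) ≫ (J.obj (J.obj X) ◁ l₁ ≫ μ J _ _) ≫
      J.map (J.obj X ◁ l₂ ≫ μ J _ _) := by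
  have h1 : ∀ x : X ⟶ J.obj (J.obj X), x ⊗ₘ (q ≫ l₁ ≫ J.map l₂) =
      (x ⊗ₘ q) ≫ J.obj (J.obj X) ◁ l₁ ≫ J.obj (J.obj X) ◁ J.map l₂ := fun x => by
    rw [← id_tensorHom, ← id_tensorHom, tensorHom_comp_tensorHom, tensorHom_comp_tensorHom,
      Category.comp_id, Category.comp_id]
  refine (involution_tensor j X Y).trans ?_
  refine (congrArg (· ≫ _) ((congrArg (j.app X ⊗ₘ ·) h).trans (h1 (j.app X)))).trans ?_
  rw [J.map_comp, Category.assoc, Category.assoc, Category.assoc, μ_natural_right_assoc]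

theorem involution_tensorFam : (n : ℕ) → (A : Fin n → M) →
    j.app (tensorFam n A) = tensorFamMap n (fun i => j.app (A i)) ≫
      laxFam J n (fun i => J.obj (A i)) ≫ J.map (laxFam J n A)
  | 0, _ => (involution_unit j).trans (Category.id_comp _).symm
  | n + 1, A => involution_step j (A 0) (tensorFam n (fun i => A i.succ))
      (Q := tensorFam n (fun i => J.obj (J.obj (A i.succ))))
      (B := tensorFam n (fun i => J.obj (A i.succ)))
      (q := tensorFamMap n (fun i => j.app (A i.succ)))
      (l₁ := laxFam J n (fun i => J.obj (A i.succ))) (l₂ := laxFam J n (fun i => A i.succ))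
      (involution_tensorFam n (fun i => A i.succ))

end

variable [SymmetricCategory M] [HasColimits M] (I : InvolutiveCategory M) [I.J.LaxBraided]
  [NatTrans.IsMonoidal I.j.hom]

theorem iteratedJ₂_involution (X Y : SymSeq C M) (t : C) (a : Profile C)
    (b : Fin a.len → Profile C) :
    (I.j.hom.app (X.val t a) ⊗ₘ tensorFamMap a.len (fun i => I.j.hom.app (Y.val (a.col i) (b i)))) ≫
        iteratedJ₂ I.J ((postcomp C I.J).obj X) ((postcomp C I.J).obj Y) t a b ≫
        I.J.map (iteratedJ₂ I.J X Y t a b) =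
      I.j.hom.app (X.val t a ⊗ valFam Y a b) :=
  (involution_step I.j.hom (X.val t a) (valFam Y a b)
    (Q := tensorFam a.len (fun i => I.J.obj (I.J.obj (Y.val (a.col i) (b i)))))
    (B := tensorFam a.len (fun i => I.J.obj (Y.val (a.col i) (b i))))
    (q := tensorFamMap a.len (fun i => I.j.hom.app (Y.val (a.col i) (b i))))
    (l₁ := laxFam I.J a.len (fun i => I.J.obj (Y.val (a.col i) (b i))))
    (l₂ := laxFam I.J a.len (fun i => Y.val (a.col i) (b i)))
    (involution_tensorFam I.j.hom a.len (fun i => Y.val (a.col i) (b i)))).symm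

theorem comp_eq_comp_of_involution {D : Type*} [Category D] {a b c d e f g h : D}
    {z : a ⟶ b} {jc : b ⟶ c} {js : a ⟶ d} {K : d ⟶ c} {x : a ⟶ e} {z' : e ⟶ f} {F : b ⟶ f}
    {i₁ : e ⟶ g} {k₁ : g ⟶ h} {G₁ : f ⟶ h} {G₂ : h ⟶ c} {i₂ : g ⟶ d}
    (h1 : z ≫ jc = js ≫ K) (h2 : z ≫ F = x ≫ z') (h3 : z' ≫ G₁ = i₁ ≫ k₁)
    (h4 : k₁ ≫ G₂ = i₂ ≫ K) (h5 : x ≫ i₁ ≫ i₂ = js) : z ≫ jc = z ≫ F ≫ G₁ ≫ G₂ := by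
  rw [h1, reassoc_of% h2, reassoc_of% h3, h4, ← h5, Category.assoc, Category.assoc]

variable [MonoidalClosed M]

/-- On a generator, naturality of `j` moves it to the summand. There it is the iterated monoidality
of `j` over the factors (`iteratedJ₂_involution`). -/
theorem circleJ₂_involution (X Y : SymSeq C M) :
    (I.symSeq C).j.hom.app (circle X Y) =
      circleHom ((I.symSeq C).j.hom.app X) ((I.symSeq C).j.hom.app Y) ≫
        circleJ₂ I.J ((postcomp C I.J).obj X) ((postcomp C I.J).obj Y) ≫
        (postcomp C I.J).map (circleJ₂ I.J X Y) := by
  refine circle_hom_ext (fun t a b => ?_)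
  exact comp_eq_comp_of_involution (I.j.hom.naturality (circleGen X Y t a b))
    (circleGen_app ((I.symSeq C).j.hom.app X) ((I.symSeq C).j.hom.app Y) t a b)
    (circleGen_circleJ₂ I.J ((postcomp C I.J).obj X) ((postcomp C I.J).obj Y) t a b)
    ((I.J.map_comp _ _).symm.trans ((congrArg I.J.map (circleGen_circleJ₂ I.J X Y t a b)).trans
      (I.J.map_comp _ _))) (iteratedJ₂_involution I X Y t a b)

theorem circleJ₀_involution :
    (I.symSeq C).j.hom.app circleUnit =
      circleJ₀ I.J ≫ (postcomp C I.J).map (circleJ₀ I.J) := by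
  refine Generators.presents_unit.hom_ext (fun t s => ?_)
  have h1 : circleUnitι t ≫ I.j.hom.app ((circleUnit : SymSeq C M).val t (single t)) = _ :=
    I.j.hom.naturality (circleUnitι t)
  have h2 := circleUnitι_circleJ₀ (C := C) I.J t
  have h3 := (I.J.map_comp _ _).symm.trans ((congrArg I.J.map h2).trans (I.J.map_comp _ _))
  refine h1.trans ?_
  refine (congrArg (· ≫ _) (involution_unit I.j.hom)).trans ?_
  refine Eq.trans ?_ (Category.assoc _ _ _)
  refine Eq.trans ?_ (congrArg (· ≫ _) h2).symm
  refine ((Category.assoc _ _ _).trans (congrArg (ε I.J ≫ ·) h3.symm)).trans ?_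
  exact (Category.assoc _ _ _).symm

end Involution

/-! ### The involutive monoidal structure. -/

section InvolutiveCircle

variable {C : Type v} {M : Type u} [Category.{v} M] [MonoidalCategory M] [SymmetricCategory M]
  [HasColimits M] [MonoidalClosed M]

/-- Post-composition with a lax symmetric monoidal functor is a lax monoidal functor for the circle
product. -/
@[reducible] noncomputable def circleLaxMonoidal (J : M ⥤ M) [J.LaxBraided] :
    letI := (circleMonoidal (C := C) (M := M)).monoidalCategory
    (postcomp C J).LaxMonoidal :=
  letI := (circleMonoidal (C := C) (M := M)).monoidalCategory
  { ε := circleJ₀ J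
    μ := circleJ₂ J
    μ_natural_left := fun {X Y} x Z => by
      have h := circleJ₂_natural J x (𝟙 Z)
      rw [CategoryTheory.Functor.map_id] at h
      exact h
    μ_natural_right := fun {X Y} Z x => by
      have h := circleJ₂_natural J (𝟙 Z) x
      rw [CategoryTheory.Functor.map_id] at h
      exact h
    associativity := circleJ₂_associativity J
    left_unitality := circleJ₂_left_unitality J
    right_unitality := circleJ₂_right_unitality J }

theorem exists_involutiveMonoidal (I : InvolutiveCategory M) (S : InvolutiveSymmetricMonoidal I) :
    letI := S.lax
    letI := (circleMonoidal (C := C) (M := M)).monoidalCategory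
    ∃ T : InvolutiveMonoidal (I.symSeq C),
      (∀ X Y : SymSeq C M, T.lax.μ X Y = circleJ₂ I.J X Y) ∧ T.lax.ε = circleJ₀ I.J := by
  let _ := S.lax
  have := S.monoidal_j
  let _ := (circleMonoidal (C := C) (M := M)).monoidalCategory
  let _ : (I.symSeq C).J.LaxMonoidal := circleLaxMonoidal I.J
  refine ⟨⟨circleLaxMonoidal I.J, ?_⟩, fun _ _ => rfl, rfl⟩
  exact
    { unit := (Category.id_comp _).trans (circleJ₀_involution I)
      tensor := fun X Y => (Category.id_comp _).trans (circleJ₂_involution I X Y) }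

end InvolutiveCircle

/-! ### Representing compatible families of morphisms by limits of internal homs. -/

section Copresentation

variable {M : Type u} [Category.{v} M] [MonoidalCategory M] [SymmetricCategory M]
  [MonoidalClosed M] [HasLimits M]

/-- The families of morphisms `A ⊗ V i ⟶ W i` that are compatible with given morphisms between the
`V i` and between the `W i` are represented by an object. -/
theorem exists_representing_families {I K : Type v} (V W : I → M) (s t : K → I)
    (x : ∀ k, V (s k) ⟶ V (t k)) (y : ∀ k, W (s k) ⟶ W (t k)) :
    ∃ (R : M) (ev : ∀ i, R ⊗ V i ⟶ W i), (∀ k, R ◁ x k ≫ ev (t k) = ev (s k) ≫ y k) ∧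
      ∀ (A : M) (φ : ∀ i, A ⊗ V i ⟶ W i), (∀ k, A ◁ x k ≫ φ (t k) = φ (s k) ≫ y k) →
        ∃! g : A ⟶ R, ∀ i, g ▷ V i ≫ ev i = φ i := by
  -- A family of transposes lies in the equalizer of `f` and `f'` exactly when it satisfies all the
  -- compatibilities: `f` composes with `y k` after the morphism at `s k`, `f'` with `x k` before
  -- the morphism at `t k`.
  let f : (∏ᶜ fun i => (ihom (V i)).obj (W i)) ⟶ ∏ᶜ fun k => (ihom (V (s k))).obj (W (t k)) :=
    Pi.lift fun k => Pi.π _ (s k) ≫ (ihom (V (s k))).map (y k)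
  let f' : (∏ᶜ fun i => (ihom (V i)).obj (W i)) ⟶ ∏ᶜ fun k => (ihom (V (s k))).obj (W (t k)) :=
    Pi.lift fun k => Pi.π _ (t k) ≫ (MonoidalClosed.pre (x k)).app (W (t k))
  let π : ∀ i, equalizer f f' ⟶ (ihom (V i)).obj (W i) := fun i => equalizer.ι f f' ≫ Pi.π _ i
  -- The internal hom is evaluated from the left, so the braiding first exchanges the two factors.
  let ev : ∀ i, equalizer f f' ⊗ V i ⟶ W i := fun i =>
    (β_ _ _).hom ≫ MonoidalClosed.uncurry (π i)
  have hev : ∀ {A : M} (g : A ⟶ equalizer f f') i,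
      g ▷ V i ≫ ev i = (β_ _ _).hom ≫ MonoidalClosed.uncurry (g ≫ π i) := fun g i => by
    rw [BraidedCategory.braiding_naturality_left_assoc]
    exact congrArg ((β_ _ _).hom ≫ ·) (MonoidalClosed.uncurry_natural_left _ _).symm
  have hπ : ∀ k, π (s k) ≫ (ihom (V (s k))).map (y k) =
      π (t k) ≫ (MonoidalClosed.pre (x k)).app (W (t k)) := fun k => by
    have h := congrArg (· ≫ Pi.π _ k) (equalizer.condition f f')
    simpa [f, f', π] using h
  refine ⟨equalizer f f', ev, fun k => ?_, fun A φ hφ => ?_⟩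
  · have h := congrArg MonoidalClosed.uncurry (hπ k)
    rw [MonoidalClosed.uncurry_natural_right, MonoidalClosed.uncurry_pre_app] at h
    rw [BraidedCategory.braiding_naturality_right_assoc, Category.assoc, h]
  · let ψ : ∀ i, A ⟶ (ihom (V i)).obj (W i) := fun i =>
      MonoidalClosed.curry ((β_ (V i) A).hom ≫ φ i)
    have hψ : ∀ k, ψ (s k) ≫ (ihom (V (s k))).map (y k) =
        ψ (t k) ≫ (MonoidalClosed.pre (x k)).app (W (t k)) := fun k => by
      rw [← MonoidalClosed.curry_natural_right, MonoidalClosed.curry_pre_app, Category.assoc, ← hφ,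
        BraidedCategory.braiding_naturality_left_assoc]
    have hψ' : Pi.lift ψ ≫ f = Pi.lift ψ ≫ f' := Pi.hom_ext _ _ fun k => by
      simpa [f, f'] using hψ k
    refine ⟨equalizer.lift (Pi.lift ψ) hψ', fun i => ?_, fun g hg => ?_⟩
    · have h : equalizer.lift (Pi.lift ψ) hψ' ≫ π i = ψ i := by simp [π]
      rw [hev, h, MonoidalClosed.uncurry_curry, SymmetricCategory.symmetry_assoc]
    · refine equalizer.hom_ext (Pi.hom_ext _ _ fun i => ?_)
      have h : g ≫ π i = ψ i := by
        refine MonoidalClosed.uncurry_injective ?_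
        rw [MonoidalClosed.uncurry_curry, ← hg i, hev, SymmetricCategory.symmetry_assoc]
      simpa [π] using h

end Copresentation

/-! ### The right adjoint of the circle product with a fixed sequence. -/

section RightAdjoint

variable {C : Type v} {M : Type u} [Category.{v} M] [MonoidalCategory M] [SymmetricCategory M]

variable [MonoidalClosed M] [HasLimits M]

/-- The values of the right adjoint of the circle product with `Y`. -/
theorem exists_circleHomVal (Y Z : SymSeq C M) (t : C) (a : Profile C) :
    ∃ (R : M) (ev : ∀ (a' : Profile C) (h : a ⟶ a') (b : Fin a'.len → Profile C),
      R ⊗ valFam Y a' b ⟶ Z.val t (concat b)),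
      (∀ (a' a'' : Profile C) (h : a ⟶ a') (p : a' ⟶ a'') (b : Fin a'.len → Profile C)
        (b' : Fin a''.len → Profile C) (β : ∀ i, b (p.perm i) ⟶ b' i),
        R ◁ famMap Y p β ≫ ev a'' (h ≫ p) b' = ev a' h b ≫ Z.act rfl (concatMap p.perm β)) ∧
      ∀ (A : M) (φ : ∀ (a' : Profile C) (h : a ⟶ a') (b : Fin a'.len → Profile C),
        A ⊗ valFam Y a' b ⟶ Z.val t (concat b)),
        (∀ (a' a'' : Profile C) (h : a ⟶ a') (p : a' ⟶ a'') (b : Fin a'.len → Profile C)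
          (b' : Fin a''.len → Profile C) (β : ∀ i, b (p.perm i) ⟶ b' i),
          A ◁ famMap Y p β ≫ φ a'' (h ≫ p) b' = φ a' h b ≫ Z.act rfl (concatMap p.perm β)) →
        ∃! g : A ⟶ R, ∀ a' h b, g ▷ valFam Y a' b ≫ ev a' h b = φ a' h b := by
  -- The limit runs over all `a ⟶ a'`, not only over `a' = a`. With this freedom functoriality in
  -- `a` is obtained by precomposing the index, and one index set contains the relations for all
  -- permutations.
  let I := Σ (a' : Profile C) (_ : a ⟶ a'), (Fin a'.len → Profile C)
  let K := Σ (i : I) (a'' : Profile C) (p : i.1 ⟶ a'') (b' : Fin a''.len → Profile C),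
    ∀ j, i.2.2 (p.perm j) ⟶ b' j
  obtain ⟨R, ev, h1, h2⟩ := exists_representing_families (I := I) (K := K)
    (fun i => valFam Y i.1 i.2.2) (fun i => Z.val t (concat i.2.2)) (fun k => k.1)
    (fun k => ⟨k.2.1, k.1.2.1 ≫ k.2.2.1, k.2.2.2.1⟩) (fun k => famMap Y k.2.2.1 k.2.2.2.2)
    (fun k => Z.act rfl (concatMap k.2.2.1.perm k.2.2.2.2))
  refine ⟨R, fun a' h b => ev ⟨a', h, b⟩, fun a' a'' h p b b' β => h1 ⟨⟨a', h, b⟩, a'', p, b', β⟩,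
    fun A φ hφ => ?_⟩
  obtain ⟨g, hg, hu⟩ := h2 A (fun i => φ i.1 i.2.1 i.2.2)
    (fun k => hφ k.1.1 k.2.1 k.1.2.1 k.2.2.1 k.1.2.2 k.2.2.2.1 k.2.2.2.2)
  exact ⟨g, fun a' h b => hg ⟨a', h, b⟩, fun g' hg' => hu g' (fun i => hg' i.1 i.2.1 i.2.2)⟩

/-- The right adjoint of the circle product with `Y`, as a symmetric sequence. -/
theorem exists_circleHomSeq (Y Z : SymSeq C M) :
    ∃ (R : SymSeq C M) (ev : ∀ (t : C) (a a' : Profile C) (_ : a ⟶ a')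
      (b : Fin a'.len → Profile C), R.val t a ⊗ valFam Y a' b ⟶ Z.val t (concat b)),
      (∀ (t : C) (a a' a'' : Profile C) (h : a ⟶ a') (p : a' ⟶ a'') (b : Fin a'.len → Profile C)
        (b' : Fin a''.len → Profile C) (β : ∀ i, b (p.perm i) ⟶ b' i),
        R.val t a ◁ famMap Y p β ≫ ev t a a'' (h ≫ p) b' =
          ev t a a' h b ≫ Z.act rfl (concatMap p.perm β)) ∧
      (∀ (t t' : C) (ht : t = t') (a a' a'' : Profile C) (f : a ⟶ a') (h : a' ⟶ a'')
        (b : Fin a''.len → Profile C), R.act ht f ▷ valFam Y a'' b ≫ ev t' a' a'' h b =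
          ev t a a'' (f ≫ h) b ≫ Z.act ht (𝟙 (concat b))) ∧
      ∀ (t : C) (a : Profile C) (A : M) (φ : ∀ (a' : Profile C) (_ : a ⟶ a')
        (b : Fin a'.len → Profile C), A ⊗ valFam Y a' b ⟶ Z.val t (concat b)),
        (∀ (a' a'' : Profile C) (h : a ⟶ a') (p : a' ⟶ a'') (b : Fin a'.len → Profile C)
          (b' : Fin a''.len → Profile C) (β : ∀ i, b (p.perm i) ⟶ b' i),
          A ◁ famMap Y p β ≫ φ a'' (h ≫ p) b' = φ a' h b ≫ Z.act rfl (concatMap p.perm β)) →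
        ∃! g : A ⟶ R.val t a, ∀ a' h b, g ▷ valFam Y a' b ≫ ev t a a' h b = φ a' h b := by
  choose R ev hev hR using fun t a => exists_circleHomVal Y Z t a
  -- The action of a morphism on the values is defined by representability from reindexing the
  -- evaluations; its uniqueness yields the functor laws.
  have lift : ∀ {p q : Profile C × Discrete C} (f : p ⟶ q),
      ∃! g : R p.2.as p.1 ⟶ R q.2.as q.1, ∀ a' h b,
        g ▷ valFam Y a' b ≫ ev q.2.as q.1 a' h b =
          ev p.2.as p.1 a' (f.1 ≫ h) b ≫ Z.act (Discrete.eq_of_hom f.2) (𝟙 (concat b)) :=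
    fun {p q} f => hR q.2.as q.1 _ _ (fun a' a'' h r b b' β => by
      rw [← Category.assoc f.1 h r, reassoc_of% hev, Category.assoc, SymSeq.act_comp,
        SymSeq.act_comp, Category.comp_id, Category.id_comp])
  let RR : Profile C × Discrete C ⥤ M :=
    { obj p := R p.2.as p.1
      map f := (lift f).choose
      map_id p := (lift (𝟙 p)).unique (lift (𝟙 p)).choose_spec.1 (fun a' h b => by
        rw [id_whiskerRight, Category.id_comp]
        refine Eq.symm ((congrArg (_ ≫ ·) (Z.act_id _ _)).trans ((Category.comp_id _).trans ?_))
        exact congrArg (fun h => ev _ _ a' h b) (Category.id_comp h))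
      map_comp {p q r} f f' := (lift (f ≫ f')).unique (lift (f ≫ f')).choose_spec.1
        (fun a' h b => by
          rw [comp_whiskerRight, Category.assoc, (lift f').choose_spec.1,
            reassoc_of% ((lift f).choose_spec.1), SymSeq.act_comp, Category.comp_id]
          exact congrArg (fun h => ev _ _ a' h b ≫ _) (Category.assoc f.1 f'.1 h).symm) }
  exact ⟨RR, ev, hev, fun t t' ht a a' a'' f h b => (lift (p := (a, Discrete.mk t))
    (q := (a', Discrete.mk t')) (f, Discrete.eqToHom ht)).choose_spec.1 a'' h b, hR⟩

variable [HasColimits M]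

/-- The circle product with `Y` has couniversal arrows. -/
theorem exists_circleHomSeq_couniversal (Y Z : SymSeq C M) :
    ∃ (R : SymSeq C M) (ev : circle R Y ⟶ Z), ∀ (X : SymSeq C M) (f : circle X Y ⟶ Z),
      ∃! g : X ⟶ R, circleHom g (𝟙 Y) ≫ ev = f := by
  obtain ⟨R, ev, h1, h2, h3⟩ := exists_circleHomSeq Y Z
  -- The evaluation at any `h` comes from the one at the identity by the action of `R`, so only the
  -- evaluations at identities are needed to define the counit.
  have act_ev : ∀ (t : C) (a a' : Profile C) (h : a ⟶ a') (b : Fin a'.len → Profile C),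
      R.act rfl h ▷ valFam Y a' b ≫ ev t a' a' (𝟙 a') b = ev t a a' h b := fun t a a' h b => by
    rw [h2, SymSeq.act_id, Category.comp_id, Category.comp_id]
  obtain ⟨F, hF⟩ := exists_circle_desc (X := R) (Y := Y) (W := Z)
    (fun t a b => ev t a a (𝟙 a) b) (fun t a a' p b b' β => by
      rw [tensorHom_def', Category.assoc, act_ev]
      have h := h1 t a a a' (𝟙 a) p b b' β
      rw [Category.id_comp] at h
      exact h)
  refine ⟨R, F, fun X f => ?_⟩
  have hgen : ∀ (g : X ⟶ R) t a b, circleGen X Y t a b ≫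
      SymSeq.app (circleHom g (𝟙 Y) ≫ F) t (concat b) =
        SymSeq.app g t a ▷ valFam Y a b ≫ ev t a a (𝟙 a) b := fun g t a b => by
    rw [SymSeq.comp_app, ← Category.assoc, circleGen_app, Category.assoc, hF]
    refine congrArg (· ≫ ev t a a (𝟙 a) b) ?_
    refine (congrArg (SymSeq.app g t a ⊗ₘ ·) (tensorFamMap_id _ _)).trans (tensorHom_id _ _)
  -- The value of the transpose at every index `h` is forced by naturality in the left variable.
  let φ : ∀ (t : C) (a a' : Profile C) (_ : a ⟶ a') (b : Fin a'.len → Profile C),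
      X.val t a ⊗ valFam Y a' b ⟶ Z.val t (concat b) := fun t a a' h b =>
    X.act rfl h ▷ valFam Y a' b ≫ circleGen X Y t a' b ≫ SymSeq.app f t (concat b)
  have hc : ∀ (t : C) (a a' a'' : Profile C) (h : a ⟶ a') (p : a' ⟶ a'')
      (b : Fin a'.len → Profile C) (b' : Fin a''.len → Profile C) (β : ∀ i, b (p.perm i) ⟶ b' i),
      X.val t a ◁ famMap Y p β ≫ φ t a a'' (h ≫ p) b' =
        φ t a a' h b ≫ Z.act rfl (concatMap p.perm β) := fun t a a' a'' h p b b' β => by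
    have e : X.val t a ◁ famMap Y p β ≫ X.act rfl (h ≫ p) ▷ valFam Y a'' b' =
        X.act rfl h ▷ valFam Y a' b ≫ (X.act rfl p ⊗ₘ famMap Y p β) := by
      rw [whisker_exchange, ← X.act_comp rfl rfl h p, comp_whiskerRight, Category.assoc,
        MonoidalCategory.tensorHom_def]
    rw [← Category.assoc, e, Category.assoc, ← Category.assoc (_ ⊗ₘ _), circleGen_natural,
      Category.assoc, SymSeq.act_app, Category.assoc, Category.assoc]
  have key := fun t a => h3 t a (X.val t a) (φ t a) (hc t a)
  have hφ : ∀ t a b, φ t a a (𝟙 a) b = circleGen X Y t a b ≫ SymSeq.app f t (concat b) :=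
    fun t a b => by
      refine (congrArg (fun e => e ▷ valFam Y a b ≫ _) (X.act_id t a)).trans ?_
      rw [id_whiskerRight, Category.id_comp]
  choose g hg hu using key
  have hg' : ∀ (g' : X ⟶ R), circleHom g' (𝟙 Y) ≫ F = f → ∀ t a, SymSeq.app g' t a = g t a :=
    fun g' hg' t a => hu t a _ (fun a' h b => by
      rw [← act_ev, ← comp_whiskerRight_assoc, ← SymSeq.act_app, comp_whiskerRight_assoc]
      refine congrArg (_ ≫ ·) ?_
      rw [← hgen, hg'])
  let G : X ⟶ R :=
    { app p := g p.2.as p.1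
      naturality p q k := by
        obtain ⟨a, ⟨t⟩⟩ := p
        obtain ⟨a', ⟨t'⟩⟩ := q
        obtain ⟨k, l⟩ := k
        obtain rfl : t = t' := Discrete.eq_of_hom l
        change X.act rfl k ≫ g t a' = g t a ≫ R.act rfl k
        -- Both sides of the naturality square represent the same compatible family, namely `φ`
        -- reindexed along `k`.
        refine (h3 t a' (X.val t a) (fun a'' h b => φ t a a'' (k ≫ h) b) ?_).unique
          (fun a'' h b => ?_) (fun a'' h b => ?_)
        · intro a₁ a₂ h p b b' β
          rw [← Category.assoc k h p]
          exact hc t a a₁ a₂ (k ≫ h) p b b' β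
        · rw [comp_whiskerRight, Category.assoc, hg, ← comp_whiskerRight_assoc, SymSeq.act_comp]
        · rw [comp_whiskerRight, Category.assoc, h2, SymSeq.act_id, Category.comp_id, hg] }
  refine ⟨G, ?_, fun g' hg'' => NatTrans.ext (funext fun p => hg' g' hg'' p.2.as p.1)⟩
  refine circle_hom_ext (fun t a b => ?_)
  rw [hgen]
  exact (hg t a a (𝟙 a) b).trans (hφ t a b)

/-- If `M` has all limits, then the circle product with `Y` on the right has a right adjoint. -/
theorem isLeftAdjoint_tensorRight (Y : SymSeq C M) :
    letI := (circleMonoidal (C := C) (M := M)).monoidalCategory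
    (tensorRight Y).IsLeftAdjoint := by
  let _ := (circleMonoidal (C := C) (M := M)).monoidalCategory
  -- A right adjoint exists if there is a couniversal arrow to every `Z`, and this is what the
  -- preceding construction provides.
  rw [isLeftAdjoint_iff_hasTerminal_costructuredArrow]
  intro Z
  obtain ⟨R, ev, h⟩ := exists_circleHomSeq_couniversal Y Z
  refine IsTerminal.hasTerminal (X := CostructuredArrow.mk (S := tensorRight Y) (Y := R) ev)
    (IsTerminal.ofUniqueHom (fun A => CostructuredArrow.homMk (h A.left A.hom).choose
      (h A.left A.hom).choose_spec.1) (fun A m => ?_))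
  exact CostructuredArrow.hom_ext _ _ ((h A.left A.hom).unique (CostructuredArrow.w m)
    (h A.left A.hom).choose_spec.1)

end RightAdjoint

end CircleSeq

/-- The equation between `j_* J_*` and `J_* j_*` is part of the involutive category `I.symSeq C`;
what remains are the monoidal structure, the right adjoints and the compatibility of the two. -/
theorem theorem4p4 {C : Type v} [Nonempty C] {M : Type u} [Category.{v} M] [MonoidalCategory M]
    [SymmetricCategory M] [MonoidalClosed M] [HasColimits M] (I : InvolutiveCategory M)
    (S : InvolutiveSymmetricMonoidal I) :
    letI := S.lax
    ∃ K : CircleMonoidal C M,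
      letI := K.monoidalCategory
      (HasLimits M → ∀ Y : SymSeq C M, (tensorRight Y).IsLeftAdjoint) ∧
      ∃ T : InvolutiveMonoidal (I.symSeq C),
        (∀ X Y : SymSeq C M, T.lax.μ X Y = circleJ₂ I.J X Y) ∧ T.lax.ε = circleJ₀ I.J := by
  exact ⟨circleMonoidal, fun _ Y => isLeftAdjoint_tensorRight Y, exists_involutiveMonoidal I S⟩
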